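/- **Setting.** Let $\Omega\subset\mathbb{R}^3$ be an open, bounded, simply connected polyhedral domain with connected Lipschitz boundary, let $\mathcal{T}_h$ be a conforming mesh of $\Omega$ by finitely many tetrahedra, and let $1\le k\le k'$ be integers. Let $\mu:\Omega\to\mathbb{R}$ satisfy $0<\mu_0\le\mu\le\mu_1$. For $D\subset\mathbb{R}^3$, $(\cdot,\cdot)_D$ and $\|\cdot\|_D$ are the $L^2(D)$ inner product and norm. $P_k$ denotes the polynomials of total degree at most $k$, $R_k=\{\mathbf v+\mathbf x\times\mathbf w : \mathbf v,\mathbf w\in P_{k-1}^3\}$ the first-kind Nédélec space and $D_k=\{\mathbf v+\mathbf x\,w : \mathbf v\in P_{k-1}^3,\ w\in P_{k-1}\}$ the Raviart–Thomas space. $P_k^{-1}(\mathcal{T}_h)$, $R_k^{-1}(\mathcal{T}_h)$, $D_k^{-1}(\mathcal{T}_h)$ denote the spaces of functions whose restriction to each element lies in $P_k$, $R_k$, $D_k$; moreover $P_{k,0}(\mathcal{T}_h)=P_k^{-1}(\mathcal{T}_h)\cap H^1_0(\Omega)$, $R_{k,0}(\mathcal{T}_h)=R_k^{-1}(\mathcal{T}_h)\cap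 H_0(\mathrm{curl};\Omega)$ and $D_k(\mathcal{T}_h)=D_k^{-1}(\mathcal{T}_h)\cap H(\mathrm{div};\Omega)$. $\nabla_h$ is the elementwise gradient. Assume * (A1) $\mu$ is constant within each element of $\mathcal{T}_h$; * (A2) $\mathbf j\in D_{k'}(\mathcal{T}_h)$ and $\nabla\cdot\mathbf j=0$ in $\Omega$. Let $\mathbf u\in H_0(\mathrm{curl};\Omega)$ with $\nabla\cdot\mathbf u=0$ satisfy $(\mu^{-1}\nabla\times\mathbf u,\nabla\times\mathbf w)_\Omega=(\mathbf j,\mathbf w)_\Omega$ for all $\mathbf w\in H_0(\mathrm{curl};\Omega)$. Let $\mathbf u_h\in R_{k,0}(\mathcal{T}_h)$ satisfy $(\mu^{-1}\nabla\times\mathbf u_h,\nabla\times\mathbf w)_\Omega=(\mathbf j,\mathbf w)_\Omega$ for all $\mathbf w\in R_{k,0}(\mathcal{T}_h)$ and $(\mathbf u_h,\nabla\psi)_\Omega=0$ for all $\psi\in P_{k,0}(\mathcal{T}_h)$. Put $\mathbf H=\mu^{-1}\nabla\times\mathbf u$ and $\mathbf H_h=\mu^{-1}\nabla\times\mathbf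 u_h$. For each internal face $f$ label its two adjacent elements $T^+$ and $T^-$, in either order; let $\hat{\mathbf n}^\pm$ be the unit normal on $f$ pointing out of $T^\pm$, and put $\hat{\mathbf n}_f=\hat{\mathbf n}^+$. **Theorem.** The following problems are solvable one after the other, and each has a unique solution, with the one proviso stated in Step 4. 1. For each element $T$: find $\hat{\mathbf H}|_T\in R_{k'}$ with $\nabla\times\hat{\mathbf H}|_T=\mathbf j|_T-\nabla\times\mathbf H_h|_T$ and $(\hat{\mathbf H},\nabla\psi)_T=0$ for all $\psi\in P_{k'}$. 2. For each internal face $f$: find $\lambda_f\in P_{k'}(f)$ with $-\hat{\mathbf n}_f\times\nabla_f\lambda_f=\hat{\mathbf n}^+\times(\mathbf H_h+\hat{\mathbf H})|_{T^+}+\hat{\mathbf n}^-\times(\mathbf H_h+\hat{\mathbf H})|_{T^-}$ on $f$ and $(\lambda_f,1)_f=0$, where $\nabla_f$ is the gradient along $f$. 3. For each Lagrangian node $\mathbf x$ of degree $k'$ of the mesh: find values $\phi_{T,\mathbf x}$, one for each element $T$ with $\mathbf x\in\overline T$, such that $\phi_{T^+,\mathbf x}-\phi_{T^-,\mathbf x}=\lambda_f(\mathbf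 x)$ for every internal face $f$ with $\mathbf x\in\overline f$, and $\sum_{T:\,\overline T\ni\mathbf x}\phi_{T,\mathbf x}=0$. There is then exactly one $\phi\in P_{k'}^{-1}(\mathcal{T}_h)$ with these nodal values. 4. For each mesh vertex $\nu$, let $\mathcal T_\nu$ be the set of elements with vertex $\nu$, let $\omega_\nu$ be the interior of the union of the closed elements in $\mathcal T_\nu$, and let $\Gamma_\nu=\partial\omega_\nu$ if $\nu\in\Omega$ and $\Gamma_\nu=\partial\omega_\nu\setminus\partial\Omega$ if $\nu\in\partial\Omega$. Let $X_\nu$ be the space of functions in $H^1(\omega_\nu)$ that are polynomials of degree at most $k'+1$ on each element of $\mathcal T_\nu$ and vanish on $\Gamma_\nu$. Find $\alpha_\nu\in X_\nu$ with $(\mu\nabla\alpha_\nu,\nabla\psi)_{\omega_\nu}=(\mu\nabla_h(\theta_\nu\phi),\nabla\psi)_{\omega_\nu}$ for all $\psi\in X_\nu$, where $\theta_\nu$ is the hat function of $\nu$. A solution always exists; it is unique if $\Gamma_\nu\neq\emptyset$, and unique up to an additive constant if $\Gamma_\nu=\emptyset$. Finally extend each $\alpha_\nu$ by zero to $\Omega$,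 and set $\alpha=\sum_\nu\alpha_\nu$ and $\tilde{\mathbf H}^\Delta=\hat{\mathbf H}+\nabla_h\phi-\nabla\alpha$. Then $$\|\mu^{1/2}(\mathbf H-\mathbf H_h)\|_\Omega\le\|\mu^{1/2}\tilde{\mathbf H}^\Delta\|_\Omega=\eta_h,\qquad \eta_h:=\Big(\sum_{T\in\mathcal{T}_h}\|\mu^{1/2}\tilde{\mathbf H}^\Delta\|_T^2\Big)^{1/2}.$$ -/

import Mathlib

open MeasureTheory Filter Topology
open scoped ContDiff Matrix

noncomputable section

namespace Magnetostatic

/-! ## Points, vectors, differential operators -/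

/-- The ambient Euclidean space `ℝ³`. -/
abbrev E := EuclideanSpace ℝ (Fin 3)

/-- Values of vector fields; inner products of vectors are always written `v ⬝ᵥ w`. -/
abbrev V := Fin 3 → ℝ

/-- The partial derivative `∂_i φ` of a scalar function. -/
def pd (i : Fin 3) (φ : E → ℝ) (x : E) : ℝ := fderiv ℝ φ x (EuclideanSpace.single i 1)

/-- The classical gradient of a scalar function. -/
def grad (φ : E → ℝ) (x : E) : V := fun i => pd i φ x

/-- The classical curl of a vector field. -/
def curl (φ : E → V) (x : E) : V :=
  ![pd 1 (fun y => φ y 2) x - pd 2 (fun y => φ y 1) x,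
    pd 2 (fun y => φ y 0) x - pd 0 (fun y => φ y 2) x,
    pd 0 (fun y => φ y 1) x - pd 1 (fun y => φ y 0) x]

/-- `φ ∈ C_c^∞(D)`, with values in `F`. -/
def IsTest {F : Type*} [NormedAddCommGroup F] [NormedSpace ℝ F] (D : Set E) (φ : E → F) : Prop :=
  ContDiff ℝ ∞ φ ∧ HasCompactSupport φ ∧ tsupport φ ⊆ D

/-- The `L²(D)³` inner product. -/
def ip (D : Set E) (u w : E → V) : ℝ := ∫ x in D, u x ⬝ᵥ w x

/-- The `L²(D)³` norm. -/
def l2norm (D : Set E) (u : E → V) : ℝ := √(ip D u u)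

/-! ## Sobolev spaces -/

/-- `g` is the weak gradient of `φ` on `D`. -/
def HasWeakGrad (D : Set E) (φ : E → ℝ) (g : E → V) : Prop :=
  ∀ ζ : E → ℝ, IsTest D ζ → ∀ i, ∫ x in D, φ x * pd i ζ x = - ∫ x in D, g x i * ζ x

/-- `φ ∈ H¹(D)` with weak gradient `g`. -/
def MemH1 (D : Set E) (φ : E → ℝ) (g : E → V) : Prop :=
  MemLp φ 2 (volume.restrict D) ∧ MemLp g 2 (volume.restrict D) ∧ HasWeakGrad D φ g

/-- `φ ∈ H¹₀(D)` with weak gradient `g`: the closure of `C_c^∞(D)` in `H¹(D)`. -/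
def MemH10 (D : Set E) (φ : E → ℝ) (g : E → V) : Prop :=
  MemLp φ 2 (volume.restrict D) ∧ MemLp g 2 (volume.restrict D) ∧
  ∃ ζ : ℕ → E → ℝ, (∀ n, IsTest D (ζ n)) ∧
    Tendsto (fun n => eLpNorm (φ - ζ n) 2 (volume.restrict D)) atTop (𝓝 0) ∧
    Tendsto (fun n => eLpNorm (g - grad (ζ n)) 2 (volume.restrict D)) atTop (𝓝 0)

/-- `u ∈ H₀(curl; D)` with weak curl `c`: the closure of `C_c^∞(D)³` in `H(curl; D)`. -/
def MemH0Curl (D : Set E) (u c : E → V) : Prop :=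
  MemLp u 2 (volume.restrict D) ∧ MemLp c 2 (volume.restrict D) ∧
  ∃ ζ : ℕ → E → V, (∀ n, IsTest D (ζ n)) ∧
    Tendsto (fun n => eLpNorm (u - ζ n) 2 (volume.restrict D)) atTop (𝓝 0) ∧
    Tendsto (fun n => eLpNorm (c - curl (ζ n)) 2 (volume.restrict D)) atTop (𝓝 0)

/-- `u ∈ H(div⁰; D)`: square integrable with vanishing weak divergence. -/
def MemHDivZero (D : Set E) (u : E → V) : Prop :=
  MemLp u 2 (volume.restrict D) ∧ ∀ ζ : E → ℝ, IsTest D ζ → ip D u (grad ζ) = 0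

/-! ## The domain -/

/-- The boundary of `Ω` is Lipschitz: near each boundary point, in suitable Cartesian coordinates,
`Ω` is the region above the graph of a Lipschitz function. -/
def HasLipschitzBoundary (Ω : Set E) : Prop :=
  ∀ x ∈ frontier Ω, ∃ (L : E ≃ₗᵢ[ℝ] E) (g : EuclideanSpace ℝ (Fin 2) → ℝ) (K : NNReal),
    LipschitzWith K g ∧ ∃ U ∈ 𝓝 x, Ω ∩ U = {y ∈ U | g !₂[L y 0, L y 1] < L y 2}

/-- Open, bounded, simply connected, with connected Lipschitz boundary. That the domain is
polyhedral is contained in the existence of a tetrahedral mesh, see `TetMesh`. -/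
structure IsAdmissibleDomain (Ω : Set E) : Prop where
  isOpen : IsOpen Ω
  bounded : Bornology.IsBounded Ω
  simplyConnected : SimplyConnectedSpace Ω
  connected_frontier : IsConnected (frontier Ω)
  lipschitz : HasLipschitzBoundary Ω

/-! ## Polynomial spaces -/

/-- Polynomials in the three space variables. -/
abbrev SPoly := MvPolynomial (Fin 3) ℝ

/-- Polynomial vector fields. -/
abbrev VPoly := Fin 3 → SPoly

/-- Point value of a polynomial. -/
def ev (p : SPoly) (x : E) : ℝ := MvPolynomial.eval (fun i => x i) p

/-- Point value of a polynomial vector field. -/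
def evV (u : VPoly) (x : E) : V := fun i => ev (u i) x

/-- Gradient of a polynomial. -/
def gradP (p : SPoly) : VPoly := fun i => MvPolynomial.pderiv i p

/-- Curl of a polynomial vector field. -/
def curlP (u : VPoly) : VPoly :=
  ![MvPolynomial.pderiv 1 (u 2) - MvPolynomial.pderiv 2 (u 1),
    MvPolynomial.pderiv 2 (u 0) - MvPolynomial.pderiv 0 (u 2),
    MvPolynomial.pderiv 0 (u 1) - MvPolynomial.pderiv 1 (u 0)]

/-- The field `x ↦ x`. -/
def idP : VPoly := fun i => MvPolynomial.X i

/-- `P_k`: polynomials of total degree at most `k`. -/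
def PolyDeg (k : ℕ) : Submodule ℝ SPoly := MvPolynomial.restrictTotalDegree (Fin 3) ℝ k

/-- The first-kind Nédélec space `R_k` (used for `k ≥ 1`). -/
def Nedelec (k : ℕ) : Set VPoly :=
  {u | (∀ i, u i ∈ PolyDeg k) ∧ ∃ v w : VPoly, (∀ i, v i ∈ PolyDeg (k - 1)) ∧
    (∀ i, w i ∈ PolyDeg (k - 1)) ∧ u = v + idP ⨯₃ w}

/-- The Raviart-Thomas space `D_k` (used for `k ≥ 1`). -/
def RaviartThomas (k : ℕ) : Set VPoly :=
  {u | (∀ i, u i ∈ PolyDeg k) ∧ ∃ (v : VPoly) (w : SPoly), (∀ i, v i ∈ PolyDeg (k - 1)) ∧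
    w ∈ PolyDeg (k - 1) ∧ u = v + w • idP}

/-! ## Meshes -/

/-- The closed simplex with the given vertices. -/
abbrev hull (s : Finset E) : Set E := convexHull ℝ (s : Set E)

/-- A conforming tetrahedral mesh of `Ω`: a finite simplicial complex, each of whose simplices is a
face of a tetrahedron, and which covers exactly the closure of `Ω`. -/
structure TetMesh (Ω : Set E) extends Geometry.SimplicialComplex ℝ E where
  finite_faces : faces.Finite
  pure : ∀ s ∈ faces, ∃ T ∈ faces, s ⊆ T ∧ T.card = 4
  space_eq : toSimplicialComplex.space = closure Ω

namespace TetMesh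

variable {Ω : Set E} (M : TetMesh Ω)

/-- The elements (tetrahedra) of the mesh, given by their sets of vertices. -/
abbrev Elem := {T : Finset E // T ∈ M.faces ∧ T.card = 4}

/-- The vertices of the mesh. -/
abbrev Vertex := {ν : E // {ν} ∈ M.faces}

/-- The internal faces: triangles shared by two distinct elements. -/
abbrev IntFace := {f : Finset E // f ∈ M.faces ∧ f.card = 3 ∧
  ∃ T T' : M.Elem, T ≠ T' ∧ f ⊆ T.1 ∧ f ⊆ T'.1}

/-- A labelling, for each internal face, of its two adjacent elements as `T⁺` and `T⁻`. -/
structure FaceOrientation where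
  plus : M.IntFace → M.Elem
  minus : M.IntFace → M.Elem
  ne : ∀ f, plus f ≠ minus f
  subset_plus : ∀ f, f.1 ⊆ (plus f).1
  subset_minus : ∀ f, f.1 ⊆ (minus f).1

/-- A labelling exists on every mesh. -/
theorem nonempty_faceOrientation : Nonempty M.FaceOrientation := by
  choose T T' h using fun f : M.IntFace => f.2.2.2
  exact ⟨⟨T, T', fun f => (h f).1, fun f => (h f).2.1, fun f => (h f).2.2⟩⟩

variable {M}

/-- Points of a face belong to the element `T⁺`. -/
theorem FaceOrientation.mem_plus (o : M.FaceOrientation) {f : M.IntFace} {x : E}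
    (hx : x ∈ hull f.1) : x ∈ hull (o.plus f).1 :=
  convexHull_mono (Finset.coe_subset.2 (o.subset_plus f)) hx

/-- Points of a face belong to the element `T⁻`. -/
theorem FaceOrientation.mem_minus (o : M.FaceOrientation) {f : M.IntFace} {x : E}
    (hx : x ∈ hull f.1) : x ∈ hull (o.minus f).1 :=
  convexHull_mono (Finset.coe_subset.2 (o.subset_minus f)) hx

/-- The piecewise polynomial function with `φ|_T = φ T` on each open element. The discontinuous
spaces `P_k^{-1}`, `R_k^{-1}`, `D_k^{-1}` are represented by families of polynomials indexed by the
elements. -/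
def pw (φ : M.Elem → SPoly) (x : E) : ℝ :=
  ∑ᶠ T : M.Elem, (interior (hull T.1)).indicator (ev (φ T)) x

/-- The piecewise polynomial vector field with `u|_T = u T` on each open element. -/
def pwV (u : M.Elem → VPoly) (x : E) : V :=
  ∑ᶠ T : M.Elem, (interior (hull T.1)).indicator (evV (u T)) x

/-- Elementwise gradient. -/
def gradh (φ : M.Elem → SPoly) : M.Elem → VPoly := fun T => gradP (φ T)

/-- Elementwise curl. -/
def curlh (u : M.Elem → VPoly) : M.Elem → VPoly := fun T => curlP (u T)

variable (M)

/-- `P_{k,0}(𝒯_h) = P_k^{-1}(𝒯_h) ∩ H¹₀(Ω)`. -/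
def P0 (k : ℕ) : Set (M.Elem → SPoly) :=
  {ψ | (∀ T, ψ T ∈ PolyDeg k) ∧ MemH10 Ω (pw ψ) (pwV (gradh ψ))}

/-- `R_{k,0}(𝒯_h) = R_k^{-1}(𝒯_h) ∩ H₀(curl; Ω)`. -/
def R0 (k : ℕ) : Set (M.Elem → VPoly) :=
  {w | (∀ T, w T ∈ Nedelec k) ∧ MemH0Curl Ω (pwV w) (pwV (curlh w))}

/-- `D_k(𝒯_h) ∩ H(div⁰; Ω)`. -/
def DDivZero (k : ℕ) : Set (M.Elem → VPoly) :=
  {j | (∀ T, j T ∈ RaviartThomas k) ∧ MemHDivZero Ω (pwV j)}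

/-! ## The continuous and the discrete problem -/

/-- The permeability is constant within each element; `μT T` is its value on `T`. -/
def IsPiecewiseConst (μ : E → ℝ) (μT : M.Elem → ℝ) : Prop :=
  ∀ T : M.Elem, ∀ᵐ x ∂(volume.restrict (hull T.1)), μ x = μT T

end TetMesh

/-- `u`, with weak curl `c`, is the solution of the variational problem: `u` lies in
`H₀(curl; Ω) ∩ H(div⁰; Ω)` and `(μ⁻¹ ∇×u, ∇×w)_Ω = (j, w)_Ω` for all `w ∈ H₀(curl; Ω)`. -/
def IsWeakSolution (Ω : Set E) (μ : E → ℝ) (j u c : E → V) : Prop :=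
  MemH0Curl Ω u c ∧ MemHDivZero Ω u ∧
  ∀ w cw : E → V, MemH0Curl Ω w cw → ip Ω (fun x => (μ x)⁻¹ • c x) cw = ip Ω j w

namespace TetMesh

variable {Ω : Set E} (M : TetMesh Ω)

/-- `uh` is the Nédélec finite element solution of degree `k`. -/
def IsFEMSolution (k : ℕ) (μ : E → ℝ) (j : E → V) (uh : M.Elem → VPoly) : Prop :=
  uh ∈ M.R0 k ∧
  (∀ w ∈ M.R0 k,
    ip Ω (fun x => (μ x)⁻¹ • pwV (curlh uh) x) (pwV (curlh w)) = ip Ω j (pwV w)) ∧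
  ∀ ψ ∈ M.P0 k, ip Ω (pwV uh) (pwV (gradh ψ)) = 0

variable {M}

/-- The discrete magnetic field `H_h = μ⁻¹ ∇×u_h`, elementwise. -/
def Hh (μT : M.Elem → ℝ) (uh : M.Elem → VPoly) : M.Elem → VPoly :=
  fun T => (μT T)⁻¹ • curlP (uh T)

/-! ## Step 1: element problems -/

/-- `G ∈ R_{k'}(T)` solves `∇×G = j|_T - ∇×H_h|_T` and `(G, ∇ψ)_T = 0` for all
`ψ ∈ P_{k'}(T)`. -/
def IsElementSolution (k' : ℕ) (j H : M.Elem → VPoly) (T : M.Elem) (G : VPoly) : Prop :=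
  G ∈ Nedelec k' ∧ curlP G = j T - curlP (H T) ∧
  ∀ ψ ∈ PolyDeg k', ip (hull T.1) (evV G) (evV (gradP ψ)) = 0

/-! ## Step 2: face problems -/

end TetMesh

/-- `n` is a unit normal of the face `f` of the tetrahedron `T`, pointing out of `T`. -/
def IsOutwardNormal (T f : Finset E) (n : V) : Prop :=
  n ⬝ᵥ n = 1 ∧ (∀ a ∈ f, ∀ b ∈ f, n ⬝ᵥ (fun i => a i - b i) = 0) ∧
  ∀ a ∈ f, ∀ b ∈ T, b ∉ f → n ⬝ᵥ (fun i => b i - a i) < 0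

/-- The outward unit normal of `T` on its face `f`. -/
def outwardNormal (T f : Finset E) : V := Classical.epsilon (IsOutwardNormal T f)

/-- The gradient along a face with unit normal `n`, for the restriction of `p` to the face: the
tangential part of `∇p`, which depends only on the values of `p` on the face. -/
def faceGrad (n : V) (p : SPoly) (x : E) : V :=
  evV (gradP p) x - (n ⬝ᵥ evV (gradP p) x) • n

namespace TetMesh

variable {Ω : Set E} {M : TetMesh Ω}

/-- The tangential jump `n⁺ × G⁺ + n⁻ × G⁻` on an internal face. -/
def tangentialJump (o : M.FaceOrientation) (G : M.Elem → VPoly) (f : M.IntFace) (x : E) : V :=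
  outwardNormal (o.plus f).1 f.1 ⨯₃ evV (G (o.plus f)) x +
    outwardNormal (o.minus f).1 f.1 ⨯₃ evV (G (o.minus f)) x

/-- `lam ∈ P_{k'}(f)` solves `-n_f × ∇_f lam = ⟦G⟧` on `f` and `(lam, 1)_f = 0`, with
`n_f = n⁺`. Here `p` is any polynomial whose restriction to `f` is `lam`. -/
def IsFaceSolution (k' : ℕ) (o : M.FaceOrientation) (G : M.Elem → VPoly) (f : M.IntFace)
    (lam : hull f.1 → ℝ) : Prop :=
  ∃ p ∈ PolyDeg k', (∀ x : hull f.1, lam x = ev p x) ∧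
    (∀ x ∈ hull f.1,
      -(outwardNormal (o.plus f).1 f.1 ⨯₃ faceGrad (outwardNormal (o.plus f).1 f.1) p x) =
        tangentialJump o G f x) ∧
    ∫ x in hull f.1, ev p x ∂μHE[2] = 0

/-! ## Step 3: node problems -/

variable (M) in
/-- The Lagrangian nodes of degree `k'` of the mesh: the points whose barycentric coordinates in
some element are integer multiples of `1 / k'`. -/
def nodes (k' : ℕ) : Set E :=
  {x | ∃ (T : M.Elem) (m : E → ℕ), ∑ a ∈ T.1, m a = k' ∧
    x = ∑ a ∈ T.1, ((m a : ℝ) / (k' : ℝ)) • a}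

/-- The values `d T`, for the closed elements `T` that contain the node `x`, satisfy
`d T⁺ - d T⁻ = lam_f(x)` for all internal faces whose closure contains `x`, and sum to zero. -/
def IsNodeSolution (o : M.FaceOrientation) (lam : (f : M.IntFace) → hull f.1 → ℝ) (x : E)
    (d : {T : M.Elem // x ∈ hull T.1} → ℝ) : Prop :=
  (∀ (f : M.IntFace) (hx : x ∈ hull f.1),
    d ⟨o.plus f, o.mem_plus hx⟩ - d ⟨o.minus f, o.mem_minus hx⟩ = lam f ⟨x, hx⟩) ∧
  ∑ᶠ T, d T = 0

/-- `φ ∈ P_{k'}^{-1}(𝒯_h)` is the field whose values at each Lagrangian node solve the node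
problem. -/
def IsNodalField (k' : ℕ) (o : M.FaceOrientation) (lam : (f : M.IntFace) → hull f.1 → ℝ)
    (φ : M.Elem → SPoly) : Prop :=
  (∀ T, φ T ∈ PolyDeg k') ∧
  ∀ x ∈ M.nodes k', IsNodeSolution o lam x (fun T => ev (φ T.1) x)

/-! ## Step 4: vertex patch problems -/

variable (M) in
/-- The vertex patch `ω_ν`: the interior of the union of the closed elements with vertex `ν`. -/
def patch (ν : E) : Set E := interior (⋃ T : {T : M.Elem // ν ∈ T.1}, hull T.1.1)

open Classical in
variable (M) in
/-- `Γ_ν`: the boundary of the patch for an interior vertex, and that boundary without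
`∂Ω` for a vertex on `∂Ω`. -/
def patchGamma (ν : E) : Set E :=
  if ν ∈ frontier Ω then frontier (M.patch ν) \ frontier Ω else frontier (M.patch ν)

variable (M) in
/-- `P_{k,0,Γ_ν}(𝒯_ν)`: piecewise polynomials of degree `k` on the patch, in `H¹(ω_ν)`, vanishing
on `Γ_ν`; they are extended by zero to the elements outside the patch. -/
def patchSpace (k : ℕ) (ν : E) : Set (M.Elem → SPoly) :=
  {α | (∀ T, α T ∈ PolyDeg k) ∧ (∀ T, ν ∉ T.1 → α T = 0) ∧
    MemH1 (M.patch ν) (pw α) (pwV (gradh α)) ∧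
    ∀ T : M.Elem, ν ∈ T.1 → ∀ x ∈ hull T.1 ∩ M.patchGamma ν, ev (α T) x = 0}

open Classical in
variable (M) in
/-- The hat function `θ_ν`: on each element the affine polynomial with value `1` at `ν` and `0` at
all the other vertices. -/
def hat (ν : E) : M.Elem → SPoly := fun T =>
  Classical.epsilon fun p : SPoly => p ∈ PolyDeg 1 ∧ ∀ a ∈ T.1, ev p a = if a = ν then 1 else 0

/-- `α ∈ P_{k'+1,0,Γ_ν}(𝒯_ν)` solves `(μ∇α, ∇ψ) = (μ∇_h(θ_ν φ), ∇ψ)` on the patch for all `ψ` in the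
same space. -/
def IsPatchSolution (k' : ℕ) (μ : E → ℝ) (φ : M.Elem → SPoly) (ν : E) (α : M.Elem → SPoly) : Prop :=
  α ∈ M.patchSpace (k' + 1) ν ∧
  ∀ ψ ∈ M.patchSpace (k' + 1) ν,
    ip (M.patch ν) (fun x => μ x • pwV (gradh α) x) (pwV (gradh ψ)) =
      ip (M.patch ν) (fun x => μ x • pwV (gradh (M.hat ν * φ)) x) (pwV (gradh ψ))

/-! ## Step 5: the equilibrated field and the estimator -/

/-- The field `Ĥ + ∇_h φ - ∇α`, where `α` is the sum of the `α_ν`. -/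
def equilibratedField (Hhat : M.Elem → VPoly) (φ : M.Elem → SPoly)
    (α : M.Vertex → M.Elem → SPoly) : M.Elem → VPoly :=
  fun T => Hhat T + gradP (φ T) - gradP (∑ᶠ ν : M.Vertex, α ν T)

/-- The local estimator `η_T = ‖μ^{1/2} G‖_T`. -/
def etaT (μ : E → ℝ) (G : M.Elem → VPoly) (T : M.Elem) : ℝ :=
  l2norm (hull T.1) (fun x => √(μ x) • pwV G x)

/-- The estimator `η_h = (∑_T η_T²)^{1/2}`. -/
def etah (μ : E → ℝ) (G : M.Elem → VPoly) : ℝ := √(∑ᶠ T : M.Elem, etaT μ G T ^ 2)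

end TetMesh

end Magnetostatic

end

open Magnetostatic Magnetostatic.TetMesh

open MeasureTheory Filter Topology
open scoped ContDiff Matrix

noncomputable section

namespace Magnetostatic

/-! The error bound is a Prager–Synge argument. Put F = H_h + H̃^Δ. If F has elementwise curl j and
no tangential jump across internal faces, then elementwise integration by parts and density give (F,
∇×w) = (j, w) for every w in H₀(curl) (`ip_eq_of_memH0Curl`). The exact field H satisfies the same
identity, so F − H is orthogonal to ∇×(u − u_h) = μ(H − H_h), and Pythagoras in the μ-weighted inner
product gives the estimate (`l2norm_error_le`). The curl of F is j by Step 1, since gradients have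
no curl. The tangential jump vanishes because the jump of ∇_h φ is the face gradient of λ_f, which
by Step 2 cancels the jump of H_h + Ĥ, while α is continuous across every internal face
(`equilibrated_jump`). For this only the membership of α_ν in X_ν matters, not the equation that it
solves.

Steps 1 and 2 rest on the explicit radial potentials of polynomial fields. A divergence-free field
in D_{k'} has degree at most k' − 1 and is the curl of a Nédélec field; a curl-free Nédélec field is
the gradient of a polynomial of degree k' (`existsUnique_elementSolution`). On a face, the curl of
the jump of H_h + Ĥ is the jump of j, whose normal component vanishes because j is weakly
divergence-free; the radial potential centred at a vertex of the face then yields λ_f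
(`existsUnique_faceSolution`).

Step 3 is the core. The prescribed differences at a node x are compatible only if a signed sum of
the λ_f around each edge through x that meets Ω vanishes (`edge_condition`). To prove this, the
discrete equation is tested with the lowest-order edge function, which lies in R_{k,0}
(`edgeField_mem_R0`). Since Ĥ is orthogonal to constant fields, the equation holds for H_h + Ĥ as
well; integrating by parts on the elements, then on the faces, shows that the signed sum has mean
zero over the edge. Its derivative along the edge telescopes around the edge, so it is constant
there, hence zero.

That the edge conditions suffice is a local topological statement. It is proved by analysis rather
than by walking through the star of x (`exists_forall_sub_eq`). The jumps define a normal field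
concentrated on the faces, whose curl is concentrated on the edges with the edge conditions as
coefficients. After mollification this is a smooth closed form. The Lipschitz boundary makes Ω
star-shaped near x, so the Poincaré lemma supplies a potential, and its values inside the elements
are the required numbers. The same mollification shows that values without jumps agree
(`eq_of_forall_face_eq`), which gives uniqueness at a node and also the uniqueness up to constants
in Step 4. Lagrange unisolvence on elements and on faces carries the nodal statements over to
polynomials.

Step 4 is a projection with respect to a semidefinite form on a finite-dimensional space
(`exists_projection`).

All integrations by parts come from one Stokes formula on simplices, written with mean values over
faces, so that no area or length is ever computed. -/

/-! ## The Stokes formula on simplices -/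

/-- The corner simplex `{t | 0 ≤ t i, ∑ t i ≤ 1}` in `ℝⁿ`. -/
def cornerSimplex (n : ℕ) : Set (Fin n → ℝ) := {t | (∀ i, 0 ≤ t i) ∧ ∑ i, t i ≤ 1}

theorem isClosed_cornerSimplex (n : ℕ) : IsClosed (cornerSimplex n) := by
  refine IsClosed.inter (s₁ := {t : Fin n → ℝ | ∀ i, 0 ≤ t i}) ?_ ?_
  · simp only [Set.ofPred_forall]
    exact isClosed_iInter fun i => isClosed_le continuous_const (continuous_apply i)
  · exact isClosed_le (continuous_finsetSum _ fun i _ => continuous_apply i) continuous_const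

theorem isCompact_cornerSimplex (n : ℕ) : IsCompact (cornerSimplex n) := by
  refine Metric.isCompact_of_isClosed_isBounded (isClosed_cornerSimplex n) ?_
  refine (Metric.isBounded_Icc (0 : Fin n → ℝ) 1).subset fun t ht => ⟨fun i => ht.1 i, fun i => ?_⟩
  exact (Finset.single_le_sum (f := t) (fun j _ => ht.1 j) (Finset.mem_univ i)).trans ht.2

theorem measurableSet_cornerSimplex (n : ℕ) : MeasurableSet (cornerSimplex n) :=
  (isClosed_cornerSimplex n).measurableSet

theorem volume_cornerSimplex_lt_top (n : ℕ) : volume (cornerSimplex n) < ⊤ :=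
  (isCompact_cornerSimplex n).measure_lt_top

theorem volume_cornerSimplex_pos (n : ℕ) : 0 < volume (cornerSimplex n) := by
  let U : Set (Fin n → ℝ) := {t | (∀ i, 0 < t i) ∧ ∑ i, t i < 1}
  have hU : IsOpen U := by
    refine IsOpen.inter (s := {t : Fin n → ℝ | ∀ i, 0 < t i}) ?_ ?_
    · simp only [Set.ofPred_forall]
      exact isOpen_iInter_of_finite fun i => isOpen_lt continuous_const (continuous_apply i)
    · exact isOpen_lt (continuous_finsetSum _ fun i _ => continuous_apply i) continuous_const
  have hne : U.Nonempty := by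
    refine ⟨fun _ => 1 / (n + 1), fun i => by positivity, ?_⟩
    simp only [Finset.sum_const, Finset.card_univ, Fintype.card_fin, nsmul_eq_mul]
    rw [mul_one_div, div_lt_one (by positivity)]
    linarith
  exact (hU.measure_pos volume hne).trans_le
    (measure_mono fun t ht => ⟨fun i => (ht.1 i).le, ht.2.le⟩)

theorem insertNth_mem_cornerSimplex {n : ℕ} (i : Fin (n + 1)) (r : ℝ) (s : Fin n → ℝ) :
    (i.insertNth r s : Fin (n + 1) → ℝ) ∈ cornerSimplex (n + 1) ↔
      s ∈ cornerSimplex n ∧ r ∈ Set.Icc 0 (1 - ∑ j, s j) := by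
  simp only [cornerSimplex, Set.mem_ofPred_eq, Fin.forall_iff_succAbove i, Fin.insertNth_apply_same,
    Fin.insertNth_apply_succAbove, Fin.sum_univ_succAbove _ i, Set.mem_Icc]
  constructor
  · rintro ⟨⟨h1, h2⟩, h3⟩
    exact ⟨⟨h2, by linarith⟩, h1, by linarith⟩
  · rintro ⟨⟨h1, h2⟩, h3, h4⟩
    exact ⟨⟨h3, h1⟩, by linarith⟩

theorem continuous_insertNth {n : ℕ} (i : Fin (n + 1)) :
    Continuous fun p : ℝ × (Fin n → ℝ) => (i.insertNth p.1 p.2 : Fin (n + 1) → ℝ) := by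
  refine continuous_pi fun j => ?_
  refine Fin.succAboveCases i ?_ (fun j => ?_) j
  · simpa using continuous_fst
  · simp only [Fin.insertNth_apply_succAbove]; fun_prop

/-- Fubini and the fundamental theorem of calculus on the corner simplex. -/
theorem integral_cornerSimplex_fderiv {n : ℕ} (i : Fin (n + 1)) {H : (Fin (n + 1) → ℝ) → ℝ}
    (hH : ContDiff ℝ 1 H) :
    ∫ t in cornerSimplex (n + 1), fderiv ℝ H t (Pi.single i 1) =
      ∫ s in cornerSimplex n, (H (i.insertNth (1 - ∑ j, s j) s) - H (i.insertNth 0 s)) := by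
  set F : (Fin (n + 1) → ℝ) → ℝ := fun t => fderiv ℝ H t (Pi.single i 1) with hF
  have hFc : Continuous F := (hH.continuous_fderiv one_ne_zero).clm_apply continuous_const
  have hInt : Integrable ((cornerSimplex (n + 1)).indicator F) := by
    rw [integrable_indicator_iff (measurableSet_cornerSimplex _)]
    exact hFc.continuousOn.integrableOn_compact (isCompact_cornerSimplex _)
  have hmp := (volume_preserving_piFinSuccAbove (fun _ : Fin (n + 1) => ℝ) i).symm
  rw [← integral_indicator (measurableSet_cornerSimplex _),
    ← hmp.integral_comp (MeasurableEquiv.measurableEmbedding _)]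
  have hInt' := (hmp.integrable_comp_emb (MeasurableEquiv.measurableEmbedding _)).2 hInt
  rw [Measure.volume_eq_prod] at hInt' ⊢
  refine (integral_prod_symm _ hInt').trans ?_
  rw [← integral_indicator (measurableSet_cornerSimplex _)]
  congr 1
  ext s
  have key : ∀ r, ((MeasurableEquiv.piFinSuccAbove (fun _ : Fin (n + 1) => ℝ) i).symm (r, s)) =
      (i.insertNth r s : Fin (n + 1) → ℝ) := fun r => rfl
  simp only [Function.comp_apply, key]
  by_cases hs : s ∈ cornerSimplex n
  · have h0 : (0 : ℝ) ≤ 1 - ∑ j, s j := by linarith [hs.2]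
    rw [Set.indicator_of_mem hs]
    have : (fun r : ℝ => (cornerSimplex (n + 1)).indicator F (i.insertNth r s)) =
        (Set.Icc 0 (1 - ∑ j, s j)).indicator (fun r => F (i.insertNth r s)) := by
      ext r
      by_cases hr : r ∈ Set.Icc 0 (1 - ∑ j, s j)
      · rw [Set.indicator_of_mem hr, Set.indicator_of_mem]
        exact (insertNth_mem_cornerSimplex i r s).2 ⟨hs, hr⟩
      · rw [Set.indicator_of_notMem hr, Set.indicator_of_notMem]
        exact fun h => hr ((insertNth_mem_cornerSimplex i r s).1 h).2
    rw [this, integral_indicator measurableSet_Icc, integral_Icc_eq_integral_Ioc,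
      ← intervalIntegral.integral_of_le h0]
    refine intervalIntegral.integral_eq_sub_of_hasDerivAt (f := fun r => H (i.insertNth r s))
      (fun r _ => ?_) ?_
    · have h1 : HasDerivAt (fun r : ℝ => (i.insertNth r s : Fin (n + 1) → ℝ)) (Pi.single i 1) r := by
        rw [hasDerivAt_pi]
        intro j
        refine Fin.succAboveCases i ?_ (fun j => ?_) j
        · simp only [Fin.insertNth_apply_same, Pi.single_eq_same]; exact hasDerivAt_id' r
        · simpa using hasDerivAt_const r (s j)
      exact ((hH.differentiable one_ne_zero) _).hasFDerivAt.comp_hasDerivAt r h1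
    · exact (hFc.comp ((continuous_insertNth i).comp (by fun_prop : Continuous
        fun r : ℝ => (r, s)))).intervalIntegrable _ _
  · rw [Set.indicator_of_notMem hs]
    have : (fun r : ℝ => (cornerSimplex (n + 1)).indicator F (i.insertNth r s)) = fun _ => 0 := by
      ext r
      exact Set.indicator_of_notMem (fun h => hs ((insertNth_mem_cornerSimplex i r s).1 h).1) _
    rw [this, integral_zero]

/-! ### Affine parametrization of simplices and Hausdorff measure -/

/-- The affine parametrization of the simplex with vertices `v`. -/
def param {n : ℕ} (v : Fin (n + 1) → E) (t : Fin n → ℝ) : E :=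
  v 0 + ∑ i, t i • (v i.succ - v 0)

theorem continuous_param {n : ℕ} (v : Fin (n + 1) → E) : Continuous (param v) := by
  unfold param; fun_prop

theorem param_insertNth_zero {n : ℕ} (v : Fin (n + 2) → E) (i : Fin (n + 1)) (s : Fin n → ℝ) :
    param v (i.insertNth 0 s) = param (fun j => v (i.succ.succAbove j)) s := by
  simp [param, Fin.sum_univ_succAbove _ i]

/-- On the slanted facet the weight of `v 0` is zero, so `v 0` drops out and `v i.succ` takes over
the role of the base point. -/
theorem param_insertNth_one_sub {n : ℕ} (v : Fin (n + 2) → E) (i : Fin (n + 1)) (s : Fin n → ℝ) :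
    param v (i.insertNth (1 - ∑ j, s j) s) =
      param (Fin.cons (v i.succ) fun j => v (i.succAbove j).succ) s := by
  simp only [param, Fin.sum_univ_succAbove _ i, Fin.insertNth_apply_same,
    Fin.insertNth_apply_succAbove, Fin.cons_zero, Fin.cons_succ, smul_sub, sub_smul, one_smul,
    Finset.sum_sub_distrib, ← Finset.sum_smul]
  abel

theorem param_eq_sum {n : ℕ} (v : Fin (n + 1) → E) (t : Fin n → ℝ) :
    param v t = ∑ i, (Fin.cons (1 - ∑ j, t j) t : Fin (n + 1) → ℝ) i • v i := by
  simp only [param, Fin.sum_univ_succ, Fin.cons_zero, Fin.cons_succ, smul_sub, sub_smul, one_smul,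
    Finset.sum_sub_distrib, ← Finset.sum_smul]
  abel

theorem image_param_cornerSimplex {n : ℕ} {v : Fin (n + 1) → E} (hv : Function.Injective v) :
    param v '' cornerSimplex n = hull (Finset.univ.map ⟨v, hv⟩) := by
  ext x
  rw [Finset.mem_convexHull']
  simp only [Finset.mem_map, Finset.mem_univ, true_and, Function.Embedding.coeFn_mk,
    forall_exists_index, forall_apply_eq_imp_iff, Finset.sum_map]
  constructor
  · rintro ⟨t, ht, rfl⟩
    refine ⟨fun y => (Fin.cons (1 - ∑ j, t j) t : Fin (n + 1) → ℝ) (Function.invFun v y), ?_, ?_, ?_⟩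
    · intro i
      beta_reduce
      rw [Function.leftInverse_invFun hv]
      refine Fin.cases ?_ (fun i => ?_) i
      · simpa using ht.2
      · simpa using ht.1 i
    · simp [Function.leftInverse_invFun hv _, Fin.sum_univ_succ]
    · simp only [Function.leftInverse_invFun hv _, param_eq_sum]
  · rintro ⟨w, h0, h1, rfl⟩
    rw [Fin.sum_univ_succ] at h1
    refine ⟨fun i => w (v i.succ), ⟨fun i => h0 _, by linarith [h0 0]⟩, ?_⟩
    rw [param_eq_sum, Fin.sum_univ_succ, Fin.sum_univ_succ]
    simp only [Fin.cons_zero, Fin.cons_succ]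
    rw [← h1, add_sub_cancel_right]

/-- Transported to the direction space, Hausdorff measure and the image of Lebesgue measure are both
Haar measures, hence proportional. The factor is never evaluated: face integrals enter only as mean
values, where it cancels. -/
theorem exists_restrict_range_param_eq {n : ℕ} {v : Fin (n + 1) → E} (hv : AffineIndependent ℝ v) :
    Function.Injective (param v) ∧ IsClosedEmbedding (param v) ∧
    ∃ c : ENNReal, c ≠ 0 ∧ c ≠ ⊤ ∧
      (μHE[n] : Measure E).restrict (Set.range (param v)) = c • (volume.map (param v)) := by
  have hli : LinearIndependent ℝ fun i : Fin n => v i.succ - v 0 := by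
    have := (affineIndependent_iff_linearIndependent_vsub ℝ v 0).1 hv
    exact this.comp (fun i : Fin n => (⟨i.succ, Fin.succ_ne_zero i⟩ : {x : Fin (n + 1) // x ≠ 0}))
      fun i j h => Fin.succ_injective n (congrArg Subtype.val h)
  let W := Submodule.span ℝ (Set.range fun i : Fin n => v i.succ - v 0)
  let b : Module.Basis (Fin n) ℝ W := Module.Basis.span hli
  let e : (Fin n → ℝ) ≃L[ℝ] W := b.equivFun.symm.toContinuousLinearEquiv
  let ι : W → E := fun w => v 0 + w
  have hι : Isometry ι := (isometry_add_left (v 0)).comp isometry_subtype_coe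
  have hparam : param v = ι ∘ e := by
    ext1 t
    simp only [param, ι, e, Function.comp_apply, LinearEquiv.coe_toContinuousLinearEquiv',
      Module.Basis.equivFun_symm_apply, Submodule.coe_sum, Submodule.coe_smul]
    simp_rw [b, Module.Basis.span_apply hli]
  have hfin : Module.finrank ℝ W = n := by simpa using Module.finrank_eq_card_basis b
  have hHaar : (μHE[n] : Measure W).IsAddHaarMeasure := by
    have := isAddHaarMeasure_euclideanHausdorffMeasure (E := W)
    rwa [hfin] at this
  have hmap : ((volume : Measure (Fin n → ℝ)).map e).IsAddHaarMeasure := inferInstance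
  have heq := Measure.isAddLeftInvariant_eq_smul (μHE[n] : Measure W)
    ((volume : Measure (Fin n → ℝ)).map e)
  have hcl : IsClosedEmbedding (param v) := by
    rw [hparam]
    exact hι.isClosedEmbedding.comp e.toHomeomorph.isClosedEmbedding
  refine ⟨hcl.injective, hcl, (Measure.addHaarScalarFactor (μHE[n] : Measure W)
    ((volume : Measure (Fin n → ℝ)).map e) : NNReal), ?_, ENNReal.coe_ne_top, ?_⟩
  · simpa using (Measure.addHaarScalarFactor_pos_of_isAddHaarMeasure (μHE[n] : Measure W)
      ((volume : Measure (Fin n → ℝ)).map e)).ne'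
  · have h2 := hι.map_euclideanHausdorffMeasure (d := n)
    have hr : Set.range (param v) = Set.range ι := by
      rw [hparam, e.surjective.range_comp]
    rw [hr, ← h2, hparam, ← Measure.map_map hι.continuous.measurable e.continuous.measurable,
      ← Measure.map_smul]
    exact congrArg (Measure.map ι) heq

/-- The mean value of `h` over the simplex with vertex set `s`. -/
def avg (s : Finset E) (h : E → ℝ) : ℝ := ⨍ x in hull s, h x ∂μHE[s.card - 1]

theorem exists_restrict_hull_eq {n : ℕ} {v : Fin (n + 1) → E} (hv : AffineIndependent ℝ v) :
    ∃ c : ENNReal, c ≠ 0 ∧ c ≠ ⊤ ∧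
      (μHE[n] : Measure E).restrict (hull (Finset.univ.map ⟨v, hv.injective⟩)) =
        c • ((volume.restrict (cornerSimplex n)).map (param v)) := by
  obtain ⟨hinj, hcl, c, hc0, hct, hc⟩ := exists_restrict_range_param_eq hv
  have hsub : hull (Finset.univ.map ⟨v, hv.injective⟩) ⊆ Set.range (param v) := by
    rw [← image_param_cornerSimplex]; exact Set.image_subset_range _ _
  have hpre : param v ⁻¹' hull (Finset.univ.map ⟨v, hv.injective⟩) = cornerSimplex n := by
    rw [← image_param_cornerSimplex, hinj.preimage_image]
  have hm : MeasurableSet (hull (Finset.univ.map ⟨v, hv.injective⟩)) := by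
    rw [← image_param_cornerSimplex]
    exact ((isCompact_cornerSimplex n).image (continuous_param v)).measurableSet
  refine ⟨c, hc0, hct, ?_⟩
  rw [← Set.inter_eq_left.2 hsub, ← Measure.restrict_restrict hm, hc, Measure.restrict_smul,
    hcl.measurableEmbedding.restrict_map, hpre]

theorem avg_map_eq {n : ℕ} {v : Fin (n + 1) → E} (hv : AffineIndependent ℝ v) (h : E → ℝ) :
    avg (Finset.univ.map ⟨v, hv.injective⟩) h = ⨍ t in cornerSimplex n, h (param v t) := by
  obtain ⟨-, hcl, -⟩ := exists_restrict_range_param_eq hv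
  obtain ⟨c, hc0, hct, hr⟩ := exists_restrict_hull_eq hv
  have hcard : (Finset.univ.map ⟨v, hv.injective⟩ : Finset E).card - 1 = n := by simp
  rw [avg, hcard, average_eq, average_eq, hr, integral_smul_measure,
    hcl.measurableEmbedding.integral_map]
  have hc' : c.toReal ≠ 0 := ENNReal.toReal_ne_zero.2 ⟨hc0, hct⟩
  simp only [Measure.real, Measure.smul_apply, smul_eq_mul, ENNReal.toReal_mul, mul_inv,
    hcl.measurableEmbedding.map_apply, Set.preimage_univ]
  field_simp

theorem affineIndependent_of_forall_mem {s : Finset E} (hs : AffineIndependent ℝ ((↑) : s → E))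
    {ι : Type*} {v : ι → E} (hinj : Function.Injective v) (hmem : ∀ i, v i ∈ s) :
    AffineIndependent ℝ v := by
  let g : ι ↪ s := ⟨fun i => ⟨v i, hmem i⟩, fun _ _ h => hinj (congrArg Subtype.val h)⟩
  have h := hs.comp_embedding g
  have e : ((↑) : s → E) ∘ g = v := rfl
  rwa [e] at h

theorem affineIndependent_subset {s t : Finset E} (hs : AffineIndependent ℝ ((↑) : s → E))
    (hts : t ⊆ s) : AffineIndependent ℝ ((↑) : t → E) :=
  affineIndependent_of_forall_mem hs Subtype.val_injective fun i => hts i.2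

theorem exists_enum (s : Finset E) : ∃ u : Fin s.card → E, ∃ hu : Function.Injective u,
    Finset.univ.map ⟨u, hu⟩ = s := by
  have hinj : Function.Injective fun i => (s.equivFin.symm i : E) :=
    Subtype.val_injective.comp s.equivFin.symm.injective
  refine ⟨fun i => s.equivFin.symm i, hinj, ?_⟩
  ext x
  simp only [Finset.mem_map, Finset.mem_univ, true_and, Function.Embedding.coeFn_mk]
  exact ⟨fun ⟨i, hi⟩ => hi ▸ (s.equivFin.symm i).2, fun hx => ⟨s.equivFin ⟨x, hx⟩, by simp⟩⟩

/-- The dimensional constant in the Stokes formula for mean values over a simplex with `m` vertices. -/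
def stokesConst (m : ℕ) : ℝ :=
  volume.real (cornerSimplex (m - 2)) / volume.real (cornerSimplex (m - 1))

theorem volume_real_cornerSimplex_pos (n : ℕ) : 0 < volume.real (cornerSimplex n) :=
  ENNReal.toReal_pos (volume_cornerSimplex_pos n).ne' (volume_cornerSimplex_lt_top n).ne

theorem stokesConst_pos (m : ℕ) : 0 < stokesConst m :=
  div_pos (volume_real_cornerSimplex_pos _) (volume_real_cornerSimplex_pos _)

/-- The Stokes formula for mean values over simplices. -/
theorem avg_fderiv_sub {s : Finset E} (hs : AffineIndependent ℝ ((↑) : s → E)) {a b : E}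
    (ha : a ∈ s) (hb : b ∈ s) {h : E → ℝ} (hh : ContDiff ℝ 1 h) :
    avg s (fun x => fderiv ℝ h x (b - a)) =
      stokesConst s.card * (avg (s.erase a) h - avg (s.erase b) h) := by
  rcases eq_or_ne a b with rfl | hab
  · simp [avg]
  obtain ⟨u, hu, hus⟩ := exists_enum ((s.erase a).erase b)
  generalize ((s.erase a).erase b).card = n at u hu hus
  have hmem : ∀ i, u i ∈ (s.erase a).erase b := fun i => by
    rw [← hus]; exact Finset.mem_map_of_mem ⟨u, hu⟩ (Finset.mem_univ i)
  have hub : ∀ i, u i ≠ b := fun i => (Finset.mem_erase.1 (hmem i)).1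
  have hua : ∀ i, u i ≠ a := fun i => (Finset.mem_erase.1 (Finset.mem_erase.1 (hmem i)).2).1
  have hus' : ∀ i, u i ∈ s := fun i =>
    (Finset.mem_erase.1 (Finset.mem_erase.1 (hmem i)).2).2
  have hrange : ∀ x, x ∈ s → x ≠ a → x ≠ b → ∃ i, u i = x := fun x hx hxa hxb => by
    have : x ∈ Finset.univ.map ⟨u, hu⟩ := by rw [hus]; simp [hx, hxa, hxb]
    simpa using this
  let vb : Fin (n + 1) → E := Fin.cons b u
  let va : Fin (n + 1) → E := Fin.cons a u
  -- With the vertices ordered a, b, and then the others, the direction of coordinate 0 is b − a.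
  -- The facet where this coordinate vanishes is the one without b, and the slanted facet is the one
  -- without a.
  let v : Fin (n + 2) → E := Fin.cons a vb
  have hvb : Function.Injective vb := Fin.cons_injective_iff.2 ⟨by simpa using hub, hu⟩
  have hva : Function.Injective va := Fin.cons_injective_iff.2 ⟨by simpa using hua, hu⟩
  have hv : Function.Injective v := by
    refine Fin.cons_injective_iff.2 ⟨?_, hvb⟩
    rintro ⟨i, hi⟩
    revert hi
    refine Fin.cases (fun h => hab h.symm) (fun i h => hua i h) i
  have mvb : ∀ i, vb i ∈ s := fun i => by
    refine Fin.cases ?_ (fun i => ?_) i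
    · exact hb
    · exact hus' i
  have mva : ∀ i, va i ∈ s := fun i => by
    refine Fin.cases ?_ (fun i => ?_) i
    · exact ha
    · exact hus' i
  have mv : ∀ i, v i ∈ s := fun i => by
    refine Fin.cases ?_ (fun i => ?_) i
    · exact ha
    · exact mvb i
  have e1 : Finset.univ.map ⟨v, hv⟩ = s := by
    ext x
    simp only [Finset.mem_map, Finset.mem_univ, true_and, Function.Embedding.coeFn_mk]
    refine ⟨fun ⟨i, hi⟩ => hi ▸ mv i, fun hx => ?_⟩
    by_cases hxa : x = a
    · exact ⟨0, hxa.symm⟩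
    by_cases hxb : x = b
    · exact ⟨1, hxb.symm⟩
    obtain ⟨i, hi⟩ := hrange x hx hxa hxb
    exact ⟨i.succ.succ, hi⟩
  have e2 : Finset.univ.map ⟨vb, hvb⟩ = s.erase a := by
    ext x
    simp only [Finset.mem_map, Finset.mem_univ, true_and, Function.Embedding.coeFn_mk,
      Finset.mem_erase]
    constructor
    · rintro ⟨i, rfl⟩
      refine ⟨?_, mvb i⟩
      refine Fin.cases ?_ (fun i => ?_) i
      · exact hab.symm
      · exact hua i
    · rintro ⟨hxa, hx⟩
      by_cases hxb : x = b
      · exact ⟨0, hxb.symm⟩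
      obtain ⟨i, hi⟩ := hrange x hx hxa hxb
      exact ⟨i.succ, hi⟩
  have e3 : Finset.univ.map ⟨va, hva⟩ = s.erase b := by
    ext x
    simp only [Finset.mem_map, Finset.mem_univ, true_and, Function.Embedding.coeFn_mk,
      Finset.mem_erase]
    constructor
    · rintro ⟨i, rfl⟩
      refine ⟨?_, mva i⟩
      refine Fin.cases ?_ (fun i => ?_) i
      · exact hab
      · exact hub i
    · rintro ⟨hxb, hx⟩
      by_cases hxa : x = a
      · exact ⟨0, hxa.symm⟩
      obtain ⟨i, hi⟩ := hrange x hx hxa hxb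
      exact ⟨i.succ, hi⟩
  have hcard : s.card = n + 2 := by rw [← e1]; simp
  have a1 := avg_map_eq (affineIndependent_of_forall_mem hs hv mv) (fun x => fderiv ℝ h x (b - a))
  have a2 := avg_map_eq (affineIndependent_of_forall_mem hs hvb mvb) h
  have a3 := avg_map_eq (affineIndependent_of_forall_mem hs hva mva) h
  rw [e1] at a1; rw [e2] at a2; rw [e3] at a3
  rw [a1, a2, a3, hcard, stokesConst]
  have hpd : ContDiff ℝ 1 (param v) := by unfold param; fun_prop
  have hst := integral_cornerSimplex_fderiv (0 : Fin (n + 1)) (hh.comp hpd)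
  have hfd : ∀ t, fderiv ℝ (h ∘ param v) t (Pi.single 0 1) = fderiv ℝ h (param v t) (b - a) := by
    intro t
    rw [fderiv_comp t (hh.differentiable one_ne_zero _) (hpd.differentiable one_ne_zero _)]
    have h1 : HasFDerivAt (param v)
        (∑ i, (ContinuousLinearMap.proj (R := ℝ) (φ := fun _ : Fin (n + 1) => ℝ) i).smulRight
          (v i.succ - v 0)) t := by
      unfold param
      refine HasFDerivAt.const_add _ (HasFDerivAt.fun_sum fun i _ => ?_)
      exact ((ContinuousLinearMap.proj (R := ℝ) (φ := fun _ : Fin (n + 1) => ℝ) i).hasFDerivAt).smul_const _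
    rw [h1.fderiv]
    simp [Pi.single_apply, ite_smul]
    rfl
  simp_rw [hfd] at hst
  simp only [Function.comp_apply, param_insertNth_zero, param_insertNth_one_sub] at hst
  have v1 : (Fin.cons (v (Fin.succ 0)) fun j => v (Fin.succAbove (0 : Fin (n + 1)) j).succ) = vb := by
    funext i
    refine Fin.cases ?_ (fun i => ?_) i
    · rfl
    · rfl
  have v2 : (fun j => v ((Fin.succ (0 : Fin (n + 1))).succAbove j)) = va := by
    funext i
    refine Fin.cases ?_ (fun i => ?_) i
    · rfl
    · simp only [Fin.succ_succAbove_succ]; rfl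
  rw [v1, v2] at hst
  have ib : ∀ w : Fin (n + 1) → E, IntegrableOn (fun t => h (param w t)) (cornerSimplex n) := fun w =>
    (hh.continuous.comp (continuous_param w)).continuousOn.integrableOn_compact
      (isCompact_cornerSimplex n)
  rw [integral_sub (ib vb) (ib va)] at hst
  rw [setAverage_eq, setAverage_eq, setAverage_eq, hst]
  have p1 := (volume_real_cornerSimplex_pos n).ne'
  have p2 := (volume_real_cornerSimplex_pos (n + 1)).ne'
  have q1 : n + 2 - 2 = n := rfl
  have q2 : n + 2 - 1 = n + 1 := rfl
  rw [q1, q2, smul_eq_mul, smul_eq_mul, smul_eq_mul]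
  field_simp

/-! ## Mean values over simplices -/

section avg

variable {s : Finset E}

theorem isCompact_hull (s : Finset E) : IsCompact (hull s) := s.finite_toSet.isCompact_convexHull ℝ

theorem isClosed_hull (s : Finset E) : IsClosed (hull s) := (isCompact_hull s).isClosed

theorem measurableSet_hull (s : Finset E) : MeasurableSet (hull s) := (isClosed_hull s).measurableSet

theorem exists_param (hs : AffineIndependent ℝ ((↑) : s → E))
    (hne : s.Nonempty) : ∃ (n : ℕ) (v : Fin (n + 1) → E), s.card = n + 1 ∧
    param v '' cornerSimplex n = hull s ∧
    (∀ h, avg s h = ⨍ t in cornerSimplex n, h (param v t)) ∧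
    ∃ c : ENNReal, c ≠ 0 ∧ c ≠ ⊤ ∧ (μHE[s.card - 1] : Measure E).restrict (hull s) =
        c • ((volume.restrict (cornerSimplex n)).map (param v)) := by
  obtain ⟨u, hu, hus⟩ := exists_enum s
  obtain ⟨n, hn⟩ : ∃ n, s.card = n + 1 := ⟨s.card - 1, by have := hne.card_pos; omega⟩
  have hmem : ∀ i, u i ∈ s := fun i => by
    have := Finset.mem_map_of_mem ⟨u, hu⟩ (Finset.mem_univ i)
    rwa [hus] at this
  have hind := affineIndependent_of_forall_mem hs hu hmem
  have hc : s.card - 1 = n := by omega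
  rw [hc]
  generalize s.card = m at u hu hus hn hmem hind
  subst hn
  obtain rfl := hus
  refine ⟨n, u, rfl, image_param_cornerSimplex hu, fun h => avg_map_eq hind h,
    exists_restrict_hull_eq hind⟩

theorem measure_hull_pos_lt_top (hs : AffineIndependent ℝ ((↑) : s → E))
    (hne : s.Nonempty) :
    0 < (μHE[s.card - 1] : Measure E) (hull s) ∧ (μHE[s.card - 1] : Measure E) (hull s) < ⊤ := by
  obtain ⟨n, v, -, -, -, c, hc0, hct, h⟩ := exists_param hs hne
  have h1 : (μHE[s.card - 1] : Measure E) (hull s) = c * volume (cornerSimplex n) := by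
    rw [← Measure.restrict_apply_univ, h, Measure.smul_apply,
      Measure.map_apply (continuous_param v).measurable MeasurableSet.univ, Set.preimage_univ,
      Measure.restrict_apply_univ, smul_eq_mul]
  rw [h1]
  exact ⟨ENNReal.mul_pos hc0 (volume_cornerSimplex_pos n).ne',
    ENNReal.mul_lt_top hct.lt_top (volume_cornerSimplex_lt_top n)⟩

theorem avg_eq (h : E → ℝ) : avg s h = ((μHE[s.card - 1] : Measure E).real (hull s))⁻¹ *
    ∫ x in hull s, h x ∂μHE[s.card - 1] := by
  rw [avg, setAverage_eq, smul_eq_mul]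

theorem avg_eq_zero_iff (hs : AffineIndependent ℝ ((↑) : s → E))
    (hne : s.Nonempty) (h : E → ℝ) :
    avg s h = 0 ↔ ∫ x in hull s, h x ∂μHE[s.card - 1] = 0 := by
  obtain ⟨h1, h2⟩ := measure_hull_pos_lt_top hs hne
  have : (μHE[s.card - 1] : Measure E).real (hull s) ≠ 0 := (ENNReal.toReal_pos h1.ne' h2.ne).ne'
  rw [avg_eq, mul_eq_zero]
  simp [this]

theorem integrableOn_hull (hs : AffineIndependent ℝ ((↑) : s → E))
    (hne : s.Nonempty) {h : E → ℝ} (hh : ContinuousOn h (hull s)) :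
    IntegrableOn h (hull s) μHE[s.card - 1] := by
  have : IsFiniteMeasure ((μHE[s.card - 1] : Measure E).restrict (hull s)) :=
    isFiniteMeasure_restrict.2 (measure_hull_pos_lt_top hs hne).2.ne
  have := hh.integrableOn_compact' (μ := (μHE[s.card - 1] : Measure E).restrict (hull s))
    (isCompact_hull s) (measurableSet_hull s)
  rwa [IntegrableOn, Measure.restrict_restrict (measurableSet_hull s), Set.inter_self] at this

theorem avg_congr {h h' : E → ℝ} (e : ∀ x ∈ hull s, h x = h' x) : avg s h = avg s h' := by
  rw [avg_eq, avg_eq, setIntegral_congr_fun (measurableSet_hull s) e]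

theorem avg_const (hs : AffineIndependent ℝ ((↑) : s → E))
    (hne : s.Nonempty) (c : ℝ) : avg s (fun _ => c) = c := by
  obtain ⟨h1, h2⟩ := measure_hull_pos_lt_top hs hne
  exact setAverage_const h1.ne' h2.ne c

theorem avg_const_mul (c : ℝ) (h : E → ℝ) : avg s (fun x => c * h x) = c * avg s h := by
  rw [avg_eq, avg_eq, integral_const_mul]; ring

theorem avg_add (hs : AffineIndependent ℝ ((↑) : s → E))
    (hne : s.Nonempty) {h h' : E → ℝ} (hh : ContinuousOn h (hull s))
    (hh' : ContinuousOn h' (hull s)) : avg s (fun x => h x + h' x) = avg s h + avg s h' := by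
  rw [avg_eq, avg_eq, avg_eq, integral_add (integrableOn_hull hs hne hh)
    (integrableOn_hull hs hne hh')]; ring

theorem avg_sub (hs : AffineIndependent ℝ ((↑) : s → E))
    (hne : s.Nonempty) {h h' : E → ℝ} (hh : ContinuousOn h (hull s))
    (hh' : ContinuousOn h' (hull s)) : avg s (fun x => h x - h' x) = avg s h - avg s h' := by
  rw [avg_eq, avg_eq, avg_eq, integral_sub (integrableOn_hull hs hne hh)
    (integrableOn_hull hs hne hh')]; ring

theorem avg_sum (hs : AffineIndependent ℝ ((↑) : s → E))
    (hne : s.Nonempty) {ι : Type*} (I : Finset ι) {h : ι → E → ℝ}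
    (hh : ∀ i ∈ I, ContinuousOn (h i) (hull s)) :
    avg s (fun x => ∑ i ∈ I, h i x) = ∑ i ∈ I, avg s (h i) := by
  simp only [avg_eq]
  rw [integral_finsetSum _ fun i hi => integrableOn_hull hs hne (hh i hi), Finset.mul_sum]

theorem avg_pos (hs : AffineIndependent ℝ ((↑) : s → E))
    (hne : s.Nonempty) {h : E → ℝ} (hh : ContinuousOn h (hull s))
    (h0 : ∀ x ∈ hull s, 0 ≤ h x) {z : E} (hz : z ∈ hull s) (hpos : 0 < h z) : 0 < avg s h := by
  obtain ⟨n, v, -, him, hav, -⟩ := exists_param hs hne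
  have hmaps : Set.MapsTo (param v) (cornerSimplex n) (hull s) := by
    rw [← him]; exact Set.mapsTo_image _ _
  have hc : ContinuousOn (fun t => h (param v t)) (cornerSimplex n) :=
    hh.comp (continuous_param v).continuousOn hmaps
  have hInt : IntegrableOn (fun t => h (param v t)) (cornerSimplex n) :=
    hc.integrableOn_compact (isCompact_cornerSimplex n)
  rw [hav, setAverage_eq, smul_eq_mul]
  refine mul_pos (inv_pos.2 (volume_real_cornerSimplex_pos n)) ?_
  rw [setIntegral_pos_iff_support_of_nonneg_ae
    (ae_restrict_of_forall_mem (measurableSet_cornerSimplex n) fun t ht => h0 _ (hmaps ht)) hInt]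
  rw [← him] at hz
  obtain ⟨t, ht, rfl⟩ := hz
  -- near `t` the function is positive, and every neighbourhood of `t` meets the open simplex
  obtain ⟨U, hU, htU, hUpos⟩ : ∃ U : Set (Fin n → ℝ), IsOpen U ∧ t ∈ U ∧
      ∀ t' ∈ U ∩ cornerSimplex n, 0 < h (param v t') := by
    have := (hc t ht).eventually (lt_mem_nhds hpos)
    rw [eventually_nhdsWithin_iff] at this
    obtain ⟨U, hU1, hU2, hU3⟩ := eventually_nhds_iff.1 this
    exact ⟨U, hU2, hU3, fun t' h' => hU1 t' h'.1 h'.2⟩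
  let O : Set (Fin n → ℝ) := {t | (∀ i, 0 < t i) ∧ ∑ i, t i < 1}
  have hO : IsOpen O := by
    refine IsOpen.inter (s := {t : Fin n → ℝ | ∀ i, 0 < t i}) ?_ ?_
    · simp only [Set.ofPred_forall]
      exact isOpen_iInter_of_finite fun i => isOpen_lt continuous_const (continuous_apply i)
    · exact isOpen_lt (continuous_finsetSum _ fun i _ => continuous_apply i) continuous_const
  have hne' : (U ∩ O).Nonempty := by
    let c : Fin n → ℝ := fun _ => 1 / (n + 1)
    have hcO : c ∈ O := by
      refine ⟨fun i => by simp only [c]; positivity, ?_⟩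
      simp only [c, Finset.sum_const, Finset.card_univ, Fintype.card_fin, nsmul_eq_mul]
      rw [mul_one_div, div_lt_one (by positivity)]
      linarith
    have hlim : Tendsto (fun r : ℝ => t + r • (c - t)) (𝓝[>] 0) (𝓝 t) := by
      have : Continuous fun r : ℝ => t + r • (c - t) := by fun_prop
      have h := this.tendsto 0
      simp only [zero_smul, add_zero] at h
      exact h.mono_left nhdsWithin_le_nhds
    obtain ⟨r, hrU, hr⟩ := ((hlim.eventually (hU.mem_nhds htU)).and
      (Ioo_mem_nhdsGT (zero_lt_one' ℝ))).exists
    refine ⟨_, hrU, fun i => ?_, ?_⟩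
    · have h1 := ht.1 i
      have h2 := hcO.1 i
      have : (t + r • (c - t)) i = (1 - r) * t i + r * c i := by simp; ring
      rw [this]
      have := mul_pos hr.1 h2
      have := mul_nonneg (sub_nonneg.2 hr.2.le) h1
      linarith
    · have h1 := ht.2
      have h2 := hcO.2
      have : ∑ i, (t + r • (c - t)) i = (1 - r) * ∑ i, t i + r * ∑ i, c i := by
        rw [Finset.mul_sum, Finset.mul_sum, ← Finset.sum_add_distrib]
        exact Finset.sum_congr rfl fun i _ => by simp; ring
      rw [this]
      nlinarith [hr.1, hr.2]
  refine ((hU.inter hO).measure_pos volume hne').trans_le (measure_mono fun t' ht' => ?_)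
  have hm : t' ∈ cornerSimplex n := ⟨fun i => (ht'.2.1 i).le, ht'.2.2.le⟩
  exact ⟨(hUpos t' ⟨ht'.1, hm⟩).ne', hm⟩

theorem setIntegral_hull_eq_mul_avg (hs : AffineIndependent ℝ ((↑) : s → E))
    (hcard : s.card = 4) (h : E → ℝ) :
    ∫ x in hull s, h x = volume.real (hull s) * avg s h := by
  have hv : (μHE[s.card - 1] : Measure E) = volume := by
    rw [hcard]; exact EuclideanSpace.euclideanHausdorffMeasure_eq_volume 3
  have hne : s.Nonempty := Finset.card_pos.1 (by omega)
  obtain ⟨h1, h2⟩ := measure_hull_pos_lt_top hs hne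
  have h3 := (ENNReal.toReal_pos h1.ne' h2.ne).ne'
  rw [avg_eq, hv]
  rw [hv] at h3
  rw [Measure.real, mul_inv_cancel_left₀ h3]

theorem volume_hull_pos (hs : AffineIndependent ℝ ((↑) : s → E))
    (hcard : s.card = 4) : 0 < volume.real (hull s) := by
  have hv : (μHE[s.card - 1] : Measure E) = volume := by
    rw [hcard]; exact EuclideanSpace.euclideanHausdorffMeasure_eq_volume 3
  have hne : s.Nonempty := Finset.card_pos.1 (by omega)
  obtain ⟨h1, h2⟩ := measure_hull_pos_lt_top hs hne
  rw [hv] at h1 h2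
  exact ENNReal.toReal_pos h1.ne' h2.ne

end avg

/-! ## Point values of polynomials -/

theorem pderiv_comm (i j : Fin 3) (p : SPoly) :
    MvPolynomial.pderiv i (MvPolynomial.pderiv j p) =
      MvPolynomial.pderiv j (MvPolynomial.pderiv i p) := by
  rcases eq_or_ne i j with rfl | hij
  · rfl
  ext d
  simp only [MvPolynomial.coeff_pderiv, Finsupp.add_apply, Finsupp.single_eq_of_ne hij,
    Finsupp.single_eq_of_ne hij.symm, add_zero]
  rw [add_right_comm]
  ring

section ev

open MvPolynomial

variable (p q : SPoly) (x : E)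

@[simp] theorem ev_add : ev (p + q) x = ev p x + ev q x := by simp [ev]
@[simp] theorem ev_sub : ev (p - q) x = ev p x - ev q x := by simp [ev]
@[simp] theorem ev_mul : ev (p * q) x = ev p x * ev q x := by simp [ev]
@[simp] theorem ev_zero : ev 0 x = 0 := by simp [ev]
@[simp] theorem ev_one : ev 1 x = 1 := by simp [ev]
@[simp] theorem ev_C (c : ℝ) : ev (C c) x = c := by simp [ev]
@[simp] theorem ev_X (i : Fin 3) : ev (X i) x = x i := by simp [ev]
@[simp] theorem ev_smul (c : ℝ) : ev (c • p) x = c * ev p x := by simp [ev]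

theorem ev_sum {ι : Type*} (s : Finset ι) (f : ι → SPoly) :
    ev (∑ i ∈ s, f i) x = ∑ i ∈ s, ev (f i) x := by simp [ev]

theorem ev_prod {ι : Type*} (s : Finset ι) (f : ι → SPoly) :
    ev (∏ i ∈ s, f i) x = ∏ i ∈ s, ev (f i) x := by simp [ev]

theorem evV_add (u w : VPoly) : evV (u + w) x = evV u x + evV w x := by ext i; simp [evV]
theorem evV_sub (u w : VPoly) : evV (u - w) x = evV u x - evV w x := by ext i; simp [evV]
@[simp] theorem evV_zero : evV 0 x = 0 := by ext i; simp [evV]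
theorem evV_smul (c : ℝ) (u : VPoly) : evV (c • u) x = c • evV u x := by ext i; simp [evV]

theorem gradP_add : gradP (p + q) = gradP p + gradP q := by ext1 i; simp [gradP]
theorem gradP_sub : gradP (p - q) = gradP p - gradP q := by ext1 i; simp [gradP]
@[simp] theorem gradP_zero : gradP 0 = 0 := by ext1 i; simp [gradP]
theorem gradP_smul (c : ℝ) : gradP (c • p) = c • gradP p := by ext1 i; simp [gradP]

theorem gradP_sum {ι : Type*} (s : Finset ι) (f : ι → SPoly) :
    gradP (∑ i ∈ s, f i) = ∑ i ∈ s, gradP (f i) := by ext1 i; simp [gradP]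

theorem curlP_add (u w : VPoly) : curlP (u + w) = curlP u + curlP w := by
  ext1 i; fin_cases i <;> simp [curlP] <;> ring
theorem curlP_sub (u w : VPoly) : curlP (u - w) = curlP u - curlP w := by
  ext1 i; fin_cases i <;> simp [curlP] <;> ring
theorem curlP_gradP : curlP (gradP p) = 0 := by
  ext1 i; fin_cases i <;> simp [curlP, gradP, sub_eq_zero] <;> exact pderiv_comm _ _ _

end ev

theorem continuous_ev (p : SPoly) : Continuous (ev p) := by
  unfold ev
  exact (MvPolynomial.continuous_eval p).comp (by fun_prop)

theorem continuous_evV (u : VPoly) : Continuous (evV u) :=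
  continuous_pi fun i => continuous_ev (u i)

theorem hasFDerivAt_ev (p : SPoly) (x : E) :
    HasFDerivAt (ev p) (∑ i, ev (MvPolynomial.pderiv i p) x •
      (EuclideanSpace.proj i : E →L[ℝ] ℝ)) x := by
  induction p using MvPolynomial.induction_on with
  | C a =>
    have : ev (MvPolynomial.C a) = fun _ => a := by ext; simp
    rw [this]
    simpa using hasFDerivAt_const a x
  | add p q hp hq =>
    have : ev (p + q) = fun y => ev p y + ev q y := by ext; simp
    rw [this]
    refine (hp.add hq).congr_fderiv ?_
    simp [add_smul, Finset.sum_add_distrib]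
  | mul_X p n hp =>
    have : ev (p * MvPolynomial.X n) = fun y => ev p y * y n := by ext; simp
    rw [this]
    refine (hp.mul ((EuclideanSpace.proj n : E →L[ℝ] ℝ).hasFDerivAt (x := x))).congr_fderiv ?_
    ext y
    fin_cases n <;> simp [Fin.sum_univ_three, MvPolynomial.pderiv_X] <;> ring

theorem contDiff_ev (p : SPoly) {n : ℕ∞} : ContDiff ℝ n (ev p) := by
  induction p using MvPolynomial.induction_on with
  | C a =>
    have : ev (MvPolynomial.C a) = fun _ => a := by ext; simp
    rw [this]; fun_prop
  | add p q hp hq =>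
    have : ev (p + q) = fun y => ev p y + ev q y := by ext; simp
    rw [this]; fun_prop
  | mul_X p n hp =>
    have : ev (p * MvPolynomial.X n) = fun y => ev p y * y n := by ext; simp
    rw [this]; fun_prop

theorem fderiv_ev (p : SPoly) (x τ : E) :
    fderiv ℝ (ev p) x τ = evV (gradP p) x ⬝ᵥ (fun i => τ i) := by
  rw [(hasFDerivAt_ev p x).fderiv]
  simp [dotProduct, evV, gradP]

theorem pd_ev (i : Fin 3) (p : SPoly) (x : E) : pd i (ev p) x = ev (MvPolynomial.pderiv i p) x := by
  rw [pd, fderiv_ev]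
  simp [evV, gradP, dotProduct, Pi.single_apply]

/-- A polynomial that vanishes on a nonempty open set is zero. -/
theorem eq_zero_of_ev_eq_zero {p : SPoly} {U : Set E} (hU : IsOpen U) (hne : U.Nonempty)
    (h : ∀ x ∈ U, ev p x = 0) : p = 0 := by
  obtain ⟨x, hx⟩ := hne
  let φ : (Fin 3 → ℝ) → E := fun y => WithLp.toLp 2 y
  have hφ : Continuous φ := PiLp.continuous_toLp 2 _
  have hO : IsOpen (φ ⁻¹' U) := hU.preimage hφ
  have hxO : (fun i => x i) ∈ φ ⁻¹' U := hx
  obtain ⟨ε, hε, hb⟩ := Metric.isOpen_iff.1 hO _ hxO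
  refine MvPolynomial.funext_set (fun i => Metric.ball (x i) ε) (fun i => ?_) fun y hy => ?_
  · rw [Real.ball_eq_Ioo]; exact Set.Ioo_infinite (by linarith)
  · have : y ∈ φ ⁻¹' U := hb ((ball_pi (fun i => x i) hε).symm ▸ hy)
    simpa [ev] using h _ this

theorem ev_injective {p q : SPoly} (h : ∀ x, ev p x = ev q x) : p = q :=
  sub_eq_zero.1 (eq_zero_of_ev_eq_zero isOpen_univ ⟨0, trivial⟩ fun x _ => by simp [h x])

/-! ## Degrees -/

theorem mem_polyDeg {k : ℕ} {p : SPoly} : p ∈ PolyDeg k ↔ p.totalDegree ≤ k :=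
  MvPolynomial.mem_restrictTotalDegree _ _ _

theorem mem_polyDeg_iff {k : ℕ} {p : SPoly} :
    p ∈ PolyDeg k ↔ ∀ d ∈ p.support, d.degree ≤ k := by
  rw [mem_polyDeg, MvPolynomial.totalDegree, Finset.sup_le_iff]
  rfl

theorem polyDeg_mono {k l : ℕ} (h : k ≤ l) : PolyDeg k ≤ PolyDeg l := fun p hp =>
  mem_polyDeg.2 ((mem_polyDeg.1 hp).trans h)

theorem mul_mem_polyDeg {k l : ℕ} {p q : SPoly} (hp : p ∈ PolyDeg k) (hq : q ∈ PolyDeg l) :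
    p * q ∈ PolyDeg (k + l) :=
  mem_polyDeg.2 ((MvPolynomial.totalDegree_mul p q).trans
    (add_le_add (mem_polyDeg.1 hp) (mem_polyDeg.1 hq)))

theorem C_mem_polyDeg (c : ℝ) (k : ℕ) : MvPolynomial.C c ∈ PolyDeg k :=
  mem_polyDeg.2 (by simp)

theorem X_mem_polyDeg (i : Fin 3) : (MvPolynomial.X i : SPoly) ∈ PolyDeg 1 :=
  mem_polyDeg.2 (by simp)

theorem pderiv_mem_polyDeg {k : ℕ} {p : SPoly} (hp : p ∈ PolyDeg k) (i : Fin 3) :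
    MvPolynomial.pderiv i p ∈ PolyDeg (k - 1) := by
  rw [mem_polyDeg_iff] at hp ⊢
  intro d hd
  rw [MvPolynomial.mem_support_iff, MvPolynomial.coeff_pderiv] at hd
  have := hp _ (MvPolynomial.mem_support_iff.2 (left_ne_zero_of_mul hd))
  simp only [map_add, Finsupp.degree_single] at this
  omega

theorem eq_C_of_mem_polyDeg_zero {p : SPoly} (hp : p ∈ PolyDeg 0) :
    p = MvPolynomial.C (MvPolynomial.coeff 0 p) :=
  MvPolynomial.totalDegree_eq_zero_iff_eq_C.1 (Nat.le_zero.1 (mem_polyDeg.1 hp))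

theorem pderiv_eq_zero_of_mem_polyDeg_zero {p : SPoly} (hp : p ∈ PolyDeg 0) (i : Fin 3) :
    MvPolynomial.pderiv i p = 0 := by
  rw [eq_C_of_mem_polyDeg_zero hp, MvPolynomial.pderiv_C]

theorem eq_C_of_gradP_eq_zero {p : SPoly} (h : gradP p = 0) :
    p = MvPolynomial.C (MvPolynomial.coeff 0 p) := by
  ext d
  rw [MvPolynomial.coeff_C]
  split_ifs with hd
  · rw [hd]
  · obtain ⟨i, hi⟩ : ∃ i, d i ≠ 0 := by
      by_contra! hcon
      exact hd (Finsupp.ext fun i => (hcon i).symm)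
    have h1 := congrArg (MvPolynomial.coeff (d - Finsupp.single i 1)) (congrFun h i)
    rw [gradP, MvPolynomial.coeff_pderiv] at h1
    have h2 : d - Finsupp.single i 1 + Finsupp.single i 1 = d :=
      tsub_add_cancel_of_le (Finsupp.single_le_iff.2 (Nat.one_le_iff_ne_zero.2 hi))
    rw [h2] at h1
    exact (mul_eq_zero.1 h1).resolve_right (by positivity)

/-- The monomial basis of `P_k`. -/
def polyDegBasis (k : ℕ) : Module.Basis {d : Fin 3 →₀ ℕ | d.degree ≤ k} ℝ (PolyDeg k) :=
  MvPolynomial.basisRestrictSupport ℝ {d : Fin 3 →₀ ℕ | d.degree ≤ k}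

theorem finite_degree_le (k : ℕ) : {d : Fin 3 →₀ ℕ | d.degree ≤ k}.Finite := by
  refine (Set.finite_Iic (Finsupp.equivFunOnFinite.symm fun _ : Fin 3 => k)).subset fun d hd i => ?_
  exact (Finsupp.le_degree i d).trans hd

instance (k : ℕ) : FiniteDimensional ℝ (PolyDeg k) := by
  have := (finite_degree_le k).to_subtype
  exact (polyDegBasis k).finiteDimensional_of_finite

/-! ## Degree scaling and polynomial potentials -/

/-- Division of the homogeneous part of degree `m` by `m + c`. -/
def degScale (c : ℕ) : SPoly →ₗ[ℝ] SPoly :=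
  (MvPolynomial.basisMonomials (Fin 3) ℝ).constr ℝ
    fun d => MvPolynomial.monomial d (((d.degree + c : ℕ) : ℝ)⁻¹)

theorem degScale_monomial (c : ℕ) (d : Fin 3 →₀ ℕ) (a : ℝ) :
    degScale c (MvPolynomial.monomial d a) =
      MvPolynomial.monomial d (((d.degree + c : ℕ) : ℝ)⁻¹ * a) := by
  have : MvPolynomial.monomial d a = a • MvPolynomial.basisMonomials (Fin 3) ℝ d := by
    simp [MvPolynomial.smul_monomial]
  rw [this, map_smul, degScale, Module.Basis.constr_basis, MvPolynomial.smul_monomial, smul_eq_mul,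
    mul_comm]

theorem coeff_degScale (c : ℕ) (d : Fin 3 →₀ ℕ) (p : SPoly) :
    MvPolynomial.coeff d (degScale c p) = ((d.degree + c : ℕ) : ℝ)⁻¹ * MvPolynomial.coeff d p := by
  induction p using MvPolynomial.induction_on' with
  | monomial e a =>
    rw [degScale_monomial, MvPolynomial.coeff_monomial, MvPolynomial.coeff_monomial]
    split_ifs with h
    · rw [h]
    · simp
  | add p q hp hq => simp [hp, hq, mul_add]

theorem degScale_mem_polyDeg {k : ℕ} {p : SPoly} (hp : p ∈ PolyDeg k) (c : ℕ) :
    degScale c p ∈ PolyDeg k := by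
  rw [mem_polyDeg_iff] at hp ⊢
  intro d hd
  rw [MvPolynomial.mem_support_iff, coeff_degScale] at hd
  exact hp d (MvPolynomial.mem_support_iff.2 (right_ne_zero_of_mul hd))

theorem pderiv_degScale (c : ℕ) (i : Fin 3) (p : SPoly) :
    MvPolynomial.pderiv i (degScale c p) = degScale (c + 1) (MvPolynomial.pderiv i p) := by
  ext d
  rw [MvPolynomial.coeff_pderiv, coeff_degScale, coeff_degScale, MvPolynomial.coeff_pderiv]
  simp only [map_add, Finsupp.degree_single]
  rw [show d.degree + 1 + c = d.degree + (c + 1) by ring]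
  ring

theorem degScale_X_mul (c : ℕ) (i : Fin 3) (p : SPoly) :
    degScale c (MvPolynomial.X i * p) = MvPolynomial.X i * degScale (c + 1) p := by
  induction p using MvPolynomial.induction_on' with
  | monomial e a =>
    rw [degScale_monomial, MvPolynomial.X, MvPolynomial.monomial_mul, MvPolynomial.monomial_mul,
      degScale_monomial]
    simp only [map_add, Finsupp.degree_single, one_mul]
    rw [show 1 + e.degree + c = e.degree + (c + 1) by ring]
  | add p q hp hq => simp [hp, hq, mul_add]

/-- `degScale c` inverts the Euler operator `x·∇ + c`. -/
theorem degScale_euler {c : ℕ} (hc : c ≠ 0) (p : SPoly) :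
    degScale c (∑ i, MvPolynomial.X i * MvPolynomial.pderiv i p + (c : ℝ) • p) = p := by
  induction p using MvPolynomial.induction_on' with
  | monomial e a =>
    have h := (MvPolynomial.isHomogeneous_monomial (n := e.degree) a rfl).sum_X_mul_pderiv
    rw [h, ← Nat.cast_smul_eq_nsmul ℝ, ← add_smul, map_smul, degScale_monomial,
      MvPolynomial.smul_monomial, smul_eq_mul]
    congr 1
    have : ((e.degree + c : ℕ) : ℝ) ≠ 0 := by positivity
    push_cast at this ⊢
    field_simp
  | add p q hp hq =>
    simp only [map_add, mul_add, Finset.sum_add_distrib, smul_add] at hp hq ⊢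
    linear_combination hp + hq

/-- The integral of t^m over [0, 1] is 1 / (m + 1). In this form one sees that the scaled polynomial
vanishes at x as soon as the original one vanishes on the segment from 0 to x. -/
theorem ev_degScale_one (p : SPoly) (x : E) : ev (degScale 1 p) x = ∫ t in (0 : ℝ)..1, ev p (t • x) := by
  induction p using MvPolynomial.induction_on' with
  | monomial e a =>
    rw [degScale_monomial]
    simp only [ev, MvPolynomial.eval_monomial]
    have : ∀ t : ℝ, (e.prod fun n k => (t • x) n ^ k) = t ^ e.degree * e.prod fun n k => x n ^ k := by
      intro t
      simp only [PiLp.smul_apply, smul_eq_mul, mul_pow, Finsupp.prod_mul]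
      congr 1
      rw [Finsupp.prod, Finset.prod_pow_eq_pow_sum]
      rfl
    simp only [this]
    rw [intervalIntegral.integral_const_mul, intervalIntegral.integral_mul_const, integral_pow]
    simp
    ring
  | add p q hp hq =>
    have hc : ∀ p : SPoly, Continuous fun t : ℝ => ev p (t • x) := fun p =>
      (continuous_ev p).comp (by fun_prop)
    simp only [map_add, ev_add, hp, hq]
    rw [intervalIntegral.integral_add ((hc p).intervalIntegrable _ _)
      ((hc q).intervalIntegrable _ _)]

/-- Divergence of a polynomial vector field. -/
def divP (u : VPoly) : SPoly := ∑ i, MvPolynomial.pderiv i (u i)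

/-- The radial potential of a polynomial vector field. -/
def radialPot (u : VPoly) : SPoly := degScale 0 (∑ i, MvPolynomial.X i * u i)

/-- The homotopy formula for the radial field: ∂_i (x·u) = (x·∇ + 1) u_i + (x × ∇×u)_i, and
`degScale 1` inverts x·∇ + 1. The undefined weight of `degScale 0` at degree zero is harmless, as
x·u has no constant term. -/
theorem gradP_radialPot (u : VPoly) (i : Fin 3) :
    gradP (radialPot u) i = u i + degScale 1 ((idP ⨯₃ curlP u) i) := by
  rw [gradP, radialPot, pderiv_degScale]
  conv_rhs => rw [← degScale_euler one_ne_zero (u i), ← map_add]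
  congr 1
  fin_cases i <;> simp [Fin.sum_univ_three, cross_apply, curlP, idP, MvPolynomial.pderiv_X]
    <;> ring

/-- The radial vector potential of a polynomial vector field. -/
def radialVecPot (u : VPoly) : VPoly := fun i => degScale 1 ((u ⨯₃ idP) i)

/-- Pulling the coordinate factor out of `degScale` raises the shift from 1 to 2. The result
exhibits the potential as x × w with w of the same degree as u, the second summand in the definition
of the Nédélec space. -/
theorem radialVecPot_eq (u : VPoly) :
    radialVecPot u = idP ⨯₃ (fun i => -degScale 2 (u i)) := by
  ext1 i
  fin_cases i <;> simp [radialVecPot, cross_apply, idP, mul_comm _ (MvPolynomial.X _),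
    degScale_X_mul] <;> ring

/-- For divergence-free u one has ∇×(u × x) = (x·∇ + 2) u, and differentiation turns `degScale 1`
into `degScale 2`, which inverts that operator. -/
theorem curlP_radialVecPot {u : VPoly} (hu : divP u = 0) : curlP (radialVecPot u) = u := by
  have key : ∀ i, curlP (radialVecPot u) i = degScale 2 (curlP (u ⨯₃ idP) i) := by
    intro i
    fin_cases i <;> simp [curlP, radialVecPot, pderiv_degScale]
  ext1 i
  rw [key]
  conv_rhs => rw [← degScale_euler two_ne_zero (u i)]
  congr 1
  simp only [divP, Fin.sum_univ_three] at hu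
  rw [Nat.cast_smul_eq_nsmul]
  fin_cases i <;> simp [Fin.sum_univ_three, cross_apply, curlP, idP, MvPolynomial.pderiv_X]
  · linear_combination (-MvPolynomial.X 0) * hu
  · linear_combination (-MvPolynomial.X 1) * hu
  · linear_combination (-MvPolynomial.X 2) * hu

/-! ## Affine polynomials and affine substitutions -/

/-- The affine polynomial `c + B · x`. -/
def affPoly (c : ℝ) (B : V) : SPoly := MvPolynomial.C c + ∑ i, MvPolynomial.C (B i) * MvPolynomial.X i

theorem ev_affPoly (c : ℝ) (B : V) (x : E) : ev (affPoly c B) x = c + B ⬝ᵥ fun i => x i := by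
  simp [affPoly, ev_sum, dotProduct]

theorem gradP_affPoly (c : ℝ) (B : V) : gradP (affPoly c B) = fun i => MvPolynomial.C (B i) := by
  ext1 i
  fin_cases i <;> simp [gradP, affPoly, Fin.sum_univ_three, MvPolynomial.pderiv_X]

theorem affPoly_mem_polyDeg (c : ℝ) (B : V) : affPoly c B ∈ PolyDeg 1 :=
  add_mem (C_mem_polyDeg c 1) (sum_mem fun i _ => by
    simpa using mul_mem_polyDeg (C_mem_polyDeg (B i) 0) (X_mem_polyDeg i))

theorem pow_mem_polyDeg {k : ℕ} {p : SPoly} (hp : p ∈ PolyDeg k) (n : ℕ) : p ^ n ∈ PolyDeg (n * k) := by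
  rw [mem_polyDeg] at hp ⊢
  exact (MvPolynomial.totalDegree_pow p n).trans (Nat.mul_le_mul_left n hp)

theorem prod_mem_polyDeg {ι : Type*} (s : Finset ι) {k : ι → ℕ} {p : ι → SPoly}
    (hp : ∀ i ∈ s, p i ∈ PolyDeg (k i)) : ∏ i ∈ s, p i ∈ PolyDeg (∑ i ∈ s, k i) := by
  rw [mem_polyDeg]
  exact (MvPolynomial.totalDegree_finsetProd s p).trans
    (Finset.sum_le_sum fun i hi => mem_polyDeg.1 (hp i hi))

theorem ev_bind₁ (A : VPoly) (p : SPoly) (x : E) :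
    ev (MvPolynomial.bind₁ A p) x = ev p (WithLp.toLp 2 (evV A x)) := by
  unfold ev
  rw [MvPolynomial.eval, MvPolynomial.eval₂Hom_bind₁]
  rfl

theorem bind₁_mem_polyDeg {A : VPoly} (hA : ∀ i, A i ∈ PolyDeg 1) {k : ℕ} {p : SPoly}
    (hp : p ∈ PolyDeg k) : MvPolynomial.bind₁ A p ∈ PolyDeg k := by
  rw [MvPolynomial.as_sum p, map_sum]
  refine sum_mem fun d hd => ?_
  rw [MvPolynomial.bind₁_monomial]
  have h1 : ∏ i ∈ d.support, A i ^ d i ∈ PolyDeg (∑ i ∈ d.support, d i) :=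
    prod_mem_polyDeg _ fun i _ => by simpa using pow_mem_polyDeg (hA i) (d i)
  have h2 := mul_mem_polyDeg (C_mem_polyDeg (MvPolynomial.coeff d p) 0) h1
  rw [zero_add] at h2
  exact polyDeg_mono (mem_polyDeg_iff.1 hp d hd) h2

/-- The polynomial `y ↦ p (y + a)`. -/
def shiftP (a : E) (p : SPoly) : SPoly :=
  MvPolynomial.bind₁ (fun i => MvPolynomial.X i + MvPolynomial.C (a i)) p

theorem ev_shiftP (a : E) (p : SPoly) (x : E) : ev (shiftP a p) x = ev p (x + a) := by
  rw [shiftP, ev_bind₁]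
  congr 1
  ext i
  simp [evV]

theorem shiftP_mem_polyDeg (a : E) {k : ℕ} {p : SPoly} (hp : p ∈ PolyDeg k) :
    shiftP a p ∈ PolyDeg k :=
  bind₁_mem_polyDeg (fun i => add_mem (X_mem_polyDeg i) (C_mem_polyDeg _ _)) hp

theorem pderiv_shiftP (a : E) (p : SPoly) (i : Fin 3) :
    MvPolynomial.pderiv i (shiftP a p) = shiftP a (MvPolynomial.pderiv i p) := by
  refine ev_injective fun x => ?_
  rw [ev_shiftP, ← pd_ev, ← pd_ev, pd, pd]
  have : ev (shiftP a p) = fun y => ev p (y + a) := funext fun y => ev_shiftP a p y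
  rw [this, fderiv_comp_add_right]

/-! ## Projections with respect to semidefinite forms -/

/-- The form may degenerate on S, as the energy form does on constants. By Cauchy–Schwarz a null
vector is orthogonal to everything, so the equation only has to be solved on a complement of the
kernel, where the form is nondegenerate. No solvability condition on g arises. -/
theorem exists_projection {W : Type*} [AddCommGroup W] [Module ℝ W] (B : W →ₗ[ℝ] W →ₗ[ℝ] ℝ)
    (hsymm : ∀ u w, B u w = B w u) (hpsd : ∀ u, 0 ≤ B u u) (S : Submodule ℝ W)
    [FiniteDimensional ℝ S] (g : W) : ∃ s ∈ S, ∀ ψ ∈ S, B s ψ = B g ψ := by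
  have hCS : ∀ ψ, B ψ ψ = 0 → ∀ g, B g ψ = 0 := by
    intro ψ hψ g
    by_contra hne
    -- With this t the value of the form at g + tψ would be −1.
    obtain ⟨t, ht⟩ : ∃ t : ℝ, t * B g ψ = -(B g g + 1) / 2 :=
      ⟨-(B g g + 1) / 2 / B g ψ, div_mul_cancel₀ _ hne⟩
    have h := hpsd (g + t • ψ)
    simp only [map_add, map_smul, LinearMap.add_apply, LinearMap.smul_apply, smul_eq_mul, hψ,
      hsymm ψ g, ht] at h
    linarith
  let b : S →ₗ[ℝ] Module.Dual ℝ S := (B.domRestrict₁₂ S S)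
  have hb : ∀ s t : S, b s t = B s t := fun _ _ => rfl
  obtain ⟨C, hC⟩ := (LinearMap.ker b).exists_isCompl
  let b' : C →ₗ[ℝ] Module.Dual ℝ C := b.domRestrict₁₂ C C
  have hker : ∀ s : S, s ∈ LinearMap.ker b → ∀ g, B g s = 0 := fun s hs g =>
    hCS s (by rw [← hb, LinearMap.mem_ker.1 hs]; rfl) g
  have hdec : ∀ s : S, ∃ s₀ ∈ LinearMap.ker b, ∃ s₁ ∈ C, s₀ + s₁ = s := fun s => by
    have : s ∈ LinearMap.ker b ⊔ C := by rw [hC.sup_eq_top]; trivial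
    exact Submodule.mem_sup.1 this
  have hinj : Function.Injective b' := by
    rw [← LinearMap.ker_eq_bot, LinearMap.ker_eq_bot']
    intro s hs
    have : (s : S) ∈ LinearMap.ker b := by
      rw [LinearMap.mem_ker]
      ext ψ
      obtain ⟨ψ₀, h0, ψ₁, h1, rfl⟩ := hdec ψ
      have e0 := hker ψ₀ h0 (s : S)
      have e1 := LinearMap.congr_fun hs ⟨ψ₁, h1⟩
      simp only [b', b, LinearMap.domRestrict₁₂_apply, LinearMap.zero_apply] at e1
      rw [hb, Submodule.coe_add, map_add, e0, e1, add_zero]; rfl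
    exact Subtype.ext (Submodule.disjoint_def.1 hC.disjoint _ this s.2)
  have hsurj : Function.Surjective b' :=
    (LinearMap.injective_iff_surjective_of_finrank_eq_finrank
      (Subspace.dual_finrank_eq (K := ℝ) (V := C)).symm).1 hinj
  obtain ⟨s, hs⟩ := hsurj (((B g).domRestrict S).domRestrict C)
  refine ⟨s, (s : S).2, fun ψ hψ => ?_⟩
  obtain ⟨ψ₀, h0, ψ₁, h1, e⟩ := hdec ⟨ψ, hψ⟩
  have e' : (ψ₀ : W) + ψ₁ = ψ := congrArg Subtype.val e
  have e1 := LinearMap.congr_fun hs ⟨ψ₁, h1⟩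
  simp only [b', b, LinearMap.domRestrict₁₂_apply, LinearMap.domRestrict_apply] at e1
  rw [← e', map_add, map_add, hker ψ₀ h0, hker ψ₀ h0, e1]

/-! ## Nédélec and Raviart-Thomas fields -/

theorem curlP_mem_polyDeg {k : ℕ} {u : VPoly} (hu : ∀ i, u i ∈ PolyDeg k) (i : Fin 3) :
    curlP u i ∈ PolyDeg (k - 1) := by
  fin_cases i <;> exact sub_mem (pderiv_mem_polyDeg (hu _) _) (pderiv_mem_polyDeg (hu _) _)

theorem idP_cross_mem_polyDeg {k : ℕ} {w : VPoly} (hw : ∀ i, w i ∈ PolyDeg k) (i : Fin 3) :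
    (idP ⨯₃ w) i ∈ PolyDeg (k + 1) := by
  rw [cross_apply, add_comm k]
  fin_cases i <;> exact sub_mem (mul_mem_polyDeg (X_mem_polyDeg _) (hw _))
    (mul_mem_polyDeg (X_mem_polyDeg _) (hw _))

theorem mem_nedelec {k : ℕ} (hk : 1 ≤ k) {v w : VPoly} (hv : ∀ i, v i ∈ PolyDeg (k - 1))
    (hw : ∀ i, w i ∈ PolyDeg (k - 1)) : v + idP ⨯₃ w ∈ Nedelec k := by
  refine ⟨fun i => add_mem (polyDeg_mono (by omega) (hv i)) ?_, v, w, hv, hw, rfl⟩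
  have := idP_cross_mem_polyDeg hw i
  rwa [Nat.sub_add_cancel hk] at this

theorem mem_nedelec_of_polyDeg {k : ℕ} (hk : 1 ≤ k) {v : VPoly} (hv : ∀ i, v i ∈ PolyDeg (k - 1)) :
    v ∈ Nedelec k := by
  simpa using mem_nedelec hk hv (w := 0) fun i => zero_mem _

theorem nedelec_sub {k : ℕ} {u w : VPoly} (hu : u ∈ Nedelec k) (hw : w ∈ Nedelec k) :
    u - w ∈ Nedelec k := by
  obtain ⟨hu, v₁, w₁, h1, h2, e⟩ := hu
  obtain ⟨hw, v₂, w₂, h3, h4, e'⟩ := hw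
  refine ⟨fun i => sub_mem (hu i) (hw i), v₁ - v₂, w₁ - w₂, fun i => sub_mem (h1 i) (h3 i),
    fun i => sub_mem (h2 i) (h4 i), ?_⟩
  rw [e, e', map_sub]
  abel

theorem nedelec_add {k : ℕ} {u w : VPoly} (hu : u ∈ Nedelec k) (hw : w ∈ Nedelec k) :
    u + w ∈ Nedelec k := by
  obtain ⟨hu, v₁, w₁, h1, h2, e⟩ := hu
  obtain ⟨hw, v₂, w₂, h3, h4, e'⟩ := hw
  refine ⟨fun i => add_mem (hu i) (hw i), v₁ + v₂, w₁ + w₂, fun i => add_mem (h1 i) (h3 i),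
    fun i => add_mem (h2 i) (h4 i), ?_⟩
  rw [e, e', map_add]
  abel

theorem idP_dot_cross (w : VPoly) : ∑ i, MvPolynomial.X i * (idP ⨯₃ w) i = (0 : SPoly) := by
  simp [Fin.sum_univ_three, cross_apply, idP]; ring

/-- Since x·(x × w) = 0, the top-degree part of a Nédélec field does not contribute to x·u. This is
why the degree is k and not k + 1. -/
theorem radialPot_mem_polyDeg {k : ℕ} (hk : 1 ≤ k) {u : VPoly} (hu : u ∈ Nedelec k) :
    radialPot u ∈ PolyDeg k := by
  obtain ⟨-, v, w, hv, hw, rfl⟩ := hu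
  have : ∑ i, MvPolynomial.X i * (v + idP ⨯₃ w) i = ∑ i, MvPolynomial.X i * v i := by
    simp only [Pi.add_apply, mul_add, Finset.sum_add_distrib, idP_dot_cross, add_zero]
  rw [radialPot, this]
  refine degScale_mem_polyDeg (sum_mem fun i _ => ?_) 0
  have := mul_mem_polyDeg (X_mem_polyDeg i) (hv i)
  rwa [Nat.add_sub_cancel' hk] at this

theorem exists_eq_gradP {k : ℕ} (hk : 1 ≤ k) {u : VPoly} (hu : u ∈ Nedelec k) (hc : curlP u = 0) :
    ∃ ψ ∈ PolyDeg k, u = gradP ψ := by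
  refine ⟨radialPot u, radialPot_mem_polyDeg hk hu, ?_⟩
  ext1 i
  rw [gradP_radialPot, hc]
  simp

theorem exists_curlP_eq {k : ℕ} (hk : 1 ≤ k) {u : VPoly} (hu : ∀ i, u i ∈ PolyDeg (k - 1))
    (hd : divP u = 0) : ∃ w ∈ Nedelec k, curlP w = u := by
  refine ⟨radialVecPot u, ?_, curlP_radialVecPot hd⟩
  rw [radialVecPot_eq]
  simpa using mem_nedelec hk (v := 0) (fun i => zero_mem _)
    fun i => neg_mem (degScale_mem_polyDeg (hu i) 2)

theorem divP_curlP (u : VPoly) : divP (curlP u) = 0 := by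
  simp only [divP, curlP, Fin.sum_univ_three, Matrix.cons_val, map_sub]
  rw [pderiv_comm 0 1, pderiv_comm 0 2, pderiv_comm 1 2]
  ring

theorem divP_sub (u w : VPoly) : divP (u - w) = divP u - divP w := by
  simp [divP, Finset.sum_sub_distrib]

/-- A divergence-free Raviart-Thomas field has degree at most `k - 1`. -/
theorem raviartThomas_mem_polyDeg {k : ℕ} (hk : 1 ≤ k) {u : VPoly} (hu : u ∈ RaviartThomas k)
    (hd : divP u = 0) (i : Fin 3) : u i ∈ PolyDeg (k - 1) := by
  obtain ⟨-, v, w, hv, hw, rfl⟩ := hu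
  -- The divergence of x w is (x·∇ + 3) w. Inverting this operator expresses w through ∇·v, which
  -- has one degree less than v.
  have he : ∑ i, MvPolynomial.X i * MvPolynomial.pderiv i w + ((3 : ℕ) : ℝ) • w = -divP v := by
    have : divP (v + w • idP) = divP v +
        (∑ i, MvPolynomial.X i * MvPolynomial.pderiv i w + ((3 : ℕ) : ℝ) • w) := by
      rw [Nat.cast_smul_eq_nsmul]
      simp [divP, Fin.sum_univ_three, idP, MvPolynomial.pderiv_X]
      ring
    rw [hd] at this
    linear_combination -this
  have hw' : w = degScale 3 (-divP v) := by rw [← he, degScale_euler three_ne_zero]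
  refine add_mem (hv i) ?_
  simp only [Pi.smul_apply, smul_eq_mul, idP]
  rcases Nat.lt_or_ge 1 k with h | h
  · have h1 : w ∈ PolyDeg (k - 1 - 1) := by
      rw [hw']
      exact degScale_mem_polyDeg (neg_mem (sum_mem fun i _ => pderiv_mem_polyDeg (hv i) i)) 3
    have := mul_mem_polyDeg h1 (X_mem_polyDeg i)
    rwa [Nat.sub_add_cancel (by omega)] at this
  -- Here k − 1 − 1 truncates and the degree count gains nothing. Instead v is constant, so w
  -- vanishes.
  · have hk1 : k = 1 := by omega
    subst hk1
    have : w = 0 := by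
      rw [hw']
      simp only [divP]
      rw [Finset.sum_eq_zero fun i _ => pderiv_eq_zero_of_mem_polyDeg_zero (hv i) i]
      simp
    simp [this]

theorem gradP_mem_polyDeg {k : ℕ} {p : SPoly} (hp : p ∈ PolyDeg k) (i : Fin 3) :
    gradP p i ∈ PolyDeg (k - 1) := pderiv_mem_polyDeg hp i

theorem curlP_nedelec_mem_polyDeg {k : ℕ} {u : VPoly} (hu : u ∈ Nedelec k) (i : Fin 3) :
    curlP u i ∈ PolyDeg (k - 1) := curlP_mem_polyDeg hu.1 i

/-! ## Barycentric coordinates of a tetrahedron -/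

/-- A nondegenerate tetrahedron, given by its vertices. -/
structure IsTet (T : Finset E) : Prop where
  indep : AffineIndependent ℝ ((↑) : T → E)
  card : T.card = 4

/-- The barycentric coordinate polynomial of the vertex `v` of `T` (zero if `v ∉ T`). -/
def lam (T : Finset E) (v : E) : SPoly :=
  open Classical in
  Classical.epsilon fun p : SPoly => p ∈ PolyDeg 1 ∧ ∀ a ∈ T, ev p a = if a = v then 1 else 0

/-- The constant gradient of `lam T v`. -/
def glam (T : Finset E) (v : E) : V := evV (gradP (lam T v)) 0

theorem ev_eq_of_mem_polyDeg_one {p : SPoly} (hp : p ∈ PolyDeg 1) (x : E) :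
    ev p x = ev p 0 + evV (gradP p) 0 ⬝ᵥ x.ofLp := by
  have h1 : gradP (p - affPoly (ev p 0) (evV (gradP p) 0)) = 0 := by
    rw [gradP_sub, gradP_affPoly]
    ext1 i
    have h2 := eq_C_of_mem_polyDeg_zero (gradP_mem_polyDeg hp i)
    rw [Pi.sub_apply, Pi.zero_apply, sub_eq_zero, h2]
    congr 1
    rw [evV, h2, ev_C, MvPolynomial.coeff_C, if_pos rfl]
  have h3 := eq_C_of_gradP_eq_zero h1
  have h4 : ∀ y, ev p y - ev (affPoly (ev p 0) (evV (gradP p) 0)) y =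
      MvPolynomial.coeff 0 (p - affPoly (ev p 0) (evV (gradP p) 0)) := fun y => by
    rw [← ev_sub]; conv_lhs => rw [h3]
    rw [ev_C]
  have h5 := h4 x
  rw [← h4 0, ev_affPoly, ev_affPoly] at h5
  simp only [PiLp.zero_apply] at h5
  have : (evV (gradP p) 0 ⬝ᵥ fun _ => (0 : ℝ)) = 0 := by simp [dotProduct]
  rw [this] at h5
  change ev p x = ev p 0 + evV (gradP p) 0 ⬝ᵥ fun i => x i
  linarith

theorem ev_sum_smul_of_mem_polyDeg_one {p : SPoly} (hp : p ∈ PolyDeg 1) {ι : Type*} (s : Finset ι)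
    (c : ι → ℝ) (hc : ∑ i ∈ s, c i = 1) (y : ι → E) :
    ev p (∑ i ∈ s, c i • y i) = ∑ i ∈ s, c i * ev p (y i) := by
  have h : ∀ i, ev p (y i) = ev p 0 + evV (gradP p) 0 ⬝ᵥ (y i).ofLp := fun i =>
    ev_eq_of_mem_polyDeg_one hp _
  rw [ev_eq_of_mem_polyDeg_one hp]
  simp only [h, mul_add, Finset.sum_add_distrib, ← Finset.sum_mul, hc, one_mul]
  congr 1
  simp only [WithLp.ofLp_sum, WithLp.ofLp_smul, dotProduct_sum, dotProduct_smul, smul_eq_mul]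

namespace IsTet

variable {T : Finset E}

/-- The vertices as an affine basis. -/
def basis (hT : IsTet T) : AffineBasis T ℝ E :=
  ⟨(↑), hT.indep, by
    refine (hT.indep.affineSpan_eq_top_iff_card_eq_finrank_add_one).2 ?_
    simp [hT.card]⟩

theorem basis_apply (hT : IsTet T) (v : T) : hT.basis v = v := rfl

open Classical in
theorem lam_spec (hT : IsTet T) (v : E) : lam T v ∈ PolyDeg 1 ∧ ∀ a ∈ T, ev (lam T v) a = if a = v then 1 else 0 := by
  refine Classical.epsilon_spec (p := fun p : SPoly => p ∈ PolyDeg 1 ∧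
    ∀ a ∈ T, ev p a = if a = v then 1 else 0) ?_
  by_cases hv : v ∈ T
  · let g : E →ᵃ[ℝ] ℝ := hT.basis.coord ⟨v, hv⟩
    refine ⟨affPoly (g 0) fun i => g.linear (EuclideanSpace.single i 1), affPoly_mem_polyDeg _ _, ?_⟩
    have hg : ∀ x, ev (affPoly (g 0) fun i => g.linear (EuclideanSpace.single i 1)) x = g x := by
      intro x
      rw [ev_affPoly, show g x = g.linear x + g 0 from congrFun g.decomp x]
      have hx : x = ∑ i, x i • EuclideanSpace.single i (1 : ℝ) := by
        ext j
        simp [Finset.sum_apply, Pi.single_apply]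
      have h0 : g.linear x = ∑ i, g.linear (EuclideanSpace.single i 1) * x i := by
        conv_lhs => rw [hx, map_sum]
        simp [mul_comm]
      rw [h0]
      simp [dotProduct, add_comm]
    intro a ha
    rw [hg]
    have := hT.basis.coord_apply ⟨v, hv⟩ ⟨a, ha⟩
    rw [basis_apply] at this
    rw [this]
    simp [eq_comm]
  · refine ⟨0, zero_mem _, fun a ha => ?_⟩
    rw [if_neg (ne_of_mem_of_not_mem ha hv), ev_zero]

theorem lam_mem (hT : IsTet T) (v : E) : lam T v ∈ PolyDeg 1 := (hT.lam_spec v).1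

theorem lam_self (hT : IsTet T) {v : E} (hv : v ∈ T) : ev (lam T v) v = 1 := by
  rw [(hT.lam_spec v).2 v hv, if_pos rfl]

theorem lam_of_ne (hT : IsTet T) {a v : E} (ha : a ∈ T) (h : a ≠ v) : ev (lam T v) a = 0 := by
  rw [(hT.lam_spec v).2 a ha, if_neg h]

theorem exists_weights (hT : IsTet T) (x : E) : ∃ c : E → ℝ, ∑ v ∈ T, c v = 1 ∧ ∑ v ∈ T, c v • v = x := by
  classical
  refine ⟨fun v => if h : v ∈ T then hT.basis.coord ⟨v, h⟩ x else 0, ?_, ?_⟩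
  · have := hT.basis.sum_coord_apply_eq_one x
    rw [← this, ← Finset.sum_coe_sort T]
    exact Finset.sum_congr rfl fun v _ => by simp
  · have := hT.basis.linear_combination_coord_eq_self x
    conv_rhs => rw [← this, ]
    rw [← Finset.sum_coe_sort T]
    exact Finset.sum_congr rfl fun v _ => by simp [basis_apply]

theorem lam_sum_smul (hT : IsTet T) {c : E → ℝ} (hc : ∑ v ∈ T, c v = 1) {v : E} (hv : v ∈ T) :
    ev (lam T v) (∑ a ∈ T, c a • a) = c v := by
  rw [ev_sum_smul_of_mem_polyDeg_one (hT.lam_mem v) _ _ hc, Finset.sum_eq_single v]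
  · rw [hT.lam_self hv, mul_one]
  · intro b hb hbv
    rw [hT.lam_of_ne hb hbv, mul_zero]
  · exact fun h => absurd hv h

theorem sum_lam (hT : IsTet T) (x : E) : ∑ v ∈ T, ev (lam T v) x = 1 := by
  obtain ⟨c, hc, rfl⟩ := hT.exists_weights x
  rw [← hc]
  exact Finset.sum_congr rfl fun v hv => by rw [hT.lam_sum_smul hc hv]

theorem sum_lam_smul (hT : IsTet T) (x : E) : ∑ v ∈ T, ev (lam T v) x • v = x := by
  obtain ⟨c, hc, h⟩ := hT.exists_weights x
  conv_rhs => rw [← h]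
  exact Finset.sum_congr rfl fun v hv => by rw [← hT.lam_sum_smul hc hv, h]

theorem lam_of_notMem (hT : IsTet T) {v : E} (hv : v ∉ T) (x : E) : ev (lam T v) x = 0 := by
  conv_lhs => rw [← hT.sum_lam_smul x]
  rw [ev_sum_smul_of_mem_polyDeg_one (hT.lam_mem v) _ _ (hT.sum_lam x)]
  exact Finset.sum_eq_zero fun a ha => by
    rw [hT.lam_of_ne ha (ne_of_mem_of_not_mem ha hv), mul_zero]

theorem ev_eq_sum_lam (hT : IsTet T) {p : SPoly} (hp : p ∈ PolyDeg 1) (x : E) :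
    ev p x = ∑ v ∈ T, ev (lam T v) x * ev p v := by
  conv_lhs => rw [← hT.sum_lam_smul x]
  rw [ev_sum_smul_of_mem_polyDeg_one hp _ _ (hT.sum_lam x)]

theorem mem_hull_iff (hT : IsTet T) {x : E} : x ∈ hull T ↔ ∀ v ∈ T, 0 ≤ ev (lam T v) x := by
  rw [Finset.mem_convexHull']
  constructor
  · rintro ⟨w, h0, h1, rfl⟩ v hv
    rw [hT.lam_sum_smul h1 hv]
    exact h0 v hv
  · exact fun h => ⟨fun v => ev (lam T v) x, h, hT.sum_lam x, hT.sum_lam_smul x⟩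

theorem mem_hull_subset_iff (hT : IsTet T) {s : Finset E} (hs : s ⊆ T) {x : E} :
    x ∈ hull s ↔ x ∈ hull T ∧ ∀ v ∈ T, v ∉ s → ev (lam T v) x = 0 := by
  classical
  constructor
  · intro h
    refine ⟨convexHull_mono (Finset.coe_subset.2 hs) h, fun v hv hvs => ?_⟩
    rw [Finset.mem_convexHull'] at h
    obtain ⟨w, -, h1, rfl⟩ := h
    rw [ev_sum_smul_of_mem_polyDeg_one (hT.lam_mem v) _ _ h1]
    refine Finset.sum_eq_zero fun a ha => ?_
    rw [hT.lam_of_ne (hs ha) (ne_of_mem_of_not_mem ha hvs), mul_zero]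
  · rintro ⟨h, h0⟩
    rw [Finset.mem_convexHull']
    refine ⟨fun v => ev (lam T v) x, fun v hv => hT.mem_hull_iff.1 h v (hs hv), ?_, ?_⟩
    · rw [← hT.sum_lam x]
      exact Finset.sum_subset hs fun v hv hvs => h0 v hv hvs
    · conv_rhs => rw [← hT.sum_lam_smul x]
      exact Finset.sum_subset hs fun v hv hvs => by
        beta_reduce; rw [h0 v hv hvs, zero_smul]

theorem mem_interior_iff (hT : IsTet T) {x : E} : x ∈ interior (hull T) ↔ ∀ v ∈ T, 0 < ev (lam T v) x := by
  have hopen : IsOpen {x : E | ∀ v ∈ T, 0 < ev (lam T v) x} := by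
    have : {x : E | ∀ v ∈ T, 0 < ev (lam T v) x} = ⋂ v ∈ T, {x | 0 < ev (lam T v) x} := by
      ext x; simp
    rw [this]
    exact isOpen_biInter_finset fun v _ => isOpen_lt continuous_const (continuous_ev _)
  constructor
  · intro hx
    have hr : Set.range hT.basis = (T : Set E) := by
      ext y; simp [basis_apply]
    have h1 := hT.basis.interior_convexHull
    rw [hr] at h1
    rw [h1] at hx
    intro v hv
    have hc : ev (lam T v) x = hT.basis.coord ⟨v, hv⟩ x := by
      have h2 := hT.basis.linear_combination_coord_eq_self x
      have h3 := hT.basis.sum_coord_apply_eq_one x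
      conv_lhs => rw [← h2]
      rw [ev_sum_smul_of_mem_polyDeg_one (hT.lam_mem v) _ _ h3, Finset.sum_eq_single ⟨v, hv⟩]
      · rw [basis_apply, hT.lam_self hv, mul_one]
      · intro b _ hb
        rw [basis_apply, hT.lam_of_ne b.2 (fun h => hb (Subtype.ext h)), mul_zero]
      · simp
    rw [hc]
    exact hx ⟨v, hv⟩
  · intro hx
    exact interior_maximal (fun y hy => hT.mem_hull_iff.2 fun v hv => (hy v hv).le) hopen hx

theorem nonempty (hT : IsTet T) : T.Nonempty := Finset.card_pos.1 (by rw [hT.card]; norm_num)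

theorem lam_sub (hT : IsTet T) (v x y : E) : ev (lam T v) x - ev (lam T v) y = glam T v ⬝ᵥ (x - y).ofLp := by
  rw [ev_eq_of_mem_polyDeg_one (hT.lam_mem v) x, ev_eq_of_mem_polyDeg_one (hT.lam_mem v) y, glam,
    WithLp.ofLp_sub, dotProduct_sub]
  ring

theorem gradP_lam (hT : IsTet T) (v : E) (x : E) : evV (gradP (lam T v)) x = glam T v := by
  ext i
  have := eq_C_of_mem_polyDeg_zero (gradP_mem_polyDeg (hT.lam_mem v) i)
  rw [glam, evV, evV, this, ev_C, ev_C]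

theorem gradP_lam_eq (hT : IsTet T) (v : E) : gradP (lam T v) = fun i => MvPolynomial.C (glam T v i) := by
  ext1 i
  refine ev_injective fun x => ?_
  rw [ev_C, ← hT.gradP_lam v x]; rfl

theorem lam_eq (hT : IsTet T) (v : E) : lam T v = affPoly (ev (lam T v) 0) (glam T v) := by
  refine ev_injective fun x => ?_
  rw [ev_affPoly]
  exact ev_eq_of_mem_polyDeg_one (hT.lam_mem v) x

theorem glam_dot_sub (hT : IsTet T) {a b v : E} (ha : a ∈ T) (hb : b ∈ T) (hav : a ≠ v) (hbv : b ≠ v) :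
    glam T v ⬝ᵥ (b - a).ofLp = 0 := by
  rw [← hT.lam_sub, hT.lam_of_ne ha hav, hT.lam_of_ne hb hbv, sub_zero]

theorem glam_dot_sub_self (hT : IsTet T) {a v : E} (ha : a ∈ T) (hv : v ∈ T) (hav : a ≠ v) :
    glam T v ⬝ᵥ (v - a).ofLp = 1 := by
  rw [← hT.lam_sub, hT.lam_of_ne ha hav, hT.lam_self hv, sub_zero]

theorem sum_glam_dot (hT : IsTet T) (τ : E) : ∑ v ∈ T, glam T v ⬝ᵥ τ.ofLp = 0 := by
  have h1 := hT.sum_lam τ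
  rw [← hT.sum_lam 0, ← sub_eq_zero, ← Finset.sum_sub_distrib] at h1
  rw [← h1]
  exact Finset.sum_congr rfl fun v _ => by rw [hT.lam_sub, sub_zero]

theorem sum_glam (hT : IsTet T) : ∑ v ∈ T, glam T v = 0 := by
  ext i
  have := hT.sum_glam_dot (EuclideanSpace.single i 1)
  simpa [dotProduct, Pi.single_apply] using this

theorem sum_glam_dot_smul (hT : IsTet T) (τ : E) : ∑ v ∈ T, (glam T v ⬝ᵥ τ.ofLp) • v = τ := by
  have h : ∀ v, glam T v ⬝ᵥ τ.ofLp = ev (lam T v) τ - ev (lam T v) 0 := fun v => by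
    rw [hT.lam_sub, sub_zero]
  simp only [h, sub_smul, Finset.sum_sub_distrib, hT.sum_lam_smul, sub_zero]

end IsTet

/-! ## The Stokes formula on a tetrahedron and on its faces -/

/-- A direction with barycentric weights of sum zero is a combination of the edges that leave one
vertex a. The terms with the face opposite to a carry the sum of the weights and cancel. -/
theorem avg_fderiv_eq {s : Finset E} (hs : AffineIndependent ℝ ((↑) : s → E)) (hne : s.Nonempty)
    {c : E → ℝ} (hc : ∑ v ∈ s, c v = 0) {h : E → ℝ} (hh : ContDiff ℝ 1 h) {τ : E}
    (hτ : τ = ∑ v ∈ s, c v • v) :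
    avg s (fun x => fderiv ℝ h x τ) = -stokesConst s.card * ∑ v ∈ s, c v * avg (s.erase v) h := by
  obtain ⟨a, ha⟩ := hne
  have h1 : τ = ∑ v ∈ s, c v • (v - a) := by
    simp only [smul_sub, Finset.sum_sub_distrib, ← Finset.sum_smul, hc, zero_smul, sub_zero, hτ]
  have h2 : ∀ x, fderiv ℝ h x τ = ∑ v ∈ s, c v * fderiv ℝ h x (v - a) := fun x => by
    conv_lhs => rw [h1, map_sum]
    simp
  have hcont : ∀ σ : E, Continuous fun x => fderiv ℝ h x σ := fun σ =>
    (hh.continuous_fderiv one_ne_zero).clm_apply continuous_const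
  simp only [h2]
  rw [avg_sum hs ⟨a, ha⟩ _ (h := fun v x => c v * fderiv ℝ h x (v - a))
    fun v _ => (continuous_const.mul (hcont _)).continuousOn]
  simp only [avg_const_mul]
  have h3 : ∀ v ∈ s, c v * avg s (fun x => fderiv ℝ h x (v - a)) =
      c v * (stokesConst s.card * avg (s.erase a) h) -
        stokesConst s.card * (c v * avg (s.erase v) h) := fun v hv => by
    rw [avg_fderiv_sub hs ha hv hh]; ring
  rw [Finset.sum_congr rfl h3, Finset.sum_sub_distrib, ← Finset.sum_mul, hc, ← Finset.mul_sum]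
  ring

/-- The inward normal of `T` on the face opposite to `v`, scaled by a multiple of its area. -/
def areaNormal (T : Finset E) (v : E) : V := volume.real (hull T) • glam T v

theorem IsTet.integral_fderiv {T : Finset E} (hT : IsTet T) {h : E → ℝ} (hh : ContDiff ℝ 1 h)
    (τ : E) : ∫ x in hull T, fderiv ℝ h x τ =
      -stokesConst 4 * ∑ v ∈ T, (areaNormal T v ⬝ᵥ τ.ofLp) * avg (T.erase v) h := by
  rw [setIntegral_hull_eq_mul_avg hT.indep hT.card,
    avg_fderiv_eq hT.indep hT.nonempty (hT.sum_glam_dot τ) hh (hT.sum_glam_dot_smul τ).symm, hT.card]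
  simp only [areaNormal, smul_dotProduct, smul_eq_mul, mul_assoc, ← Finset.mul_sum]
  ring

theorem IsTet.integral_pd {T : Finset E} (hT : IsTet T) {h : E → ℝ} (hh : ContDiff ℝ 1 h)
    (i : Fin 3) : ∫ x in hull T, pd i h x =
      -stokesConst 4 * ∑ v ∈ T, areaNormal T v i * avg (T.erase v) h := by
  have := hT.integral_fderiv hh (EuclideanSpace.single i 1)
  simpa [pd] using this

theorem IsTet.erase_indep {T : Finset E} (hT : IsTet T) (w : E) :
    AffineIndependent ℝ ((↑) : ↥(T.erase w) → E) :=
  affineIndependent_subset hT.indep (Finset.erase_subset _ _)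

theorem IsTet.card_erase {T : Finset E} (hT : IsTet T) {w : E} (hw : w ∈ T) :
    (T.erase w).card = 3 := by rw [Finset.card_erase_of_mem hw, hT.card]

theorem IsTet.erase_nonempty {T : Finset E} (hT : IsTet T) {w : E} (hw : w ∈ T) :
    (T.erase w).Nonempty := Finset.card_pos.1 (by rw [hT.card_erase hw]; norm_num)

/-- The Stokes formula on the face of `T` opposite to `w`, for tangential directions. -/
theorem IsTet.avg_face_fderiv {T : Finset E} (hT : IsTet T) {w : E} (hw : w ∈ T) {h : E → ℝ}
    (hh : ContDiff ℝ 1 h) {τ : E} (hτ : glam T w ⬝ᵥ τ.ofLp = 0) :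
    avg (T.erase w) (fun x => fderiv ℝ h x τ) =
      -stokesConst 3 * ∑ v ∈ T.erase w, (glam T v ⬝ᵥ τ.ofLp) * avg ((T.erase w).erase v) h := by
  have h1 : ∑ v ∈ T.erase w, glam T v ⬝ᵥ τ.ofLp = 0 := by
    rw [← hT.sum_glam_dot τ, ← Finset.add_sum_erase _ _ hw, hτ, zero_add]
  have h2 : τ = ∑ v ∈ T.erase w, (glam T v ⬝ᵥ τ.ofLp) • v := by
    conv_lhs => rw [← hT.sum_glam_dot_smul τ, ← Finset.add_sum_erase _ _ hw, hτ, zero_smul, zero_add]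
  rw [avg_fderiv_eq (hT.erase_indep w) (hT.erase_nonempty hw) h1 hh h2, hT.card_erase hw]

/-! ## Geometry of the mesh -/

/-- The vertex of `T` that does not belong to `f`. -/
def opp (T f : Finset E) : E :=
  open Classical in if h : (T \ f).Nonempty then h.choose else 0

theorem opp_mem_sdiff {T f : Finset E} (h : (T \ f).Nonempty) : opp T f ∈ T \ f := by
  classical
  rw [opp, dif_pos h]
  exact h.choose_spec

theorem IsTet.opp_spec {T f : Finset E} (hT : IsTet T) (hf : f ⊆ T) (hc : f.card = 3) :
    opp T f ∈ T ∧ opp T f ∉ f ∧ T.erase (opp T f) = f := by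
  have h1 : (T \ f).card = 1 := by rw [Finset.card_sdiff_of_subset hf, hT.card, hc]
  have h2 := opp_mem_sdiff (Finset.card_pos.1 (by omega : 0 < (T \ f).card))
  rw [Finset.mem_sdiff] at h2
  refine ⟨h2.1, h2.2, (Finset.eq_of_subset_of_card_le (fun a ha => ?_) ?_).symm⟩
  · exact Finset.mem_erase.2 ⟨fun h => h2.2 (h ▸ ha), hf ha⟩
  · rw [hT.card_erase h2.1, hc]

theorem IsTet.opp_erase {T : Finset E} (hT : IsTet T) {w : E} (hw : w ∈ T) :
    opp T (T.erase w) = w := by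
  obtain ⟨h1, h2, -⟩ := hT.opp_spec (Finset.erase_subset w T) (hT.card_erase hw)
  by_contra h
  exact h2 (Finset.mem_erase.2 ⟨h, h1⟩)

/-- An affine function that vanishes at the vertices of a face is a multiple of the opposite
barycentric coordinate. -/
theorem IsTet.ev_eq_mul_lam {T : Finset E} (hT : IsTet T) {w : E} (hw : w ∈ T) {p : SPoly}
    (hp : p ∈ PolyDeg 1) (h0 : ∀ a ∈ T.erase w, ev p a = 0) (x : E) :
    ev p x = ev p w * ev (lam T w) x := by
  rw [hT.ev_eq_sum_lam hp x, ← Finset.add_sum_erase _ _ hw,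
    Finset.sum_eq_zero fun a ha => by rw [h0 a ha, mul_zero], add_zero, mul_comm]

theorem IsTet.interior_nonempty {T : Finset E} (hT : IsTet T) : (interior (hull T)).Nonempty := by
  refine ⟨∑ v ∈ T, (4 : ℝ)⁻¹ • v, hT.mem_interior_iff.2 fun v hv => ?_⟩
  rw [hT.lam_sum_smul (c := fun _ => (4 : ℝ)⁻¹) (by simp [hT.card]) hv]
  norm_num

namespace TetMesh

variable {Ω : Set E} {M : TetMesh Ω}

instance : Finite M.Elem :=
  (M.finite_faces.subset fun T (hT : T ∈ {T | T ∈ M.faces ∧ T.card = 4}) => hT.1).to_subtype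

instance : Fintype M.Elem := Fintype.ofFinite _

instance : Finite M.IntFace :=
  (M.finite_faces.subset fun f (hf : f ∈ {f | f ∈ M.faces ∧ f.card = 3 ∧
    ∃ T T' : M.Elem, T ≠ T' ∧ f ⊆ T.1 ∧ f ⊆ T'.1}) => hf.1).to_subtype

instance : Fintype M.IntFace := Fintype.ofFinite _

instance : Finite M.Vertex := by
  have : (fun ν : E => ({ν} : Finset E)) ⁻¹' M.faces = {ν : E | {ν} ∈ M.faces} := rfl
  have h := M.finite_faces.preimage (f := fun ν : E => ({ν} : Finset E))
    (Finset.singleton_injective.injOn)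
  exact h.to_subtype

instance : Fintype M.Vertex := Fintype.ofFinite _

theorem isTet (T : M.Elem) : IsTet T.1 := ⟨M.indep T.2.1, T.2.2⟩

theorem mem_hull_inter {T T' : M.Elem} {x : E} (h : x ∈ hull T.1) (h' : x ∈ hull T'.1) :
    x ∈ hull (T.1 ∩ T'.1) := by
  have := M.inter_subset_convexHull T.2.1 T'.2.1 ⟨h, h'⟩
  rwa [← Finset.coe_inter] at this

theorem lam_eq_zero_of_notMem {T T' : M.Elem} {x : E} (h : x ∈ hull T.1) (h' : x ∈ hull T'.1)
    {v : E} (hv : v ∈ T.1) (hv' : v ∉ T'.1) : ev (lam T.1 v) x = 0 :=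
  (((isTet T).mem_hull_subset_iff Finset.inter_subset_left).1 (mem_hull_inter h h')).2 v hv
    fun hm => hv' (Finset.mem_inter.1 hm).2

theorem exists_mem_notMem {T T' : M.Elem} (h : T ≠ T') : ∃ v ∈ T.1, v ∉ T'.1 := by
  by_contra! hcon
  exact h (Subtype.ext (Finset.eq_of_subset_of_card_le hcon (by rw [T.2.2, T'.2.2])))

theorem eq_of_mem_interior {T T' : M.Elem} {x : E} (h : x ∈ interior (hull T.1))
    (h' : x ∈ hull T'.1) : T = T' := by
  by_contra hne
  obtain ⟨v, hv, hv'⟩ := exists_mem_notMem hne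
  have h1 := lam_eq_zero_of_notMem (interior_subset h) h' hv hv'
  have h2 := (isTet T).mem_interior_iff.1 h v hv
  linarith

/-- The barycentric coordinates of a common point agree. -/
theorem lam_eq_lam {T T' : M.Elem} {x : E} (h : x ∈ hull T.1) (h' : x ∈ hull T'.1) (v : E) :
    ev (lam T.1 v) x = ev (lam T'.1 v) x := by
  have key := mem_hull_inter h h'
  rw [Finset.mem_convexHull'] at key
  obtain ⟨c, -, hc, rfl⟩ := key
  rw [ev_sum_smul_of_mem_polyDeg_one ((isTet T).lam_mem v) _ _ hc,
    ev_sum_smul_of_mem_polyDeg_one ((isTet T').lam_mem v) _ _ hc]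
  refine Finset.sum_congr rfl fun a ha => ?_
  rw [Finset.mem_inter] at ha
  rw [((isTet T).lam_spec v).2 a ha.1, ((isTet T').lam_spec v).2 a ha.2]

theorem closure_eq_iUnion : closure Ω = ⋃ T : M.Elem, hull T.1 := by
  rw [← M.space_eq]
  ext x
  rw [Geometry.SimplicialComplex.mem_space_iff, Set.mem_iUnion]
  constructor
  · rintro ⟨s, hs, hx⟩
    obtain ⟨T, hT, hsT, hc⟩ := M.pure s hs
    exact ⟨⟨T, hT, hc⟩, convexHull_mono (Finset.coe_subset.2 hsT) hx⟩
  · rintro ⟨T, hx⟩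
    exact ⟨T.1, T.2.1, hx⟩

theorem hull_subset_closure (T : M.Elem) : hull T.1 ⊆ closure Ω := by
  rw [closure_eq_iUnion (M := M)]
  exact Set.subset_iUnion (fun T : M.Elem => hull T.1) T

theorem exists_elem_of_mem_closure (M : TetMesh Ω) {x : E} (hx : x ∈ closure Ω) :
    ∃ T : M.Elem, x ∈ hull T.1 := by
  rw [closure_eq_iUnion (M := M)] at hx
  exact Set.mem_iUnion.1 hx

/-- A small ball around `x` meets only the elements that contain `x`. -/
theorem exists_ball_mem_hull (M : TetMesh Ω) (x : E) :
    ∃ r > 0, ∀ T : M.Elem, ∀ y ∈ Metric.ball x r, y ∈ hull T.1 → x ∈ hull T.1 := by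
  have h : ∀ T : M.Elem, ∀ᶠ y in 𝓝 x, y ∈ hull T.1 → x ∈ hull T.1 := by
    intro T
    by_cases hx : x ∈ hull T.1
    · exact Eventually.of_forall fun _ _ => hx
    · filter_upwards [(isClosed_hull T.1).isOpen_compl.mem_nhds hx] with y hy h
      exact absurd h hy
  obtain ⟨r, hr, hb⟩ := Metric.eventually_nhds_iff_ball.1 (eventually_all.2 h)
  exact ⟨r, hr, fun T y hy => hb y hy T⟩

end TetMesh

/-! ## Lipschitz domains -/

section domain

variable {Ω : Set E}

/-- Horizontal part of a point in a chart. -/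
def horiz (L : E ≃ₗᵢ[ℝ] E) (y : E) : EuclideanSpace ℝ (Fin 2) := !₂[L y 0, L y 1]

theorem continuous_horiz (L : E ≃ₗᵢ[ℝ] E) : Continuous (horiz L) := by
  unfold horiz
  refine (PiLp.continuous_toLp 2 _).comp (continuous_pi fun i => ?_)
  fin_cases i
  · exact (EuclideanSpace.proj (𝕜 := ℝ) (0 : Fin 3)).continuous.comp L.continuous
  · exact (EuclideanSpace.proj (𝕜 := ℝ) (1 : Fin 3)).continuous.comp L.continuous

theorem continuous_vert (L : E ≃ₗᵢ[ℝ] E) : Continuous fun y => L y 2 :=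
  (EuclideanSpace.proj (𝕜 := ℝ) (2 : Fin 3)).continuous.comp L.continuous

theorem horiz_add (L : E ≃ₗᵢ[ℝ] E) (x y : E) : horiz L (x + y) = horiz L x + horiz L y := by
  ext i; fin_cases i <;> simp [horiz]

theorem horiz_smul (L : E ≃ₗᵢ[ℝ] E) (c : ℝ) (y : E) : horiz L (c • y) = c • horiz L y := by
  ext i; fin_cases i <;> simp [horiz]

theorem horiz_symm_single (L : E ≃ₗᵢ[ℝ] E) :
    horiz L (L.symm (EuclideanSpace.single 2 1)) = 0 := by
  ext i; fin_cases i <;> simp [horiz]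

/-- Points strictly below the graph are not in the closure. -/
theorem notMem_closure_of_below {L : E ≃ₗᵢ[ℝ] E} {g : EuclideanSpace ℝ (Fin 2) → ℝ}
    (hg : Continuous g) {U : Set E} (hU : Ω ∩ U = {y ∈ U | g (horiz L y) < L y 2}) {y : E}
    (hy : y ∈ interior U) (hlt : L y 2 < g (horiz L y)) : y ∉ closure Ω := by
  intro hc
  have hO : IsOpen {y | L y 2 < g (horiz L y)} :=
    isOpen_lt (continuous_vert L) (hg.comp (continuous_horiz L))
  obtain ⟨z, hz, hzΩ⟩ := mem_closure_iff.1 hc _ (isOpen_interior.inter hO) ⟨hy, hlt⟩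
  have h1 : z ∈ Ω ∩ U := ⟨hzΩ, interior_subset hz.1⟩
  rw [hU] at h1
  have h2 : L z 2 < g (horiz L z) := hz.2
  exact absurd h1.2 (not_lt.2 h2.le)

/-- A mesh only knows the closure of Ω; this recovers Ω from it. At a boundary point, going straight
down in the chart leads at once to points below the graph, which have a neighbourhood free of Ω. -/
theorem IsAdmissibleDomain.interior_closure (hΩ : IsAdmissibleDomain Ω) :
    interior (closure Ω) = Ω := by
  refine Set.Subset.antisymm (fun x hx => ?_) hΩ.isOpen.subset_interior_closure
  by_contra hxΩ
  have hfr : x ∈ frontier Ω := by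
    rw [hΩ.isOpen.frontier_eq]
    exact ⟨interior_subset hx, hxΩ⟩
  obtain ⟨L, g, K, hgL, U, hU, hUe⟩ := hΩ.lipschitz x hfr
  have hUe' : Ω ∩ U = {y ∈ U | g (horiz L y) < L y 2} := hUe
  have hle : L x 2 ≤ g (horiz L x) := by
    by_contra hcon
    have : x ∈ Ω ∩ U := by
      rw [hUe']; exact ⟨mem_of_mem_nhds hU, not_le.1 hcon⟩
    exact hxΩ this.1
  have hcont : Continuous fun t : ℝ => x + (-t) • L.symm (EuclideanSpace.single 2 1) := by fun_prop
  have hlim : Tendsto (fun t : ℝ => x + (-t) • L.symm (EuclideanSpace.single 2 1)) (𝓝[>] 0) (𝓝 x) := by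
    have h := hcont.tendsto 0
    simp only [neg_zero, zero_smul, add_zero] at h
    exact h.mono_left nhdsWithin_le_nhds
  obtain ⟨t, ⟨ht1, ht2⟩, ht⟩ := ((hlim.eventually (Filter.inter_mem (isOpen_interior.mem_nhds hx)
    (isOpen_interior.mem_nhds (mem_interior_iff_mem_nhds.2 hU)))).and self_mem_nhdsWithin).exists
  refine notMem_closure_of_below hgL.continuous hUe' ht2 ?_ (interior_subset ht1)
  rw [horiz_add, horiz_smul, horiz_symm_single, smul_zero, add_zero]
  have : L (x + (-t) • L.symm (EuclideanSpace.single 2 1)) 2 = L x 2 - t := by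
    simp [sub_eq_add_neg]
  rw [this]
  have : (0 : ℝ) < t := ht
  linarith

end domain

namespace TetMesh

variable {Ω : Set E} {M : TetMesh Ω}

theorem interior_hull_subset (hΩ : IsAdmissibleDomain Ω) (T : M.Elem) : interior (hull T.1) ⊆ Ω :=
  (interior_mono (hull_subset_closure T)).trans hΩ.interior_closure.subset

/-- Near each point of the closure, the domain is star-shaped with respect to an open set. -/
theorem exists_star (hΩ : IsAdmissibleDomain Ω) (M : TetMesh Ω) {x : E} (hx : x ∈ closure Ω) {ε : ℝ}
    (hε : 0 < ε) : ∃ r > 0, r ≤ ε ∧ ∃ P : Set E, IsOpen P ∧ P.Nonempty ∧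
      P ⊆ Ω ∩ Metric.ball x r ∧ ∀ p ∈ P, ∀ y ∈ Ω ∩ Metric.ball x r,
        segment ℝ p y ⊆ Ω ∩ Metric.ball x r := by
  by_cases hxΩ : x ∈ Ω
  · obtain ⟨r, hr, hb⟩ := Metric.isOpen_iff.1 hΩ.isOpen x hxΩ
    refine ⟨min r ε, lt_min hr hε, min_le_right _ _, Metric.ball x (min r ε), Metric.isOpen_ball,
      ⟨x, Metric.mem_ball_self (lt_min hr hε)⟩, ?_, ?_⟩
    · exact fun y hy => ⟨hb (Metric.ball_subset_ball (min_le_left _ _) hy), hy⟩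
    · intro p hp y hy z hz
      have : z ∈ Metric.ball x (min r ε) := (convex_ball x _).segment_subset hp hy.2 hz
      exact ⟨hb (Metric.ball_subset_ball (min_le_left _ _) this), this⟩
  have hfr : x ∈ frontier Ω := by
    rw [hΩ.isOpen.frontier_eq]; exact ⟨hx, hxΩ⟩
  obtain ⟨L, g, K, hgL, U, hU, hUe⟩ := hΩ.lipschitz x hfr
  have hUe' : Ω ∩ U = {y ∈ U | g (horiz L y) < L y 2} := hUe
  obtain ⟨r₀, hr₀, hball⟩ := exists_ball_mem_hull M x
  obtain ⟨r₁, hr₁, hUb⟩ := Metric.mem_nhds_iff.1 hU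
  set r := min (min r₀ r₁) ε with hrdef
  have hr : 0 < r := lt_min (lt_min hr₀ hr₁) hε
  have hrr₀ : r ≤ r₀ := (min_le_left _ _).trans (min_le_left _ _)
  have hrr₁ : r ≤ r₁ := (min_le_left _ _).trans (min_le_right _ _)
  have hmem : ∀ y ∈ Metric.ball x r, (y ∈ Ω ↔ g (horiz L y) < L y 2) := by
    intro y hy
    have hyU : y ∈ U := hUb (Metric.ball_subset_ball hrr₁ hy)
    constructor
    · intro h
      have : y ∈ Ω ∩ U := ⟨h, hyU⟩
      rw [hUe'] at this
      exact this.2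
    · intro h
      have : y ∈ Ω ∩ U := by rw [hUe']; exact ⟨hyU, h⟩
      exact this.1
  have hgx : g (horiz L x) ≤ L x 2 := by
    by_contra hcon
    exact notMem_closure_of_below hgL.continuous hUe' (mem_interior_iff_mem_nhds.2 hU)
      (not_le.1 hcon) hx
  -- contraction towards `x`
  have hcontr : ∀ y ∈ Ω ∩ Metric.ball x r, ∀ s : ℝ, 0 < s → s ≤ 1 → x + s • (y - x) ∈ Ω := by
    intro y hy s hs hs1
    rw [← hΩ.interior_closure]
    have hcont : Continuous fun z : E => x + s⁻¹ • (z - x) := by fun_prop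
    refine mem_interior.2 ⟨(fun z : E => x + s⁻¹ • (z - x)) ⁻¹' (Ω ∩ Metric.ball x r), ?_,
      (hΩ.isOpen.inter Metric.isOpen_ball).preimage hcont, ?_⟩
    · intro z hz
      obtain ⟨hz1, hz2⟩ := hz
      obtain ⟨T, hT⟩ := exists_elem_of_mem_closure M (subset_closure hz1)
      have hxT := hball T _ (Metric.ball_subset_ball hrr₀ hz2) hT
      refine hull_subset_closure T ?_
      have : z = (1 - s) • x + s • (x + s⁻¹ • (z - x)) := by
        rw [smul_add, smul_smul, mul_inv_cancel₀ hs.ne', one_smul, sub_smul, one_smul]; abel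
      rw [this]
      exact (convex_convexHull ℝ _) hxT hT (by linarith) hs.le (by ring)
    · simpa [smul_smul, inv_mul_cancel₀ hs.ne'] using hy
  have hlip : ∀ a b, g (a + b) ≤ g a + K * ‖b‖ := by
    intro a b
    have h1 := hgL.dist_le_mul (a + b) a
    rw [Real.dist_eq, dist_eq_norm, add_sub_cancel_left] at h1
    linarith [le_abs_self (g (a + b) - g a)]
  -- The upward cone at x that is steeper than the Lipschitz constant: adding a vector of this cone
  -- raises a point by more than the graph can rise.
  let P : Set E := Metric.ball x r ∩ {p | K * ‖horiz L (p - x)‖ < L (p - x) 2}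
  have hPΩ : P ⊆ Ω ∩ Metric.ball x r := by
    rintro p ⟨hp1, hp2⟩
    refine ⟨(hmem p hp1).2 ?_, hp1⟩
    have h1 : p = x + (p - x) := by abel
    have h2 := hlip (horiz L x) (horiz L (p - x))
    rw [← horiz_add, ← h1] at h2
    have h3 : L p 2 = L x 2 + L (p - x) 2 := by simp
    have h4 : K * ‖horiz L (p - x)‖ < L (p - x) 2 := hp2
    linarith
  refine ⟨r, hr, min_le_right _ _, P, ?_, ?_, hPΩ, ?_⟩
  · refine Metric.isOpen_ball.inter (isOpen_lt ?_ ?_)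
    · exact continuous_const.mul ((continuous_horiz L).comp (by fun_prop)).norm
    · exact (continuous_vert L).comp (by fun_prop)
  · refine ⟨x + (r / 2) • L.symm (EuclideanSpace.single 2 1), ?_, ?_⟩
    · rw [Metric.mem_ball, dist_eq_norm, add_sub_cancel_left, norm_smul, L.symm.norm_map]
      simp [abs_of_pos hr]; linarith
    · change (K : ℝ) * ‖horiz L (x + (r / 2) • L.symm (EuclideanSpace.single 2 1) - x)‖ <
        L (x + (r / 2) • L.symm (EuclideanSpace.single 2 1) - x) 2
      rw [add_sub_cancel_left, horiz_smul, horiz_symm_single]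
      simp [hr]
  · intro p hp y hy z hz
    have hzb : z ∈ Metric.ball x r := (convex_ball x r).segment_subset hp.1 hy.2 hz
    refine ⟨?_, hzb⟩
    obtain ⟨a, b, ha, hb, hab, rfl⟩ := hz
    rcases hb.eq_or_lt with rfl | hb
    · have ha1 : a = 1 := by linarith
      simpa [ha1] using (hPΩ hp).1
    have h1 := hcontr y hy b hb (by linarith)
    have hb1 : x + b • (y - x) ∈ Metric.ball x r := by
      have h2 := hy.2
      rw [Metric.mem_ball, dist_eq_norm] at h2 ⊢
      rw [add_sub_cancel_left, norm_smul, Real.norm_of_nonneg hb.le]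
      nlinarith [norm_nonneg (y - x)]
    have h3 := (hmem _ hb1).1 h1
    -- The point of the segment is the contraction of y towards x, followed by a step in the cone.
    -- The contraction stays in Ω because near x all elements contain x, and the step in the cone
    -- keeps the point above the graph.
    have h4 : a • p + b • y = (x + b • (y - x)) + a • (p - x) := by
      have : a = 1 - b := by linarith
      subst this
      module
    rw [h4] at hzb ⊢
    refine (hmem _ hzb).2 ?_
    rw [horiz_add, horiz_smul]
    have h5 := hlip (horiz L (x + b • (y - x))) (a • horiz L (p - x))
    rw [norm_smul, Real.norm_of_nonneg ha] at h5
    have h6 : L (x + b • (y - x) + a • (p - x)) 2 = L (x + b • (y - x)) 2 + a * L (p - x) 2 := by simp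
    have h7 : K * ‖horiz L (p - x)‖ < L (p - x) 2 := hp.2
    rw [h6]
    have h8 : a * (K * ‖horiz L (p - x)‖) ≤ a * L (p - x) 2 := mul_le_mul_of_nonneg_left h7.le ha
    linarith [mul_left_comm a (K : ℝ) ‖horiz L (p - x)‖]

/-! ## Faces -/

theorem card_inter_eq {T T' : M.Elem} (h : T ≠ T') {f : Finset E} (hf : f ⊆ T.1) (hf' : f ⊆ T'.1)
    (hc : f.card = 3) : T.1 ∩ T'.1 = f := by
  refine (Finset.eq_of_subset_of_card_le (Finset.subset_inter hf hf') ?_).symm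
  by_contra hcon
  obtain ⟨v, hv, hv'⟩ := exists_mem_notMem h
  have : T.1 ∩ T'.1 ⊆ T.1.erase v := fun a ha => by
    rw [Finset.mem_inter] at ha
    exact Finset.mem_erase.2 ⟨fun h => hv' (h ▸ ha.2), ha.1⟩
  have := Finset.card_le_card this
  rw [(isTet T).card_erase hv] at this
  omega

/-- The centroid of a triangle. -/
def centroid (f : Finset E) : E := ∑ a ∈ f, (3 : ℝ)⁻¹ • a

theorem centroid_mem {f : Finset E} (hc : f.card = 3) : centroid f ∈ hull f := by
  rw [Finset.mem_convexHull']
  exact ⟨fun _ => 3⁻¹, fun _ _ => by norm_num, by simp [hc], rfl⟩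

theorem lam_centroid {T f : Finset E} (hT : IsTet T) (hf : f ⊆ T) (hc : f.card = 3) {v : E}
    (hv : v ∈ f) : 0 < ev (lam T v) (centroid f) := by
  rw [centroid, ev_sum_smul_of_mem_polyDeg_one (hT.lam_mem v) _ _ (by simp [hc]),
    Finset.sum_eq_single v]
  · rw [hT.lam_self (hf hv)]; norm_num
  · intro b hb hbv
    rw [hT.lam_of_ne (hf hb) hbv, mul_zero]
  · exact fun h => absurd hv h

theorem lam_eq_zero_of_mem_face {T f : Finset E} (hT : IsTet T) (hf : f ⊆ T) {v : E} (hv : v ∈ T)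
    (hvf : v ∉ f) {x : E} (hx : x ∈ hull f) : ev (lam T v) x = 0 :=
  ((hT.mem_hull_subset_iff hf).1 hx).2 v hv hvf

section pair

variable {T T' : M.Elem} (h : T ≠ T') {f : Finset E} (hf : f ⊆ T.1) (hf' : f ⊆ T'.1)
  (hc : f.card = 3)

/-- The two elements at a common face lie on opposite sides of it. -/
theorem lam_opp_neg (h : T ≠ T') (hf : f ⊆ T.1) (hf' : f ⊆ T'.1) (hc : f.card = 3) :
    ev (lam T.1 (opp T.1 f)) (opp T'.1 f) < 0 := by
  obtain ⟨hw, hwf, he⟩ := (isTet T).opp_spec hf hc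
  obtain ⟨hw', hwf', he'⟩ := (isTet T').opp_spec hf' hc
  set w := opp T.1 f
  set w' := opp T'.1 f
  by_contra hcon
  rw [not_lt] at hcon
  have hcont : Continuous fun t : ℝ => (1 - t) • centroid f + t • w' := by fun_prop
  have hlim : Tendsto (fun t : ℝ => (1 - t) • centroid f + t • w') (𝓝[>] 0) (𝓝 (centroid f)) := by
    have h := hcont.tendsto 0
    simp only [sub_zero, one_smul, zero_smul, add_zero] at h
    exact h.mono_left nhdsWithin_le_nhds
  have hpos : ∀ᶠ y in 𝓝 (centroid f), ∀ v ∈ f, 0 < ev (lam T.1 v) y := by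
    rw [Finset.eventually_all]
    exact fun v hv => (continuous_ev _).continuousAt.eventually
      (lt_mem_nhds (lam_centroid (isTet T) hf hc hv))
  -- A point slightly moved from the centroid towards w' would lie in both elements. Its coordinate
  -- with respect to w' in T' is t > 0, whereas a common point has coordinate zero for every vertex
  -- that is not shared.
  obtain ⟨t, ht, ht0, ht1⟩ := ((hlim.eventually hpos).and (Ioo_mem_nhdsGT (zero_lt_one' ℝ))).exists
  have hev : ∀ p ∈ PolyDeg 1, ev p ((1 - t) • centroid f + t • w') =
      (1 - t) * ev p (centroid f) + t * ev p w' := by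
    intro p hp
    have := ev_sum_smul_of_mem_polyDeg_one hp Finset.univ ![1 - t, t] (by simp) ![centroid f, w']
    simpa using this
  have h1 : (1 - t) • centroid f + t • w' ∈ hull T.1 := by
    refine (isTet T).mem_hull_iff.2 fun v hv => ?_
    by_cases hvf : v ∈ f
    · exact (ht v hvf).le
    · have hvw : v = w := by
        by_contra hne
        exact hvf (he ▸ Finset.mem_erase.2 ⟨hne, hv⟩)
      rw [hvw, hev _ ((isTet T).lam_mem w),
        lam_eq_zero_of_mem_face (isTet T) hf hw hwf (centroid_mem hc), mul_zero, zero_add]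
      exact mul_nonneg ht0.le hcon
  have h2 : (1 - t) • centroid f + t • w' ∈ hull T'.1 :=
    (convex_convexHull ℝ _) (convexHull_mono (Finset.coe_subset.2 hf') (centroid_mem hc))
      (subset_convexHull ℝ _ hw') (by linarith) ht0.le (by ring)
  have hw'T : w' ∉ T.1 := fun hm => hwf' (by
    rw [← card_inter_eq h hf hf' hc]; exact Finset.mem_inter.2 ⟨hm, hw'⟩)
  have h3 := lam_eq_zero_of_notMem h2 h1 hw' hw'T
  rw [hev _ ((isTet T').lam_mem w'),
    lam_eq_zero_of_mem_face (isTet T') hf' hw' hwf' (centroid_mem hc), mul_zero, zero_add,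
    (isTet T').lam_self hw', mul_one] at h3
  linarith

/-- On the other side of a face, the opposite barycentric coordinates are proportional. -/
theorem lam_opp_eq_mul (hf : f ⊆ T.1) (hf' : f ⊆ T'.1) (hc : f.card = 3) (x : E) :
    ev (lam T'.1 (opp T'.1 f)) x =
      ev (lam T'.1 (opp T'.1 f)) (opp T.1 f) * ev (lam T.1 (opp T.1 f)) x := by
  obtain ⟨hw, hwf, he⟩ := (isTet T).opp_spec hf hc
  obtain ⟨hw', hwf', he'⟩ := (isTet T').opp_spec hf' hc
  refine (isTet T).ev_eq_mul_lam hw ((isTet T').lam_mem _) (fun a ha => ?_) x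
  rw [he] at ha
  exact (isTet T').lam_of_ne (hf' ha) (ne_of_mem_of_not_mem ha hwf')

/-- A face belongs to at most two elements. -/
theorem eq_or_eq_of_subset {T'' : M.Elem} (h : T ≠ T') (hf : f ⊆ T.1) (hf' : f ⊆ T'.1)
    (hf'' : f ⊆ T''.1) (hc : f.card = 3) : T'' = T ∨ T'' = T' := by
  by_contra! hcon
  have h1 := lam_opp_neg hcon.1.symm hf hf'' hc
  have h2 := lam_opp_neg hcon.2.symm hf' hf'' hc
  have h3 := lam_opp_neg h.symm hf' hf hc
  -- Three elements would be pairwise on opposite sides of the plane of f. The product of two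
  -- negative factors contradicts the third sign.
  rw [lam_opp_eq_mul hf hf' hc] at h2
  nlinarith

/-- Near a relative interior point of f only the coordinate opposite to f can change sign, and by
proportionality it is nonnegative in at least one of the two elements. -/
theorem exists_ball_subset_union (h : T ≠ T') (hf : f ⊆ T.1) (hf' : f ⊆ T'.1) (hc : f.card = 3)
    {z : E} (hz : ∀ v ∈ f, 0 < ev (lam T.1 v) z) (hzf : z ∈ hull f) :
    ∀ᶠ y in 𝓝 z, y ∈ hull T.1 ∪ hull T'.1 := by
  obtain ⟨hw, hwf, he⟩ := (isTet T).opp_spec hf hc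
  obtain ⟨hw', hwf', he'⟩ := (isTet T').opp_spec hf' hc
  have hzT : z ∈ hull T.1 := convexHull_mono (Finset.coe_subset.2 hf) hzf
  have hzT' : z ∈ hull T'.1 := convexHull_mono (Finset.coe_subset.2 hf') hzf
  have h1 : ∀ᶠ y in 𝓝 z, ∀ v ∈ f, 0 < ev (lam T.1 v) y := by
    rw [Finset.eventually_all]
    exact fun v hv => (continuous_ev _).continuousAt.eventually (lt_mem_nhds (hz v hv))
  have h2 : ∀ᶠ y in 𝓝 z, ∀ v ∈ f, 0 < ev (lam T'.1 v) y := by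
    rw [Finset.eventually_all]
    exact fun v hv => (continuous_ev _).continuousAt.eventually
      (lt_mem_nhds (lam_eq_lam hzT hzT' v ▸ hz v hv))
  filter_upwards [h1, h2] with y hy1 hy2
  rcases le_or_gt 0 (ev (lam T.1 (opp T.1 f)) y) with hle | hlt
  · left
    refine (isTet T).mem_hull_iff.2 fun v hv => ?_
    by_cases hvf : v ∈ f
    · exact (hy1 v hvf).le
    · rwa [show v = opp T.1 f by
        by_contra hne
        exact hvf (he ▸ Finset.mem_erase.2 ⟨hne, hv⟩)]
  · right
    refine (isTet T').mem_hull_iff.2 fun v hv => ?_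
    by_cases hvf : v ∈ f
    · exact (hy2 v hvf).le
    · rw [show v = opp T'.1 f by
        by_contra hne
        exact hvf (he' ▸ Finset.mem_erase.2 ⟨hne, hv⟩), lam_opp_eq_mul hf hf' hc]
      exact (mul_pos_of_neg_of_neg (lam_opp_neg h.symm hf' hf hc) hlt).le

theorem mem_of_mem_relint_face (hΩ : IsAdmissibleDomain Ω) (h : T ≠ T') (hf : f ⊆ T.1)
    (hf' : f ⊆ T'.1) (hc : f.card = 3) {z : E} (hz : ∀ v ∈ f, 0 < ev (lam T.1 v) z)
    (hzf : z ∈ hull f) : z ∈ Ω := by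
  rw [← hΩ.interior_closure, mem_interior_iff_mem_nhds]
  filter_upwards [exists_ball_subset_union h hf hf' hc hz hzf] with y hy
  exact hy.elim (fun h => hull_subset_closure T h) fun h => hull_subset_closure T' h

end pair

/-- Points of the face `f` near a given point, with positive barycentric coordinates. -/
theorem exists_relint_near {f : Finset E} {T : Finset E} (hT : IsTet T) (hf : f ⊆ T)
    (hc : f.card = 3) {z : E} (hz : z ∈ hull f) {U : Set E} (hU : U ∈ 𝓝 z) :
    ∃ y ∈ U, y ∈ hull f ∧ ∀ v ∈ f, 0 < ev (lam T v) y := by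
  have hcont : Continuous fun t : ℝ => (1 - t) • z + t • centroid f := by fun_prop
  have hlim : Tendsto (fun t : ℝ => (1 - t) • z + t • centroid f) (𝓝[>] 0) (𝓝 z) := by
    have h := hcont.tendsto 0
    simp only [sub_zero, one_smul, zero_smul, add_zero] at h
    exact h.mono_left nhdsWithin_le_nhds
  obtain ⟨t, ht, ht0, ht1⟩ := ((hlim.eventually hU).and (Ioo_mem_nhdsGT (zero_lt_one' ℝ))).exists
  refine ⟨_, ht, (convex_convexHull ℝ _) hz (centroid_mem hc) (by linarith) ht0.le (by ring),
    fun v hv => ?_⟩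
  have := ev_sum_smul_of_mem_polyDeg_one (hT.lam_mem v) Finset.univ ![1 - t, t] (by simp)
    ![z, centroid f]
  simp only [Fin.sum_univ_two, Matrix.cons_val_zero, Matrix.cons_val_one] at this
  rw [this]
  have h1 := hT.mem_hull_iff.1 (convexHull_mono (Finset.coe_subset.2 hf) hz) v (hf hv)
  have h2 := lam_centroid hT hf hc hv
  have := mul_pos ht0 h2
  have := mul_nonneg (by linarith : 0 ≤ 1 - t) h1
  linarith

/-- A face of an element that meets `Ω` belongs to another element, too. -/
theorem exists_ne_elem (hΩ : IsAdmissibleDomain Ω) {T : M.Elem} {f : Finset E} (hf : f ⊆ T.1)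
    (hc : f.card = 3) {z : E} (hz : z ∈ hull f) (hzΩ : z ∈ Ω) : ∃ T' : M.Elem, T ≠ T' ∧ f ⊆ T'.1 := by
  obtain ⟨hw, hwf, he⟩ := (isTet T).opp_spec hf hc
  obtain ⟨y, hyΩ, hyf, hy⟩ := exists_relint_near (isTet T) hf hc hz (hΩ.isOpen.mem_nhds hzΩ)
  obtain ⟨r, hr, hball⟩ := exists_ball_mem_hull M y
  have hyT : y ∈ hull T.1 := convexHull_mono (Finset.coe_subset.2 hf) hyf
  -- A relative interior point y of the face is pushed out of T, away from the opposite vertex,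
  -- while staying in Ω. The element found there contains y and therefore all vertices of f.
  have hcont : Continuous fun t : ℝ => y + t • (y - opp T.1 f) := by fun_prop
  have hlim : Tendsto (fun t : ℝ => y + t • (y - opp T.1 f)) (𝓝[>] 0) (𝓝 y) := by
    have h := hcont.tendsto 0
    simp only [zero_smul, add_zero] at h
    exact h.mono_left nhdsWithin_le_nhds
  obtain ⟨t, ⟨ht1, ht2⟩, ht⟩ := ((hlim.eventually (Filter.inter_mem (Metric.ball_mem_nhds y hr)
    (hΩ.isOpen.mem_nhds hyΩ))).and self_mem_nhdsWithin).exists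
  have ht : (0 : ℝ) < t := ht
  obtain ⟨T', hT'⟩ := exists_elem_of_mem_closure M (subset_closure ht2)
  have hyT' := hball T' _ ht1 hT'
  refine ⟨T', ?_, fun v hv => ?_⟩
  · rintro rfl
    have h1 := (isTet T).mem_hull_iff.1 hT' _ hw
    have h2 := (isTet T).lam_sub (opp T.1 f) (y + t • (y - opp T.1 f)) y
    have h3 := (isTet T).lam_sub (opp T.1 f) y (opp T.1 f)
    rw [add_sub_cancel_left, WithLp.ofLp_smul, dotProduct_smul, ← h3, smul_eq_mul,
      lam_eq_zero_of_mem_face (isTet T) hf hw hwf hyf, (isTet T).lam_self hw] at h2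
    linarith
  · by_contra hcon
    have h1 := lam_eq_zero_of_notMem hyT hyT' (hf hv) hcon
    have h2 := hy v hv
    linarith

end TetMesh

/-! ## Integration over the mesh -/

theorem volume_frontier_hull (s : Finset E) : volume (frontier (hull s)) = 0 :=
  (convex_convexHull ℝ _).addHaar_frontier volume

theorem interior_hull_ae_eq (s : Finset E) : interior (hull s) =ᵐ[volume] hull s :=
  interior_ae_eq_of_null_frontier (volume_frontier_hull s)

theorem ae_mem_interior (s : Finset E) :
    ∀ᵐ x ∂(volume.restrict (hull s)), x ∈ interior (hull s) := by
  rw [← Measure.restrict_congr_set (interior_hull_ae_eq s)]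
  exact ae_restrict_mem isOpen_interior.measurableSet

theorem integrableOn_hull_volume {F : Type*} [NormedAddCommGroup F] (s : Finset E) {h : E → F}
    (hh : Continuous h) : IntegrableOn h (hull s) :=
  hh.continuousOn.integrableOn_compact (isCompact_hull s)

namespace TetMesh

variable {Ω : Set E} {M : TetMesh Ω}

theorem disjoint_interior {T T' : M.Elem} (h : T ≠ T') :
    Disjoint (interior (hull T.1)) (interior (hull T'.1)) :=
  Set.disjoint_left.2 fun _ hx hx' => h (eq_of_mem_interior hx (interior_subset hx'))

theorem ae_eq_biUnion_interior {D : Set E} (S : Finset M.Elem)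
    (h1 : ∀ T ∈ S, interior (hull T.1) ⊆ D) (h2 : D ⊆ ⋃ T ∈ S, hull T.1) :
    D =ᵐ[volume] (⋃ T ∈ S, interior (hull T.1) : Set E) := by
  have hnull : volume (⋃ T ∈ S, frontier (hull T.1)) = 0 :=
    (measure_biUnion_null_iff S.countable_toSet).2 fun T _ => volume_frontier_hull T.1
  refine Filter.EventuallyLE.antisymm ?_ (LE.le.eventuallyLE (Set.iUnion₂_subset h1))
  refine Filter.mem_of_superset (compl_mem_ae_iff.2 hnull) fun x hx hxD => ?_
  obtain ⟨T, hT, hxT⟩ := Set.mem_iUnion₂.1 (h2 hxD)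
  refine Set.mem_iUnion₂.2 ⟨T, hT, ?_⟩
  by_contra hcon
  exact hx (Set.mem_iUnion₂.2 ⟨T, hT, subset_closure hxT, hcon⟩)

/-- Integrals over a union of elements, elementwise. -/
theorem setIntegral_eq_sum {D : Set E} (S : Finset M.Elem)
    (h1 : ∀ T ∈ S, interior (hull T.1) ⊆ D) (h2 : D ⊆ ⋃ T ∈ S, hull T.1) {F : E → ℝ}
    {Fc : M.Elem → E → ℝ} (hc : ∀ T ∈ S, Continuous (Fc T))
    (hF : ∀ T ∈ S, ∀ᵐ x ∂(volume.restrict (hull T.1)), F x = Fc T x) :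
    ∫ x in D, F x = ∑ T ∈ S, ∫ x in hull T.1, Fc T x := by
  have hr : ∀ T : M.Elem, (volume : Measure E).restrict (interior (hull T.1)) =
      volume.restrict (hull T.1) := fun T => Measure.restrict_congr_set (interior_hull_ae_eq T.1)
  rw [setIntegral_congr_set (ae_eq_biUnion_interior S h1 h2), integral_biUnion_finset]
  · refine Finset.sum_congr rfl fun T hT => ?_
    rw [hr]
    exact integral_congr_ae (hF T hT)
  · exact fun T _ => isOpen_interior.measurableSet
  · exact fun T _ T' _ h => disjoint_interior h
  · intro T hT
    rw [IntegrableOn, hr]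
    exact (integrableOn_hull_volume T.1 (hc T hT)).congr ((hF T hT).mono fun x hx => hx.symm)

theorem setIntegral_domain (hΩ : IsAdmissibleDomain Ω) {F : E → ℝ}
    {Fc : M.Elem → E → ℝ} (hc : ∀ T, Continuous (Fc T))
    (hF : ∀ T : M.Elem, ∀ᵐ x ∂(volume.restrict (hull T.1)), F x = Fc T x) :
    ∫ x in Ω, F x = ∑ T, ∫ x in hull T.1, Fc T x := by
  refine setIntegral_eq_sum Finset.univ (fun T _ => interior_hull_subset hΩ T) ?_
    (fun T _ => hc T) fun T _ => hF T
  intro x hx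
  obtain ⟨T, hT⟩ := exists_elem_of_mem_closure M (subset_closure hx)
  exact Set.mem_iUnion₂.2 ⟨T, Finset.mem_univ T, hT⟩

open Classical in
theorem setIntegral_patch {ν : E} {F : E → ℝ}
    {Fc : M.Elem → E → ℝ} (hc : ∀ T, Continuous (Fc T))
    (hF : ∀ T : M.Elem, ν ∈ T.1 → ∀ᵐ x ∂(volume.restrict (hull T.1)), F x = Fc T x) :
    ∫ x in M.patch ν, F x = ∑ T : M.Elem with ν ∈ T.1, ∫ x in hull T.1, Fc T x := by
  refine setIntegral_eq_sum _ (fun T hT => ?_) (fun x hx => ?_) (fun T _ => hc T)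
    fun T hT => hF T (Finset.mem_filter.1 hT).2
  · refine interior_mono ?_
    exact Set.subset_iUnion (fun T : {T : M.Elem // ν ∈ T.1} => hull T.1.1)
      ⟨T, (Finset.mem_filter.1 hT).2⟩
  · obtain ⟨T, hT⟩ := Set.mem_iUnion.1 (interior_subset hx)
    exact Set.mem_iUnion₂.2 ⟨T.1, Finset.mem_filter.2 ⟨Finset.mem_univ _, T.2⟩, hT⟩

theorem pw_eq (φ : M.Elem → SPoly) {T : M.Elem} {x : E} (hx : x ∈ interior (hull T.1)) :
    pw φ x = ev (φ T) x := by
  rw [pw, finsum_eq_single _ T, Set.indicator_of_mem hx]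
  intro T' hT'
  exact Set.indicator_of_notMem (fun h => hT' (eq_of_mem_interior h (interior_subset hx))) _

theorem pwV_eq (u : M.Elem → VPoly) {T : M.Elem} {x : E} (hx : x ∈ interior (hull T.1)) :
    pwV u x = evV (u T) x := by
  rw [pwV, finsum_eq_single _ T, Set.indicator_of_mem hx]
  intro T' hT'
  exact Set.indicator_of_notMem (fun h => hT' (eq_of_mem_interior h (interior_subset hx))) _

theorem ae_pw_eq (φ : M.Elem → SPoly) (T : M.Elem) :
    ∀ᵐ x ∂(volume.restrict (hull T.1)), pw φ x = ev (φ T) x :=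
  (ae_mem_interior T.1).mono fun _ hx => pw_eq φ hx

theorem ae_pwV_eq (u : M.Elem → VPoly) (T : M.Elem) :
    ∀ᵐ x ∂(volume.restrict (hull T.1)), pwV u x = evV (u T) x :=
  (ae_mem_interior T.1).mono fun _ hx => pwV_eq u hx

end TetMesh

/-! ## Test functions -/

theorem exists_bump {z : E} {U : Set E} (hU : U ∈ 𝓝 z) : ∃ ζ : E → ℝ, IsTest U ζ ∧
    (∀ x, 0 ≤ ζ x) ∧ ζ z = 1 := by
  obtain ⟨ε, hε, hb⟩ := Metric.nhds_basis_closedBall.mem_iff.1 hU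
  let f : ContDiffBump z := ⟨ε / 2, ε, by positivity, by linarith⟩
  refine ⟨f, ⟨f.contDiff, f.hasCompactSupport, ?_⟩, fun x => f.nonneg, ?_⟩
  · rw [f.tsupport_eq]; exact hb
  · exact f.one_of_mem_closedBall (Metric.mem_closedBall_self f.rIn_pos.le)

theorem IsTest.differentiable {F : Type*} [NormedAddCommGroup F] [NormedSpace ℝ F] {D : Set E}
    {ζ : E → F} (h : IsTest D ζ) : Differentiable ℝ ζ := h.1.differentiable (by simp)

theorem IsTest.contDiff_one {F : Type*} [NormedAddCommGroup F] [NormedSpace ℝ F] {D : Set E}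
    {ζ : E → F} (h : IsTest D ζ) : ContDiff ℝ 1 ζ := h.1.of_le (by exact_mod_cast le_top)

theorem IsTest.eq_zero {F : Type*} [NormedAddCommGroup F] [NormedSpace ℝ F] {D : Set E}
    {ζ : E → F} (h : IsTest D ζ) {x : E} (hx : x ∉ D) : ζ x = 0 :=
  image_eq_zero_of_notMem_tsupport fun h' => hx (h.2.2 h')

theorem pd_mul {u w : E → ℝ} (hu : Differentiable ℝ u) (hw : Differentiable ℝ w) (i : Fin 3)
    (x : E) : pd i (fun y => u y * w y) x = pd i u x * w x + u x * pd i w x := by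
  rw [pd, fderiv_fun_mul (hu x) (hw x)]
  simp [pd]; ring

theorem pd_sub {u w : E → ℝ} (hu : Differentiable ℝ u) (hw : Differentiable ℝ w) (i : Fin 3)
    (x : E) : pd i (fun y => u y - w y) x = pd i u x - pd i w x := by
  rw [pd, fderiv_fun_sub (hu x) (hw x)]
  simp [pd]

theorem pd_const_mul {u : E → ℝ} (hu : Differentiable ℝ u) (c : ℝ) (i : Fin 3)
    (x : E) : pd i (fun y => c * u y) x = c * pd i u x := by
  rw [pd, fderiv_const_mul (hu x)]
  simp [pd]

theorem continuous_pd {u : E → ℝ} (hu : ContDiff ℝ 1 u) (i : Fin 3) : Continuous (pd i u) :=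
  (hu.continuous_fderiv one_ne_zero).clm_apply continuous_const

theorem pd_eq_zero_of_notMem_tsupport {u : E → ℝ} {x : E} (hx : x ∉ tsupport u) (i : Fin 3) :
    pd i u x = 0 := by
  rw [pd, show fderiv ℝ u x = 0 from image_eq_zero_of_notMem_tsupport
    fun h => hx (tsupport_fderiv_subset ℝ h)]
  rfl

/-- Integration by parts of ζ against itself. It supplies the global side of the comparison of the
two area normals at a face in `areaNormal_eq_neg`. -/
theorem integral_pd_sq {ζ : E → ℝ} {D : Set E} (h : IsTest D ζ) (i : Fin 3) :
    ∫ x, pd i (fun y => ζ y * ζ y) x = 0 := by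
  have hc := continuous_pd h.contDiff_one i
  have hInt : Integrable fun x => ζ x * pd i ζ x :=
    (h.1.continuous.mul hc).integrable_of_hasCompactSupport h.2.1.mul_right
  have hInt' : Integrable fun x => pd i ζ x * ζ x := by simpa only [mul_comm] using hInt
  have hsq : Integrable fun x => ζ x * ζ x :=
    (h.1.continuous.mul h.1.continuous).integrable_of_hasCompactSupport h.2.1.mul_right
  have key := integral_mul_fderiv_eq_neg_fderiv_mul_of_integrable (μ := volume) (𝕜 := ℝ)
    (v := EuclideanSpace.single i (1 : ℝ)) (f := ζ) (g := ζ) hInt' hInt hsq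
    (fun x _ => h.differentiable x) fun x _ => h.differentiable x
  have h1 : ∀ x, pd i (fun y => ζ y * ζ y) x = pd i ζ x * ζ x + ζ x * pd i ζ x :=
    pd_mul h.differentiable h.differentiable i
  simp only [h1]
  rw [integral_add hInt' hInt]
  have key' : ∫ x, ζ x * pd i ζ x = -∫ x, pd i ζ x * ζ x := key
  rw [key']; ring

/-- A continuous function on a face that is orthogonal to all test functions vanishes. -/
theorem eq_zero_of_avg_mul_eq_zero {T f : Finset E} (hT : IsTet T) (hf : f ⊆ T) (hc : f.card = 3)
    {q : E → ℝ} (hq : Continuous q) {D : Set E}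
    (hD : ∀ x ∈ hull f, (∀ v ∈ f, 0 < ev (lam T v) x) → D ∈ 𝓝 x)
    (h : ∀ ζ : E → ℝ, IsTest D ζ → avg f (fun x => q x * ζ x) = 0) {z : E} (hz : z ∈ hull f) :
    q z = 0 := by
  by_contra hne
  obtain ⟨y, hyq, hyf, hy⟩ := exists_relint_near hT hf hc hz
    (hq.continuousAt.eventually (isOpen_ne.mem_nhds hne) : {x | q x ≠ 0} ∈ 𝓝 z)
  have hpos : 0 < q y * q y := mul_self_pos.2 hyq
  have hU : D ∩ {x | 0 < q y * q x} ∈ 𝓝 y := Filter.inter_mem (hD y hyf hy)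
    ((isOpen_lt continuous_const (continuous_const.mul hq)).mem_nhds hpos)
  obtain ⟨ζ, hζ, hζ0, hζ1⟩ := exists_bump hU
  have h1 := h ζ ⟨hζ.1, hζ.2.1, hζ.2.2.trans Set.inter_subset_left⟩
  have h2 : 0 < avg f (fun x => q y * (q x * ζ x)) := by
    refine avg_pos (affineIndependent_subset hT.indep hf) (Finset.card_pos.1 (by omega))
      (by have := hζ.1.continuous; fun_prop) (fun x _ => ?_) hyf (by rw [hζ1]; simpa using hpos)
    by_cases hx : x ∈ D ∩ {x | 0 < q y * q x}
    · have : 0 < q y * q x := hx.2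
      rw [← mul_assoc]
      exact mul_nonneg this.le (hζ0 x)
    · rw [hζ.eq_zero hx]; simp
  rw [avg_const_mul, h1, mul_zero] at h2
  exact lt_irrefl _ h2

/-! ## The Gauss theorem -/

/-- The Gauss theorem on a tetrahedron. -/
theorem IsTet.integral_div {T : Finset E} (hT : IsTet T) {Ψ : E → V}
    (hΨ : ∀ i, ContDiff ℝ 1 fun x => Ψ x i) :
    ∫ x in hull T, ∑ i, pd i (fun y => Ψ y i) x =
      -stokesConst 4 * ∑ w ∈ T, avg (T.erase w) (fun x => areaNormal T w ⬝ᵥ Ψ x) := by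
  rw [integral_finsetSum _ fun i _ => integrableOn_hull_volume T (continuous_pd (hΨ i) i)]
  simp only [hT.integral_pd (hΨ _)]
  rw [← Finset.mul_sum, Finset.sum_comm]
  congr 1
  refine Finset.sum_congr rfl fun w hw => ?_
  simp only [dotProduct]
  rw [avg_sum (hT.erase_indep w) (hT.erase_nonempty hw)]
  · exact Finset.sum_congr rfl fun i _ => (avg_const_mul _ _).symm
  · exact fun i _ => (continuous_const.mul (hΨ i).continuous).continuousOn

namespace TetMesh

variable {Ω : Set E} {M : TetMesh Ω}

/-- Areas are not computed. For a bump ζ near the centroid of f, the derivative of ζ² has integral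
zero over the whole space. By Stokes on the two elements the same integral is a multiple of the sum
of the two normals times the mean of ζ² over f, all other faces being off the support. That mean is
positive. -/
theorem areaNormal_eq_neg {T T' : M.Elem} (h : T ≠ T') {f : Finset E} (hf : f ⊆ T.1)
    (hf' : f ⊆ T'.1) (hc : f.card = 3) :
    areaNormal T.1 (opp T.1 f) = -areaNormal T'.1 (opp T'.1 f) := by
  obtain ⟨hw, hwf, he⟩ := (isTet T).opp_spec hf hc
  obtain ⟨hw', hwf', he'⟩ := (isTet T').opp_spec hf' hc
  have hz := centroid_mem hc
  have hpos : ∀ T : M.Elem, f ⊆ T.1 → ∀ᶠ y in 𝓝 (centroid f), ∀ v ∈ f, 0 < ev (lam T.1 v) y := by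
    intro T hf
    rw [Finset.eventually_all]
    exact fun v hv => (continuous_ev _).continuousAt.eventually
      (lt_mem_nhds (lam_centroid (isTet T) hf hc hv))
  obtain ⟨ζ, hζ, hζ0, hζ1⟩ := exists_bump ((hpos T hf).and ((hpos T' hf').and
    (exists_ball_subset_union h hf hf' hc (fun v hv => lam_centroid (isTet T) hf hc hv) hz)))
  have hsm : ContDiff ℝ 1 fun y => ζ y * ζ y := hζ.contDiff_one.mul hζ.contDiff_one
  have hface : ∀ T : M.Elem, f ⊆ T.1 → (∀ y, ζ y ≠ 0 → ∀ v ∈ f, 0 < ev (lam T.1 v) y) → ∀ i,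
      ∫ x in hull T.1, pd i (fun y => ζ y * ζ y) x =
      -stokesConst 4 * (areaNormal T.1 (opp T.1 f) i * avg f fun y => ζ y * ζ y) := by
    intro T hf hs i
    obtain ⟨hw, hwf, he⟩ := (isTet T).opp_spec hf hc
    rw [(isTet T).integral_pd hsm i, ← Finset.add_sum_erase _ _ hw, Finset.sum_eq_zero, add_zero, he]
    intro v hv
    rw [he] at hv
    have : avg (T.1.erase v) (fun y => ζ y * ζ y) = 0 := by
      rw [← avg_const ((isTet T).erase_indep v) ((isTet T).erase_nonempty (hf hv)) 0]
      refine avg_congr fun x hx => ?_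
      by_contra hne
      have h1 := hs x (fun h => hne (by rw [h, mul_zero])) v hv
      have h2 := lam_eq_zero_of_mem_face (isTet T) (Finset.erase_subset _ _) (hf hv)
        (Finset.notMem_erase _ _) hx
      linarith
    rw [this, mul_zero]
  have hsupp : ∀ y, ζ y ≠ 0 → (∀ v ∈ f, 0 < ev (lam T.1 v) y) ∧ (∀ v ∈ f, 0 < ev (lam T'.1 v) y) ∧
      y ∈ hull T.1 ∪ hull T'.1 := fun y hy => hζ.2.2 (subset_tsupport _ hy)
  have havg : 0 < avg f fun y => ζ y * ζ y :=
    avg_pos (affineIndependent_subset (isTet T).indep hf) (Finset.card_pos.1 (by omega))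
      hsm.continuous.continuousOn (fun x _ => mul_self_nonneg _) hz (by rw [hζ1]; norm_num)
  ext i
  have h1 := hface T hf (fun y hy => (hsupp y hy).1) i
  have h2 := hface T' hf' (fun y hy => (hsupp y hy).2.1) i
  have h3 := integral_pd_sq hζ i
  have h4 : ∫ x, pd i (fun y => ζ y * ζ y) x =
      ∫ x in hull T.1 ∪ hull T'.1, pd i (fun y => ζ y * ζ y) x := by
    refine (setIntegral_eq_integral_of_forall_compl_eq_zero fun x hx => ?_).symm
    refine pd_eq_zero_of_notMem_tsupport (fun hmem => hx ?_) i
    exact (hζ.2.2 (tsupport_mul_subset_left hmem)).2.2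
  classical
  have h5 := setIntegral_eq_sum (M := M) (D := hull T.1 ∪ hull T'.1) {T, T'}
    (F := pd i (fun y => ζ y * ζ y)) (Fc := fun _ => pd i (fun y => ζ y * ζ y))
    (fun S hS => ?_) (fun x hx => ?_) (fun _ _ => continuous_pd hsm i)
    (fun _ _ => Eventually.of_forall fun _ => rfl)
  · rw [Finset.sum_pair h, h1, h2, ← h4, h3] at h5
    have hk := stokesConst_pos 4
    have h6 : (stokesConst 4 * avg f fun y => ζ y * ζ y) *
      (areaNormal T.1 (opp T.1 f) i + areaNormal T'.1 (opp T'.1 f) i) = 0 := by linarith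
    have h7 := (mul_eq_zero.1 h6).resolve_left (mul_pos hk havg).ne'
    simp only [Pi.neg_apply]
    linarith
  · rcases Finset.mem_insert.1 hS with rfl | hS
    · exact interior_subset.trans Set.subset_union_left
    · rw [Finset.mem_singleton.1 hS]
      exact interior_subset.trans Set.subset_union_right
  · rcases hx with hx | hx
    · exact Set.mem_iUnion₂.2 ⟨T, by simp, hx⟩
    · exact Set.mem_iUnion₂.2 ⟨T', by simp, hx⟩

/-- The scaled normal of an internal face. -/
def faceNormal (o : M.FaceOrientation) (f : M.IntFace) : V :=
  areaNormal (o.plus f).1 (opp (o.plus f).1 f.1)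

theorem areaNormal_minus (o : M.FaceOrientation) (f : M.IntFace) :
    areaNormal (o.minus f).1 (opp (o.minus f).1 f.1) = -faceNormal o f := by
  rw [areaNormal_eq_neg (o.ne f).symm (o.subset_minus f) (o.subset_plus f) f.2.2.1, faceNormal]

/-- Sums over the faces of all elements, regrouped by the internal faces. -/
theorem sum_elem_eq_sum_intFace (o : M.FaceOrientation) {F : M.Elem → E → ℝ}
    (h0 : ∀ (T : M.Elem), ∀ w ∈ T.1, (∀ f : M.IntFace, f.1 ≠ T.1.erase w) → F T w = 0) :
    ∑ T : M.Elem, ∑ w ∈ T.1, F T w = ∑ f : M.IntFace,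
      (F (o.plus f) (opp (o.plus f).1 f.1) + F (o.minus f) (opp (o.minus f).1 f.1)) := by
  classical
  have h1 : ∀ T : M.Elem, ∀ w ∈ T.1, F T w =
      ∑ f : M.IntFace, if f.1 = T.1.erase w then F T w else 0 := by
    intro T w hw
    by_cases h : ∃ f : M.IntFace, f.1 = T.1.erase w
    · obtain ⟨f, hf⟩ := h
      rw [Finset.sum_eq_single f, if_pos hf]
      · exact fun f' _ hne => if_neg fun h => hne (Subtype.ext (h.trans hf.symm))
      · exact fun h => absurd (Finset.mem_univ f) h
    · push Not at h
      rw [h0 T w hw h]; simp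
  rw [Finset.sum_congr rfl fun T _ => Finset.sum_congr rfl (h1 T)]
  rw [Finset.sum_congr rfl fun T _ => Finset.sum_comm, Finset.sum_comm]
  refine Finset.sum_congr rfl fun f _ => ?_
  have h2 : ∀ T : M.Elem, f.1 ⊆ T.1 →
      (∑ w ∈ T.1, if f.1 = T.1.erase w then F T w else 0) = F T (opp T.1 f.1) := by
    intro T hf
    obtain ⟨hw, hwf, he⟩ := (isTet T).opp_spec hf f.2.2.1
    rw [Finset.sum_eq_single (opp T.1 f.1), if_pos he.symm]
    · intro w hw' hne
      rw [if_neg]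
      intro h
      apply hne
      rw [h, (isTet T).opp_erase hw']
    · exact fun h => absurd hw h
  rw [Finset.sum_eq_add (o.plus f) (o.minus f) (o.ne f), h2 _ (o.subset_plus f),
    h2 _ (o.subset_minus f)]
  · intro T _ hne
    refine Finset.sum_eq_zero fun w hw => if_neg fun h => ?_
    rcases eq_or_eq_of_subset (o.ne f) (o.subset_plus f) (o.subset_minus f)
      (h ▸ Finset.erase_subset _ _ : f.1 ⊆ T.1) f.2.2.1 with h | h
    · exact hne.1 h
    · exact hne.2 h
  · exact fun h => absurd (Finset.mem_univ _) h
  · exact fun h => absurd (Finset.mem_univ _) h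

/-- The elementwise divergence theorem. -/
theorem sum_integral_div (o : M.FaceOrientation) {Ψ : M.Elem → E → V}
    (hΨ : ∀ T i, ContDiff ℝ 1 fun x => Ψ T x i)
    (h0 : ∀ (T : M.Elem), ∀ w ∈ T.1, (∀ f : M.IntFace, f.1 ≠ T.1.erase w) →
      ∀ x ∈ hull (T.1.erase w), areaNormal T.1 w ⬝ᵥ Ψ T x = 0) :
    ∑ T : M.Elem, ∫ x in hull T.1, ∑ i, pd i (fun y => Ψ T y i) x =
      -stokesConst 4 * ∑ f : M.IntFace,
        avg f.1 (fun x => faceNormal o f ⬝ᵥ (Ψ (o.plus f) x - Ψ (o.minus f) x)) := by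
  simp only [(isTet _).integral_div (hΨ _)]
  rw [← Finset.mul_sum, sum_elem_eq_sum_intFace o]
  · congr 1
    refine Finset.sum_congr rfl fun f _ => ?_
    rw [((isTet _).opp_spec (o.subset_plus f) f.2.2.1).2.2,
      ((isTet _).opp_spec (o.subset_minus f) f.2.2.1).2.2, areaNormal_minus, ← avg_add]
    · refine avg_congr fun x _ => ?_
      rw [neg_dotProduct, dotProduct_sub, faceNormal]; ring
    · exact affineIndependent_subset (isTet _).indep (o.subset_plus f)
    · exact Finset.card_pos.1 (by rw [f.2.2.1]; norm_num)
    · exact (continuous_const.dotProduct (continuous_pi fun i => (hΨ _ i).continuous)).continuousOn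
    · exact (continuous_const.dotProduct (continuous_pi fun i => (hΨ _ i).continuous)).continuousOn
  · intro T w hw h
    rw [← avg_const ((isTet T).erase_indep w) ((isTet T).erase_nonempty hw) 0]
    exact avg_congr (h0 T w hw h)

/-- Faces that are not internal do not meet the domain. -/
theorem notMem_of_forall_ne (hΩ : IsAdmissibleDomain Ω) {T : M.Elem} {w : E} (hw : w ∈ T.1)
    (h : ∀ f : M.IntFace, f.1 ≠ T.1.erase w) {x : E} (hx : x ∈ hull (T.1.erase w)) : x ∉ Ω := by
  intro hxΩ
  obtain ⟨T', hne, hs⟩ := exists_ne_elem hΩ (Finset.erase_subset w T.1)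
    ((isTet T).card_erase hw) hx hxΩ
  exact h ⟨T.1.erase w, M.down_closed T.2.1 (Finset.erase_subset _ _)
    ((isTet T).erase_nonempty hw), (isTet T).card_erase hw, T, T', hne,
    Finset.erase_subset _ _, hs⟩ rfl

/-- The elementwise divergence theorem for fields that vanish outside of the domain. -/
theorem sum_integral_div_of_eq_zero (hΩ : IsAdmissibleDomain Ω) (o : M.FaceOrientation)
    {Ψ : M.Elem → E → V} (hΨ : ∀ T i, ContDiff ℝ 1 fun x => Ψ T x i)
    (h0 : ∀ T, ∀ x, x ∉ Ω → Ψ T x = 0) :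
    ∑ T : M.Elem, ∫ x in hull T.1, ∑ i, pd i (fun y => Ψ T y i) x =
      -stokesConst 4 * ∑ f : M.IntFace,
        avg f.1 (fun x => faceNormal o f ⬝ᵥ (Ψ (o.plus f) x - Ψ (o.minus f) x)) :=
  sum_integral_div o hΨ fun T w hw h x hx => by
    rw [h0 T x (notMem_of_forall_ne hΩ hw h hx), dotProduct_zero]

end TetMesh

/-! ## Weakly divergence-free piecewise polynomials -/

namespace TetMesh

variable {Ω : Set E} {M : TetMesh Ω}

/-- The part of the domain near an internal face that meets no other face. -/
def faceNhd (o : M.FaceOrientation) (f : M.IntFace) : Set E :=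
  {x | x ∈ Ω ∧ x ∈ hull (o.plus f).1 ∪ hull (o.minus f).1 ∧
    ∀ v ∈ f.1, 0 < ev (lam (o.plus f).1 v) x ∧ 0 < ev (lam (o.minus f).1 v) x}

theorem faceNhd_subset (o : M.FaceOrientation) (f : M.IntFace) : faceNhd o f ⊆ Ω :=
  fun _ hx => hx.1

theorem faceNhd_mem_nhds (hΩ : IsAdmissibleDomain Ω) (o : M.FaceOrientation) (f : M.IntFace) {x : E}
    (hx : x ∈ hull f.1) (hpos : ∀ v ∈ f.1, 0 < ev (lam (o.plus f).1 v) x) :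
    faceNhd o f ∈ 𝓝 x := by
  have h1 := mem_of_mem_relint_face hΩ (o.ne f) (o.subset_plus f) (o.subset_minus f) f.2.2.1 hpos hx
  have h2 := exists_ball_subset_union (o.ne f) (o.subset_plus f) (o.subset_minus f) f.2.2.1 hpos hx
  have h3 : ∀ᶠ y in 𝓝 x, ∀ v ∈ f.1,
      0 < ev (lam (o.plus f).1 v) y ∧ 0 < ev (lam (o.minus f).1 v) y := by
    rw [Finset.eventually_all]
    intro v hv
    have h4 := hpos v hv
    have h5 := h4
    rw [lam_eq_lam (o.mem_plus hx) (o.mem_minus hx)] at h5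
    exact ((continuous_ev _).continuousAt.eventually (lt_mem_nhds h4)).and
      ((continuous_ev _).continuousAt.eventually (lt_mem_nhds h5))
  filter_upwards [hΩ.isOpen.mem_nhds h1, h2, h3] with y hy1 hy2 hy3
  exact ⟨hy1, hy2, hy3⟩

/-- All vertices of f have a positive coordinate at x, so each of them must be a vertex of any face
that contains x. -/
theorem eq_of_mem_faceNhd (o : M.FaceOrientation) {f g : M.IntFace} {x : E} (hx : x ∈ faceNhd o f)
    (hg : x ∈ hull g.1) : g = f := by
  have key : ∀ T : M.Elem, f.1 ⊆ T.1 → x ∈ hull T.1 → (∀ v ∈ f.1, 0 < ev (lam T.1 v) x) →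
      f.1 ⊆ g.1 := by
    intro T hf hxT hpos v hv
    by_contra hvg
    have h1 := lam_eq_lam hxT (o.mem_plus hg) v
    have h2 := hpos v hv
    by_cases hvT : v ∈ (o.plus g).1
    · rw [h1, lam_eq_zero_of_mem_face (isTet _) (o.subset_plus g) hvT hvg hg] at h2
      exact lt_irrefl _ h2
    · rw [h1, (isTet _).lam_of_notMem hvT] at h2
      exact lt_irrefl _ h2
  have hsub : f.1 ⊆ g.1 := by
    rcases hx.2.1 with h | h
    · exact key _ (o.subset_plus f) h fun v hv => (hx.2.2 v hv).1
    · exact key _ (o.subset_minus f) h fun v hv => (hx.2.2 v hv).2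
  exact Subtype.ext (Finset.eq_of_subset_of_card_le hsub (by rw [f.2.2.1, g.2.2.1])).symm

theorem face_indep (f : M.IntFace) : AffineIndependent ℝ ((↑) : f.1 → E) := M.indep f.2.1

theorem face_nonempty (f : M.IntFace) : f.1.Nonempty :=
  Finset.card_pos.1 (by rw [f.2.2.1]; norm_num)

/-- Fundamental lemma for functions on the internal faces. -/
theorem jump_eq_zero (hΩ : IsAdmissibleDomain Ω) (o : M.FaceOrientation) {q : M.IntFace → E → ℝ}
    (f : M.IntFace) (hq : Continuous (q f)) {D : Set E}
    (hD : ∀ x ∈ hull f.1, (∀ v ∈ f.1, 0 < ev (lam (o.plus f).1 v) x) → D ∈ 𝓝 x)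
    (h : ∀ ζ : E → ℝ, IsTest (D ∩ Ω) ζ → ∑ g : M.IntFace, avg g.1 (fun x => q g x * ζ x) = 0)
    {z : E} (hz : z ∈ hull f.1) : q f z = 0 := by
  refine eq_zero_of_avg_mul_eq_zero (isTet (o.plus f)) (o.subset_plus f) f.2.2.1 hq
    (D := D ∩ faceNhd o f) (fun x hx hpos => Filter.inter_mem (hD x hx hpos)
      (faceNhd_mem_nhds hΩ o f hx hpos)) (fun ζ hζ => ?_) hz
  rw [← h ζ ⟨hζ.1, hζ.2.1, hζ.2.2.trans (Set.inter_subset_inter_right _ (faceNhd_subset o f))⟩,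
    Finset.sum_eq_single f]
  · intro g _ hg
    rw [← avg_const (face_indep g) (face_nonempty g) 0]
    refine avg_congr fun x hx => ?_
    rw [hζ.eq_zero fun h => hg (eq_of_mem_faceNhd o h.2 hx), mul_zero]
  · exact fun h => absurd (Finset.mem_univ f) h

end TetMesh

theorem pd_evV_mul (u : VPoly) {ζ : E → ℝ} (hζ : Differentiable ℝ ζ) (x : E) :
    ∑ i, pd i (fun y => evV u y i * ζ y) x = evV u x ⬝ᵥ grad ζ x + ev (divP u) x * ζ x := by
  have h : ∀ i, pd i (fun y => evV u y i * ζ y) x =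
      ev (MvPolynomial.pderiv i (u i)) x * ζ x + evV u x i * pd i ζ x := fun i => by
    rw [← pd_ev]
    exact pd_mul ((contDiff_ev (u i) (n := 1)).differentiable (by simp)) hζ i x
  simp only [h, Finset.sum_add_distrib, dotProduct, grad, divP, ev_sum, Finset.sum_mul]
  ring

theorem continuous_grad {ζ : E → ℝ} (h : ContDiff ℝ 1 ζ) : Continuous (grad ζ) :=
  continuous_pi fun i => continuous_pd h i

/-- A polynomial that is orthogonal to the test functions of an open set vanishes. -/
theorem eq_zero_of_integral_mul_eq_zero {p : SPoly} {U : Set E} (hU : IsOpen U) (hne : U.Nonempty)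
    (h : ∀ ζ : E → ℝ, IsTest U ζ → ∫ x, ev p x * ζ x = 0) : p = 0 := by
  refine eq_zero_of_ev_eq_zero hU hne fun x hx => ?_
  by_contra hpx
  have hpos : 0 < ev p x * ev p x := mul_self_pos.2 hpx
  obtain ⟨ζ, hζ, hζ0, hζ1⟩ := exists_bump (Filter.inter_mem (hU.mem_nhds hx)
    ((isOpen_lt continuous_const (continuous_const.mul (continuous_ev p))).mem_nhds hpos))
  have h1 := h ζ ⟨hζ.1, hζ.2.1, hζ.2.2.trans Set.inter_subset_left⟩
  have hcont : Continuous fun y => ev p x * (ev p y * ζ y) :=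
    continuous_const.mul ((continuous_ev p).mul hζ.1.continuous)
  have h2 : 0 < ∫ y, ev p x * (ev p y * ζ y) := by
    refine hcont.integral_pos_of_hasCompactSupport_nonneg_nonzero (hζ.2.1.mul_left.mul_left)
      (fun y => ?_) (x := x) (by rw [hζ1, mul_one]; exact hpos.ne')
    by_cases hy : y ∈ U ∩ {y | 0 < ev p x * ev p y}
    · rw [← mul_assoc]
      exact mul_nonneg (le_of_lt hy.2) (hζ0 y)
    · simp [hζ.eq_zero hy]
  rw [integral_const_mul, h1, mul_zero] at h2
  exact lt_irrefl _ h2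

namespace TetMesh

variable {Ω : Set E} {M : TetMesh Ω}

/-- Elementwise Green formula for (j, ∇ζ) = 0. Test functions supported in one element isolate the
divergence term; once it is known to vanish, test functions near one face isolate its normal jump.
-/
theorem sum_avg_add_sum_integral_eq_zero (hΩ : IsAdmissibleDomain Ω) (o : M.FaceOrientation)
    {j : M.Elem → VPoly} (hj : MemHDivZero Ω (pwV j)) {ζ : E → ℝ} (hζ : IsTest Ω ζ) :
    stokesConst 4 * ∑ f : M.IntFace, avg f.1 (fun x =>
      (faceNormal o f ⬝ᵥ (evV (j (o.plus f)) x - evV (j (o.minus f)) x)) * ζ x) +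
      ∑ T : M.Elem, ∫ x in hull T.1, ev (divP (j T)) x * ζ x = 0 := by
  have h1 := hj.2 ζ hζ
  have hg := continuous_grad hζ.contDiff_one
  rw [ip, setIntegral_domain hΩ (Fc := fun T x => evV (j T) x ⬝ᵥ grad ζ x)
    (fun T => (continuous_evV _).dotProduct hg)
    (fun T => (ae_pwV_eq j T).mono fun x hx => by rw [hx])] at h1
  have h2 := sum_integral_div_of_eq_zero hΩ o (Ψ := fun T x i => evV (j T) x i * ζ x)
    (fun T i => (contDiff_ev (j T i) (n := 1)).mul hζ.contDiff_one)
    (fun T x hx => by ext i; simp [hζ.eq_zero hx])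
  simp only [pd_evV_mul _ hζ.differentiable] at h2
  have h3 : ∀ T : M.Elem, ∫ x in hull T.1, (evV (j T) x ⬝ᵥ grad ζ x + ev (divP (j T)) x * ζ x) =
      (∫ x in hull T.1, evV (j T) x ⬝ᵥ grad ζ x) + ∫ x in hull T.1, ev (divP (j T)) x * ζ x :=
    fun T => integral_add (integrableOn_hull_volume _ ((continuous_evV _).dotProduct hg))
      (integrableOn_hull_volume _ ((continuous_ev _).mul hζ.1.continuous))
  simp only [h3, Finset.sum_add_distrib, h1, zero_add] at h2
  rw [h2, neg_mul, ← sub_eq_add_neg, ← mul_sub, ← Finset.sum_sub_distrib]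
  refine mul_eq_zero_of_right _ (Finset.sum_eq_zero fun f _ => ?_)
  rw [sub_eq_zero]
  refine avg_congr fun x _ => ?_
  simp only [dotProduct, Pi.sub_apply, Finset.sum_mul]
  exact Finset.sum_congr rfl fun i _ => by ring

theorem divP_eq_zero (hΩ : IsAdmissibleDomain Ω) (o : M.FaceOrientation)
    {j : M.Elem → VPoly} (hj : MemHDivZero Ω (pwV j)) (T : M.Elem) : divP (j T) = 0 := by
  refine eq_zero_of_integral_mul_eq_zero (isOpen_interior (s := hull T.1))
    (isTet T).interior_nonempty fun ζ hζ => ?_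
  have hζΩ : IsTest Ω ζ := ⟨hζ.1, hζ.2.1, hζ.2.2.trans (interior_hull_subset hΩ T)⟩
  have h := sum_avg_add_sum_integral_eq_zero hΩ o hj hζΩ
  rw [Finset.sum_eq_zero, mul_zero, zero_add, Finset.sum_eq_single T] at h
  · rw [← h]
    refine (setIntegral_eq_integral_of_forall_compl_eq_zero fun x hx => ?_).symm
    rw [hζ.eq_zero fun h => hx (interior_subset h), mul_zero]
  · intro T' _ hne
    rw [← integral_zero E ℝ (μ := volume.restrict (hull T'.1))]
    refine setIntegral_congr_fun (measurableSet_hull _) fun x hx => ?_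
    rw [hζ.eq_zero fun h => hne (eq_of_mem_interior h hx).symm, mul_zero]
  · exact fun h => absurd (Finset.mem_univ _) h
  · intro f _
    rw [← avg_const (face_indep f) (face_nonempty f) 0]
    refine avg_congr fun x hx => ?_
    rw [hζ.eq_zero fun h => ?_, mul_zero]
    exact o.ne f ((eq_of_mem_interior h (o.mem_plus hx)).symm.trans
      (eq_of_mem_interior h (o.mem_minus hx)))

theorem normal_jump_eq_zero (hΩ : IsAdmissibleDomain Ω) (o : M.FaceOrientation)
    {j : M.Elem → VPoly} (hj : MemHDivZero Ω (pwV j)) (f : M.IntFace) {x : E} (hx : x ∈ hull f.1) :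
    faceNormal o f ⬝ᵥ (evV (j (o.plus f)) x - evV (j (o.minus f)) x) = 0 := by
  refine jump_eq_zero hΩ o (q := fun f x =>
    faceNormal o f ⬝ᵥ (evV (j (o.plus f)) x - evV (j (o.minus f)) x)) (D := Set.univ) f
    (continuous_const.dotProduct ((continuous_evV _).sub (continuous_evV _)))
    (fun _ _ _ => Filter.univ_mem) (fun ζ hζ => ?_) hx
  rw [Set.univ_inter] at hζ
  have h := sum_avg_add_sum_integral_eq_zero hΩ o hj hζ
  rw [Finset.sum_eq_zero (s := Finset.univ (α := M.Elem)), add_zero] at h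
  · exact (mul_eq_zero.1 h).resolve_left (stokesConst_pos 4).ne'
  · intro T _
    simp [divP_eq_zero hΩ o hj T]

end TetMesh

/-! ## Element problems -/

/-- The `L²` inner product on a simplex, on polynomial vector fields. -/
def ipB (s : Finset E) : VPoly →ₗ[ℝ] VPoly →ₗ[ℝ] ℝ :=
  LinearMap.mk₂ ℝ (fun u w => ip (hull s) (evV u) (evV w))
    (fun u u' w => by
      simp only [ip, evV_add, add_dotProduct]
      exact integral_add
        (integrableOn_hull_volume s ((continuous_evV u).dotProduct (continuous_evV w)))
        (integrableOn_hull_volume s ((continuous_evV u').dotProduct (continuous_evV w))))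
    (fun c u w => by
      simp only [ip, evV_smul, smul_dotProduct, smul_eq_mul, integral_const_mul])
    (fun u w w' => by
      simp only [ip, evV_add, dotProduct_add]
      exact integral_add
        (integrableOn_hull_volume s ((continuous_evV u).dotProduct (continuous_evV w)))
        (integrableOn_hull_volume s ((continuous_evV u).dotProduct (continuous_evV w'))))
    (fun c u w => by
      simp only [ip, evV_smul, dotProduct_smul, smul_eq_mul, integral_const_mul])

theorem ipB_apply (s : Finset E) (u w : VPoly) : ipB s u w = ip (hull s) (evV u) (evV w) := rfl

theorem ipB_symm (s : Finset E) (u w : VPoly) : ipB s u w = ipB s w u := by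
  simp only [ipB_apply, ip, dotProduct_comm]

theorem dotProduct_self_nonneg' (v : V) : 0 ≤ v ⬝ᵥ v :=
  Finset.sum_nonneg fun i _ => mul_self_nonneg (v i)

theorem ipB_self_nonneg (s : Finset E) (u : VPoly) : 0 ≤ ipB s u u :=
  integral_nonneg fun _ => dotProduct_self_nonneg' _

theorem IsTet.eq_zero_of_ipB_self {T : Finset E} (hT : IsTet T) {u : VPoly} (h : ipB T u u = 0) :
    u = 0 := by
  have hc : Continuous fun x => evV u x ⬝ᵥ evV u x := (continuous_evV u).dotProduct (continuous_evV u)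
  rw [ipB_apply, ip, setIntegral_eq_zero_iff_of_nonneg_ae
    (Eventually.of_forall fun x => dotProduct_self_nonneg' _) (integrableOn_hull_volume T hc)] at h
  have h1 : ∀ x ∈ interior (hull T), evV u x ⬝ᵥ evV u x = 0 := by
    have h2 : (fun x => evV u x ⬝ᵥ evV u x) =ᵐ[volume.restrict (interior (hull T))] fun _ => 0 := by
      rw [Measure.restrict_congr_set (interior_hull_ae_eq T)]
      exact h
    exact Measure.eqOn_open_of_ae_eq h2 isOpen_interior hc.continuousOn continuousOn_const
  ext1 i
  refine eq_zero_of_ev_eq_zero isOpen_interior hT.interior_nonempty fun x hx => ?_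
  exact congrFun (dotProduct_self_eq_zero.1 (h1 x hx)) i

/-- The gradient as a linear map. -/
def gradPₗ : SPoly →ₗ[ℝ] VPoly where
  toFun := gradP
  map_add' p q := gradP_add p q
  map_smul' c p := gradP_smul p c

theorem gradP_mem_nedelec {k : ℕ} (hk : 1 ≤ k) {ψ : SPoly} (hψ : ψ ∈ PolyDeg k) :
    gradP ψ ∈ Nedelec k := mem_nedelec_of_polyDeg hk (gradP_mem_polyDeg hψ)

namespace TetMesh

variable {Ω : Set E} {M : TetMesh Ω}

theorem Hh_mem_polyDeg {k : ℕ} {uh : M.Elem → VPoly} (huh : ∀ T, uh T ∈ Nedelec k)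
    (μT : M.Elem → ℝ) (T : M.Elem) (i : Fin 3) : Hh μT uh T i ∈ PolyDeg (k - 1) :=
  Submodule.smul_mem _ _ (curlP_nedelec_mem_polyDeg (huh T) i)

/-- The data are divergence-free of degree k' − 1, hence the curl of a Nédélec field w, and
subtracting from w its projection onto the gradients keeps the curl. Two solutions differ by a
gradient of a polynomial in P_{k'} that is orthogonal to all such gradients, itself included. -/
theorem existsUnique_elementSolution {k' : ℕ} (hk' : 1 ≤ k') {j H : M.Elem → VPoly} {T : M.Elem}
    (hj : j T ∈ RaviartThomas k') (hdiv : divP (j T) = 0) (hH : ∀ i, H T i ∈ PolyDeg (k' - 1)) :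
    ∃! G : VPoly, IsElementSolution k' j H T G := by
  have hcurl : ∀ i, curlP (H T) i ∈ PolyDeg (k' - 1) := fun i =>
    polyDeg_mono (by omega) (curlP_mem_polyDeg hH i)
  obtain ⟨w, hw, hwc⟩ := exists_curlP_eq hk' (u := j T - curlP (H T))
    (fun i => sub_mem (raviartThomas_mem_polyDeg hk' hj hdiv i) (hcurl i))
    (by rw [divP_sub, hdiv, divP_curlP, sub_zero])
  obtain ⟨s, hs, hproj⟩ := exists_projection (ipB T.1) (ipB_symm T.1) (ipB_self_nonneg T.1)
    ((PolyDeg k').map gradPₗ) w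
  obtain ⟨ψ, hψ, rfl⟩ := hs
  refine ⟨w - gradP ψ, ⟨nedelec_sub hw (gradP_mem_nedelec hk' hψ), ?_, fun χ hχ => ?_⟩, ?_⟩
  · rw [curlP_sub, curlP_gradP, sub_zero, hwc]
  · have h := hproj (gradP χ) ⟨χ, hχ, rfl⟩
    change ipB T.1 (w - gradP ψ) (gradP χ) = 0
    rw [map_sub, LinearMap.sub_apply, ← h]
    exact sub_self _
  · rintro G ⟨hG, hGc, hGo⟩
    have hd : G - (w - gradP ψ) ∈ Nedelec k' :=
      nedelec_sub hG (nedelec_sub hw (gradP_mem_nedelec hk' hψ))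
    obtain ⟨χ, hχ, e⟩ := exists_eq_gradP hk' hd (by
      rw [curlP_sub, curlP_sub, curlP_gradP, sub_zero, hwc, hGc, sub_self])
    have h1 : ipB T.1 G (gradP χ) = 0 := hGo χ hχ
    have h2 : ipB T.1 (gradP ψ) (gradP χ) = ipB T.1 w (gradP χ) := hproj (gradP χ) ⟨χ, hχ, rfl⟩
    have h3 : ipB T.1 (G - (w - gradP ψ)) (gradP χ) = 0 := by
      rw [map_sub, map_sub, LinearMap.sub_apply, LinearMap.sub_apply, h1, h2, sub_self, sub_zero]
    rw [← e] at h3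
    exact sub_eq_zero.1 ((isTet T).eq_zero_of_ipB_self h3)

end TetMesh

/-! ## Normals -/

theorem IsTet.glam_ne_zero {T : Finset E} (hT : IsTet T) {w : E} (hw : w ∈ T) : glam T w ≠ 0 := by
  intro h
  obtain ⟨a, ha⟩ := hT.erase_nonempty hw
  have h1 := hT.glam_dot_sub_self (Finset.mem_of_mem_erase ha) hw (Finset.ne_of_mem_erase ha)
  rw [h, zero_dotProduct] at h1
  exact zero_ne_one h1

theorem dotProduct_self_pos' {v : V} (hv : v ≠ 0) : 0 < v ⬝ᵥ v :=
  lt_of_le_of_ne (dotProduct_self_nonneg' v) fun h => hv (dotProduct_self_eq_zero.1 h.symm)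

/-- The affine function n·(x − a) vanishes at the vertices of f, so it is a multiple of the
barycentric coordinate opposite to f, and comparing gradients identifies n. The factor is negative
because that coordinate increases inwards. -/
theorem IsTet.isOutwardNormal_iff {T f : Finset E} (hT : IsTet T) (hf : f ⊆ T) (hc : f.card = 3)
    {n : V} : IsOutwardNormal T f n ↔ n ⬝ᵥ n = 1 ∧ ∃ t : ℝ, 0 < t ∧ n = -t • glam T (opp T f) := by
  obtain ⟨hw, hwf, he⟩ := hT.opp_spec hf hc
  constructor
  · rintro ⟨h1, h2, h3⟩
    obtain ⟨a, ha⟩ : f.Nonempty := Finset.card_pos.1 (by omega)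
    refine ⟨h1, -(n ⬝ᵥ fun i => opp T f i - a i), neg_pos.2 (h3 a ha _ hw hwf), ?_⟩
    have hev : ∀ x : E, ev (affPoly (-(n ⬝ᵥ fun i => a i)) n) x = n ⬝ᵥ fun i => x i - a i := by
      intro x
      rw [ev_affPoly]
      simp only [dotProduct, mul_sub, Finset.sum_sub_distrib]; ring
    have key := hT.ev_eq_mul_lam hw (affPoly_mem_polyDeg (-(n ⬝ᵥ fun i => a i)) n)
      (fun b hb => by rw [he] at hb; rw [hev]; exact h2 b hb a ha)
    have hpoly : affPoly (-(n ⬝ᵥ fun i => a i)) n =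
        (n ⬝ᵥ fun i => opp T f i - a i) • lam T (opp T f) :=
      ev_injective fun x => by rw [key x, hev]; simp
    have hg := congrArg (fun p => evV (gradP p) 0) hpoly
    simp only [gradP_affPoly, gradP_smul, evV_smul] at hg
    rw [neg_neg]
    ext i
    have := congrFun hg i
    simpa [evV, glam] using this
  · rintro ⟨h1, t, ht, rfl⟩
    refine ⟨h1, fun a ha b hb => ?_, fun a ha b hb hbf => ?_⟩
    · have := hT.glam_dot_sub (hf hb) (hf ha) (ne_of_mem_of_not_mem hb hwf)
        (ne_of_mem_of_not_mem ha hwf)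
      rw [smul_dotProduct]
      exact smul_eq_zero_of_right _ this
    · have hbw : b = opp T f := by
        by_contra hne
        exact hbf (he ▸ Finset.mem_erase.2 ⟨hne, hb⟩)
      subst hbw
      have := hT.glam_dot_sub_self (hf ha) hw (ne_of_mem_of_not_mem ha hwf)
      have h4 : glam T (opp T f) ⬝ᵥ (fun i => opp T f i - a i) = 1 := this
      rw [smul_dotProduct, h4]
      simpa using ht

theorem IsTet.outwardNormal_spec {T f : Finset E} (hT : IsTet T) (hf : f ⊆ T) (hc : f.card = 3) :
    outwardNormal T f ⬝ᵥ outwardNormal T f = 1 ∧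
      ∃ t : ℝ, 0 < t ∧ outwardNormal T f = -t • glam T (opp T f) := by
  rw [← hT.isOutwardNormal_iff hf hc]
  refine Classical.epsilon_spec (p := IsOutwardNormal T f) ?_
  have hpos := dotProduct_self_pos' (hT.glam_ne_zero (hT.opp_spec hf hc).1)
  refine ⟨-(√(glam T (opp T f) ⬝ᵥ glam T (opp T f)))⁻¹ • glam T (opp T f),
    (hT.isOutwardNormal_iff hf hc).2 ⟨?_, _, inv_pos.2 (Real.sqrt_pos.2 hpos), rfl⟩⟩
  rw [smul_dotProduct, dotProduct_smul, smul_smul, neg_mul_neg, ← mul_inv,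
    Real.mul_self_sqrt hpos.le, smul_eq_mul, inv_mul_cancel₀ hpos.ne']

/-- Both sides say that a is parallel to n. Pairing with tangential vectors is insensitive to the
length and sign of the normal, and later face identities are used in that form. -/
theorem cross_eq_zero_iff {n a : V} (hn : n ⬝ᵥ n = 1) : n ⨯₃ a = 0 ↔ ∀ τ, n ⬝ᵥ τ = 0 → a ⬝ᵥ τ = 0 := by
  constructor
  · intro h τ hτ
    have h1 : ∀ i, (n ⨯₃ a) i = 0 := fun i => congrFun h i
    have h10 := h1 0
    have h11 := h1 1
    have h12 := h1 2
    simp only [cross_apply, Matrix.cons_val, dotProduct, Fin.sum_univ_three] at *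
    linear_combination (n 0 * τ 1 - n 1 * τ 0) * h12 + (n 1 * τ 2 - n 2 * τ 1) * h10 +
      (n 2 * τ 0 - n 0 * τ 2) * h11 + (a 0 * n 0 + a 1 * n 1 + a 2 * n 2) * hτ -
      (a 0 * τ 0 + a 1 * τ 1 + a 2 * τ 2) * hn
  · intro h
    have h1 : ∀ b : V, (n ⨯₃ a) ⬝ᵥ b = 0 := by
      intro b
      have := h (b ⨯₃ n) (by rw [dotProduct_comm]; simp [cross_apply, dotProduct, Fin.sum_univ_three]; ring)
      rw [← this]
      simp [cross_apply, dotProduct, Fin.sum_univ_three]; ring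
    exact dotProduct_self_eq_zero.1 (h1 _)

namespace TetMesh

variable {Ω : Set E} {M : TetMesh Ω}

/-- Both normals are negative multiples of area normals that are opposite to each other, so they are
opposite up to a positive factor, and the unit length makes that factor one. -/
theorem outwardNormal_minus (o : M.FaceOrientation) (f : M.IntFace) :
    outwardNormal (o.minus f).1 f.1 = -outwardNormal (o.plus f).1 f.1 := by
  obtain ⟨h1, t, ht, e⟩ := (isTet (o.plus f)).outwardNormal_spec (o.subset_plus f) f.2.2.1
  obtain ⟨h2, s, hs, e'⟩ := (isTet (o.minus f)).outwardNormal_spec (o.subset_minus f) f.2.2.1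
  have h3 := areaNormal_eq_neg (o.ne f) (o.subset_plus f) (o.subset_minus f) f.2.2.1
  have hv := volume_hull_pos (isTet (o.plus f)).indep (isTet (o.plus f)).card
  have hv' := volume_hull_pos (isTet (o.minus f)).indep (isTet (o.minus f)).card
  rw [areaNormal, areaNormal] at h3
  set v := volume.real (hull (o.plus f).1)
  set v' := volume.real (hull (o.minus f).1)
  have h4 : outwardNormal (o.minus f).1 f.1 =
      -(s * v * t⁻¹ * v'⁻¹) • outwardNormal (o.plus f).1 f.1 := by
    have : glam (o.minus f).1 (opp (o.minus f).1 f.1) =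
        -(v'⁻¹ * v) • glam (o.plus f).1 (opp (o.plus f).1 f.1) := by
      rw [neg_smul, mul_smul, h3, smul_neg, neg_neg, smul_smul, inv_mul_cancel₀ hv'.ne', one_smul]
    rw [e, e', this, smul_smul, smul_smul]
    congr 1
    field_simp
  have hc : 0 < s * v * t⁻¹ * v'⁻¹ := by positivity
  set c := s * v * t⁻¹ * v'⁻¹
  rw [h4, smul_dotProduct, dotProduct_smul, h1, smul_eq_mul, smul_eq_mul, mul_one, neg_mul_neg] at h2
  have : c = 1 := by nlinarith
  rw [h4, this, neg_smul, one_smul]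

theorem exists_outwardNormal_eq_smul (o : M.FaceOrientation) (f : M.IntFace) :
    ∃ t : ℝ, t ≠ 0 ∧ outwardNormal (o.plus f).1 f.1 = t • faceNormal o f := by
  obtain ⟨h1, t, ht, e⟩ := (isTet (o.plus f)).outwardNormal_spec (o.subset_plus f) f.2.2.1
  have hv := volume_hull_pos (isTet (o.plus f)).indep (isTet (o.plus f)).card
  refine ⟨-t * (volume.real (hull (o.plus f).1))⁻¹,
    mul_ne_zero (neg_ne_zero.2 ht.ne') (inv_ne_zero hv.ne'), ?_⟩
  rw [e, faceNormal, areaNormal, smul_smul, mul_assoc, inv_mul_cancel₀ hv.ne', mul_one]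

theorem outwardNormal_dot_eq_zero_iff (o : M.FaceOrientation) (f : M.IntFace) (τ : V) :
    outwardNormal (o.plus f).1 f.1 ⬝ᵥ τ = 0 ↔ faceNormal o f ⬝ᵥ τ = 0 := by
  obtain ⟨t, ht, e⟩ := exists_outwardNormal_eq_smul o f
  rw [e, smul_dotProduct, smul_eq_mul, mul_eq_zero]
  exact or_iff_right ht

theorem faceNormal_dot_sub (o : M.FaceOrientation) {f : M.IntFace} {x y : E} (hx : x ∈ hull f.1)
    (hy : y ∈ hull f.1) : faceNormal o f ⬝ᵥ (y - x).ofLp = 0 := by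
  obtain ⟨hw, hwf, -⟩ := (isTet (o.plus f)).opp_spec (o.subset_plus f) f.2.2.1
  rw [faceNormal, areaNormal, smul_dotProduct, ← (isTet _).lam_sub,
    lam_eq_zero_of_mem_face (isTet _) (o.subset_plus f) hw hwf hx,
    lam_eq_zero_of_mem_face (isTet _) (o.subset_plus f) hw hwf hy]
  simp

/-! ## Face problems -/

/-- The face equation says that `∇p + G⁺ - G⁻` is normal to the face. -/
theorem face_equation_iff (o : M.FaceOrientation) (G : M.Elem → VPoly) (f : M.IntFace) (p : SPoly)
    (x : E) :
    -(outwardNormal (o.plus f).1 f.1 ⨯₃ faceGrad (outwardNormal (o.plus f).1 f.1) p x) =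
        tangentialJump o G f x ↔
      ∀ τ, faceNormal o f ⬝ᵥ τ = 0 →
        (evV (gradP p) x + (evV (G (o.plus f)) x - evV (G (o.minus f)) x)) ⬝ᵥ τ = 0 := by
  have hn := ((isTet (o.plus f)).outwardNormal_spec (o.subset_plus f) f.2.2.1).1
  simp only [← outwardNormal_dot_eq_zero_iff]
  rw [← cross_eq_zero_iff hn, tangentialJump, outwardNormal_minus, faceGrad, neg_eq_iff_add_eq_zero]
  refine Eq.congr ?_ rfl
  simp only [map_sub, map_smul, cross_self, smul_zero, sub_zero, map_neg, LinearMap.neg_apply,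
    map_add]
  abel

end TetMesh

/-- A polynomial is constant along a segment on which its tangential derivative vanishes. -/
theorem ev_eq_of_gradP_dot_eq_zero {p : SPoly} {x y : E}
    (h : ∀ z ∈ segment ℝ x y, evV (gradP p) z ⬝ᵥ (y - x).ofLp = 0) : ev p x = ev p y := by
  have hd : ∀ t : ℝ, HasDerivAt (fun t : ℝ => ev p (x + t • (y - x)))
      (evV (gradP p) (x + t • (y - x)) ⬝ᵥ (y - x).ofLp) t := by
    intro t
    have h1 : HasDerivAt (fun t : ℝ => x + t • (y - x)) (y - x) t := by
      simpa using ((hasDerivAt_id t).smul_const (y - x)).const_add x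
    have h2 := ((hasFDerivAt_ev p (x + t • (y - x))).differentiableAt.hasFDerivAt).comp_hasDerivAt t h1
    rw [fderiv_ev] at h2
    exact h2
  have h2 := constant_of_has_deriv_right_zero (a := (0 : ℝ)) (b := 1)
    (f := fun t : ℝ => ev p (x + t • (y - x)))
    (fun t _ => (hd t).continuousAt.continuousWithinAt) (fun t ht => by
      have h3 := hd t
      rw [h _ (by rw [segment_eq_image']; exact ⟨t, ⟨ht.1, ht.2.le⟩, rfl⟩)] at h3
      exact h3.hasDerivWithinAt) 1 (by simp)
  simpa using h2.symm

theorem shiftP_nedelec {k : ℕ} (hk : 1 ≤ k) (a : E) {u : VPoly} (hu : u ∈ Nedelec k) :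
    (fun i => shiftP a (u i)) ∈ Nedelec k := by
  obtain ⟨-, v, w, hv, hw, rfl⟩ := hu
  have key : (fun i => shiftP a ((v + idP ⨯₃ w) i)) =
      (fun i => shiftP a (v i) + ((fun i => MvPolynomial.C (a i)) ⨯₃ fun i => shiftP a (w i)) i) +
        idP ⨯₃ fun i => shiftP a (w i) := by
    ext1 i
    refine ev_injective fun x => ?_
    fin_cases i <;> simp [ev_shiftP, cross_apply, idP] <;> ring
  rw [key]
  refine mem_nedelec hk (fun i => add_mem (shiftP_mem_polyDeg a (hv i)) ?_)
    fun i => shiftP_mem_polyDeg a (hw i)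
  have h : ∀ i j, MvPolynomial.C (a i) * shiftP a (w j) ∈ PolyDeg (k - 1) := fun i j => by
    rw [MvPolynomial.C_mul']
    exact Submodule.smul_mem _ _ (shiftP_mem_polyDeg a (hw j))
  rw [cross_apply]
  fin_cases i <;> exact sub_mem (h _ _) (h _ _)

/-- A field whose curl is tangential on a convex planar set has a tangential potential there. -/
theorem exists_tangential_potential {k : ℕ} (hk : 1 ≤ k) {u : VPoly} (hu : u ∈ Nedelec k) {s : Set E}
    (hs : Convex ℝ s) {a : E} (ha : a ∈ s) {n : V} (hn0 : n ≠ 0) (hn : ∀ x ∈ s, n ⬝ᵥ (x - a).ofLp = 0)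
    (hc : ∀ x ∈ s, n ⬝ᵥ evV (curlP u) x = 0) :
    ∃ p ∈ PolyDeg k, ∀ x ∈ s, ∀ τ, n ⬝ᵥ τ = 0 → (evV (gradP p) x - evV u x) ⬝ᵥ τ = 0 := by
  -- The radial potential is centred at the origin, so the field is shifted to bring a there. Then
  -- all rays from the origin to points of the shifted set stay in that set.
  set us : VPoly := fun i => shiftP a (u i) with hus
  refine ⟨shiftP (-a) (radialPot us),
    shiftP_mem_polyDeg _ (radialPot_mem_polyDeg hk (shiftP_nedelec hk a hu)), fun x hx τ hτ => ?_⟩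
  have hcurl : ∀ y i, ev (curlP us i) y = ev (curlP u i) (y + a) := by
    intro y i
    fin_cases i <;> simp [curlP, hus, pderiv_shiftP, ev_shiftP]
  have h1 : ∀ i, evV (gradP (shiftP (-a) (radialPot us))) x i - evV u x i =
      ev (degScale 1 ((idP ⨯₃ curlP us) i)) (x - a) := by
    intro i
    simp only [evV, gradP, pderiv_shiftP, ev_shiftP]
    have := congrArg (fun p => ev p (x + -a)) (gradP_radialPot us i)
    simp only [gradP, ev_add] at this
    rw [this, hus]
    simp [ev_shiftP, sub_eq_add_neg]
  -- The defect of the homotopy formula, paired with τ, is the mean along the segment from a to x of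
  -- (x − a) × ∇×u paired with τ. Both factors of the cross product are tangential, so it is normal
  -- and the pairing vanishes.
  have h2 : (evV (gradP (shiftP (-a) (radialPot us))) x - evV u x) ⬝ᵥ τ =
      ev (degScale 1 (∑ i, τ i • (idP ⨯₃ curlP us) i)) (x - a) := by
    rw [map_sum, ev_sum]
    refine Finset.sum_congr rfl fun i _ => ?_
    rw [Pi.sub_apply, h1 i, map_smul]
    simp [mul_comm]
  rw [h2, ev_degScale_one]
  rw [intervalIntegral.integral_congr (g := fun _ => (0 : ℝ)), intervalIntegral.integral_zero]
  intro t ht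
  rw [Set.uIcc_of_le zero_le_one] at ht
  have hmem : t • (x - a) + a ∈ s := by
    have := hs ha hx (by linarith [ht.2] : 0 ≤ 1 - t) ht.1 (by ring)
    convert this using 1
    module
  have hc1 := hc _ hmem
  have hn1 := hn x hx
  have hc2 : n ⬝ᵥ (fun i => ev (curlP us i) (t • (x - a))) = 0 := by
    simp only [hcurl]
    exact hc1
  -- Three vectors orthogonal to n have triple product zero. Algebraically, each component of n
  -- times the triple product is a combination of the three orthogonality relations, and one
  -- component is nonzero.
  obtain ⟨i, hi⟩ := Function.ne_iff.1 hn0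
  refine (mul_eq_zero.1 (?_ : n i * _ = 0)).resolve_left hi
  generalize hy : x - a = y at *
  simp only [dotProduct, Fin.sum_univ_three] at hc2 hn1 hτ
  simp only [ev_add, ev_smul, Fin.sum_univ_three, cross_apply, Matrix.cons_val, ev_sub, ev_mul, idP,
    ev_X, PiLp.smul_apply, smul_eq_mul]
  generalize ev (curlP us 0) (t • y) = c0 at *
  generalize ev (curlP us 1) (t • y) = c1 at *
  generalize ev (curlP us 2) (t • y) = c2 at *
  fin_cases i
  · simp only [Fin.zero_eta]
    linear_combination t * (c1 * τ 2 - c2 * τ 1) * hn1 + t * (τ 1 * y 2 - τ 2 * y 1) * hc2 +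
      t * (y 1 * c2 - y 2 * c1) * hτ
  · simp only [Fin.mk_one]
    linear_combination t * (c2 * τ 0 - c0 * τ 2) * hn1 + t * (τ 2 * y 0 - τ 0 * y 2) * hc2 +
      t * (y 2 * c0 - y 0 * c2) * hτ
  · simp only [Fin.reduceFinMk]
    linear_combination t * (c0 * τ 1 - c1 * τ 0) * hn1 + t * (τ 0 * y 1 - τ 1 * y 0) * hc2 +
      t * (y 0 * c1 - y 1 * c0) * hτ

namespace TetMesh

variable {Ω : Set E} {M : TetMesh Ω}

theorem faceNormal_ne_zero (o : M.FaceOrientation) (f : M.IntFace) : faceNormal o f ≠ 0 :=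
  smul_ne_zero (volume_hull_pos (isTet (o.plus f)).indep (isTet (o.plus f)).card).ne'
    ((isTet (o.plus f)).glam_ne_zero
      ((isTet (o.plus f)).opp_spec (o.subset_plus f) f.2.2.1).1)

theorem avg_eq_zero_iff_integral (f : M.IntFace) (h : E → ℝ) :
    avg f.1 h = 0 ↔ ∫ x in hull f.1, h x ∂μHE[2] = 0 := by
  have := avg_eq_zero_iff (face_indep f) (face_nonempty f) h
  rwa [f.2.2.1] at this

/-- The condition on the curls says that the tangential jump is curl-free in the plane of the face.
Its radial potential has degree k' because the jump is a Nédélec field. Two potentials differ by a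
constant along each segment to a fixed vertex, and the mean value fixes that constant. -/
theorem existsUnique_faceSolution {k' : ℕ} (hk' : 1 ≤ k') (o : M.FaceOrientation)
    {G : M.Elem → VPoly} (hG : ∀ T, G T ∈ Nedelec k') (f : M.IntFace)
    (hcurl : ∀ x ∈ hull f.1,
      faceNormal o f ⬝ᵥ (evV (curlP (G (o.plus f))) x - evV (curlP (G (o.minus f))) x) = 0) :
    ∃! lam : hull f.1 → ℝ, IsFaceSolution k' o G f lam := by
  obtain ⟨a, ha⟩ := face_nonempty f
  have ha' : a ∈ hull f.1 := subset_convexHull ℝ _ ha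
  obtain ⟨p, hp, hpt⟩ := exists_tangential_potential hk' (nedelec_sub (hG (o.minus f)) (hG (o.plus f)))
    (convex_convexHull ℝ (f.1 : Set E)) ha' (faceNormal_ne_zero o f)
    (fun x hx => faceNormal_dot_sub o ha' hx) (fun x hx => by
      have := hcurl x hx
      rw [← neg_sub, dotProduct_neg, neg_eq_zero] at this
      rwa [curlP_sub, evV_sub])
  have hgrad : ∀ c, gradP (p - MvPolynomial.C c) = gradP p := fun c => by
    rw [gradP_sub, sub_eq_self]
    ext1 i
    simp [gradP]
  refine ⟨fun x => ev (p - MvPolynomial.C (avg f.1 (ev p))) x,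
    ⟨p - MvPolynomial.C (avg f.1 (ev p)), sub_mem hp (C_mem_polyDeg _ _), fun _ => rfl,
      fun x hx => ?_, ?_⟩, ?_⟩
  · rw [face_equation_iff]
    intro τ hτ
    rw [hgrad, ← hpt x hx τ hτ, evV_sub]
    congr 1
    abel
  · rw [← avg_eq_zero_iff_integral]
    change avg f.1 (fun x => ev (p - MvPolynomial.C (avg f.1 (ev p))) x) = 0
    simp only [ev_sub, ev_C]
    rw [avg_sub (face_indep f) (face_nonempty f) (continuous_ev p).continuousOn
      continuousOn_const, avg_const (face_indep f) (face_nonempty f)]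
    exact sub_self _
  · rintro l ⟨q, hq, hlq, hqe, hqi⟩
    have hconst : ∀ x ∈ hull f.1, ev (q - p) x = ev (q - p) a := by
      intro x hx
      refine ev_eq_of_gradP_dot_eq_zero fun z hz => ?_
      have hzf : z ∈ hull f.1 := (convex_convexHull ℝ _).segment_subset hx ha' hz
      have hτ := faceNormal_dot_sub o hx ha'
      have h1 := (face_equation_iff o G f q z).1 (hqe z hzf) _ hτ
      have h2 := hpt z hzf _ hτ
      rw [gradP_sub, evV_sub, sub_dotProduct]
      rw [evV_sub, sub_dotProduct, sub_dotProduct] at h2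
      rw [add_dotProduct, sub_dotProduct] at h1
      linarith
    rw [← avg_eq_zero_iff_integral] at hqi
    have h3 : avg f.1 (ev q) - avg f.1 (ev p) = ev (q - p) a := by
      rw [← avg_sub (face_indep f) (face_nonempty f) (continuous_ev q).continuousOn
        (continuous_ev p).continuousOn, ← avg_const (face_indep f) (face_nonempty f) (ev (q - p) a)]
      exact avg_congr fun x hx => by rw [← hconst x hx, ev_sub]
    ext x
    have h4 := hconst x x.2
    rw [hlq x]
    simp only [ev_sub, ev_C] at h3 h4 ⊢
    linarith

end TetMesh

/-! ## Mollification -/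

/-- The convolution of the measure with density `c` with respect to `ν` and the function `g`. -/
def conv (ν : Measure E) (c g : E → ℝ) (y : E) : ℝ := ∫ z, c z * g (y - z) ∂ν

theorem integrable_conv {ν : Measure E} {c g : E → ℝ} (hc : Integrable c ν) (hg : Continuous g)
    (hcs : HasCompactSupport g) (y : E) : Integrable (fun z => c z * g (y - z)) ν := by
  obtain ⟨C, hC⟩ := hg.bounded_above_of_compact_support hcs
  exact hc.mul_bdd (c := C) (hg.comp (continuous_const.sub continuous_id)).aestronglyMeasurable
    (Eventually.of_forall fun z => hC _)

/-- The measure is left arbitrary because two cases occur: volume on an element, for mollified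
piecewise polynomials, and surface measure on a face, for mollified jumps. -/
theorem hasFDerivAt_conv {ν : Measure E} {c g : E → ℝ} (hc : Integrable c ν) (hg : ContDiff ℝ 1 g)
    (hcs : HasCompactSupport g) (y : E) :
    HasFDerivAt (conv ν c g) (∫ z, c z • fderiv ℝ g (y - z) ∂ν) y := by
  obtain ⟨C, hC⟩ := (hg.continuous_fderiv one_ne_zero).bounded_above_of_compact_support
    (hcs.fderiv ℝ)
  have hm : ∀ y, AEStronglyMeasurable (fun z => fderiv ℝ g (y - z)) ν := fun y =>
    ((hg.continuous_fderiv one_ne_zero).comp (by fun_prop)).aestronglyMeasurable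
  refine hasFDerivAt_integral_of_dominated_of_fderiv_le (𝕜 := ℝ)
    (F := fun y z => c z * g (y - z)) (F' := fun y z => c z • fderiv ℝ g (y - z))
    (bound := fun z => ‖c z‖ * C) (s := Set.univ) Filter.univ_mem ?_
    (integrable_conv hc hg.continuous hcs y) ?_ ?_ (hc.norm.mul_const C) ?_
  · exact Eventually.of_forall fun y => (integrable_conv hc hg.continuous hcs y).1
  · exact hc.1.smul (hm y)
  · refine Eventually.of_forall fun z y' _ => ?_
    rw [norm_smul]
    exact mul_le_mul_of_nonneg_left (hC _) (norm_nonneg _)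
  · refine Eventually.of_forall fun z y' _ => ?_
    have h1 := ((hg.differentiable one_ne_zero) (y' - z)).hasFDerivAt
    have h2 := h1.comp y' ((hasFDerivAt_id y').sub_const z)
    exact (h2.const_mul (c z)).congr_fderiv (by ext; simp)

theorem pd_conv {ν : Measure E} {c g : E → ℝ} (hc : Integrable c ν) (hg : ContDiff ℝ 1 g)
    (hcs : HasCompactSupport g) (i : Fin 3) (y : E) :
    pd i (conv ν c g) y = conv ν c (pd i g) y := by
  obtain ⟨C, hC⟩ := (hg.continuous_fderiv one_ne_zero).bounded_above_of_compact_support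
    (hcs.fderiv ℝ)
  have hInt : Integrable (fun z => c z • fderiv ℝ g (y - z)) ν :=
    hc.smul_bdd C ((hg.continuous_fderiv one_ne_zero).comp
      (by fun_prop)).aestronglyMeasurable (Eventually.of_forall fun z => hC _)
  rw [pd, (hasFDerivAt_conv hc hg hcs y).fderiv, ContinuousLinearMap.integral_apply hInt]
  rfl

theorem differentiable_conv {ν : Measure E} {c g : E → ℝ} (hc : Integrable c ν) (hg : ContDiff ℝ 1 g)
    (hcs : HasCompactSupport g) : Differentiable ℝ (conv ν c g) := fun y =>
  (hasFDerivAt_conv hc hg hcs y).differentiableAt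

theorem pd_comp_sub_left {g : E → ℝ} (hg : Differentiable ℝ g) (i : Fin 3) (y z : E) :
    pd i (fun z => g (y - z)) z = -pd i g (y - z) := by
  have h := (hg (y - z)).hasFDerivAt.comp z ((hasFDerivAt_id z).const_sub y)
  have h' : HasFDerivAt (fun z => g (y - z)) _ z := h
  rw [pd, h'.fderiv]
  simp [pd]

/-- A closed form on an open set that is star-shaped with respect to a point has a potential. -/
theorem exists_potential_of_starConvex {U : Set E} (hU : IsOpen U) {p : E} (hp : p ∈ U)
    (hstar : ∀ y ∈ U, segment ℝ p y ⊆ U) {θ : E → E →L[ℝ] ℝ} {dθ : E → E →L[ℝ] E →L[ℝ] ℝ}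
    (hθ : ∀ x ∈ U, HasFDerivAt θ (dθ x) x) (hsymm : ∀ x ∈ U, ∀ a b, dθ x a b = dθ x b a) :
    ∃ d : E → ℝ, ∀ y ∈ U, HasFDerivAt d (θ y) y := by
  refine ⟨fun b => curveIntegral θ (Path.segment p b), fun y hy => ?_⟩
  obtain ⟨ε, hε, hb⟩ := Metric.isOpen_iff.1 hU y hy
  have hsub : convexHull ℝ (insert p (Metric.ball y ε)) ⊆ U := by
    rw [convexHull_insert ⟨y, Metric.mem_ball_self hε⟩, (convex_ball y ε).convexHull_eq]
    intro z hz
    obtain ⟨a, ha, b, hb', hz⟩ := mem_convexJoin.1 hz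
    rw [Set.mem_singleton_iff.1 ha] at hz
    exact hstar b (hb hb') hz
  have hball : Metric.ball y ε ⊆ convexHull ℝ (insert p (Metric.ball y ε)) :=
    (Set.subset_insert _ _).trans (subset_convexHull ℝ _)
  have h := (convex_convexHull ℝ (insert p (Metric.ball y ε))
    ).hasFDerivWithinAt_curveIntegral_segment_of_hasFDerivWithinAt_symmetric
    (fun x hx => (hθ x (hsub hx)).hasFDerivWithinAt) (fun a ha x _ y _ => hsymm a (hsub ha) x y)
    (subset_convexHull ℝ _ (Set.mem_insert p _)) (hball (Metric.mem_ball_self hε))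
  exact h.hasFDerivAt (Filter.mem_of_superset (Metric.ball_mem_nhds y hε) hball)

/-- A function is constant along segments on which its derivative vanishes. -/
theorem eq_of_hasFDerivAt_zero {F : E → ℝ} {x y : E}
    (h : ∀ z ∈ segment ℝ x y, HasFDerivAt F (0 : E →L[ℝ] ℝ) z) : F x = F y := by
  have hd : ∀ t ∈ Set.Icc (0 : ℝ) 1, HasDerivAt (fun t : ℝ => F (x + t • (y - x))) 0 t := by
    intro t ht
    have h1 : HasDerivAt (fun t : ℝ => x + t • (y - x)) (y - x) t := by
      simpa using ((hasDerivAt_id t).smul_const (y - x)).const_add x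
    exact (h _ (by rw [segment_eq_image']; exact ⟨t, ht, rfl⟩)).comp_hasDerivAt t h1
  have h2 := constant_of_has_deriv_right_zero (a := (0 : ℝ)) (b := 1)
    (f := fun t : ℝ => F (x + t • (y - x)))
    (fun t ht => (hd t ht).continuousAt.continuousWithinAt)
    (fun t ht => (hd t ⟨ht.1, ht.2.le⟩).hasDerivWithinAt) 1 (by simp)
  simpa using h2.symm

/-- The properties of a smoothing kernel of radius `δ`. -/
structure IsKernel (δ : ℝ) (ρ : E → ℝ) : Prop where
  contDiff : ContDiff ℝ ∞ ρ
  hasCompactSupport : HasCompactSupport ρ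
  norm_lt : ∀ z, ρ z ≠ 0 → ‖z‖ < δ
  integral_eq : ∫ z, ρ z = 1
  nonneg : ∀ z, 0 ≤ ρ z

theorem exists_isKernel {δ : ℝ} (hδ : 0 < δ) : ∃ ρ, IsKernel δ ρ := by
  let f : ContDiffBump (0 : E) := ⟨δ / 2, δ, by positivity, by linarith⟩
  refine ⟨f.normed volume, f.contDiff_normed, f.hasCompactSupport_normed, fun z hz => ?_,
    f.integral_normed, fun z => f.nonneg_normed z⟩
  have : z ∈ Function.support (f.normed volume) := hz
  rw [f.support_normed_eq] at this
  simpa using this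

namespace IsKernel

variable {δ : ℝ} {ρ : E → ℝ}

theorem contDiff_one (h : IsKernel δ ρ) : ContDiff ℝ 1 ρ := h.contDiff.of_le (by exact_mod_cast le_top)

theorem eq_zero (h : IsKernel δ ρ) {y z : E} (hz : z ∉ Metric.closedBall y δ) : ρ (y - z) = 0 := by
  by_contra hne
  have := h.norm_lt _ hne
  rw [Metric.mem_closedBall, dist_comm, dist_eq_norm] at hz
  exact hz this.le

theorem contDiff_sub (h : IsKernel δ ρ) (y : E) : ContDiff ℝ 1 fun z => ρ (y - z) :=
  h.contDiff_one.comp (contDiff_const.sub contDiff_id)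

theorem setIntegral_eq_one (h : IsKernel δ ρ) {y : E} {s : Set E} (hs : Metric.closedBall y δ ⊆ s) :
    ∫ z in s, ρ (y - z) = 1 := by
  rw [setIntegral_eq_integral_of_forall_compl_eq_zero fun z hz => h.eq_zero fun h' => hz (hs h'),
    integral_sub_left_eq_self ρ volume y, h.integral_eq]

end IsKernel

namespace TetMesh

variable {Ω : Set E} {M : TetMesh Ω}

/-- The mollification of a piecewise polynomial function. -/
def moll (ρ : E → ℝ) (p : M.Elem → SPoly) (y : E) : ℝ :=
  ∑ T : M.Elem, conv (volume.restrict (hull T.1)) (ev (p T)) ρ y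

theorem differentiable_moll {δ : ℝ} {ρ : E → ℝ} (hρ : IsKernel δ ρ) (p : M.Elem → SPoly) :
    Differentiable ℝ (moll ρ p) :=
  Differentiable.fun_sum fun T _ => differentiable_conv
    (integrableOn_hull_volume T.1 (continuous_ev (p T))) hρ.contDiff_one hρ.hasCompactSupport

/-- The gradient of the mollification, in terms of the elementwise gradient and the jumps. -/
theorem pd_moll (hΩ : IsAdmissibleDomain Ω) (o : M.FaceOrientation) {δ : ℝ} {ρ : E → ℝ}
    (hρ : IsKernel δ ρ) (p : M.Elem → SPoly) {y : E} (hy : Metric.closedBall y δ ⊆ Ω) (i : Fin 3) :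
    pd i (moll ρ p) y = stokesConst 4 * ∑ f : M.IntFace, faceNormal o f i * avg f.1 (fun z =>
        (ev (p (o.plus f)) z - ev (p (o.minus f)) z) * ρ (y - z)) +
      moll ρ (fun T => MvPolynomial.pderiv i (p T)) y := by
  have hInt : ∀ T : M.Elem, Integrable (ev (p T)) (volume.restrict (hull T.1)) := fun T =>
    integrableOn_hull_volume T.1 (continuous_ev (p T))
  have h1 : pd i (moll ρ p) y =
      ∑ T : M.Elem, conv (volume.restrict (hull T.1)) (ev (p T)) (pd i ρ) y := by
    rw [pd]
    unfold moll
    rw [fderiv_fun_sum fun T _ => differentiable_conv (hInt T) hρ.contDiff_one hρ.hasCompactSupport y]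
    rw [ContinuousLinearMap.sum_apply]
    exact Finset.sum_congr rfl fun T _ => pd_conv (hInt T) hρ.contDiff_one hρ.hasCompactSupport i y
  have hdiff : Differentiable ℝ fun z => ρ (y - z) := (hρ.contDiff_sub y).differentiable one_ne_zero
  have hev : ∀ q : SPoly, Differentiable ℝ (ev q) := fun q =>
    (contDiff_ev q (n := 1)).differentiable (by simp)
  -- The kernel centred at y vanishes outside Ω by `hy`, so the divergence theorem applies to the
  -- i-th unit vector times p ρ(y − ·). It moves the derivative from the kernel to p at the cost of
  -- the face jumps.
  have h2 := sum_integral_div_of_eq_zero hΩ o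
    (Ψ := fun T z k => if k = i then ev (p T) z * ρ (y - z) else 0) (fun T k => by
      by_cases hk : k = i
      · simp only [hk, if_true]
        exact (contDiff_ev (p T) (n := 1)).mul (hρ.contDiff_sub y)
      · simp only [hk, if_false]
        exact contDiff_const) (fun T x hx => by
      ext k
      simp [hρ.eq_zero fun h => hx (hy h)])
  have h3 : ∀ T : M.Elem, ∀ z, ∑ k, pd k (fun z => if k = i then ev (p T) z * ρ (y - z) else 0) z =
      ev (MvPolynomial.pderiv i (p T)) z * ρ (y - z) - ev (p T) z * pd i ρ (y - z) := by
    intro T z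
    rw [Finset.sum_eq_single i]
    · simp only [if_true]
      rw [pd_mul (hev _) hdiff, pd_ev, pd_comp_sub_left (hρ.contDiff_one.differentiable one_ne_zero)]
      ring
    · intro k _ hk
      simp [hk, pd]
    · exact fun h => absurd (Finset.mem_univ i) h
  simp only [h3] at h2
  have h4 : ∀ T : M.Elem, ∫ z in hull T.1,
      (ev (MvPolynomial.pderiv i (p T)) z * ρ (y - z) - ev (p T) z * pd i ρ (y - z)) =
      conv (volume.restrict (hull T.1)) (ev (MvPolynomial.pderiv i (p T))) ρ y -
        conv (volume.restrict (hull T.1)) (ev (p T)) (pd i ρ) y := fun T =>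
    integral_sub
      (integrableOn_hull_volume _ ((continuous_ev _).mul (hρ.contDiff_sub y).continuous))
      (integrableOn_hull_volume _ ((continuous_ev _).mul
        ((continuous_pd hρ.contDiff_one i).comp (by fun_prop))))
  simp only [h4, Finset.sum_sub_distrib] at h2
  rw [h1]
  have h5 : ∑ f : M.IntFace, avg f.1 (fun x => faceNormal o f ⬝ᵥ
      ((fun k => if k = i then ev (p (o.plus f)) x * ρ (y - x) else 0) -
        fun k => if k = i then ev (p (o.minus f)) x * ρ (y - x) else 0)) =
      ∑ f : M.IntFace, faceNormal o f i * avg f.1 (fun z =>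
        (ev (p (o.plus f)) z - ev (p (o.minus f)) z) * ρ (y - z)) := by
    refine Finset.sum_congr rfl fun f _ => ?_
    rw [← avg_const_mul]
    refine avg_congr fun x _ => ?_
    rw [dotProduct, Finset.sum_eq_single i]
    · simp only [Pi.sub_apply, if_true]; ring
    · intro k _ hk
      simp [hk]
    · exact fun h => absurd (Finset.mem_univ i) h
  rw [h5] at h2
  unfold moll
  linarith

end TetMesh

/-! ## The mesh near a point -/

theorem fderiv_eq_sum_pd (F : E → ℝ) (x τ : E) : fderiv ℝ F x τ = ∑ i, τ i * pd i F x := by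
  have : τ = ∑ i, τ i • (EuclideanSpace.single i (1 : ℝ) : E) := by
    ext j
    simp [Pi.single_apply]
  conv_lhs => rw [this, map_sum]
  simp [pd]

theorem hasFDerivAt_zero_of_pd {F : E → ℝ} {x : E} (hF : DifferentiableAt ℝ F x)
    (h : ∀ i, pd i F x = 0) : HasFDerivAt F (0 : E →L[ℝ] ℝ) x := by
  refine hF.hasFDerivAt.congr_fderiv ?_
  ext τ
  rw [fderiv_eq_sum_pd]
  simp [h]

theorem isOpen_closedBall_subset {D : Set E} (hD : IsOpen D) {δ : ℝ} :
    IsOpen {y | Metric.closedBall y δ ⊆ D} := by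
  rw [Metric.isOpen_iff]
  intro y hy
  obtain ⟨ε, hε, h⟩ := (isCompact_closedBall y δ).exists_thickening_subset_open hD hy
  refine ⟨ε, hε, fun y' hy' z hz => h ?_⟩
  rw [Metric.mem_thickening_iff]
  refine ⟨z - y' + y, ?_, ?_⟩
  · rw [Metric.mem_closedBall, dist_eq_norm] at hz ⊢
    simpa using hz
  · rw [Metric.mem_ball, dist_eq_norm] at hy'
    rw [dist_eq_norm]
    convert hy' using 2
    abel

theorem eventually_closedBall_subset {D : Set E} (hD : IsOpen D) {K : Set E} (hK : IsCompact K)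
    (h : K ⊆ D) : ∀ᶠ δ in 𝓝[>] (0 : ℝ), ∀ y ∈ K, Metric.closedBall y δ ⊆ D := by
  obtain ⟨ε, hε, h⟩ := hK.exists_cthickening_subset_open hD h
  filter_upwards [Ioc_mem_nhdsGT hε] with δ hδ y hy
  exact (Metric.closedBall_subset_closedBall hδ.2).trans
    ((Metric.closedBall_subset_cthickening hy ε).trans h)

namespace TetMesh

variable {Ω : Set E} {M : TetMesh Ω}

theorem exists_ball_mem_hull_face (M : TetMesh Ω) (x : E) :
    ∃ r > 0, ∀ s ∈ M.faces, ∀ y ∈ Metric.ball x r, y ∈ hull s → x ∈ hull s := by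
  have h : ∀ s ∈ M.faces, ∀ᶠ y in 𝓝 x, y ∈ hull s → x ∈ hull s := by
    intro s _
    by_cases hx : x ∈ hull s
    · exact Eventually.of_forall fun _ _ => hx
    · filter_upwards [(isClosed_hull s).isOpen_compl.mem_nhds hx] with y hy h
      exact absurd h hy
  obtain ⟨r, hr, hb⟩ := Metric.eventually_nhds_iff_ball.1 ((M.finite_faces.eventually_all).2 h)
  exact ⟨r, hr, fun s hs y hy => hb y hy s hs⟩

/-- A neighbourhood of `x` in the domain that meets only simplices containing `x` and is
star-shaped with respect to a small ball around `p`. -/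
structure IsLocalDomain (M : TetMesh Ω) (x : E) (D : Set E) (p : E) : Prop where
  isOpen : IsOpen D
  subset : D ⊆ Ω
  mem_hull : ∀ s ∈ M.faces, ∀ y ∈ D, y ∈ hull s → x ∈ hull s
  exists_ball : ∃ r > 0, ∀ y ∈ Ω, y ∈ Metric.ball x r → y ∈ D
  convex_inter : ∀ y ∈ D, ∀ z ∈ D, segment ℝ y z ⊆ Ω → segment ℝ y z ⊆ D
  star : ∀ᶠ δ in 𝓝[>] (0 : ℝ), Metric.closedBall p δ ⊆ D ∧ ∀ y, Metric.closedBall y δ ⊆ D →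
    ∀ z ∈ segment ℝ p y, Metric.closedBall z δ ⊆ D

theorem exists_isLocalDomain (hΩ : IsAdmissibleDomain Ω) (M : TetMesh Ω) {x : E}
    (hx : x ∈ closure Ω) : ∃ D p, IsLocalDomain M x D p := by
  obtain ⟨r₀, hr₀, hball⟩ := exists_ball_mem_hull_face M x
  obtain ⟨r, hr, hrr, P, hPo, ⟨p, hp⟩, hPs, hst⟩ := exists_star hΩ M hx hr₀
  refine ⟨Ω ∩ Metric.ball x r, p, hΩ.isOpen.inter Metric.isOpen_ball, Set.inter_subset_left,
    fun s hs y hy => hball s hs y (Metric.ball_subset_ball hrr hy.2),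
    ⟨r, hr, fun y h1 h2 => ⟨h1, h2⟩⟩, fun y hy z hz h => ?_, ?_⟩
  · exact fun a ha => ⟨h ha, (convex_ball x r).segment_subset hy.2 hz.2 ha⟩
  · filter_upwards [eventually_closedBall_subset hPo isCompact_singleton
      (Set.singleton_subset_iff.2 hp), self_mem_nhdsWithin] with δ hδ hδ0
    have hδ0 : (0 : ℝ) < δ := hδ0
    have hδ := hδ p rfl
    refine ⟨hδ.trans hPs, fun y hy z hz a ha => ?_⟩
    -- The ball around z is reached by translating the whole segment from p to y by a − z. Both
    -- translated ends remain admissible, and the domain is star-shaped with respect to every point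
    -- of P.
    have h1 : p + (a - z) ∈ P := hδ (by
      rw [Metric.mem_closedBall, dist_eq_norm] at ha ⊢
      simpa using ha)
    have h2 : y + (a - z) ∈ Ω ∩ Metric.ball x r := hy (by
      rw [Metric.mem_closedBall, dist_eq_norm] at ha ⊢
      simpa using ha)
    refine hst _ h1 _ h2 ?_
    obtain ⟨s, t, hs, ht, hst, rfl⟩ := hz
    refine ⟨s, t, hs, ht, hst, ?_⟩
    have : s = 1 - t := by linarith
    subst this
    module

variable {x p : E} {D : Set E}

theorem IsLocalDomain.exists_mem_interior (hΩ : IsAdmissibleDomain Ω) (h : IsLocalDomain M x D p)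
    {T : M.Elem} (hx : x ∈ hull T.1) : ∃ y, y ∈ D ∧ y ∈ interior (hull T.1) := by
  obtain ⟨r, hr, hb⟩ := h.exists_ball
  have h1 : x ∈ closure (interior (hull T.1)) := by
    rw [(convex_convexHull ℝ (T.1 : Set E)).closure_interior_eq_closure_of_nonempty_interior
      (isTet T).interior_nonempty]
    exact subset_closure hx
  obtain ⟨y, hy1, hy2⟩ := mem_closure_iff.1 h1 _ Metric.isOpen_ball (Metric.mem_ball_self hr)
  exact ⟨y, hb y (interior_hull_subset hΩ T hy2) hy1, hy2⟩

theorem IsLocalDomain.exists_mem_face (hΩ : IsAdmissibleDomain Ω) (h : IsLocalDomain M x D p)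
    (o : M.FaceOrientation) {f : M.IntFace} (hx : x ∈ hull f.1) :
    ∃ z, z ∈ D ∧ z ∈ hull f.1 ∧ ∀ g : M.IntFace, z ∈ hull g.1 → g = f := by
  obtain ⟨r, hr, hb⟩ := h.exists_ball
  obtain ⟨z, hz1, hz2, hz3⟩ := exists_relint_near (isTet (o.plus f)) (o.subset_plus f) f.2.2.1 hx
    (Metric.ball_mem_nhds x hr)
  have hz4 := mem_of_mem_nhds (faceNhd_mem_nhds hΩ o f hz2 hz3)
  exact ⟨z, hb z hz4.1 hz1, hz2, fun g hg => eq_of_mem_faceNhd o hz4 hg⟩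

theorem conv_eq_zero {ν : Measure E} {c g : E → ℝ} {y : E} (h : ∀ᵐ z ∂ν, g (y - z) = 0) :
    conv ν c g y = 0 := by
  rw [conv, ← integral_zero E ℝ (μ := ν)]
  exact integral_congr_ae (h.mono fun z hz => by dsimp only; rw [hz, mul_zero])

theorem moll_const {δ : ℝ} {ρ : E → ℝ} (hρ : IsKernel δ ρ) (e : M.Elem → ℝ) {y : E} {T : M.Elem}
    (hy : Metric.closedBall y δ ⊆ interior (hull T.1)) :
    moll ρ (fun T => MvPolynomial.C (e T)) y = e T := by
  rw [moll, Finset.sum_eq_single T]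
  · simp only [conv, ev_C]
    rw [integral_const_mul, hρ.setIntegral_eq_one (hy.trans interior_subset), mul_one]
  · intro T' _ hne
    refine conv_eq_zero ((ae_restrict_mem (measurableSet_hull _)).mono fun z hz => hρ.eq_zero ?_)
    exact fun h => hne (eq_of_mem_interior (hy h) hz).symm
  · exact fun h => absurd (Finset.mem_univ T) h

theorem moll_zero (ρ : E → ℝ) (y : E) : moll ρ (fun _ : M.Elem => 0) y = 0 := by
  simp [moll, conv]

/-- The distributional gradient of a piecewise constant function lives on the faces, with the jumps
times the normals as densities. This is the model for `jumpField`, where the jumps are prescribed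
without any underlying function. -/
theorem pd_moll_const (hΩ : IsAdmissibleDomain Ω) (o : M.FaceOrientation) {δ : ℝ} {ρ : E → ℝ}
    (hρ : IsKernel δ ρ) (e : M.Elem → ℝ) {y : E} (hy : Metric.closedBall y δ ⊆ Ω) (i : Fin 3) :
    pd i (moll ρ fun T : M.Elem => MvPolynomial.C (e T)) y =
      stokesConst 4 * ∑ f : M.IntFace, (e (o.plus f) - e (o.minus f)) *
        (faceNormal o f i * avg f.1 (fun z => ρ (y - z))) := by
  rw [pd_moll hΩ o hρ _ hy]
  simp only [MvPolynomial.pderiv_C, moll_zero, add_zero, ev_C, avg_const_mul]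
  congr 1
  exact Finset.sum_congr rfl fun f _ => by ring

theorem avg_kernel_eq_zero {δ : ℝ} {ρ : E → ℝ} (hρ : IsKernel δ ρ) {s : Finset E}
    (hs : AffineIndependent ℝ ((↑) : s → E)) (hne : s.Nonempty) {y : E}
    (h : ∀ z ∈ hull s, z ∉ Metric.closedBall y δ) : avg s (fun z => ρ (y - z)) = 0 := by
  rw [← avg_const hs hne 0]
  exact avg_congr fun z hz => hρ.eq_zero (h z hz)

/-- The elements at a point are connected through internal faces at this point. -/
theorem eq_of_forall_face_eq (hΩ : IsAdmissibleDomain Ω) (o : M.FaceOrientation)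
    (hx : x ∈ closure Ω) {e : M.Elem → ℝ}
    (he : ∀ f : M.IntFace, x ∈ hull f.1 → e (o.plus f) = e (o.minus f)) {T T' : M.Elem}
    (hT : x ∈ hull T.1) (hT' : x ∈ hull T'.1) : e T = e T' := by
  obtain ⟨D, p, hD⟩ := exists_isLocalDomain hΩ M hx
  obtain ⟨y, hyD, hyT⟩ := hD.exists_mem_interior hΩ hT
  obtain ⟨y', hyD', hyT'⟩ := hD.exists_mem_interior hΩ hT'
  obtain ⟨δ, ⟨hst, h1, h2⟩, hδ⟩ := (((hD.star).and ((eventually_closedBall_subset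
    (hD.isOpen.inter isOpen_interior) isCompact_singleton
      (Set.singleton_subset_iff.2 ⟨hyD, hyT⟩)).and (eventually_closedBall_subset
    (hD.isOpen.inter isOpen_interior) isCompact_singleton
      (Set.singleton_subset_iff.2 ⟨hyD', hyT'⟩)))).and self_mem_nhdsWithin).exists
  have h1 := h1 y rfl
  have h2 := h2 y' rfl
  obtain ⟨ρ, hρ⟩ := exists_isKernel (show (0 : ℝ) < δ from hδ)
  -- The mollification of e has zero gradient along the segment from p: faces through x carry no
  -- jump, and the other faces are out of reach of the kernel. So it has the same value at p and
  -- deep inside T and T'.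
  have key : ∀ y, Metric.closedBall y δ ⊆ D →
      moll ρ (fun T : M.Elem => MvPolynomial.C (e T)) p = moll ρ (fun T => MvPolynomial.C (e T)) y := by
    intro y hy
    refine eq_of_hasFDerivAt_zero fun z hz => hasFDerivAt_zero_of_pd (differentiable_moll hρ _ z)
      fun i => ?_
    have hzD := hst.2 y hy z hz
    rw [pd_moll_const hΩ o hρ e (hzD.trans hD.subset)]
    refine mul_eq_zero_of_right _ (Finset.sum_eq_zero fun f _ => ?_)
    by_cases hxf : x ∈ hull f.1
    · rw [he f hxf, sub_self, zero_mul]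
    · rw [avg_kernel_eq_zero hρ (face_indep f) (face_nonempty f), mul_zero, mul_zero]
      exact fun a ha ha' => hxf (hD.mem_hull f.1 f.2.1 a (hzD ha') ha)
  rw [← moll_const hρ e (h1.trans Set.inter_subset_right),
    ← moll_const hρ e (h2.trans Set.inter_subset_right),
    ← key y (h1.trans Set.inter_subset_left), ← key y' (h2.trans Set.inter_subset_left)]

/-! ## Potentials with prescribed jumps -/

theorem avg_kernel_eq_conv {s : Finset E} (ρ : E → ℝ) (y : E) :
    avg s (fun z => ρ (y - z)) = ((μHE[s.card - 1] : Measure E).real (hull s))⁻¹ *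
      conv ((μHE[s.card - 1] : Measure E).restrict (hull s)) (fun _ => 1) ρ y := by
  rw [avg_eq, conv]
  simp only [one_mul]

theorem differentiable_avg_kernel {δ : ℝ} {ρ : E → ℝ} (hρ : IsKernel δ ρ) {s : Finset E}
    (hs : AffineIndependent ℝ ((↑) : s → E)) (hne : s.Nonempty) :
    Differentiable ℝ fun y => avg s (fun z => ρ (y - z)) := by
  simp only [avg_kernel_eq_conv]
  exact (differentiable_conv (integrableOn_hull hs hne continuousOn_const) hρ.contDiff_one
    hρ.hasCompactSupport).const_mul _

theorem pd_avg_kernel {δ : ℝ} {ρ : E → ℝ} (hρ : IsKernel δ ρ) {s : Finset E}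
    (hs : AffineIndependent ℝ ((↑) : s → E)) (hne : s.Nonempty) (i : Fin 3) (y : E) :
    pd i (fun y => avg s (fun z => ρ (y - z))) y = -avg s (pd i fun z => ρ (y - z)) := by
  have h1 : pd i (fun z => ρ (y - z)) = fun z => -1 * pd i ρ (y - z) := by
    ext z
    rw [pd_comp_sub_left (hρ.contDiff_one.differentiable one_ne_zero)]; ring
  rw [h1, avg_const_mul, avg_kernel_eq_conv]
  simp only [avg_kernel_eq_conv]
  have hInt : Integrable (fun _ : E => (1 : ℝ)) ((μHE[s.card - 1] : Measure E).restrict (hull s)) :=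
    integrableOn_hull hs hne continuousOn_const
  rw [pd_const_mul (differentiable_conv hInt hρ.contDiff_one hρ.hasCompactSupport),
    pd_conv hInt hρ.contDiff_one hρ.hasCompactSupport]
  ring

/-- A component of the mollified field with jumps `g`. -/
def jumpField (o : M.FaceOrientation) (g : M.IntFace → ℝ) (ρ : E → ℝ) (i : Fin 3) (y : E) : ℝ :=
  stokesConst 4 * ∑ f : M.IntFace, g f * (faceNormal o f i * avg f.1 (fun z => ρ (y - z)))

theorem differentiable_jumpField (o : M.FaceOrientation) (g : M.IntFace → ℝ) {δ : ℝ} {ρ : E → ℝ}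
    (hρ : IsKernel δ ρ) (i : Fin 3) : Differentiable ℝ (jumpField o g ρ i) :=
  (Differentiable.fun_sum fun f _ => ((differentiable_avg_kernel hρ (face_indep f)
    (face_nonempty f)).const_mul _).const_mul _).const_mul _

theorem pd_jumpField (o : M.FaceOrientation) (g : M.IntFace → ℝ) {δ : ℝ} {ρ : E → ℝ}
    (hρ : IsKernel δ ρ) (i j : Fin 3) (y : E) : pd j (jumpField o g ρ i) y =
      -stokesConst 4 * ∑ f : M.IntFace, g f * (faceNormal o f i *
        avg f.1 (pd j fun z => ρ (y - z))) := by
  have hd : ∀ f : M.IntFace, Differentiable ℝ fun y => avg f.1 (fun z => ρ (y - z)) := fun f =>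
    differentiable_avg_kernel hρ (face_indep f) (face_nonempty f)
  unfold jumpField
  rw [pd_const_mul (Differentiable.fun_sum fun f _ => ((hd f).const_mul _).const_mul _), neg_mul,
    ← mul_neg, ← Finset.sum_neg_distrib]
  congr 1
  rw [pd, fderiv_fun_sum fun f _ => ((hd f).const_mul _).const_mul _ y, ContinuousLinearMap.sum_apply]
  refine Finset.sum_congr rfl fun f _ => ?_
  change pd j _ y = _
  rw [pd_const_mul ((hd f).const_mul _), pd_const_mul (hd f), pd_avg_kernel hρ (face_indep f)
    (face_nonempty f)]
  ring

/-- The contribution of the face `f` to the edge obtained by removing the vertex `v`. -/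
def edgeCoeff (o : M.FaceOrientation) (f : M.IntFace) (v : E) (i j : Fin 3) : ℝ :=
  faceNormal o f i * glam (o.plus f).1 v j - faceNormal o f j * glam (o.plus f).1 v i

-- The curl of a normal field concentrated on faces is concentrated on edges. Indeed n_i e_j − n_j
-- e_i is tangential to the face, so the Stokes formula on the triangle turns the derivative of the
-- kernel into mean values over the three edges. Collected by edges, the coefficients are the sums
-- assumed to vanish; edges that miss the ball see no kernel.
open Classical in
theorem pd_jumpField_comm (o : M.FaceOrientation) {g : M.IntFace → ℝ} {δ : ℝ} {ρ : E → ℝ}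
    (hρ : IsKernel δ ρ) {y : E} (h : ∀ e ∈ M.faces, e.card = 2 →
      (hull e ∩ Metric.closedBall y δ).Nonempty → ∀ i j, ∑ f : M.IntFace, ∑ v ∈ f.1,
        (if f.1.erase v = e then g f * edgeCoeff o f v i j else 0) = 0) (i j : Fin 3) :
    pd j (jumpField o g ρ i) y = pd i (jumpField o g ρ j) y := by
  rw [← sub_eq_zero, pd_jumpField o g hρ, pd_jumpField o g hρ, ← mul_sub, ← Finset.sum_sub_distrib]
  refine mul_eq_zero_of_right _ ?_
  have hh := hρ.contDiff_sub y
  set hy : E → ℝ := fun z => ρ (y - z) with hydef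
  have h1 : ∀ f : M.IntFace, g f * (faceNormal o f i * avg f.1 (pd j hy)) -
      g f * (faceNormal o f j * avg f.1 (pd i hy)) =
      -stokesConst 3 * ∑ v ∈ f.1, g f * edgeCoeff o f v i j * avg (f.1.erase v) hy := by
    intro f
    obtain ⟨hw, hwf, he⟩ := (isTet (o.plus f)).opp_spec (o.subset_plus f) f.2.2.1
    have h2 := (isTet (o.plus f)).avg_face_fderiv hw hh
      (τ := faceNormal o f i • EuclideanSpace.single j 1 - faceNormal o f j • EuclideanSpace.single i 1)
      (by
        have : ∀ k, glam (o.plus f).1 (opp (o.plus f).1 f.1) ⬝ᵥ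
          (EuclideanSpace.single k (1 : ℝ) : E).ofLp = glam (o.plus f).1 (opp (o.plus f).1 f.1) k := by
          intro k; simp
        rw [WithLp.ofLp_sub, WithLp.ofLp_smul, WithLp.ofLp_smul, dotProduct_sub, dotProduct_smul,
          dotProduct_smul, this, this, faceNormal, areaNormal]
        simp only [Pi.smul_apply, smul_eq_mul]
        ring)
    rw [he] at h2
    have h3 : avg f.1 (fun x => fderiv ℝ hy x (faceNormal o f i • EuclideanSpace.single j 1 -
        faceNormal o f j • EuclideanSpace.single i 1)) =
        faceNormal o f i * avg f.1 (pd j hy) - faceNormal o f j * avg f.1 (pd i hy) := by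
      rw [← avg_const_mul, ← avg_const_mul, ← avg_sub (face_indep f) (face_nonempty f)
        (h := fun x => faceNormal o f i * pd j hy x) (h' := fun x => faceNormal o f j * pd i hy x)
        (continuous_const.mul (continuous_pd hh j)).continuousOn
        (continuous_const.mul (continuous_pd hh i)).continuousOn]
      exact avg_congr fun x _ => by simp [pd]
    rw [← mul_sub, ← h3, h2, ← mul_assoc, mul_comm (g f), mul_assoc, Finset.mul_sum]
    congr 1
    refine Finset.sum_congr rfl fun v _ => ?_
    rw [edgeCoeff, WithLp.ofLp_sub, WithLp.ofLp_smul, WithLp.ofLp_smul, dotProduct_sub,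
      dotProduct_smul, dotProduct_smul]
    simp
    ring
  rw [Finset.sum_congr rfl fun f _ => h1 f, ← Finset.mul_sum]
  refine mul_eq_zero_of_right _ ?_
  rw [Finset.sum_sigma' Finset.univ (fun f : M.IntFace => f.1)
    (fun f v => g f * edgeCoeff o f v i j * avg (f.1.erase v) hy)]
  -- Pairs of a face and one of its vertices are grouped according to the remaining edge.
  rw [← Finset.sum_fiberwise_of_maps_to (g := fun q : (_ : M.IntFace) × E => q.1.1.erase q.2)
    (t := (Finset.univ.sigma fun f : M.IntFace => f.1).image fun q => q.1.1.erase q.2)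
    (fun q hq => Finset.mem_image_of_mem _ hq)]
  refine Finset.sum_eq_zero fun e he => ?_
  obtain ⟨q, hq, rfl⟩ := Finset.mem_image.1 he
  have hqv := (Finset.mem_sigma.1 hq).2
  set e := q.1.1.erase q.2 with hedef
  have hcard : e.card = 2 := by rw [hedef, Finset.card_erase_of_mem hqv, q.1.2.2.1]
  have hne : e.Nonempty := Finset.card_pos.1 (by omega)
  have hef : e ∈ M.faces := M.down_closed q.1.2.1 (Finset.erase_subset _ _) hne
  rw [Finset.sum_congr rfl (g := fun q => g q.1 * edgeCoeff o q.1 q.2 i j * avg e hy)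
    (fun a ha => by rw [(Finset.mem_filter.1 ha).2]), ← Finset.sum_mul]
  by_cases hmeet : (hull e ∩ Metric.closedBall y δ).Nonempty
  · have h4 := h e hef hcard hmeet i j
    rw [Finset.sum_sigma' Finset.univ (fun f : M.IntFace => f.1)
      (fun f v => if f.1.erase v = e then g f * edgeCoeff o f v i j else 0)] at h4
    rw [Finset.sum_filter, h4, zero_mul]
  · rw [avg_kernel_eq_zero hρ (M.indep hef) hne, mul_zero]
    exact fun z hz hz' => hmeet ⟨z, hz, hz'⟩

theorem segment_subset_interior_union {T : M.Elem} {y z : E} (hy : y ∈ interior (hull T.1))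
    (hz : z ∈ hull T.1) {a : E} (ha : a ∈ segment ℝ y z) : a = z ∨ a ∈ interior (hull T.1) := by
  obtain ⟨s, t, hs, ht, hst, rfl⟩ := ha
  rcases hs.eq_or_lt with rfl | hs
  · left
    rw [zero_smul, zero_add, show t = 1 by linarith, one_smul]
  · right
    exact (convex_convexHull ℝ _).combo_interior_self_mem_interior hy hz hs ht hst

/-- The value of the jump field near a face. -/
theorem jumpField_eq (hΩ : IsAdmissibleDomain Ω) (o : M.FaceOrientation) (g : M.IntFace → ℝ) {δ : ℝ}
    {ρ : E → ℝ} (hρ : IsKernel δ ρ) {f : M.IntFace} {y : E} (hy : Metric.closedBall y δ ⊆ Ω)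
    (hf : ∀ f' : M.IntFace, f' ≠ f → ∀ z ∈ hull f'.1, z ∉ Metric.closedBall y δ) (i : Fin 3) :
    open Classical in jumpField o g ρ i y =
      g f * pd i (moll ρ fun T => MvPolynomial.C (if T = o.plus f then 1 else 0)) y := by
  classical
  have h0 : ∀ f' : M.IntFace, f' ≠ f → avg f'.1 (fun z => ρ (y - z)) = 0 := fun f' hne =>
    avg_kernel_eq_zero hρ (face_indep f') (face_nonempty f') (hf f' hne)
  rw [pd_moll_const hΩ o hρ _ hy, jumpField, Finset.sum_eq_single f, Finset.sum_eq_single f]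
  · rw [if_pos rfl, if_neg (o.ne f).symm]; ring
  · intro f' _ hne
    rw [h0 f' hne, mul_zero, mul_zero]
  · exact fun h => absurd (Finset.mem_univ f) h
  · intro f' _ hne
    rw [h0 f' hne, mul_zero, mul_zero]
  · exact fun h => absurd (Finset.mem_univ f) h

/-- The jump field as a differential form. -/
def jumpForm (o : M.FaceOrientation) (g : M.IntFace → ℝ) (ρ : E → ℝ) (y : E) : E →L[ℝ] ℝ :=
  ∑ i, jumpField o g ρ i y • (EuclideanSpace.proj i : E →L[ℝ] ℝ)

theorem jumpForm_apply (o : M.FaceOrientation) (g : M.IntFace → ℝ) (ρ : E → ℝ) (y τ : E) :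
    jumpForm o g ρ y τ = ∑ i, τ i * jumpField o g ρ i y := by
  simp [jumpForm, mul_comm]

open Classical in
/-- Jumps that satisfy the edge conditions at a point are the differences of values on the
elements. -/
theorem exists_forall_sub_eq (hΩ : IsAdmissibleDomain Ω) (o : M.FaceOrientation)
    (hx : x ∈ closure Ω) {g : M.IntFace → ℝ}
    (hedge : ∀ e ∈ M.faces, e.card = 2 → x ∈ hull e → (hull e ∩ Ω).Nonempty →
      ∀ i j, ∑ f : M.IntFace, ∑ v ∈ f.1,
        (if f.1.erase v = e then g f * edgeCoeff o f v i j else 0) = 0) :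
    ∃ d : M.Elem → ℝ, ∀ f : M.IntFace, x ∈ hull f.1 → d (o.plus f) - d (o.minus f) = g f := by
  obtain ⟨D, p, hD⟩ := exists_isLocalDomain hΩ M hx
  have hy : ∀ T : M.Elem, ∃ y, x ∈ hull T.1 → y ∈ D ∧ y ∈ interior (hull T.1) := fun T => by
    by_cases hT : x ∈ hull T.1
    · obtain ⟨y, h⟩ := hD.exists_mem_interior hΩ hT
      exact ⟨y, fun _ => h⟩
    · exact ⟨0, fun h => absurd h hT⟩
  choose y hy using hy
  have hz : ∀ f : M.IntFace, ∃ z, x ∈ hull f.1 →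
      z ∈ D ∧ z ∈ hull f.1 ∧ ∀ g : M.IntFace, z ∈ hull g.1 → g = f := fun f => by
    by_cases hf : x ∈ hull f.1
    · obtain ⟨z, h⟩ := hD.exists_mem_face hΩ o hf
      exact ⟨z, fun _ => h⟩
    · exact ⟨0, fun h => absurd h hf⟩
  choose z hz using hz
  -- the neighbourhood of the face `f` in which the path runs
  let O : M.IntFace → Set E := fun f => D ∩ (⋃ f' : {f' : M.IntFace // f' ≠ f}, hull f'.1.1)ᶜ
  have hO : ∀ f, IsOpen (O f) := fun f =>
    hD.isOpen.inter (isClosed_iUnion_of_finite fun f' => isClosed_hull _).isOpen_compl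
  have hpath : ∀ f : M.IntFace, x ∈ hull f.1 → ∀ T : M.Elem, f.1 ⊆ T.1 →
      segment ℝ (y T) (z f) ⊆ O f := by
    intro f hxf T hfT
    have hsub : hull f.1 ⊆ hull T.1 := convexHull_mono (Finset.coe_subset.2 hfT)
    obtain ⟨h1, h2⟩ := hy T (hsub hxf)
    obtain ⟨h3, h4, h5⟩ := hz f hxf
    have hseg : ∀ a ∈ segment ℝ (y T) (z f), a = z f ∨ a ∈ interior (hull T.1) := fun a ha =>
      segment_subset_interior_union h2 (hsub h4) ha
    have hsegD : segment ℝ (y T) (z f) ⊆ D := hD.convex_inter _ h1 _ h3 fun a ha =>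
      (hseg a ha).elim (fun h => h ▸ hD.subset h3) fun h => interior_hull_subset hΩ T h
    refine fun a ha => ⟨hsegD ha, fun hmem => ?_⟩
    obtain ⟨⟨f', hne⟩, hf'⟩ := Set.mem_iUnion.1 hmem
    rcases hseg a ha with rfl | hInt
    · exact hne (h5 f' hf')
    · exact o.ne f' ((eq_of_mem_interior hInt (o.mem_plus hf')).symm.trans
        (eq_of_mem_interior hInt (o.mem_minus hf')))
  have hcompact : ∀ a b : E, IsCompact (segment ℝ a b) := fun a b => by
    rw [segment_eq_image']
    exact isCompact_Icc.image (by fun_prop)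
  have hev1 : ∀ᶠ δ in 𝓝[>] (0 : ℝ), ∀ f : M.IntFace, x ∈ hull f.1 →
      (∀ a ∈ segment ℝ (y (o.plus f)) (z f), Metric.closedBall a δ ⊆ O f) ∧
      ∀ a ∈ segment ℝ (y (o.minus f)) (z f), Metric.closedBall a δ ⊆ O f := by
    rw [eventually_all]
    intro f
    by_cases hxf : x ∈ hull f.1
    · filter_upwards [eventually_closedBall_subset (hO f) (hcompact _ _)
          (hpath f hxf _ (o.subset_plus f)),
        eventually_closedBall_subset (hO f) (hcompact _ _) (hpath f hxf _ (o.subset_minus f))]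
        with δ h1 h2 _
      exact ⟨h1, h2⟩
    · exact Eventually.of_forall fun _ h => absurd h hxf
  have hev2 : ∀ᶠ δ in 𝓝[>] (0 : ℝ), ∀ T : M.Elem, x ∈ hull T.1 →
      Metric.closedBall (y T) δ ⊆ interior (hull T.1) := by
    rw [eventually_all]
    intro T
    by_cases hxT : x ∈ hull T.1
    · filter_upwards [eventually_closedBall_subset isOpen_interior isCompact_singleton
        (Set.singleton_subset_iff.2 (hy T hxT).2)] with δ h _
      exact h _ rfl
    · exact Eventually.of_forall fun _ h => absurd h hxT
  obtain ⟨δ, ⟨⟨hst, h1⟩, h2⟩, hδ⟩ :=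
    (((hD.star.and hev1).and hev2).and self_mem_nhdsWithin).exists
  obtain ⟨ρ, hρ⟩ := exists_isKernel (show (0 : ℝ) < δ from hδ)
  have hderiv : ∀ y, HasFDerivAt (jumpForm o g ρ)
      (∑ i, (fderiv ℝ (jumpField o g ρ i) y).smulRight (EuclideanSpace.proj i : E →L[ℝ] ℝ)) y :=
    fun y => HasFDerivAt.fun_sum fun i _ =>
      (differentiable_jumpField o g hρ i y).hasFDerivAt.smul_const
        (EuclideanSpace.proj i : E →L[ℝ] ℝ)
  -- The Poincaré lemma on the set of points whose δ-ball lies in D. The form is closed there, since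
  -- an edge that meets such a ball contains x and meets Ω, so its edge condition is available.
  obtain ⟨d, hd⟩ := exists_potential_of_starConvex (isOpen_closedBall_subset hD.isOpen (δ := δ))
    hst.1 (fun y hy a ha => hst.2 y hy a ha) (fun y _ => hderiv y) (by
      intro a ha b c
      have hcomm : ∀ i j, pd j (jumpField o g ρ i) a = pd i (jumpField o g ρ j) a :=
        pd_jumpField_comm o hρ fun e he hc hne => by
          obtain ⟨q, hq1, hq2⟩ := hne
          exact hedge e he hc (hD.mem_hull e he q (ha hq2) hq1) ⟨q, hq1, hD.subset (ha hq2)⟩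
      simp only [ContinuousLinearMap.sum_apply, ContinuousLinearMap.smulRight_apply,
        fderiv_eq_sum_pd, ContinuousLinearMap.smul_apply, smul_eq_mul,
        Finset.sum_mul]
      rw [Finset.sum_comm]
      refine Finset.sum_congr rfl fun i _ => Finset.sum_congr rfl fun j _ => ?_
      rw [hcomm j i, show (EuclideanSpace.proj j : E →L[ℝ] ℝ) c = c j from rfl,
        show (EuclideanSpace.proj i : E →L[ℝ] ℝ) b = b i from rfl]
      ring)
  refine ⟨fun T => d (y T), fun f hxf => ?_⟩
  -- As long as no other face is in reach, the jump field is `g f` times the gradient of the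
  -- mollified indicator of T⁺. Hence d − g_f m is constant on the path from T⁺ through a point of f
  -- into T⁻, along which m goes from 1 to 0.
  set m : E → ℝ := moll ρ fun T : M.Elem => MvPolynomial.C (if T = o.plus f then 1 else 0) with hm
  have hconst : ∀ a b : E, (∀ c ∈ segment ℝ a b, Metric.closedBall c δ ⊆ O f) →
      d a - g f * m a = d b - g f * m b := by
    intro a b hab
    refine eq_of_hasFDerivAt_zero (F := fun a => d a - g f * m a) fun c hc => ?_
    have hcO := hab c hc
    have hcD : Metric.closedBall c δ ⊆ D := hcO.trans Set.inter_subset_left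
    have h3 := (hd c hcD).sub
      ((differentiable_moll (M := M) hρ (fun T : M.Elem => MvPolynomial.C (if T = o.plus f then 1 else 0))
        c).hasFDerivAt.const_mul (g f))
    refine h3.congr_fderiv ?_
    ext τ
    rw [ContinuousLinearMap.sub_apply, jumpForm_apply, ContinuousLinearMap.smul_apply,
      fderiv_eq_sum_pd, smul_eq_mul, Finset.mul_sum, ← Finset.sum_sub_distrib]
    refine Finset.sum_eq_zero fun i _ => ?_
    rw [jumpField_eq hΩ o g hρ (f := f) (hcD.trans hD.subset) fun f' hne q hq hq' => ?_]
    · ring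
    · exact (hcO hq').2 (Set.mem_iUnion.2 ⟨⟨f', hne⟩, hq⟩)
  have h3 := hconst _ _ (h1 f hxf).1
  have h4 := hconst _ _ (h1 f hxf).2
  have h5 : m (y (o.plus f)) = 1 := by
    rw [hm, moll_const hρ _ (h2 _ (o.mem_plus hxf)), if_pos rfl]
  have h6 : m (y (o.minus f)) = 0 := by
    rw [hm, moll_const hρ _ (h2 _ (o.mem_minus hxf)), if_neg (o.ne f).symm]
  rw [h5] at h3
  rw [h6] at h4
  linarith

-- The edge conditions give some values with the right differences, and subtracting their average
-- makes the sum zero. The difference of two solutions has no jumps, so it is the same number on all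
-- elements at x; the sum condition makes that number zero.
open Classical in
theorem existsUnique_nodeSolution (hΩ : IsAdmissibleDomain Ω) (o : M.FaceOrientation)
    (hx : x ∈ closure Ω) (lam : (f : M.IntFace) → hull f.1 → ℝ)
    (hedge : ∀ e ∈ M.faces, e.card = 2 → x ∈ hull e → (hull e ∩ Ω).Nonempty →
      ∀ i j, ∑ f : M.IntFace, ∑ v ∈ f.1, (if f.1.erase v = e then
        (if h : x ∈ hull f.1 then lam f ⟨x, h⟩ else 0) * edgeCoeff o f v i j else 0) = 0) :
    ∃! d : {T : M.Elem // x ∈ hull T.1} → ℝ, IsNodeSolution o lam x d := by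
  obtain ⟨d, hd⟩ := exists_forall_sub_eq hΩ o hx
    (g := fun f => if h : x ∈ hull f.1 then lam f ⟨x, h⟩ else 0) hedge
  obtain ⟨T₀, hT₀⟩ := exists_elem_of_mem_closure M hx
  have hcard : (Fintype.card {T : M.Elem // x ∈ hull T.1} : ℝ) ≠ 0 :=
    Nat.cast_ne_zero.2 (Fintype.card_pos_iff.2 ⟨⟨T₀, hT₀⟩⟩).ne'
  set c : ℝ := (∑ T : {T : M.Elem // x ∈ hull T.1}, d T.1) /
    Fintype.card {T : M.Elem // x ∈ hull T.1} with hc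
  refine ⟨fun T => d T.1 - c, ⟨fun f hf => ?_, ?_⟩, fun d' hd' => ?_⟩
  · have := hd f hf
    rw [dif_pos hf] at this
    linarith
  · rw [finsum_eq_sum_of_fintype, Finset.sum_sub_distrib, Finset.sum_const, nsmul_eq_mul, hc,
      Finset.card_univ, mul_div_cancel₀ _ hcard, sub_self]
  · obtain ⟨h1, h2⟩ := hd'
    have hconst : ∀ T, d' T - d T.1 = d' ⟨T₀, hT₀⟩ - d T₀ := by
      intro T
      have := eq_of_forall_face_eq hΩ o hx
        (e := fun T => if h : x ∈ hull T.1 then d' ⟨T, h⟩ - d T else 0) (fun f hf => by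
          rw [dif_pos (o.mem_plus hf), dif_pos (o.mem_minus hf)]
          have h3 := hd f hf
          rw [dif_pos hf] at h3
          have h4 := h1 f hf
          linarith) T.2 hT₀
      rwa [dif_pos T.2, dif_pos hT₀] at this
    rw [finsum_eq_sum_of_fintype] at h2
    have h3 : ∑ T : {T : M.Elem // x ∈ hull T.1}, (d' T - d T.1) =
        Fintype.card {T : M.Elem // x ∈ hull T.1} * (d' ⟨T₀, hT₀⟩ - d T₀) := by
      rw [Finset.sum_congr rfl fun T _ => hconst T, Finset.sum_const, nsmul_eq_mul, Finset.card_univ]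
    rw [Finset.sum_sub_distrib, h2] at h3
    ext T
    have h4 := hconst T
    have h5 : c = -(d' ⟨T₀, hT₀⟩ - d T₀) := by
      rw [hc, div_eq_iff hcard]
      linarith
    linarith

end TetMesh

/-! ## Lagrange interpolation -/

/-- The Lagrangian node with barycentric coordinates `m a / k`. -/
def node (T : Finset E) (k : ℕ) (m : E → ℕ) : E := ∑ a ∈ T, ((m a : ℝ) / (k : ℝ)) • a

theorem sum_div_eq_one {T : Finset E} {k : ℕ} (hk : 1 ≤ k) {m : E → ℕ} (hm : ∑ a ∈ T, m a = k) :
    ∑ a ∈ T, (m a : ℝ) / (k : ℝ) = 1 := by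
  rw [← Finset.sum_div, ← Nat.cast_sum, hm, div_self]
  exact Nat.cast_ne_zero.2 (by omega)

theorem node_mem_hull {T : Finset E} {k : ℕ} (hk : 1 ≤ k) {m : E → ℕ} (hm : ∑ a ∈ T, m a = k) :
    node T k m ∈ hull T := by
  rw [Finset.mem_convexHull']
  exact ⟨fun a => (m a : ℝ) / k, fun a _ => by positivity, sum_div_eq_one hk hm, rfl⟩

theorem IsTet.lam_node {T : Finset E} (hT : IsTet T) {k : ℕ} (hk : 1 ≤ k) {m : E → ℕ}
    (hm : ∑ a ∈ T, m a = k) {a : E} (ha : a ∈ T) : ev (lam T a) (node T k m) = m a / k :=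
  hT.lam_sum_smul (c := fun a => (m a : ℝ) / k) (sum_div_eq_one hk hm) ha

/-- The Lagrange basis function of a node. -/
def lagrange (T : Finset E) (k : ℕ) (m : E → ℕ) : SPoly :=
  ∏ a ∈ T, ∏ i ∈ Finset.range (m a),
    MvPolynomial.C (((m a : ℝ) - i)⁻¹) * (MvPolynomial.C (k : ℝ) * lam T a - MvPolynomial.C (i : ℝ))

theorem IsTet.lagrange_mem {T : Finset E} (hT : IsTet T) {k : ℕ} {m : E → ℕ}
    (hm : ∑ a ∈ T, m a = k) : lagrange T k m ∈ PolyDeg k := by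
  rw [← hm]
  refine prod_mem_polyDeg T fun a _ => ?_
  have := prod_mem_polyDeg (Finset.range (m a)) (k := fun _ => 1)
    (p := fun i : ℕ => MvPolynomial.C (((m a : ℝ) - i)⁻¹) *
      (MvPolynomial.C ((∑ a ∈ T, m a : ℕ) : ℝ) * lam T a - MvPolynomial.C (i : ℝ))) fun i _ => by
    rw [MvPolynomial.C_mul', MvPolynomial.C_mul']
    exact Submodule.smul_mem _ _ (sub_mem (Submodule.smul_mem _ _ (hT.lam_mem a)) (C_mem_polyDeg _ _))
  simpa using this

theorem IsTet.ev_lagrange {T : Finset E} (hT : IsTet T) {k : ℕ} (hk : 1 ≤ k) {m m' : E → ℕ}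
    (hm' : ∑ a ∈ T, m' a = k) :
    ev (lagrange T k m) (node T k m') =
      ∏ a ∈ T, ∏ i ∈ Finset.range (m a), ((m a : ℝ) - i)⁻¹ * ((m' a : ℝ) - i) := by
  have hk0 : (k : ℝ) ≠ 0 := Nat.cast_ne_zero.2 (by omega)
  rw [lagrange, ev_prod]
  refine Finset.prod_congr rfl fun a ha => ?_
  rw [ev_prod]
  refine Finset.prod_congr rfl fun i _ => ?_
  simp only [ev_mul, ev_sub, ev_C, hT.lam_node hk hm' ha]
  rw [mul_div_cancel₀ _ hk0]

theorem IsTet.ev_lagrange_self {T : Finset E} (hT : IsTet T) {k : ℕ} (hk : 1 ≤ k) {m : E → ℕ}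
    (hm : ∑ a ∈ T, m a = k) : ev (lagrange T k m) (node T k m) = 1 := by
  rw [hT.ev_lagrange hk hm]
  refine Finset.prod_eq_one fun a _ => Finset.prod_eq_one fun i hi => inv_mul_cancel₀ ?_
  rw [Finset.mem_range] at hi
  exact sub_ne_zero.2 (Nat.cast_lt.2 hi).ne'

/-- Two different indices with the same sum have a vertex where the second is smaller; the factor of
the basis function for that smaller integer vanishes at the other node. -/
theorem IsTet.ev_lagrange_of_ne {T : Finset E} (hT : IsTet T) {k : ℕ} (hk : 1 ≤ k) {m m' : E → ℕ}
    (hm : ∑ a ∈ T, m a = k) (hm' : ∑ a ∈ T, m' a = k) (hne : ∃ a ∈ T, m a ≠ m' a) :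
    ev (lagrange T k m) (node T k m') = 0 := by
  obtain ⟨a, ha, hlt⟩ : ∃ a ∈ T, m' a < m a := by
    by_contra! hcon
    obtain ⟨a, ha, hne⟩ := hne
    have := Finset.sum_lt_sum hcon ⟨a, ha, lt_of_le_of_ne (hcon a ha) hne⟩
    omega
  rw [hT.ev_lagrange hk hm']
  refine Finset.prod_eq_zero ha (Finset.prod_eq_zero (Finset.mem_range.2 hlt) ?_)
  rw [sub_self, mul_zero]

open Classical in
/-- Evaluation at the Lagrangian nodes. -/
def nodeEval (T : Finset E) (k : ℕ) : PolyDeg k →ₗ[ℝ] (T.piAntidiag k → ℝ) where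
  toFun p m := ev p.1 (node T k m.1)
  map_add' p q := by ext m; simp
  map_smul' c p := by ext m; simp

open Classical in
theorem IsTet.nodeEval_surjective {T : Finset E} (hT : IsTet T) {k : ℕ} (hk : 1 ≤ k) :
    Function.Surjective (nodeEval T k) := by
  intro c
  have hsum : ∀ m : T.piAntidiag k, ∑ a ∈ T, m.1 a = k := fun m => (Finset.mem_piAntidiag.1 m.2).1
  refine ⟨∑ m : T.piAntidiag k, c m • ⟨lagrange T k m.1, hT.lagrange_mem (hsum m)⟩, ?_⟩
  ext m'
  rw [map_sum, Finset.sum_apply, Finset.sum_eq_single m']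
  · rw [map_smul, Pi.smul_apply]
    change c m' • ev (lagrange T k m'.1) (node T k m'.1) = _
    rw [hT.ev_lagrange_self hk (hsum m'), smul_eq_mul, mul_one]
  · intro m _ hne
    rw [map_smul, Pi.smul_apply]
    change c m • ev (lagrange T k m.1) (node T k m'.1) = _
    rw [hT.ev_lagrange_of_ne hk (hsum m) (hsum m'), smul_zero]
    by_contra! hcon
    refine hne (Subtype.ext (funext fun a => ?_))
    by_cases ha : a ∈ T
    · exact hcon a ha
    · rw [not_imp_comm.1 ((Finset.mem_piAntidiag.1 m.2).2 a) ha,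
        not_imp_comm.1 ((Finset.mem_piAntidiag.1 m'.2).2 a) ha]
  · exact fun h => absurd (Finset.mem_univ m') h

-- Adding the missing degree k − |d| as a fourth entry sends exponents of monomials injectively to
-- node indices. With the surjectivity of nodal evaluation, this dimension count gives its
-- injectivity.
open Classical in
theorem IsTet.finrank_polyDeg_le {T : Finset E} (hT : IsTet T) (k : ℕ) :
    Module.finrank ℝ (PolyDeg k) ≤ (T.piAntidiag k).card := by
  have := (finite_degree_le k).fintype
  rw [Module.finrank_eq_card_basis (polyDegBasis k), ← Fintype.card_coe]
  let ε : T ≃ Fin 4 := T.equivFinOfCardEq hT.card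
  let m : (Fin 3 →₀ ℕ) → E → ℕ := fun d a =>
    if h : a ∈ T then (Fin.cons (k - d.degree) d : Fin 4 → ℕ) (ε ⟨a, h⟩) else 0
  have hm : ∀ d i, m d (ε.symm i) = (Fin.cons (k - d.degree) d : Fin 4 → ℕ) i := fun d i => by
    simp [m]
  have hsum : ∀ d, d.degree ≤ k → ∑ a ∈ T, m d a = k := by
    intro d hd
    rw [← Finset.sum_coe_sort T, ← ε.symm.sum_comp]
    simp only [hm, Fin.sum_univ_succ (n := 3), Fin.cons_zero, Fin.cons_succ]
    rw [Finsupp.degree_eq_sum] at hd ⊢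
    omega
  refine Fintype.card_le_of_injective (fun d : {d : Fin 3 →₀ ℕ | d.degree ≤ k} =>
    (⟨m d.1, Finset.mem_piAntidiag.2 ⟨hsum d.1 d.2, fun a ha => ?_⟩⟩ : T.piAntidiag k)) ?_
  · by_contra h
    exact ha (dif_neg h)
  · intro d d' hdd
    refine Subtype.ext (Finsupp.ext fun i => ?_)
    have h1 : m d.1 = m d'.1 := congrArg Subtype.val hdd
    have h2 := hm d.1 i.succ
    rw [h1, hm, Fin.cons_succ, Fin.cons_succ] at h2
    exact h2.symm

open Classical in
theorem IsTet.nodeEval_injective {T : Finset E} (hT : IsTet T) {k : ℕ} (hk : 1 ≤ k) :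
    Function.Injective (nodeEval T k) := by
  have h1 := LinearMap.finrank_range_add_finrank_ker (nodeEval T k)
  rw [LinearMap.range_eq_top.2 (hT.nodeEval_surjective hk), finrank_top, Module.finrank_fintype_fun_eq_card,
    Fintype.card_coe] at h1
  have h2 := hT.finrank_polyDeg_le k
  exact LinearMap.ker_eq_bot.1 (Submodule.finrank_eq_zero.1 (by omega))

/-- Unisolvence on a tetrahedron. -/
theorem IsTet.eq_of_ev_node_eq {T : Finset E} (hT : IsTet T) {k : ℕ} (hk : 1 ≤ k) {p q : SPoly}
    (hp : p ∈ PolyDeg k) (hq : q ∈ PolyDeg k)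
    (h : ∀ m : E → ℕ, ∑ a ∈ T, m a = k → ev p (node T k m) = ev q (node T k m)) : p = q := by
  classical
  have : (⟨p, hp⟩ : PolyDeg k) = ⟨q, hq⟩ := hT.nodeEval_injective hk (by
    ext m
    exact h m.1 (Finset.mem_piAntidiag.1 m.2).1)
  exact congrArg Subtype.val this

theorem IsTet.exists_ev_node_eq {T : Finset E} (hT : IsTet T) {k : ℕ} (hk : 1 ≤ k) (c : E → ℝ) :
    ∃ p ∈ PolyDeg k, ∀ m : E → ℕ, ∑ a ∈ T, m a = k → ev p (node T k m) = c (node T k m) := by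
  classical
  obtain ⟨p, hp⟩ := hT.nodeEval_surjective hk fun m => c (node T k m.1)
  refine ⟨p.1, p.2, fun m hm => ?_⟩
  -- Indices in `piAntidiag` have to vanish off T, whereas the node does not depend on the values of
  -- m there.
  let m' : E → ℕ := fun a => if a ∈ T then m a else 0
  have hmm : ∀ a ∈ T, m' a = m a := fun a ha => if_pos ha
  have hnode : node T k m = node T k m' := Finset.sum_congr rfl fun a ha => by rw [hmm a ha]
  have hm' : m' ∈ T.piAntidiag k := Finset.mem_piAntidiag.2
    ⟨by rw [Finset.sum_congr rfl hmm, hm], fun a ha => by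
      by_contra h
      exact ha (if_neg h)⟩
  rw [hnode]
  exact congrFun hp ⟨m', hm'⟩

/-- Unisolvence on a face. -/
theorem IsTet.ev_eq_zero_of_face_node {T f : Finset E} (hT : IsTet T) (hf : f ⊆ T) (hc : f.card = 3)
    {k : ℕ} (hk : 1 ≤ k) {p : SPoly} (hp : p ∈ PolyDeg k)
    (h : ∀ m : E → ℕ, ∑ a ∈ f, m a = k → ev p (node f k m) = 0) {x : E} (hx : x ∈ hull f) :
    ev p x = 0 := by
  classical
  obtain ⟨hw, hwf, he⟩ := hT.opp_spec hf hc
  set w := opp T f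
  obtain ⟨a, ha⟩ : f.Nonempty := Finset.card_pos.1 (by omega)
  -- The affine map that collapses the opposite vertex w to a vertex a of the face and fixes the
  -- face. It sends nodes of T to nodes of f, so the pulled-back polynomial vanishes at all nodes of
  -- T and unisolvence on the tetrahedron applies.
  let A : VPoly := fun i => ∑ v ∈ f, MvPolynomial.C (v i) * lam T v + MvPolynomial.C (a i) * lam T w
  have hA : ∀ i, A i ∈ PolyDeg 1 := fun i => by
    refine add_mem (sum_mem fun v _ => ?_) ?_
    · rw [MvPolynomial.C_mul']
      exact Submodule.smul_mem _ _ (hT.lam_mem v)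
    · rw [MvPolynomial.C_mul']
      exact Submodule.smul_mem _ _ (hT.lam_mem w)
  have hAx : ∀ y, (WithLp.toLp 2 (evV A y) : E) = ∑ v ∈ f, ev (lam T v) y • v + ev (lam T w) y • a := by
    intro y
    ext i
    simp [evV, A, ev_sum, mul_comm]
  have hq : MvPolynomial.bind₁ A p = 0 := by
    refine hT.eq_of_ev_node_eq hk (bind₁_mem_polyDeg hA hp) (zero_mem _) fun m hm => ?_
    rw [ev_bind₁, hAx, ev_zero]
    have hsum : ∑ b ∈ f, (m b + if b = a then m w else 0) = k := by
      rw [Finset.sum_add_distrib, Finset.sum_ite_eq' f a, if_pos ha, ← hm,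
        ← Finset.add_sum_erase _ _ hw, he, add_comm]
    rw [← h (fun b => m b + if b = a then m w else 0) hsum]
    congr 1
    have h1 : ∀ v ∈ f, (((m v + if v = a then m w else 0 : ℕ) : ℝ) / (k : ℝ)) • v =
        ev (lam T v) (node T k m) • v + if v = a then ((m w : ℝ) / k) • v else 0 := by
      intro v hv
      rw [hT.lam_node hk hm (hf hv)]
      split_ifs <;> simp [add_div, add_smul]
    rw [show node f k (fun b => m b + if b = a then m w else 0) = _ from Finset.sum_congr rfl h1,
      Finset.sum_add_distrib, Finset.sum_ite_eq' f a, if_pos ha, hT.lam_node hk hm hw]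
  have h2 : ev (MvPolynomial.bind₁ A p) x = ev p x := by
    rw [ev_bind₁, hAx, lam_eq_zero_of_mem_face hT hf hw hwf hx, zero_smul, add_zero]
    congr 1
    have := hT.sum_lam_smul x
    rwa [← Finset.add_sum_erase _ _ hw, he, lam_eq_zero_of_mem_face hT hf hw hwf hx, zero_smul,
      zero_add] at this
  rw [← h2, hq, ev_zero]

namespace TetMesh

variable {Ω : Set E} {M : TetMesh Ω}

theorem node_mem_nodes (T : M.Elem) {k : ℕ} {m : E → ℕ} (hm : ∑ a ∈ T.1, m a = k) :
    node T.1 k m ∈ M.nodes k := ⟨T, m, hm, rfl⟩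

theorem nodes_subset_closure {k : ℕ} (hk : 1 ≤ k) {x : E} (hx : x ∈ M.nodes k) : x ∈ closure Ω := by
  obtain ⟨T, m, hm, rfl⟩ := hx
  exact hull_subset_closure T (node_mem_hull hk hm)

/-- Barycentric coordinates of a common point agree in all elements that contain it, so being a node
does not depend on the element that witnesses it. -/
theorem exists_eq_node {k : ℕ} (hk : 1 ≤ k) {x : E} (hx : x ∈ M.nodes k) {T : M.Elem}
    (hxT : x ∈ hull T.1) : ∃ m : E → ℕ, ∑ a ∈ T.1, m a = k ∧ x = node T.1 k m := by
  classical
  obtain ⟨T₀, m, hm, hx0⟩ := hx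
  have hx0 : x = node T₀.1 k m := hx0
  have hk0 : (k : ℝ) ≠ 0 := Nat.cast_ne_zero.2 (by omega)
  have hxT0 : x ∈ hull T₀.1 := hx0 ▸ node_mem_hull hk hm
  have hlam : ∀ a ∈ T₀.1, ev (lam T₀.1 a) x = m a / k := fun a ha => by
    rw [hx0]; exact (isTet T₀).lam_node hk hm ha
  let m' : E → ℕ := fun a => if a ∈ T₀.1 then m a else 0
  have hl : ∀ a ∈ T.1, ev (lam T.1 a) x = (m' a : ℝ) / k := by
    intro a ha
    rw [lam_eq_lam hxT hxT0 a]
    by_cases ha0 : a ∈ T₀.1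
    · rw [hlam a ha0]; simp [m', ha0]
    · rw [(isTet T₀).lam_of_notMem ha0]; simp [m', ha0]
  refine ⟨m', ?_, ?_⟩
  · have h1 := (isTet T).sum_lam x
    rw [Finset.sum_congr rfl hl, ← Finset.sum_div, div_eq_one_iff_eq hk0] at h1
    exact_mod_cast h1
  · conv_lhs => rw [← (isTet T).sum_lam_smul x]
    exact Finset.sum_congr rfl fun a ha => by rw [hl a ha]

theorem existsUnique_nodalField {k : ℕ} (hk : 1 ≤ k) (o : M.FaceOrientation)
    {lam : (f : M.IntFace) → hull f.1 → ℝ}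
    (h : ∀ x ∈ M.nodes k, ∃! d : {T : M.Elem // x ∈ hull T.1} → ℝ, IsNodeSolution o lam x d) :
    ∃! φ : M.Elem → SPoly, IsNodalField k o lam φ := by
  classical
  choose! d hd hu using h
  have hφ : ∀ T : M.Elem, ∃ p ∈ PolyDeg k, ∀ m : E → ℕ, ∑ a ∈ T.1, m a = k →
      ev p (node T.1 k m) = if hx : node T.1 k m ∈ hull T.1 then d _ ⟨T, hx⟩ else 0 := fun T =>
    (isTet T).exists_ev_node_eq hk fun x => if hx : x ∈ hull T.1 then d x ⟨T, hx⟩ else 0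
  choose φ hφd hφe using hφ
  refine ⟨φ, ⟨hφd, fun x hx => ?_⟩, fun φ' hφ' => ?_⟩
  · have : (fun T : {T : M.Elem // x ∈ hull T.1} => ev (φ T.1) x) = d x := by
      ext T
      obtain ⟨T, hT⟩ := T
      obtain ⟨m, hm, rfl⟩ := exists_eq_node hk hx hT
      rw [hφe T m hm, dif_pos hT]
    rw [this]
    exact hd x hx
  · ext1 T
    refine (isTet T).eq_of_ev_node_eq hk (hφ'.1 T) (hφd T) fun m hm => ?_
    have hT : node T.1 k m ∈ hull T.1 := node_mem_hull hk hm
    have hn := node_mem_nodes T hm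
    rw [hφe T m hm, dif_pos hT, ← hu _ hn _ (hφ'.2 _ hn)]

/-- The nodes of the face are nodes of the mesh, where the jump condition holds by construction, and
all functions involved are polynomials of degree k; unisolvence on the face extends the identity to
the whole face. -/
theorem nodalField_jump {k : ℕ} (hk : 1 ≤ k) {o : M.FaceOrientation}
    {lam : (f : M.IntFace) → hull f.1 → ℝ} {φ : M.Elem → SPoly} (hφ : IsNodalField k o lam φ)
    {f : M.IntFace} {p : SPoly} (hp : p ∈ PolyDeg k) (hlam : ∀ x : hull f.1, lam f x = ev p x)
    {x : E} (hx : x ∈ hull f.1) : ev (φ (o.plus f)) x - ev (φ (o.minus f)) x = ev p x := by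
  classical
  have key := (isTet (o.plus f)).ev_eq_zero_of_face_node (o.subset_plus f) f.2.2.1 hk
    (p := φ (o.plus f) - φ (o.minus f) - p) (sub_mem (sub_mem (hφ.1 _) (hφ.1 _)) hp)
    (fun m hm => ?_) hx
  · simp only [ev_sub] at key
    linarith
  · have hf := node_mem_hull hk hm
    have hn : node f.1 k m ∈ M.nodes k := by
      refine ⟨o.plus f, fun a => if a ∈ f.1 then m a else 0, ?_, ?_⟩
      · rw [Finset.sum_ite_mem, Finset.inter_eq_right.2 (o.subset_plus f), hm]
      · rw [node, ← Finset.inter_eq_right.2 (o.subset_plus f), ← Finset.sum_ite_mem,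
          Finset.inter_eq_right.2 (o.subset_plus f)]
        refine Finset.sum_congr rfl fun a _ => ?_
        by_cases ha : a ∈ f.1 <;> simp [ha]
    have := (hφ.2 _ hn).1 f hf
    rw [hlam] at this
    simp only [ev_sub]
    rw [sub_eq_zero]
    exact this

end TetMesh

/-! ## Smooth truncation -/

/-- A smooth function that vanishes below `ε` and is the identity above `2 ε`. -/
def trunc (ε s : ℝ) : ℝ := s * Real.smoothTransition (s / ε - 1)

theorem contDiff_trunc (ε : ℝ) {n : ℕ∞} : ContDiff ℝ n (trunc ε) :=
  contDiff_id.mul (Real.smoothTransition.contDiff.comp ((contDiff_id.div_const ε).sub contDiff_const))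

theorem trunc_of_le {ε s : ℝ} (hε : 0 < ε) (h : s ≤ ε) : trunc ε s = 0 := by
  rw [trunc, Real.smoothTransition.zero_of_nonpos, mul_zero]
  rw [sub_nonpos, div_le_one hε]
  exact h

theorem trunc_of_ge {ε s : ℝ} (hε : 0 < ε) (h : 2 * ε ≤ s) : trunc ε s = s := by
  rw [trunc, Real.smoothTransition.one_of_one_le, mul_one]
  rw [le_sub_iff_add_le, le_div_iff₀ hε]
  linarith

theorem trunc_nonneg {ε s : ℝ} (hs : 0 ≤ s) : 0 ≤ trunc ε s :=
  mul_nonneg hs (Real.smoothTransition.nonneg _)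

theorem trunc_le {ε s : ℝ} (hs : 0 ≤ s) : trunc ε s ≤ s :=
  mul_le_of_le_one_right hs (Real.smoothTransition.le_one _)

theorem abs_trunc_sub_le {ε s : ℝ} (hε : 0 < ε) (hs : 0 ≤ s) : |trunc ε s - s| ≤ 2 * ε := by
  rcases le_or_gt (2 * ε) s with h | h
  · rw [trunc_of_ge hε h, sub_self, abs_zero]; positivity
  · rw [abs_le]
    constructor <;> linarith [trunc_nonneg (ε := ε) hs, trunc_le (ε := ε) hs]

theorem deriv_trunc_of_lt {ε s : ℝ} (hε : 0 < ε) (h : s < ε) : deriv (trunc ε) s = 0 := by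
  have : trunc ε =ᶠ[𝓝 s] fun _ => 0 := by
    filter_upwards [Iio_mem_nhds h] with t ht
    exact trunc_of_le hε (le_of_lt ht)
  rw [this.deriv_eq, deriv_const]

theorem deriv_trunc_of_gt {ε s : ℝ} (hε : 0 < ε) (h : 2 * ε < s) : deriv (trunc ε) s = 1 := by
  have : trunc ε =ᶠ[𝓝 s] id := by
    filter_upwards [Ioi_mem_nhds h] with t ht
    exact trunc_of_ge hε (le_of_lt ht)
  rw [this.deriv_eq, deriv_id]

/-- The truncations are rescalings of one function, ε · trunc 1 (s / ε), so their slopes take the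
same values and the bound does not depend on ε. -/
theorem exists_deriv_trunc_le : ∃ C : ℝ, 0 ≤ C ∧ ∀ ε s : ℝ, 0 < ε → |deriv (trunc ε) s| ≤ C := by
  have hcont : Continuous (deriv (trunc 1)) := (contDiff_trunc 1 (n := 1)).continuous_deriv le_rfl
  obtain ⟨C, hC⟩ := (isCompact_Icc (a := (1 : ℝ)) (b := 2)).exists_bound_of_continuousOn
    hcont.continuousOn
  have h1 : ∀ s, |deriv (trunc 1) s| ≤ max C 1 := by
    intro s
    rcases lt_or_ge s 1 with h | h
    · rw [deriv_trunc_of_lt one_pos h, abs_zero]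
      exact le_max_of_le_right zero_le_one
    rcases lt_or_ge 2 s with h' | h'
    · rw [deriv_trunc_of_gt one_pos (by linarith), abs_one]
      exact le_max_right _ _
    · exact (hC s ⟨h, h'⟩).trans (le_max_left _ _)
  refine ⟨max C 1, le_max_of_le_right zero_le_one, fun ε s hε => ?_⟩
  have h2 : trunc ε = fun s => ε * trunc 1 (ε⁻¹ * s) := by
    ext s
    rw [trunc, trunc]
    field_simp
  have h3 : deriv (trunc ε) s = deriv (trunc 1) (ε⁻¹ * s) := by
    have hd : DifferentiableAt ℝ (trunc 1) (ε⁻¹ * s) :=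
      (contDiff_trunc 1 (n := 1)).differentiable (by simp) _
    have h4 := (hd.hasDerivAt.comp s ((hasDerivAt_id s).const_mul ε⁻¹)).const_mul ε
    have h5 : HasDerivAt (fun s => ε * trunc 1 (ε⁻¹ * s)) _ s := h4
    rw [h2, h5.deriv]
    field_simp
  rw [h3]
  exact h1 _

theorem pd_trunc {F : E → ℝ} (hF : Differentiable ℝ F) (ε : ℝ) (i : Fin 3) (y : E) :
    pd i (fun y => trunc ε (F y)) y = deriv (trunc ε) (F y) * pd i F y := by
  have hd : DifferentiableAt ℝ (trunc ε) (F y) :=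
    (contDiff_trunc ε (n := 1)).differentiable (by simp) _
  have h := hd.hasDerivAt.comp_hasFDerivAt y (hF y).hasFDerivAt
  have h' : HasFDerivAt (fun y => trunc ε (F y)) _ y := h
  rw [pd, h'.fderiv]
  simp [pd]

/-! ## Fields of Whitney type -/

theorem contDiff_pd {F : E → ℝ} (hF : ContDiff ℝ ∞ F) (i : Fin 3) : ContDiff ℝ ∞ (pd i F) :=
  (hF.fderiv_right (m := ∞) (by simp)).clm_apply contDiff_const

theorem pd_comm {F : E → ℝ} (hF : ContDiff ℝ ∞ F) (i j : Fin 3) (y : E) :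
    pd i (pd j F) y = pd j (pd i F) y := by
  have hd : Differentiable ℝ (fderiv ℝ F) :=
    (hF.fderiv_right (m := ∞) (by simp)).differentiable (by simp)
  have h : ∀ i j, pd i (pd j F) y =
      fderiv ℝ (fderiv ℝ F) y (EuclideanSpace.single i 1) (EuclideanSpace.single j 1) := by
    intro i j
    have h1 := (hd y).hasFDerivAt.clm_apply (hasFDerivAt_const (EuclideanSpace.single j (1 : ℝ) : E) y)
    have h2 : HasFDerivAt (pd j F) _ y := h1
    rw [pd, h2.fderiv]
    simp
  rw [h, h]
  exact (hF.contDiffAt.isSymmSndFDerivAt (by simp; exact WithTop.coe_le_coe.2 (le_top : (2 : ℕ∞) ≤ ⊤))).eq _ _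

/-- The field `S ∇R - R ∇S`. -/
def whitney (S R : E → ℝ) (y : E) : V := fun i => S y * pd i R y - R y * pd i S y

theorem contDiff_whitney {S R : E → ℝ} (hS : ContDiff ℝ ∞ S) (hR : ContDiff ℝ ∞ R) :
    ContDiff ℝ ∞ (whitney S R) :=
  contDiff_pi.2 fun i => (hS.mul (contDiff_pd hR i)).sub (hR.mul (contDiff_pd hS i))

theorem curl_whitney {S R : E → ℝ} (hS : ContDiff ℝ ∞ S) (hR : ContDiff ℝ ∞ R) (y : E) :
    curl (whitney S R) y = (2 : ℝ) • (grad S y ⨯₃ grad R y) := by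
  have hd : ∀ {F : E → ℝ}, ContDiff ℝ ∞ F → Differentiable ℝ F := fun h => h.differentiable (by simp)
  have key : ∀ i j, pd j (fun y => whitney S R y i) y =
      pd j S y * pd i R y + S y * pd j (pd i R) y - (pd j R y * pd i S y + R y * pd j (pd i S) y) := by
    intro i j
    unfold whitney
    rw [pd_sub ((hd hS).fun_mul (hd (contDiff_pd hR i))) ((hd hR).fun_mul (hd (contDiff_pd hS i))),
      pd_mul (hd hS) (hd (contDiff_pd hR i)), pd_mul (hd hR) (hd (contDiff_pd hS i))]
  ext i
  fin_cases i <;> simp only [curl, key, cross_apply, grad, Pi.smul_apply, smul_eq_mul,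
    Matrix.cons_val, Fin.zero_eta, Fin.mk_one, Fin.reduceFinMk]
  · rw [pd_comm hR 1 2, pd_comm hS 1 2]; ring
  · rw [pd_comm hR 2 0, pd_comm hS 2 0]; ring
  · rw [pd_comm hR 0 1, pd_comm hS 0 1]; ring

/-! ## Convergence in `L²` -/

theorem tendsto_eLpNorm_of_bounded {ν : Measure E} [IsFiniteMeasure ν] {f : ℕ → E → V} {C : ℝ}
    (hm : ∀ n, AEStronglyMeasurable (f n) ν) (hb : ∀ n, ∀ᵐ x ∂ν, ‖f n x‖ ≤ C)
    (hl : ∀ᵐ x ∂ν, Tendsto (fun n => f n x) atTop (𝓝 0)) :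
    Tendsto (fun n => eLpNorm (f n) 2 ν) atTop (𝓝 0) := by
  have h2 : (2 : ENNReal) ≠ 0 := by norm_num
  have ht : (2 : ENNReal) ≠ ⊤ := by norm_num
  simp only [eLpNorm_eq_lintegral_rpow_enorm_toReal h2 ht]
  have key : Tendsto (fun n => ∫⁻ x, ‖f n x‖ₑ ^ (2 : ENNReal).toReal ∂ν) atTop (𝓝 (∫⁻ _, 0 ∂ν)) := by
    refine tendsto_lintegral_of_dominated_convergence'
      (fun _ => (ENNReal.ofReal C) ^ (2 : ENNReal).toReal) (fun n => (hm n).enorm.pow_const _)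
      (fun n => ?_) ?_ ?_
    · filter_upwards [hb n] with x hx
      refine ENNReal.rpow_le_rpow ?_ (by simp)
      rw [← ofReal_norm]
      exact ENNReal.ofReal_le_ofReal hx
    · rw [lintegral_const]
      exact ENNReal.mul_ne_top (ENNReal.rpow_ne_top_of_nonneg (by simp) ENNReal.ofReal_ne_top)
        (measure_ne_top _ _)
    · filter_upwards [hl] with x hx
      have h3 : Tendsto (fun n => ‖f n x‖ₑ) atTop (𝓝 0) := by
        simpa using hx.enorm
      have h4 := h3.ennrpow_const (2 : ENNReal).toReal
      simpa using h4
  rw [lintegral_zero] at key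
  have := key.ennrpow_const (1 / (2 : ENNReal).toReal)
  simpa using this

namespace TetMesh

variable {Ω : Set E} {M : TetMesh Ω}

theorem pwV_eq_sum (u : M.Elem → VPoly) :
    pwV u = fun x => ∑ T : M.Elem, (interior (hull T.1)).indicator (evV (u T)) x := by
  ext1 x
  rw [pwV, finsum_eq_sum_of_fintype]

theorem memLp_pwV {ν : Measure E} [IsFiniteMeasure ν] (u : M.Elem → VPoly) : MemLp (pwV u) 2 ν := by
  rw [pwV_eq_sum]
  refine memLp_finsetSum _ fun T _ => ?_
  obtain ⟨C, hC⟩ := (isCompact_hull T.1).exists_bound_of_continuousOn (continuous_evV (u T)).continuousOn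
  refine MemLp.of_bound ((continuous_evV (u T)).aestronglyMeasurable.indicator
    isOpen_interior.measurableSet) (max C 0) (Eventually.of_forall fun x => ?_)
  by_cases hx : x ∈ interior (hull T.1)
  · rw [Set.indicator_of_mem hx]
    exact (hC x (interior_subset hx)).trans (le_max_left _ _)
  · rw [Set.indicator_of_notMem hx, norm_zero]
    exact le_max_right _ _

theorem exists_pwV_bound (u : M.Elem → VPoly) : ∃ C, ∀ x, ‖pwV u x‖ ≤ C := by
  have h : ∀ T : M.Elem, ∃ C, ∀ x ∈ hull T.1, ‖evV (u T) x‖ ≤ C := fun T =>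
    (isCompact_hull T.1).exists_bound_of_continuousOn (continuous_evV (u T)).continuousOn
  choose C hC using h
  refine ⟨∑ T, |C T|, fun x => ?_⟩
  rw [pwV_eq_sum]
  refine (norm_sum_le _ _).trans (Finset.sum_le_sum fun T _ => ?_)
  by_cases hx : x ∈ interior (hull T.1)
  · rw [Set.indicator_of_mem hx]
    exact (hC T x (interior_subset hx)).trans (le_abs_self _)
  · rw [Set.indicator_of_notMem hx, norm_zero]
    exact abs_nonneg _

theorem isFiniteMeasure_restrict_domain (hΩ : IsAdmissibleDomain Ω) :
    IsFiniteMeasure ((volume : Measure E).restrict Ω) :=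
  isFiniteMeasure_restrict.2 hΩ.bounded.measure_lt_top.ne

theorem ae_exists_mem_interior (hΩ : IsAdmissibleDomain Ω) (M : TetMesh Ω) :
    ∀ᵐ x ∂(volume.restrict Ω), ∃ T : M.Elem, x ∈ interior (hull T.1) := by
  have h : Ω =ᵐ[volume] (⋃ T ∈ (Finset.univ : Finset M.Elem), interior (hull T.1) : Set E) :=
    ae_eq_biUnion_interior _ (fun T _ => interior_hull_subset hΩ T) fun x hx => by
      obtain ⟨T, hT⟩ := exists_elem_of_mem_closure M (subset_closure hx)
      exact Set.mem_iUnion₂.2 ⟨T, Finset.mem_univ T, hT⟩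
  rw [Measure.restrict_congr_set h]
  refine (ae_restrict_mem (Finset.measurableSet_biUnion _ fun T _ =>
    isOpen_interior.measurableSet)).mono fun x hx => ?_
  obtain ⟨T, -, hT⟩ := Set.mem_iUnion₂.1 hx
  exact ⟨T, hT⟩

/-! ## Mollified barycentric coordinates -/

theorem contDiff_moll {δ : ℝ} {ρ : E → ℝ} (hρ : IsKernel δ ρ) (p : M.Elem → SPoly) :
    ContDiff ℝ ∞ (moll ρ p) := by
  refine ContDiff.sum fun T _ => ?_
  have h1 : conv (volume.restrict (hull T.1)) (ev (p T)) ρ =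
      convolution ((hull T.1).indicator (ev (p T))) ρ (ContinuousLinearMap.lsmul ℝ ℝ) volume := by
    ext y
    rw [conv, convolution, ← integral_indicator (measurableSet_hull _)]
    refine integral_congr_ae (Eventually.of_forall fun z => ?_)
    by_cases hz : z ∈ hull T.1 <;> simp [hz]
  rw [h1]
  refine hρ.hasCompactSupport.contDiff_convolution_right _ ?_ hρ.contDiff
  exact ((integrable_indicator_iff (measurableSet_hull _)).2
    (integrableOn_hull_volume T.1 (continuous_ev (p T)))).locallyIntegrable

theorem sum_setIntegral_kernel (hΩ : IsAdmissibleDomain Ω) (M : TetMesh Ω) {δ : ℝ} {ρ : E → ℝ}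
    (hρ : IsKernel δ ρ) (y : E) : ∑ T : M.Elem, ∫ z in hull T.1, ρ (y - z) ≤ 1 := by
  have hc : Continuous fun z => ρ (y - z) := (hρ.contDiff_sub y).continuous
  rw [← setIntegral_domain (M := M) hΩ (F := fun z => ρ (y - z)) (fun T => hc)
    (fun T => Eventually.of_forall fun _ => rfl), ← hρ.integral_eq,
    ← integral_sub_left_eq_self ρ volume y]
  refine setIntegral_le_integral ?_ (Eventually.of_forall fun z => hρ.nonneg _)
  exact (hρ.contDiff.continuous.integrable_of_hasCompactSupport hρ.hasCompactSupport).comp_sub_left y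

/-- The mollification is bounded by the values near the point. -/
theorem abs_moll_le (hΩ : IsAdmissibleDomain Ω) {δ : ℝ} {ρ : E → ℝ}
    (hρ : IsKernel δ ρ) {p : M.Elem → SPoly} {y : E} {C : ℝ} (hC : 0 ≤ C)
    (h : ∀ T : M.Elem, ∀ z ∈ hull T.1, z ∈ Metric.closedBall y δ → |ev (p T) z| ≤ C) :
    |moll ρ p y| ≤ C := by
  have hc : Continuous fun z => ρ (y - z) := (hρ.contDiff_sub y).continuous
  calc |moll ρ p y| ≤ ∑ T : M.Elem, |conv (volume.restrict (hull T.1)) (ev (p T)) ρ y| :=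
        Finset.abs_sum_le_sum_abs _ _
    _ ≤ ∑ T : M.Elem, ∫ z in hull T.1, C * ρ (y - z) := by
        refine Finset.sum_le_sum fun T _ => ?_
        rw [conv]
        refine (abs_integral_le_integral_abs).trans (setIntegral_mono_on
          (integrableOn_hull_volume _ ((continuous_ev _).mul hc).abs)
          (integrableOn_hull_volume _ (continuous_const.mul hc)) (measurableSet_hull _) fun z hz => ?_)
        rw [abs_mul, abs_of_nonneg (hρ.nonneg _)]
        by_cases hzb : z ∈ Metric.closedBall y δ
        · exact mul_le_mul_of_nonneg_right (h T z hz hzb) (hρ.nonneg _)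
        · rw [hρ.eq_zero hzb, mul_zero, mul_zero]
    _ = C * ∑ T : M.Elem, ∫ z in hull T.1, ρ (y - z) := by
        rw [Finset.mul_sum]
        exact Finset.sum_congr rfl fun T _ => integral_const_mul _ _
    _ ≤ C := mul_le_of_le_one_right hC (sum_setIntegral_kernel hΩ M hρ y)

theorem moll_sub {ρ : E → ℝ} (hρ : Continuous ρ) (p q : M.Elem → SPoly) (y : E) :
    moll ρ (fun T => p T - q T) y = moll ρ p y - moll ρ q y := by
  have hc : Continuous fun z => ρ (y - z) := hρ.comp (by fun_prop)
  simp only [moll, ← Finset.sum_sub_distrib]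
  refine Finset.sum_congr rfl fun T _ => ?_
  simp only [conv, ev_sub, sub_mul]
  exact integral_sub (integrableOn_hull_volume _ ((continuous_ev _).mul hc))
    (integrableOn_hull_volume _ ((continuous_ev _).mul hc))

theorem pd_moll_of_continuous (hΩ : IsAdmissibleDomain Ω) (o : M.FaceOrientation) {δ : ℝ} {ρ : E → ℝ}
    (hρ : IsKernel δ ρ) {p : M.Elem → SPoly}
    (hp : ∀ f : M.IntFace, ∀ z ∈ hull f.1, ev (p (o.plus f)) z = ev (p (o.minus f)) z) {y : E}
    (hy : Metric.closedBall y δ ⊆ Ω) (i : Fin 3) :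
    pd i (moll ρ p) y = moll ρ (fun T => MvPolynomial.pderiv i (p T)) y := by
  rw [pd_moll hΩ o hρ p hy, Finset.sum_eq_zero, mul_zero, zero_add]
  intro f _
  have : avg f.1 (fun z => (ev (p (o.plus f)) z - ev (p (o.minus f)) z) * ρ (y - z)) = 0 := by
    rw [← avg_const (face_indep f) (face_nonempty f) 0]
    exact avg_congr fun z hz => by rw [hp f z hz, sub_self, zero_mul]
  rw [this, mul_zero]

end TetMesh

namespace TetMesh

variable {Ω : Set E} {M : TetMesh Ω}

/-! ## Edge functions -/

/-- Membership in Ω is constant on each open simplex. A point y near x is compared with z + (y − x),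
which is near z and hence in some element T' that contains z and x. Coordinates that are positive at
x stay positive at y. The others vanish at x and z, so being affine they agree at y and at the
translated point, where they are nonnegative. -/
theorem mem_of_same_carrier (hΩ : IsAdmissibleDomain Ω) {T : M.Elem} {x z : E} (hx : x ∈ hull T.1)
    (hz : z ∈ hull T.1) (hzΩ : z ∈ Ω)
    (h : ∀ v ∈ T.1, 0 < ev (lam T.1 v) x ↔ 0 < ev (lam T.1 v) z) : x ∈ Ω := by
  rw [← hΩ.interior_closure, mem_interior_iff_mem_nhds]
  obtain ⟨r, hr, hball⟩ := exists_ball_mem_hull M z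
  have hN : Metric.ball z r ∩ Ω ∈ 𝓝 z :=
    Filter.inter_mem (Metric.ball_mem_nhds z hr) (hΩ.isOpen.mem_nhds hzΩ)
  have hc : Tendsto (fun y => z + (y - x)) (𝓝 x) (𝓝 z) := by
    have : Continuous fun y : E => z + (y - x) := by fun_prop
    simpa using this.tendsto x
  have h2 : ∀ᶠ y in 𝓝 x, ∀ T' : M.Elem, ∀ v ∈ T'.1, 0 < ev (lam T'.1 v) x → 0 < ev (lam T'.1 v) y := by
    refine eventually_all.2 fun T' => (Finset.eventually_all _).2 fun v _ => ?_
    by_cases hp : 0 < ev (lam T'.1 v) x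
    · filter_upwards [(continuous_ev (lam T'.1 v)).continuousAt.eventually (lt_mem_nhds hp)] with y hy _
      exact hy
    · exact Eventually.of_forall fun y h => absurd h hp
  filter_upwards [hc.eventually hN, h2] with y hy hpos
  obtain ⟨T', hT'⟩ := exists_elem_of_mem_closure M (subset_closure hy.2)
  have hzT' : z ∈ hull T'.1 := hball T' _ hy.1 hT'
  have hxT' : x ∈ hull T'.1 := by
    refine convexHull_mono (Finset.coe_subset.2 (Finset.inter_subset_right (s₁ := T.1))) ?_
    refine ((isTet T).mem_hull_subset_iff Finset.inter_subset_left).2 ⟨hx, fun v hv hv' => ?_⟩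
    have hvT' : v ∉ T'.1 := fun h => hv' (Finset.mem_inter.2 ⟨hv, h⟩)
    have h0 := lam_eq_zero_of_notMem hz hzT' hv hvT'
    have h1 : ¬ 0 < ev (lam T.1 v) x := fun hp => by
      have := (h v hv).1 hp
      exact this.ne' h0
    exact le_antisymm (not_lt.1 h1) ((isTet T).mem_hull_iff.1 hx v hv)
  refine hull_subset_closure T' ((isTet T').mem_hull_iff.2 fun v hv => ?_)
  by_cases hp : 0 < ev (lam T'.1 v) x
  · exact (hpos T' v hv hp).le
  have h0 : ev (lam T'.1 v) z = 0 := by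
    refine le_antisymm (not_lt.1 fun hlt => hp ?_) ((isTet T').mem_hull_iff.1 hzT' v hv)
    rw [lam_eq_lam hzT' hz] at hlt
    rw [lam_eq_lam hxT' hx]
    by_cases hvT : v ∈ T.1
    · exact (h v hvT).2 hlt
    · rw [(isTet T).lam_of_notMem hvT] at hlt
      exact absurd hlt (lt_irrefl _)
  have e1 := (isTet T').lam_sub v (z + (y - x)) z
  have e2 := (isTet T').lam_sub v y x
  rw [add_sub_cancel_left] at e1
  have e3 := (isTet T').mem_hull_iff.1 hT' v hv
  have e4 := (isTet T').mem_hull_iff.1 hxT' v hv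
  linarith

/-- A point on the segment from z to x close to z is still in Ω and already has the same positive
coordinates as x. -/
theorem mem_of_carrier_subset (hΩ : IsAdmissibleDomain Ω) {T : M.Elem} {x z : E} (hx : x ∈ hull T.1)
    (hz : z ∈ hull T.1) (hzΩ : z ∈ Ω)
    (h : ∀ v ∈ T.1, 0 < ev (lam T.1 v) z → 0 < ev (lam T.1 v) x) : x ∈ Ω := by
  have hc : Tendsto (fun t : ℝ => z + t • (x - z)) (𝓝[>] 0) (𝓝 z) := by
    have : Continuous fun t : ℝ => z + t • (x - z) := by fun_prop
    have h := this.tendsto 0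
    simp only [zero_smul, add_zero] at h
    exact h.mono_left nhdsWithin_le_nhds
  obtain ⟨t, ht, ht0, ht1⟩ := ((hc.eventually (hΩ.isOpen.mem_nhds hzΩ)).and
    (Ioo_mem_nhdsGT (zero_lt_one' ℝ))).exists
  have hev : ∀ v ∈ T.1, ev (lam T.1 v) (z + t • (x - z)) =
      (1 - t) * ev (lam T.1 v) z + t * ev (lam T.1 v) x := by
    intro v hv
    have e1 := (isTet T).lam_sub v (z + t • (x - z)) z
    have e2 := (isTet T).lam_sub v x z
    rw [add_sub_cancel_left, WithLp.ofLp_smul, dotProduct_smul, ← e2, smul_eq_mul] at e1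
    linarith
  have hlam : ∀ {y}, y ∈ hull T.1 → ∀ v ∈ T.1, 0 ≤ ev (lam T.1 v) y := fun hy =>
    (isTet T).mem_hull_iff.1 hy
  refine mem_of_same_carrier hΩ hx (z := z + t • (x - z)) ?_ ht fun v hv => ?_
  · refine (isTet T).mem_hull_iff.2 fun v hv => ?_
    rw [hev v hv]
    have := hlam hz v hv
    have := hlam hx v hv
    have : 0 ≤ 1 - t := by linarith
    positivity
  · rw [hev v hv]
    have h1 := hlam hz v hv
    have h3 : 0 < 1 - t := by linarith
    constructor
    · intro hp
      positivity
    · intro hp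
      by_contra hn
      have h4 : ev (lam T.1 v) x = 0 := le_antisymm (not_lt.1 hn) (hlam hx v hv)
      have h5 : ev (lam T.1 v) z = 0 := le_antisymm (not_lt.1 fun hh => hn (h v hv hh)) h1
      rw [h4, h5] at hp
      simp at hp

/-- If the edge meets Ω, so does its whole open star, the set where the hat functions of both ends
are positive. This is what lets edge functions be approximated by fields with compact support in Ω.
-/
theorem mem_of_lam_pos (hΩ : IsAdmissibleDomain Ω) {T : M.Elem} {a b x : E}
    (hab : (hull {a, b} ∩ Ω).Nonempty) (hx : x ∈ hull T.1) (ha : 0 < ev (lam T.1 a) x)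
    (hb : 0 < ev (lam T.1 b) x) : x ∈ Ω := by
  have hmem : ∀ v, 0 < ev (lam T.1 v) x → v ∈ T.1 := fun v hv => by
    by_contra h
    rw [(isTet T).lam_of_notMem h] at hv
    exact lt_irrefl _ hv
  have hs : ({a, b} : Finset E) ⊆ T.1 := by
    intro v hv
    rcases Finset.mem_insert.1 hv with rfl | hv
    · exact hmem _ ha
    · rw [Finset.mem_singleton.1 hv]; exact hmem _ hb
  obtain ⟨z, hz, hzΩ⟩ := hab
  have hz' := ((isTet T).mem_hull_subset_iff hs).1 hz
  refine mem_of_carrier_subset hΩ hx hz'.1 hzΩ fun v hv hp => ?_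
  by_cases hve : v ∈ ({a, b} : Finset E)
  · rcases Finset.mem_insert.1 hve with rfl | hve
    · exact ha
    · rw [Finset.mem_singleton.1 hve]; exact hb
  · rw [hz'.2 v hv hve] at hp
    exact absurd hp (lt_irrefl _)

/-- The set of points where the hat function of `a` is at least `ε`. -/
def hatLevel (M : TetMesh Ω) (a : E) (ε : ℝ) : Set E :=
  ⋃ T : M.Elem, hull T.1 ∩ {z | ε ≤ ev (lam T.1 a) z}

theorem isCompact_hatLevel (a : E) (ε : ℝ) : IsCompact (hatLevel M a ε) :=
  isCompact_iUnion fun T => (isCompact_hull T.1).inter_right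
    (isClosed_le continuous_const (continuous_ev _))

/-- Compactness: otherwise points of the two level sets and points outside Ω would accumulate at a
common x. There both hat functions are at least ε, yet x is not in Ω, contrary to `mem_of_lam_pos`.
-/
theorem exists_radius (hΩ : IsAdmissibleDomain Ω) (M : TetMesh Ω) {a b : E}
    (hab : (hull {a, b} ∩ Ω).Nonempty) {ε : ℝ} (hε : 0 < ε) :
    ∃ δ : ℝ, 0 < δ ∧ δ ≤ ε ∧ ∀ y : E, (∃ z ∈ hatLevel M a ε, dist z y ≤ δ) →
      (∃ z ∈ hatLevel M b ε, dist z y ≤ δ) → Metric.closedBall y δ ⊆ Ω := by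
  by_contra hcon
  push Not at hcon
  have hd : ∀ n : ℕ, 0 < ε / (n + 1) ∧ ε / (n + 1) ≤ ε := fun n =>
    ⟨by positivity, div_le_self hε.le (by linarith [n.cast_nonneg (α := ℝ)])⟩
  choose y hy using fun n : ℕ => hcon (ε / (n + 1)) (hd n).1 (hd n).2
  choose z hz hzy using fun n => (hy n).1
  choose z' hz' hzy' using fun n => (hy n).2.1
  choose q hq hqΩ using fun n => Set.not_subset.1 (hy n).2.2
  obtain ⟨x, hx, s, hs, hlim⟩ := (isCompact_hatLevel (M := M) a ε).tendsto_subseq hz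
  have hδ : Tendsto (fun n => 2 * (ε / ((s n : ℝ) + 1))) atTop (𝓝 0) := by
    have h := (tendsto_const_div_atTop_nhds_zero_nat (2 * ε)).comp
      ((tendsto_add_atTop_nat 1).comp hs.tendsto_atTop)
    refine h.congr fun n => ?_
    simp only [Function.comp_apply]
    push_cast
    ring
  have hlim' : Tendsto (z' ∘ s) atTop (𝓝 x) := by
    refine (tendsto_iff_of_dist (squeeze_zero (fun _ => dist_nonneg) (fun n => ?_) hδ)).1 hlim
    have h1 := hzy (s n)
    have h2 := hzy' (s n)
    have h3 := dist_triangle_right (z (s n)) (z' (s n)) (y (s n))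
    simp only [Function.comp_apply]
    linarith
  have hlim'' : Tendsto (q ∘ s) atTop (𝓝 x) := by
    refine (tendsto_iff_of_dist (squeeze_zero (fun _ => dist_nonneg) (fun n => ?_) hδ)).1 hlim
    have h1 := hzy (s n)
    have h2 := Metric.mem_closedBall.1 (hq (s n))
    have h3 := dist_triangle_right (z (s n)) (q (s n)) (y (s n))
    simp only [Function.comp_apply]
    linarith
  have hxb : x ∈ hatLevel M b ε :=
    (isCompact_hatLevel b ε).isClosed.mem_of_tendsto hlim' (Eventually.of_forall fun n => hz' _)
  have hxΩ : x ∉ Ω :=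
    hΩ.isOpen.isClosed_compl.mem_of_tendsto hlim'' (Eventually.of_forall fun n => hqΩ _)
  obtain ⟨T, hT, hTa⟩ := Set.mem_iUnion.1 hx
  obtain ⟨T', hT', hTb⟩ := Set.mem_iUnion.1 hxb
  have hTa' : ε ≤ ev (lam T.1 a) x := hTa
  have hTb' : ε ≤ ev (lam T'.1 b) x := hTb
  rw [lam_eq_lam hT' hT] at hTb'
  exact hxΩ (mem_of_lam_pos hΩ hab hT (hε.trans_le hTa') (hε.trans_le hTb'))

/-- The lowest order edge function of the edge from `a` to `b`. -/
def edgeField (M : TetMesh Ω) (a b : E) : M.Elem → VPoly := fun T =>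
  lam T.1 a • gradP (lam T.1 b) - lam T.1 b • gradP (lam T.1 a)

theorem evV_edgeField (a b : E) (T : M.Elem) (x : E) : evV (edgeField M a b T) x =
    ev (lam T.1 a) x • glam T.1 b - ev (lam T.1 b) x • glam T.1 a := by
  ext i
  simp [edgeField, evV, (isTet T).gradP_lam_eq]

theorem edgeField_mem_nedelec {k : ℕ} (hk : 1 ≤ k) (a b : E) (T : M.Elem) :
    edgeField M a b T ∈ Nedelec k := by
  have e : edgeField M a b T =
      (fun i => MvPolynomial.C (ev (lam T.1 a) 0 * glam T.1 b i - ev (lam T.1 b) 0 * glam T.1 a i)) +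
        idP ⨯₃ fun i => MvPolynomial.C ((glam T.1 b ⨯₃ glam T.1 a) i) := by
    rw [edgeField, (isTet T).gradP_lam_eq, (isTet T).gradP_lam_eq]
    have ha := (isTet T).lam_eq a
    have hb := (isTet T).lam_eq b
    generalize ev (lam T.1 a) 0 = α at ha ⊢
    generalize ev (lam T.1 b) 0 = β at hb ⊢
    rw [ha, hb]
    generalize glam T.1 a = A
    generalize glam T.1 b = B
    funext i
    fin_cases i <;>
    · simp [affPoly, cross_apply, idP, Fin.sum_univ_three]
      ring
  rw [e]
  exact mem_nedelec hk (fun i => C_mem_polyDeg _ _) fun i => C_mem_polyDeg _ _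

theorem evV_curlP_edgeField (a b : E) (T : M.Elem) (x : E) :
    evV (curlP (edgeField M a b T)) x = (2 : ℝ) • (glam T.1 a ⨯₃ glam T.1 b) := by
  have h : ∀ i j, ev (MvPolynomial.pderiv j (edgeField M a b T i)) x =
      glam T.1 a j * glam T.1 b i - glam T.1 b j * glam T.1 a i := by
    intro i j
    have e : ∀ v, MvPolynomial.pderiv j (lam T.1 v) = MvPolynomial.C (glam T.1 v j) := fun v =>
      congrFun ((isTet T).gradP_lam_eq v) j
    simp [edgeField, (isTet T).gradP_lam_eq, e, mul_comm]
  ext i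
  fin_cases i <;>
  · simp [evV, curlP, h, cross_apply]
    ring

theorem moll_nonneg {δ : ℝ} {ρ : E → ℝ} (hρ : IsKernel δ ρ) {p : M.Elem → SPoly}
    (hp : ∀ T : M.Elem, ∀ z ∈ hull T.1, 0 ≤ ev (p T) z) (y : E) : 0 ≤ moll ρ p y :=
  Finset.sum_nonneg fun T _ => setIntegral_nonneg (measurableSet_hull _) fun z hz =>
    mul_nonneg (hp T z hz) (hρ.nonneg _)

theorem lam_nonneg (T : M.Elem) (a : E) {z : E} (hz : z ∈ hull T.1) : 0 ≤ ev (lam T.1 a) z := by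
  by_cases h : a ∈ T.1
  · exact (isTet T).mem_hull_iff.1 hz a h
  · rw [(isTet T).lam_of_notMem h]

theorem lam_le_one (T : M.Elem) (a : E) {z : E} (hz : z ∈ hull T.1) : ev (lam T.1 a) z ≤ 1 := by
  by_cases h : a ∈ T.1
  · rw [← (isTet T).sum_lam z]
    exact Finset.single_le_sum (f := fun v => ev (lam T.1 v) z)
      (fun v _ => lam_nonneg T v hz) h
  · rw [(isTet T).lam_of_notMem h]
    exact zero_le_one

theorem glam_of_notMem (T : M.Elem) {a : E} (h : a ∉ T.1) : glam T.1 a = 0 := by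
  have h0 : lam T.1 a = 0 := ev_injective fun x => by rw [(isTet T).lam_of_notMem h, ev_zero]
  rw [← (isTet T).gradP_lam a 0, h0, gradP_zero, evV_zero]

/-- The mollified hat function of `a`. -/
def mollHat (M : TetMesh Ω) (ρ : E → ℝ) (a : E) : E → ℝ := moll ρ fun T : M.Elem => lam T.1 a

/-- The mollified hat function of `a`, truncated at level `ε`. -/
def truncHat (M : TetMesh Ω) (ε : ℝ) (ρ : E → ℝ) (a : E) (y : E) : ℝ := trunc ε (mollHat M ρ a y)

section

variable {ε δ : ℝ} {ρ : E → ℝ}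

theorem mollHat_nonneg (hρ : IsKernel δ ρ) (a y : E) : 0 ≤ mollHat M ρ a y :=
  moll_nonneg hρ (fun T z hz => lam_nonneg T a hz) y

theorem mollHat_le_one (hΩ : IsAdmissibleDomain Ω) (hρ : IsKernel δ ρ) (a y : E) :
    mollHat M ρ a y ≤ 1 :=
  (le_abs_self _).trans (abs_moll_le hΩ hρ zero_le_one fun T z hz _ => by
    rw [abs_of_nonneg (lam_nonneg T a hz)]
    exact lam_le_one T a hz)

theorem pd_mollHat (hΩ : IsAdmissibleDomain Ω) (o : M.FaceOrientation) (hρ : IsKernel δ ρ) (a : E)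
    {y : E} (hy : Metric.closedBall y δ ⊆ Ω) (i : Fin 3) :
    pd i (mollHat M ρ a) y = moll ρ (fun T : M.Elem => MvPolynomial.C (glam T.1 a i)) y := by
  rw [mollHat, pd_moll_of_continuous hΩ o hρ
    (fun f z hz => lam_eq_lam (o.mem_plus hz) (o.mem_minus hz) a) hy]
  congr 1
  funext T
  exact congrFun ((isTet T).gradP_lam_eq a) i

theorem contDiff_truncHat (hρ : IsKernel δ ρ) (a : E) : ContDiff ℝ ∞ (truncHat M ε ρ a) :=
  (contDiff_trunc ε (n := ⊤)).comp (contDiff_moll hρ _)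

theorem pd_truncHat (hρ : IsKernel δ ρ) (a : E) (i : Fin 3) (y : E) :
    pd i (truncHat M ε ρ a) y = deriv (trunc ε) (mollHat M ρ a y) * pd i (mollHat M ρ a) y :=
  pd_trunc (differentiable_moll hρ _) ε i y

theorem exists_mem_hatLevel (hΩ : IsAdmissibleDomain Ω) (hρ : IsKernel δ ρ) (hε : 0 < ε) {a y : E}
    (h : ε < mollHat M ρ a y) : ∃ z ∈ hatLevel M a ε, dist z y ≤ δ := by
  by_contra! hcon
  refine h.not_ge ((le_abs_self _).trans (abs_moll_le hΩ hρ hε.le fun T z hz hzy => ?_))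
  rw [abs_of_nonneg (lam_nonneg T a hz)]
  by_contra! hlt
  exact (hcon z (Set.mem_iUnion.2 ⟨T, hz, hlt.le⟩)).not_ge (Metric.mem_closedBall.1 hzy)

theorem truncHat_eq_zero (hε : 0 < ε) (hρ : IsKernel δ ρ) {a y : E} (h : mollHat M ρ a y < ε) :
    truncHat M ε ρ a y = 0 ∧ grad (truncHat M ε ρ a) y = 0 := by
  refine ⟨trunc_of_le hε h.le, funext fun i => ?_⟩
  rw [grad, pd_truncHat hρ, deriv_trunc_of_lt hε h, zero_mul, Pi.zero_apply]

theorem mollHat_sub_le (hΩ : IsAdmissibleDomain Ω) (hρ : IsKernel δ ρ) (hδ : 0 ≤ δ) (a : E) {T : M.Elem} {y : E}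
    (hy : Metric.closedBall y δ ⊆ interior (hull T.1)) :
    |mollHat M ρ a y - ev (lam T.1 a) y| ≤ (∑ i, |glam T.1 a i|) * δ := by
  have h := moll_sub (M := M) hρ.contDiff.continuous (fun T => lam T.1 a)
    (fun _ => MvPolynomial.C (ev (lam T.1 a) y)) y
  rw [moll_const hρ (fun _ => ev (lam T.1 a) y) hy] at h
  rw [mollHat, ← h]
  refine abs_moll_le hΩ hρ (mul_nonneg (Finset.sum_nonneg fun i _ => abs_nonneg _) hδ)
    fun T' z hz hzy => ?_
  obtain rfl : T = T' := eq_of_mem_interior (hy hzy) hz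
  rw [ev_sub, ev_C, (isTet T).lam_sub, dotProduct, Finset.sum_mul]
  refine (Finset.abs_sum_le_sum_abs _ _).trans (Finset.sum_le_sum fun i _ => ?_)
  rw [abs_mul]
  refine mul_le_mul_of_nonneg_left ?_ (abs_nonneg _)
  have h1 := PiLp.norm_apply_le (z - y) i
  rw [Metric.mem_closedBall, dist_eq_norm] at hzy
  exact (Real.norm_eq_abs _ ▸ h1).trans hzy

/-- With the whole kernel inside one element, mollification reproduces the constant gradient
exactly, and above 2ε the truncation has slope one. If a is not a vertex of T, both sides vanish
whatever the truncation does. -/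
theorem grad_truncHat_eq (hΩ : IsAdmissibleDomain Ω) (o : M.FaceOrientation) (hε : 0 < ε)
    (hρ : IsKernel δ ρ) {a : E} {T : M.Elem} {y : E}
    (hy : Metric.closedBall y δ ⊆ interior (hull T.1)) (h : a ∈ T.1 → 2 * ε < mollHat M ρ a y) :
    grad (truncHat M ε ρ a) y = glam T.1 a := by
  funext i
  rw [grad, pd_truncHat hρ, pd_mollHat hΩ o hρ a (hy.trans (interior_hull_subset hΩ T)),
    moll_const hρ (fun T => glam T.1 a i) hy]
  by_cases ha : a ∈ T.1
  · rw [deriv_trunc_of_gt hε (h ha), one_mul]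
  · rw [glam_of_notMem T ha, Pi.zero_apply, mul_zero]

end

end TetMesh

/-! ### Smooth approximation of the edge functions -/

namespace TetMesh

variable {Ω : Set E} {M : TetMesh Ω}

theorem eventually_grad_truncHat_eq (hΩ : IsAdmissibleDomain Ω) (o : M.FaceOrientation)
    {ε δ : ℕ → ℝ} {ρ : ℕ → E → ℝ} (hε : ∀ n, 0 < ε n) (hε0 : Tendsto ε atTop (𝓝 0))
    (hδ : ∀ n, 0 < δ n) (hδ0 : Tendsto δ atTop (𝓝 0)) (hρ : ∀ n, IsKernel (δ n) (ρ n)) (a : E)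
    {T : M.Elem} {x : E} (hx : x ∈ interior (hull T.1)) :
    Tendsto (fun n => truncHat M (ε n) (ρ n) a x) atTop (𝓝 (ev (lam T.1 a) x)) ∧
      ∀ᶠ n in atTop, grad (truncHat M (ε n) (ρ n) a) x = glam T.1 a := by
  obtain ⟨r, hr, hball⟩ := Metric.isOpen_iff.1 isOpen_interior x hx
  have hsub : ∀ᶠ n in atTop, Metric.closedBall x (δ n) ⊆ interior (hull T.1) := by
    filter_upwards [hδ0.eventually (gt_mem_nhds hr)] with n hn
    exact (Metric.closedBall_subset_ball hn).trans hball
  have hlim : Tendsto (fun n => mollHat M (ρ n) a x) atTop (𝓝 (ev (lam T.1 a) x)) := by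
    rw [tendsto_iff_dist_tendsto_zero]
    have h0 : Tendsto (fun n => (∑ i, |glam T.1 a i|) * δ n) atTop (𝓝 0) := by
      simpa using hδ0.const_mul (∑ i, |glam T.1 a i|)
    refine squeeze_zero' (Eventually.of_forall fun _ => dist_nonneg) ?_ h0
    filter_upwards [hsub] with n hn
    rw [Real.dist_eq]
    exact mollHat_sub_le hΩ (hρ n) (hδ n).le a hn
  constructor
  · have h2 : Tendsto (fun n => 2 * ε n) atTop (𝓝 0) := by simpa using hε0.const_mul 2
    refine (tendsto_iff_of_dist (squeeze_zero (fun _ => dist_nonneg) (fun n => ?_) h2)).1 hlim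
    rw [dist_comm, Real.dist_eq]
    exact abs_trunc_sub_le (hε n) (mollHat_nonneg (hρ n) a x)
  · by_cases ha : a ∈ T.1
    · have hpos : 0 < ev (lam T.1 a) x := (isTet T).mem_interior_iff.1 hx a ha
      have h3 : Tendsto (fun n => mollHat M (ρ n) a x - 2 * ε n) atTop (𝓝 (ev (lam T.1 a) x)) := by
        simpa using hlim.sub (hε0.const_mul 2)
      filter_upwards [hsub, h3.eventually (lt_mem_nhds hpos)] with n hn hn'
      exact grad_truncHat_eq hΩ o (hε n) (hρ n) hn fun _ => by linarith
    · filter_upwards [hsub] with n hn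
      exact grad_truncHat_eq hΩ o (hε n) (hρ n) hn fun h => absurd h ha

theorem exists_grad_truncHat_bound (hΩ : IsAdmissibleDomain Ω) (o : M.FaceOrientation) (a : E) :
    ∃ C : ℝ, 0 ≤ C ∧ ∀ ε δ ρ, 0 < ε → IsKernel δ ρ → ∀ y : E, Metric.closedBall y δ ⊆ Ω →
      ∀ i, |pd i (truncHat M ε ρ a) y| ≤ C := by
  obtain ⟨K, hK, hK'⟩ := exists_deriv_trunc_le
  set G : ℝ := ∑ T : M.Elem, ∑ i, |glam T.1 a i|
  have hG : 0 ≤ G := Finset.sum_nonneg fun T _ => Finset.sum_nonneg fun i _ => abs_nonneg _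
  refine ⟨K * G, by positivity, fun ε δ ρ hε hρ y hy i => ?_⟩
  rw [pd_truncHat hρ, abs_mul, pd_mollHat hΩ o hρ a hy]
  refine mul_le_mul (hK' ε _ hε) ?_ (abs_nonneg _) hK
  refine abs_moll_le hΩ hρ hG fun T z _ _ => ?_
  rw [ev_C]
  exact (Finset.single_le_sum (f := fun i => |glam T.1 a i|) (fun i _ => abs_nonneg _)
    (Finset.mem_univ i)).trans (Finset.single_le_sum (f := fun T : M.Elem => ∑ i, |glam T.1 a i|)
    (fun T _ => Finset.sum_nonneg fun i _ => abs_nonneg _) (Finset.mem_univ T))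

theorem abs_truncHat_le (hΩ : IsAdmissibleDomain Ω) {ε δ : ℝ} {ρ : E → ℝ} (hρ : IsKernel δ ρ)
    (a y : E) : |truncHat M ε ρ a y| ≤ 1 := by
  rw [truncHat, abs_of_nonneg (trunc_nonneg (mollHat_nonneg hρ a y))]
  exact (trunc_le (mollHat_nonneg hρ a y)).trans (mollHat_le_one hΩ hρ a y)

theorem norm_cross_le {A B : V} {C : ℝ} (hA : ∀ i, |A i| ≤ C) (hB : ∀ i, |B i| ≤ C) :
    ‖(2 : ℝ) • (A ⨯₃ B)‖ ≤ 4 * (C * C) := by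
  have hC : 0 ≤ C := (abs_nonneg _).trans (hA 0)
  have h : ∀ i j, |A i * B j| ≤ C * C := fun i j => by
    rw [abs_mul]; exact mul_le_mul (hA i) (hB j) (abs_nonneg _) hC
  have h' : ∀ i j k l, |2 * (A i * B j - A k * B l)| ≤ 4 * (C * C) := fun i j k l => by
    have h1 := abs_le.1 (h i j)
    have h2 := abs_le.1 (h k l)
    rw [abs_le]
    constructor <;> linarith [h1.1, h1.2, h2.1, h2.2]
  refine (pi_norm_le_iff_of_nonneg (by positivity)).2 fun i => ?_
  rw [Real.norm_eq_abs]
  fin_cases i <;> simpa [cross_apply] using h' _ _ _ _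

theorem norm_whitney_le {S R : E → ℝ} {y : E} {C : ℝ} (hS : |S y| ≤ 1) (hR : |R y| ≤ 1)
    (hS' : ∀ i, |pd i S y| ≤ C) (hR' : ∀ i, |pd i R y| ≤ C) : ‖whitney S R y‖ ≤ 2 * C := by
  have hC : 0 ≤ C := (abs_nonneg _).trans (hS' 0)
  refine (pi_norm_le_iff_of_nonneg (by positivity)).2 fun i => ?_
  rw [Real.norm_eq_abs, whitney]
  refine (abs_sub _ _).trans ?_
  rw [abs_mul, abs_mul]
  nlinarith [hS' i, hR' i, abs_nonneg (pd i S y), abs_nonneg (pd i R y), abs_nonneg (S y), abs_nonneg (R y)]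

/-- The approximants are the Whitney fields of mollified and truncated hat functions. They are
supported where both mollified hats are at least ε, hence in Ω. They and their curls are uniformly
bounded and converge pointwise inside every element, so dominated convergence gives convergence in
H(curl). -/
theorem edgeField_mem_R0 (hΩ : IsAdmissibleDomain Ω) (o : M.FaceOrientation) {k : ℕ} (hk : 1 ≤ k)
    {a b : E} (hab : (hull {a, b} ∩ Ω).Nonempty) : edgeField M a b ∈ M.R0 k := by
  refine ⟨fun T => edgeField_mem_nedelec hk a b T, ?_⟩
  haveI := isFiniteMeasure_restrict_domain hΩ
  set ε : ℕ → ℝ := fun n => 1 / ((n : ℝ) + 1)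
  have hε : ∀ n, 0 < ε n := fun n => Nat.one_div_pos_of_nat
  have hε0 : Tendsto ε atTop (𝓝 0) := tendsto_one_div_add_atTop_nhds_zero_nat
  -- The radius is taken for ε/2, so that the closed condition that a mollified hat is at least ε
  -- gives the strict inequality required by `exists_mem_hatLevel`.
  choose δ hδ hδε hrad using fun n => exists_radius hΩ M hab (hε := half_pos (hε n))
  have hδ0 : Tendsto δ atTop (𝓝 0) := by
    refine squeeze_zero (fun n => (hδ n).le) (fun n => (hδε n).trans ?_) hε0
    linarith [hε n]
  choose ρ hρ using fun n => exists_isKernel (hδ n)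
  set S : ℕ → E → ℝ := fun n => truncHat M (ε n) (ρ n) a
  set R : ℕ → E → ℝ := fun n => truncHat M (ε n) (ρ n) b
  have hS : ∀ n, ContDiff ℝ ∞ (S n) := fun n => contDiff_truncHat (hρ n) a
  have hR : ∀ n, ContDiff ℝ ∞ (R n) := fun n => contDiff_truncHat (hρ n) b
  -- The gradient formula for the mollification, and so the uniform bound, is available only where
  -- the kernel stays in Ω. Elsewhere one of the two truncated hats vanishes together with its
  -- gradient.
  have hdich : ∀ n y, Metric.closedBall y (δ n) ⊆ Ω ∨
      (whitney (S n) (R n) y = 0 ∧ curl (whitney (S n) (R n)) y = 0) := by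
    intro n y
    rw [curl_whitney (hS n) (hR n)]
    rcases lt_or_ge (mollHat M (ρ n) a y) (ε n) with h | h
    · obtain ⟨h1, h2⟩ := truncHat_eq_zero (hε n) (hρ n) h
      refine Or.inr ⟨funext fun i => ?_, ?_⟩
      · have h3 := congrFun h2 i
        simp only [grad, Pi.zero_apply] at h3
        simp only [whitney, S, h1, h3, Pi.zero_apply, zero_mul, mul_zero, sub_zero]
      · simp only [S, h2]
        simp
    rcases lt_or_ge (mollHat M (ρ n) b y) (ε n) with h' | h'
    · obtain ⟨h1, h2⟩ := truncHat_eq_zero (hε n) (hρ n) h'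
      refine Or.inr ⟨funext fun i => ?_, ?_⟩
      · have h3 := congrFun h2 i
        simp only [grad, Pi.zero_apply] at h3
        simp only [whitney, R, h1, h3, Pi.zero_apply, zero_mul, mul_zero, sub_zero]
      · simp only [R, h2]
        simp
    · left
      have hh : ε n / 2 < ε n := half_lt_self (hε n)
      exact hrad n y (exists_mem_hatLevel hΩ (hρ n) (half_pos (hε n)) (hh.trans_le h))
        (exists_mem_hatLevel hΩ (hρ n) (half_pos (hε n)) (hh.trans_le h'))
  obtain ⟨Ca, hCa, hCa'⟩ := exists_grad_truncHat_bound hΩ o a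
  obtain ⟨Cb, hCb, hCb'⟩ := exists_grad_truncHat_bound hΩ o b
  have hSb : ∀ n y, Metric.closedBall y (δ n) ⊆ Ω → ∀ i, |pd i (S n) y| ≤ max Ca Cb := fun n y hy i =>
    (hCa' _ _ _ (hε n) (hρ n) y hy i).trans (le_max_left _ _)
  have hRb : ∀ n y, Metric.closedBall y (δ n) ⊆ Ω → ∀ i, |pd i (R n) y| ≤ max Ca Cb := fun n y hy i =>
    (hCb' _ _ _ (hε n) (hρ n) y hy i).trans (le_max_right _ _)
  have hC0 : 0 ≤ max Ca Cb := hCa.trans (le_max_left _ _)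
  have hb1 : ∀ n y, ‖whitney (S n) (R n) y‖ ≤ 2 * max Ca Cb := by
    intro n y
    rcases hdich n y with hy | ⟨hy, -⟩
    · exact norm_whitney_le (abs_truncHat_le hΩ (hρ n) a y) (abs_truncHat_le hΩ (hρ n) b y)
        (hSb n y hy) (hRb n y hy)
    · rw [hy, norm_zero]; positivity
  have hb2 : ∀ n y, ‖curl (whitney (S n) (R n)) y‖ ≤ 4 * (max Ca Cb * max Ca Cb) := by
    intro n y
    rcases hdich n y with hy | ⟨-, hy⟩
    · rw [curl_whitney (hS n) (hR n)]
      exact norm_cross_le (hSb n y hy) (hRb n y hy)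
    · rw [hy, norm_zero]; positivity
  have hcc : ∀ n, Continuous (curl (whitney (S n) (R n))) := by
    intro n
    rw [show curl (whitney (S n) (R n)) = fun y => (2 : ℝ) • (grad (S n) y ⨯₃ grad (R n) y) from
      funext fun y => curl_whitney (hS n) (hR n) y]
    have hpS := fun i => (contDiff_pd (hS n) i).continuous
    have hpR := fun i => (contDiff_pd (hR n) i).continuous
    refine continuous_pi fun i => ?_
    fin_cases i <;> simp [cross_apply, grad] <;> fun_prop
  refine ⟨memLp_pwV _, memLp_pwV _, fun n => whitney (S n) (R n), fun n => ?_, ?_, ?_⟩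
  · have hcl : IsClosed {y | ε n ≤ mollHat M (ρ n) a y ∧ ε n ≤ mollHat M (ρ n) b y} := by
      have hc : ∀ a, Continuous (mollHat M (ρ n) a) := fun a => (contDiff_moll (hρ n) _).continuous
      exact (isClosed_le continuous_const (hc a)).inter (isClosed_le continuous_const (hc b))
    have hsupp : tsupport (whitney (S n) (R n)) ⊆
        {y | ε n ≤ mollHat M (ρ n) a y ∧ ε n ≤ mollHat M (ρ n) b y} := by
      refine closure_minimal (fun y hy => ?_) hcl
      by_contra hcon
      refine hy ?_
      rw [Set.mem_ofPred_eq, not_and_or, not_le, not_le] at hcon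
      rcases hcon with h | h
      · obtain ⟨h1, h2⟩ := truncHat_eq_zero (hε n) (hρ n) h
        funext i
        have h3 := congrFun h2 i
        simp only [grad, Pi.zero_apply] at h3
        simp only [whitney, S, h1, h3, Pi.zero_apply, zero_mul, mul_zero, sub_zero]
      · obtain ⟨h1, h2⟩ := truncHat_eq_zero (hε n) (hρ n) h
        funext i
        have h3 := congrFun h2 i
        simp only [grad, Pi.zero_apply] at h3
        simp only [whitney, R, h1, h3, Pi.zero_apply, zero_mul, mul_zero, sub_zero]
    have hsub : tsupport (whitney (S n) (R n)) ⊆ Ω := by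
      intro y hy
      have hh : ε n / 2 < ε n := half_lt_self (hε n)
      have h := hsupp hy
      exact hrad n y (exists_mem_hatLevel hΩ (hρ n) (half_pos (hε n)) (hh.trans_le h.1))
        (exists_mem_hatLevel hΩ (hρ n) (half_pos (hε n)) (hh.trans_le h.2))
        (Metric.mem_closedBall_self (hδ n).le)
    exact ⟨contDiff_whitney (hS n) (hR n), Metric.isCompact_of_isClosed_isBounded
      (isClosed_tsupport _) (hΩ.bounded.subset hsub), hsub⟩
  · obtain ⟨K, hK⟩ := exists_pwV_bound (edgeField M a b)
    refine tendsto_eLpNorm_of_bounded (C := K + 2 * max Ca Cb) (fun n => ?_) (fun n => ?_) ?_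
    · exact (memLp_pwV (edgeField M a b)).1.sub
        (contDiff_whitney (hS n) (hR n)).continuous.aestronglyMeasurable
    · exact Eventually.of_forall fun x => (norm_sub_le _ _).trans (add_le_add (hK x) (hb1 n x))
    · filter_upwards [ae_exists_mem_interior hΩ M] with x hx
      obtain ⟨T, hT⟩ := hx
      obtain ⟨h1, h2⟩ := eventually_grad_truncHat_eq hΩ o hε hε0 hδ hδ0 hρ a hT
      obtain ⟨h3, h4⟩ := eventually_grad_truncHat_eq hΩ o hε hε0 hδ hδ0 hρ b hT
      have h5 : Tendsto (fun n => S n x • glam T.1 b - R n x • glam T.1 a) atTop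
          (𝓝 (ev (lam T.1 a) x • glam T.1 b - ev (lam T.1 b) x • glam T.1 a)) :=
        (h1.smul_const _).sub (h3.smul_const _)
      rw [← evV_edgeField, ← pwV_eq (edgeField M a b) hT] at h5
      have h6 := (tendsto_const_nhds (x := pwV (edgeField M a b) x)).sub h5
      rw [sub_self] at h6
      refine h6.congr' ?_
      filter_upwards [h2, h4] with n hn hn'
      have e : whitney (S n) (R n) x = S n x • grad (R n) x - R n x • grad (S n) x := rfl
      rw [Pi.sub_apply, e]
      simp only [S, R, hn, hn']
  · obtain ⟨K, hK⟩ := exists_pwV_bound (curlh (edgeField M a b))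
    refine tendsto_eLpNorm_of_bounded (C := K + 4 * (max Ca Cb * max Ca Cb)) (fun n => ?_)
      (fun n => ?_) ?_
    · exact (memLp_pwV (curlh (edgeField M a b))).1.sub (hcc n).aestronglyMeasurable
    · exact Eventually.of_forall fun x => (norm_sub_le _ _).trans (add_le_add (hK x) (hb2 n x))
    · filter_upwards [ae_exists_mem_interior hΩ M] with x hx
      obtain ⟨T, hT⟩ := hx
      obtain ⟨-, h2⟩ := eventually_grad_truncHat_eq hΩ o hε hε0 hδ hδ0 hρ a hT
      obtain ⟨-, h4⟩ := eventually_grad_truncHat_eq hΩ o hε hε0 hδ hδ0 hρ b hT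
      refine tendsto_const_nhds.congr' ?_
      filter_upwards [h2, h4] with n hn hn'
      rw [Pi.sub_apply, pwV_eq _ hT, curlh, evV_curlP_edgeField, curl_whitney (hS n) (hR n)]
      simp only [S, R, hn, hn', sub_self]

end TetMesh

/-! ## The edge condition -/

theorem pd_evV_cross (u G : VPoly) (x : E) :
    ∑ i, pd i (fun y => (evV u y ⨯₃ evV G y) i) x =
      evV G x ⬝ᵥ evV (curlP u) x - evV (curlP G) x ⬝ᵥ evV u x := by
  have h : ∀ i, (fun y => (evV u y ⨯₃ evV G y) i) = ev ((u ⨯₃ G) i) := by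
    intro i
    funext y
    fin_cases i <;> simp [cross_apply, evV]
  simp only [h, pd_ev]
  simp [cross_apply, evV, curlP, dotProduct, Fin.sum_univ_three]
  ring

namespace TetMesh

variable {Ω : Set E} {M : TetMesh Ω}

theorem areaNormal_dot_cross_eq_zero (T : M.Elem) {w a b : E}
    (h : a ∉ T.1.erase w ∨ b ∉ T.1.erase w) :
    areaNormal T.1 w ⬝ᵥ (glam T.1 a ⨯₃ glam T.1 b) = 0 := by
  have key : ∀ a, a ∉ T.1.erase w → a = w ∨ glam T.1 a = 0 := fun a ha => by
    by_cases haw : a = w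
    · exact Or.inl haw
    · exact Or.inr (glam_of_notMem T fun h => ha (Finset.mem_erase.2 ⟨haw, h⟩))
  rw [areaNormal, smul_dotProduct]
  rcases h with h | h
  · rcases key a h with rfl | h
    · rw [dot_self_cross, smul_zero]
    · simp [h]
  · rcases key b h with rfl | h
    · rw [dot_cross_self, smul_zero]
    · simp [h]

/-- On a face that does not contain the edge, one of the two hat functions vanishes and its gradient
is normal, so the edge function has no tangential trace there. Only faces around the edge survive in
the Green formula. -/
theorem areaNormal_dot_edgeField_cross (T : M.Elem) {w a b : E} (hw : w ∈ T.1)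
    (h : a ∉ T.1.erase w ∨ b ∉ T.1.erase w) {x : E} (hx : x ∈ hull (T.1.erase w)) (Y : V) :
    areaNormal T.1 w ⬝ᵥ (evV (edgeField M a b T) x ⨯₃ Y) = 0 := by
  have h0 : ev (lam T.1 w) x = 0 := lam_eq_zero_of_mem_face (isTet T) (Finset.erase_subset _ _) hw
    (Finset.notMem_erase _ _) hx
  have key : ∀ a, a ∉ T.1.erase w → ev (lam T.1 a) x = 0 ∧ ∃ c : ℝ, glam T.1 a = c • glam T.1 w :=
    fun a ha => by
    by_cases haw : a = w
    · exact ⟨haw ▸ h0, 1, by rw [haw, one_smul]⟩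
    · have hT : a ∉ T.1 := fun h => ha (Finset.mem_erase.2 ⟨haw, h⟩)
      exact ⟨(isTet T).lam_of_notMem hT x, 0, by rw [glam_of_notMem T hT, zero_smul]⟩
  rw [evV_edgeField, areaNormal]
  rcases h with h | h
  · obtain ⟨h1, c, h2⟩ := key a h
    rw [h1, h2]
    simp [dotProduct, cross_apply, Fin.sum_univ_three]
    ring
  · obtain ⟨h1, c, h2⟩ := key b h
    rw [h1, h2]
    simp [dotProduct, cross_apply, Fin.sum_univ_three]
    ring

/-- Hat functions are continuous across the face, so the two barycentric coordinates differ by a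
multiple of the coordinate opposite to f, whose gradient is normal. -/
theorem exists_glam_minus_eq (o : M.FaceOrientation) (f : M.IntFace) {v : E} (hv : v ∈ f.1) :
    ∃ c : ℝ, glam (o.minus f).1 v = glam (o.plus f).1 v + c • faceNormal o f := by
  set T := o.plus f
  set T' := o.minus f
  obtain ⟨hw, -, he⟩ := (isTet T).opp_spec (o.subset_plus f) f.2.2.1
  set p : SPoly := lam T'.1 v - lam T.1 v
  have hp : p ∈ PolyDeg 1 := Submodule.sub_mem _ ((isTet T').lam_mem v) ((isTet T).lam_mem v)
  have h0 : ∀ a ∈ T.1.erase (opp T.1 f.1), ev p a = 0 := by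
    intro a ha
    have ha' : a ∈ hull f.1 := subset_convexHull ℝ _ (he ▸ ha)
    rw [ev_sub, lam_eq_lam (o.mem_minus ha') (o.mem_plus ha') v, sub_self]
  have e : p = MvPolynomial.C (ev p (opp T.1 f.1)) * lam T.1 (opp T.1 f.1) :=
    ev_injective fun x => by rw [ev_mul, ev_C, (isTet T).ev_eq_mul_lam hw hp h0 x]
  have hvol := volume_hull_pos (isTet T).1 (isTet T).2
  refine ⟨ev p (opp T.1 f.1) * (volume.real (hull T.1))⁻¹, ?_⟩
  have h1 : evV (gradP p) 0 = ev p (opp T.1 f.1) • glam T.1 (opp T.1 f.1) := by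
    rw [e, MvPolynomial.C_mul', gradP_smul, evV_smul, (isTet T).gradP_lam]
    congr 1
    rw [ev_smul, (isTet T).lam_self hw, mul_one]
  rw [gradP_sub, evV_sub, (isTet T').gradP_lam, (isTet T).gradP_lam] at h1
  rw [faceNormal, areaNormal, smul_smul, mul_assoc, inv_mul_cancel₀ hvol.ne', mul_one, ← h1]
  abel

/-- The oriented area of the projection of the gradients of the hat functions of `a` and `b` to the
face `f`. -/
def edgeDet (o : M.FaceOrientation) (a b : E) (f : M.IntFace) : ℝ :=
  faceNormal o f ⬝ᵥ (glam (o.plus f).1 a ⨯₃ glam (o.plus f).1 b)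

theorem erase_opp_plus (o : M.FaceOrientation) (f : M.IntFace) :
    (o.plus f).1.erase (opp (o.plus f).1 f.1) = f.1 :=
  ((isTet _).opp_spec (o.subset_plus f) f.2.2.1).2.2

theorem erase_opp_minus (o : M.FaceOrientation) (f : M.IntFace) :
    (o.minus f).1.erase (opp (o.minus f).1 f.1) = f.1 :=
  ((isTet _).opp_spec (o.subset_minus f) f.2.2.1).2.2

theorem edgeDet_eq_zero (o : M.FaceOrientation) {a b : E} {f : M.IntFace}
    (h : a ∉ f.1 ∨ b ∉ f.1) : edgeDet o a b f = 0 :=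
  areaNormal_dot_cross_eq_zero _ (by rwa [erase_opp_plus])

theorem edgeDet_minus (o : M.FaceOrientation) (a b : E) (f : M.IntFace) :
    areaNormal (o.minus f).1 (opp (o.minus f).1 f.1) ⬝ᵥ
      (glam (o.minus f).1 a ⨯₃ glam (o.minus f).1 b) = -edgeDet o a b f := by
  by_cases h : a ∉ f.1 ∨ b ∉ f.1
  · rw [edgeDet_eq_zero o h, areaNormal_dot_cross_eq_zero _ (by rwa [erase_opp_minus]), neg_zero]
  · push Not at h
    obtain ⟨c, hc⟩ := exists_glam_minus_eq o f h.1
    obtain ⟨d, hd⟩ := exists_glam_minus_eq o f h.2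
    rw [areaNormal_minus, hc, hd, edgeDet]
    simp [dotProduct, cross_apply, Fin.sum_univ_three]
    ring

theorem isInternal_of_mem (hΩ : IsAdmissibleDomain Ω) {a b : E}
    (hab : (hull {a, b} ∩ Ω).Nonempty) {T : M.Elem} {w : E} (hw : w ∈ T.1)
    (h : ∀ f : M.IntFace, f.1 ≠ T.1.erase w) : a ∉ T.1.erase w ∨ b ∉ T.1.erase w := by
  by_contra hcon
  push Not at hcon
  obtain ⟨z, hz, hzΩ⟩ := hab
  have hs : ({a, b} : Finset E) ⊆ T.1.erase w := by
    intro v hv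
    rcases Finset.mem_insert.1 hv with rfl | hv
    · exact hcon.1
    · rw [Finset.mem_singleton.1 hv]; exact hcon.2
  exact notMem_of_forall_ne hΩ hw h (convexHull_mono (Finset.coe_subset.2 hs) hz) hzΩ

/-- Regrouping a sum over faces around an edge by elements. -/
theorem sum_edgeDet_mul (hΩ : IsAdmissibleDomain Ω) (o : M.FaceOrientation) {a b : E}
    (hab : (hull {a, b} ∩ Ω).Nonempty) (g : M.Elem → ℝ) :
    ∑ f : M.IntFace, edgeDet o a b f * (g (o.plus f) - g (o.minus f)) = 0 := by
  have h := sum_elem_eq_sum_intFace o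
    (F := fun T w => areaNormal T.1 w ⬝ᵥ (glam T.1 a ⨯₃ glam T.1 b) * g T)
    (fun T w hw hf => by
      rw [areaNormal_dot_cross_eq_zero T (isInternal_of_mem hΩ hab hw hf), zero_mul])
  -- The area normals of a tetrahedron sum to zero, so each element contributes nothing, whatever
  -- value g has on it.
  have h0 : ∀ T : M.Elem, ∑ w ∈ T.1, areaNormal T.1 w ⬝ᵥ (glam T.1 a ⨯₃ glam T.1 b) * g T = 0 := by
    intro T
    rw [← Finset.sum_mul, ← sum_dotProduct]
    simp only [areaNormal]
    rw [← Finset.smul_sum, (isTet T).sum_glam, smul_zero, zero_dotProduct, zero_mul]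
  rw [Finset.sum_eq_zero fun T _ => h0 T] at h
  rw [h]
  refine Finset.sum_congr rfl fun f _ => ?_
  rw [edgeDet_minus, ← faceNormal, ← edgeDet]
  ring

end TetMesh

/-! ### Integration by parts on the faces around an edge -/

theorem evV_gradP_mul (p q : SPoly) (x : E) :
    evV (gradP (p * q)) x = ev p x • evV (gradP q) x + ev q x • evV (gradP p) x := by
  ext i
  simp [evV, gradP, MvPolynomial.pderiv_mul]

theorem continuous_fderiv_ev (p : SPoly) (τ : E) : Continuous fun x => fderiv ℝ (ev p) x τ :=
  ((contDiff_ev p (n := 1)).continuous_fderiv one_ne_zero).clm_apply continuous_const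

namespace TetMesh

variable {Ω : Set E} {M : TetMesh Ω}

theorem exists_eq_insert_pair {f : Finset E} (hf : f.card = 3) {a b : E} (ha : a ∈ f) (hb : b ∈ f)
    (hab : a ≠ b) : ∃ c, c ≠ a ∧ c ≠ b ∧ f = {a, b, c} := by
  have h1 : ((f.erase a).erase b).card = 1 := by
    rw [Finset.card_erase_of_mem (Finset.mem_erase.2 ⟨hab.symm, hb⟩), Finset.card_erase_of_mem ha, hf]
  obtain ⟨c, hc⟩ := Finset.card_eq_one.1 h1
  have hcm : c ∈ (f.erase a).erase b := by rw [hc]; exact Finset.mem_singleton_self c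
  refine ⟨c, (Finset.mem_erase.1 (Finset.mem_erase.1 hcm).2).1, (Finset.mem_erase.1 hcm).1, ?_⟩
  rw [← hc, Finset.insert_erase (Finset.mem_erase.2 ⟨hab.symm, hb⟩), Finset.insert_erase ha]

/-- The four barycentric gradients of T⁺ sum to zero, and the one opposite to f is normal to f. -/
theorem glam_third_eq (o : M.FaceOrientation) (f : M.IntFace) {a b c : E} (hab : a ≠ b)
    (hca : c ≠ a) (hcb : c ≠ b) (hf : f.1 = {a, b, c}) :
    ∃ t : ℝ, glam (o.plus f).1 c =
      -(glam (o.plus f).1 a) - glam (o.plus f).1 b - t • faceNormal o f := by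
  have hT := isTet (o.plus f)
  obtain ⟨hw, -, he⟩ := hT.opp_spec (o.subset_plus f) f.2.2.1
  have hvol := volume_hull_pos hT.1 hT.2
  have h := hT.sum_glam
  rw [← Finset.add_sum_erase _ _ hw, he, hf, Finset.sum_insert (by simp [hab, hca.symm]),
    Finset.sum_insert (by simp [hcb.symm]), Finset.sum_singleton] at h
  refine ⟨(volume.real (hull (o.plus f).1))⁻¹, ?_⟩
  rw [faceNormal, areaNormal, smul_smul, inv_mul_cancel₀ hvol.ne', one_smul, eq_comm, ← sub_eq_zero,
    ← neg_eq_zero, ← h, hf]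
  abel

theorem avg_face_fderiv (o : M.FaceOrientation) (f : M.IntFace) {h : E → ℝ} (hh : ContDiff ℝ 1 h)
    {τ : E} (hτ : faceNormal o f ⬝ᵥ τ.ofLp = 0) :
    avg f.1 (fun x => fderiv ℝ h x τ) =
      -stokesConst 3 * ∑ v ∈ f.1, (glam (o.plus f).1 v ⬝ᵥ τ.ofLp) * avg (f.1.erase v) h := by
  have hT := isTet (o.plus f)
  obtain ⟨hw, -, he⟩ := hT.opp_spec (o.subset_plus f) f.2.2.1
  have hvol := volume_hull_pos hT.1 hT.2
  rw [faceNormal, areaNormal, smul_dotProduct, smul_eq_zero] at hτ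
  have := hT.avg_face_fderiv hw hh (hτ.resolve_left hvol.ne')
  rwa [he] at this

/-- The tangential Stokes formula is applied to p λ_a and p λ_b. These vanish on the edges opposite
to a and b, and what is left on the edge ab adds up to p, because λ_a + λ_b = 1 there. The product
rule leaves a multiple of p itself on the face, whose mean is zero; this is where the normalization
of λ_f enters. -/
theorem avg_face_edge (o : M.FaceOrientation) (f : M.IntFace) {a b : E} (ha : a ∈ f.1)
    (hb : b ∈ f.1) (hab : a ≠ b) {p : SPoly} (hp : avg f.1 (ev p) = 0) :
    avg f.1 (fun x => evV (gradP p) x ⬝ᵥ (faceNormal o f ⨯₃ evV (edgeField M a b (o.plus f)) x)) =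
      -stokesConst 3 * (edgeDet o a b f * avg {a, b} (ev p)) := by
  have hT := isTet (o.plus f)
  obtain ⟨c, hca, hcb, hf⟩ := exists_eq_insert_pair f.2.2.1 ha hb hab
  obtain ⟨t, ht⟩ := glam_third_eq o f hab hca hcb hf
  have haT := o.subset_plus f ha
  have hbT := o.subset_plus f hb
  have hindep : AffineIndependent ℝ ((↑) : ({a, b} : Finset E) → E) :=
    affineIndependent_subset (face_indep f) (by rw [hf]; intro v; simp; tauto)
  set N := faceNormal o f with hN
  set T := o.plus f with hTdef
  set A := glam T.1 a with hA
  set B := glam T.1 b with hB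
  have hdet : edgeDet o a b f = N ⬝ᵥ (A ⨯₃ B) := rfl
  set τA : E := WithLp.toLp 2 (N ⨯₃ A)
  set τB : E := WithLp.toLp 2 (N ⨯₃ B)
  have hfa : f.1.erase a = {b, c} := by
    rw [hf]
    ext v
    simp only [Finset.mem_erase, Finset.mem_insert, Finset.mem_singleton]
    grind
  have hfb : f.1.erase b = {a, c} := by
    rw [hf]
    ext v
    simp only [Finset.mem_erase, Finset.mem_insert, Finset.mem_singleton]
    grind
  have hfc : f.1.erase c = {a, b} := by
    rw [hf]
    ext v
    simp only [Finset.mem_erase, Finset.mem_insert, Finset.mem_singleton]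
    grind
  have key : ∀ (q : SPoly) (τ : E), N ⬝ᵥ τ.ofLp = 0 → avg f.1 (fun x => fderiv ℝ (ev q) x τ) =
      -stokesConst 3 * ((A ⬝ᵥ τ.ofLp) * avg {b, c} (ev q) + ((B ⬝ᵥ τ.ofLp) * avg {a, c} (ev q) +
        ((-A - B) ⬝ᵥ τ.ofLp) * avg {a, b} (ev q))) := by
    intro q τ hτ
    rw [avg_face_fderiv o f (contDiff_ev q (n := 1)) hτ]
    congr 1
    conv_lhs => rw [hf]
    rw [Finset.sum_insert (by simp [hab, hca.symm]), Finset.sum_insert (by simp [hcb.symm]),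
      Finset.sum_singleton, ← hf, hfa, hfb, hfc, ht, sub_dotProduct _ (t • N), smul_dotProduct, hτ,
      smul_zero, sub_zero]
  have hvan : ∀ {v : E} {e : Finset E}, e ⊆ T.1 → v ∈ T.1 → v ∉ e →
      avg e (ev (p * lam T.1 v)) = 0 := by
    intro v e he hv hve
    have : avg e (ev (p * lam T.1 v)) = avg e (fun x => 0 * ev p x) := avg_congr fun x hx => by
      rw [ev_mul, lam_eq_zero_of_mem_face hT he hv hve hx, mul_zero, zero_mul]
    rw [this, avg_const_mul, zero_mul]
  have hsubset : ∀ v ∈ f.1, v ∈ T.1 := fun v hv => o.subset_plus f hv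
  have hcT : c ∈ T.1 := hsubset c (by rw [hf]; simp)
  have hbc : ({b, c} : Finset E) ⊆ T.1 := by
    intro v hv; rcases Finset.mem_insert.1 hv with rfl | hv
    · exact hbT
    · rw [Finset.mem_singleton.1 hv]; exact hcT
  have hac : ({a, c} : Finset E) ⊆ T.1 := by
    intro v hv; rcases Finset.mem_insert.1 hv with rfl | hv
    · exact haT
    · rw [Finset.mem_singleton.1 hv]; exact hcT
  have habT : ({a, b} : Finset E) ⊆ T.1 := by
    intro v hv; rcases Finset.mem_insert.1 hv with rfl | hv
    · exact haT
    · rw [Finset.mem_singleton.1 hv]; exact hbT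
  have kA := key (p * lam T.1 a) τB (dot_self_cross _ _)
  have kB := key (p * lam T.1 b) τA (dot_self_cross _ _)
  rw [hvan hbc haT (by simp [hab, hca.symm])] at kA
  rw [hvan hac hbT (by simp [hab.symm, hcb.symm])] at kB
  have eB : B ⬝ᵥ τB.ofLp = 0 := dot_cross_self _ _
  have eA : A ⬝ᵥ τA.ofLp = 0 := dot_cross_self _ _
  have eAB : (-A - B) ⬝ᵥ τB.ofLp = N ⬝ᵥ (A ⨯₃ B) := by
    simp [τB, dotProduct, cross_apply, Fin.sum_univ_three]; ring
  have eBA : (-A - B) ⬝ᵥ τA.ofLp = -(N ⬝ᵥ (A ⨯₃ B)) := by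
    simp [τA, dotProduct, cross_apply, Fin.sum_univ_three]; ring
  rw [eB, eAB] at kA
  rw [eA, eBA] at kB
  have hsum : avg {a, b} (ev (p * lam T.1 a)) + avg {a, b} (ev (p * lam T.1 b)) = avg {a, b} (ev p) := by
    rw [← avg_add hindep ⟨a, by simp⟩ (continuous_ev _).continuousOn (continuous_ev _).continuousOn]
    refine avg_congr fun x hx => ?_
    have h1 := hT.sum_lam x
    rw [← Finset.sum_subset habT fun v hv hv' => lam_eq_zero_of_mem_face hT habT hv hv' hx,
      Finset.sum_pair hab] at h1
    rw [ev_mul, ev_mul, ← mul_add, h1, mul_one]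
  have hpt : ∀ x, evV (gradP p) x ⬝ᵥ (N ⨯₃ evV (edgeField M a b T) x) =
      (fderiv ℝ (ev (p * lam T.1 a)) x τB - fderiv ℝ (ev (p * lam T.1 b)) x τA) +
        2 * (N ⬝ᵥ (A ⨯₃ B)) * ev p x := by
    intro x
    rw [fderiv_ev, fderiv_ev, evV_gradP_mul, evV_gradP_mul, hT.gradP_lam, hT.gradP_lam, evV_edgeField,
      ← hA, ← hB]
    simp [τA, τB, dotProduct, cross_apply, Fin.sum_univ_three]
    ring
  simp only [hpt]
  rw [avg_add (face_indep f) (face_nonempty f)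
    (h := fun x => fderiv ℝ (ev (p * lam T.1 a)) x τB - fderiv ℝ (ev (p * lam T.1 b)) x τA)
    (h' := fun x => 2 * (N ⬝ᵥ (A ⨯₃ B)) * ev p x) ((continuous_fderiv_ev _ _).sub (continuous_fderiv_ev _ _)).continuousOn
    (continuous_const.mul (continuous_ev _)).continuousOn, avg_const_mul (2 * (N ⬝ᵥ (A ⨯₃ B))) (ev p), hp,
    avg_sub (face_indep f) (face_nonempty f) (continuous_fderiv_ev _ _).continuousOn
      (continuous_fderiv_ev _ _).continuousOn, kA, kB, hdet, ← hsum]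
  ring

end TetMesh

theorem contDiff_evV_cross (u G : VPoly) (i : Fin 3) :
    ContDiff ℝ 1 fun x => (evV u x ⨯₃ evV G x) i := by
  have h : (fun y => (evV u y ⨯₃ evV G y) i) = ev ((u ⨯₃ G) i) := by
    funext y
    fin_cases i <;> simp [cross_apply, evV]
  rw [h]
  exact contDiff_ev _ (n := 1)

namespace TetMesh

variable {Ω : Set E} {M : TetMesh Ω}

/-- Green's formula for G against the edge function: the volume part is the assumed orthogonality,
so the tangential jumps of G tested on the faces around the edge sum to zero. The jumps are the
negative face gradients of the p_f, and integration by parts on each face brings them to the edge.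
-/
theorem sum_edgeDet_mul_avg (hΩ : IsAdmissibleDomain Ω) (o : M.FaceOrientation) {a b : E}
    (hab : (hull {a, b} ∩ Ω).Nonempty) (hne : a ≠ b) {G : M.Elem → VPoly}
    (hG : ∑ T : M.Elem, ∫ x in hull T.1, (evV (G T) x ⬝ᵥ evV (curlP (edgeField M a b T)) x -
      evV (curlP (G T)) x ⬝ᵥ evV (edgeField M a b T) x) = 0) {p : M.IntFace → SPoly}
    (hp : ∀ f : M.IntFace, ∀ x ∈ hull f.1, ∀ τ, faceNormal o f ⬝ᵥ τ = 0 →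
      (evV (gradP (p f)) x + (evV (G (o.plus f)) x - evV (G (o.minus f)) x)) ⬝ᵥ τ = 0)
    (hm : ∀ f : M.IntFace, avg f.1 (ev (p f)) = 0) :
    ∑ f : M.IntFace, edgeDet o a b f * avg {a, b} (ev (p f)) = 0 := by
  have h := sum_integral_div o (Ψ := fun T x => evV (edgeField M a b T) x ⨯₃ evV (G T) x)
    (fun T i => contDiff_evV_cross _ _ i) (fun T w hw hf x hx =>
      areaNormal_dot_edgeField_cross T hw (isInternal_of_mem hΩ hab hw hf) hx _)
  simp only [pd_evV_cross] at h
  rw [hG] at h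
  have h' := (mul_eq_zero.1 h.symm).resolve_left (neg_ne_zero.2 (stokesConst_pos 4).ne')
  have key : ∀ f : M.IntFace, avg f.1 (fun x => faceNormal o f ⬝ᵥ
      (evV (edgeField M a b (o.plus f)) x ⨯₃ evV (G (o.plus f)) x -
        evV (edgeField M a b (o.minus f)) x ⨯₃ evV (G (o.minus f)) x)) =
      stokesConst 3 * (edgeDet o a b f * avg {a, b} (ev (p f))) := by
    intro f
    by_cases hf : a ∉ f.1 ∨ b ∉ f.1
    · rw [edgeDet_eq_zero o hf, zero_mul, mul_zero]
      have : ∀ x ∈ hull f.1, faceNormal o f ⬝ᵥ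
          (evV (edgeField M a b (o.plus f)) x ⨯₃ evV (G (o.plus f)) x -
            evV (edgeField M a b (o.minus f)) x ⨯₃ evV (G (o.minus f)) x) = (0 : ℝ) * 0 := by
        intro x hx
        have h1 := areaNormal_dot_edgeField_cross (o.plus f) (w := opp (o.plus f).1 f.1) (a := a)
          (b := b) ((isTet _).opp_spec (o.subset_plus f) f.2.2.1).1 (by rwa [erase_opp_plus])
          (x := x) (by rwa [erase_opp_plus]) (evV (G (o.plus f)) x)
        have h2 := areaNormal_dot_edgeField_cross (o.minus f) (w := opp (o.minus f).1 f.1) (a := a)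
          (b := b) ((isTet _).opp_spec (o.subset_minus f) f.2.2.1).1 (by rwa [erase_opp_minus])
          (x := x) (by rwa [erase_opp_minus]) (evV (G (o.minus f)) x)
        rw [areaNormal_minus, neg_dotProduct, neg_eq_zero] at h2
        rw [dotProduct_sub, h2, faceNormal, h1]
        norm_num
      rw [avg_congr this, avg_const_mul, zero_mul]
    · push Not at hf
      have e := avg_face_edge o f hf.1 hf.2 hne (hm f)
      have : ∀ x ∈ hull f.1, faceNormal o f ⬝ᵥ
          (evV (edgeField M a b (o.plus f)) x ⨯₃ evV (G (o.plus f)) x -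
            evV (edgeField M a b (o.minus f)) x ⨯₃ evV (G (o.minus f)) x) =
          (-1) * (evV (gradP (p f)) x ⬝ᵥ (faceNormal o f ⨯₃ evV (edgeField M a b (o.plus f)) x)) := by
        intro x hx
        obtain ⟨c, hc⟩ := exists_glam_minus_eq o f hf.1
        obtain ⟨d, hd⟩ := exists_glam_minus_eq o f hf.2
        have hw : evV (edgeField M a b (o.minus f)) x = evV (edgeField M a b (o.plus f)) x +
            (ev (lam (o.plus f).1 a) x * d - ev (lam (o.plus f).1 b) x * c) • faceNormal o f := by
          rw [evV_edgeField, evV_edgeField, hc, hd, lam_eq_lam (o.mem_minus hx) (o.mem_plus hx) a,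
            lam_eq_lam (o.mem_minus hx) (o.mem_plus hx) b]
          ext i
          simp
          ring
        have hj := hp f x hx (faceNormal o f ⨯₃ evV (edgeField M a b (o.plus f)) x)
          (dot_self_cross _ _)
        rw [add_dotProduct] at hj
        have : evV (gradP (p f)) x ⬝ᵥ (faceNormal o f ⨯₃ evV (edgeField M a b (o.plus f)) x) =
            -((evV (G (o.plus f)) x - evV (G (o.minus f)) x) ⬝ᵥ
              (faceNormal o f ⨯₃ evV (edgeField M a b (o.plus f)) x)) := by linarith
        rw [this, hw]
        simp [dotProduct, cross_apply, Fin.sum_univ_three]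
        ring
      rw [avg_congr this, avg_const_mul, e]
      ring
  rw [Finset.sum_congr rfl fun f _ => key f, ← Finset.mul_sum] at h'
  exact (mul_eq_zero.1 h').resolve_left (stokesConst_pos 3).ne'

/-- The edge function gives information on the mean over the edge only. The weighted sum of the p_f
is however constant along the edge, so mean zero means zero at every point. -/
theorem sum_edgeDet_mul_eq_zero (hΩ : IsAdmissibleDomain Ω) (o : M.FaceOrientation) {a b : E}
    (hab : (hull {a, b} ∩ Ω).Nonempty) (hne : a ≠ b) {G : M.Elem → VPoly}
    (hG : ∑ T : M.Elem, ∫ x in hull T.1, (evV (G T) x ⬝ᵥ evV (curlP (edgeField M a b T)) x -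
      evV (curlP (G T)) x ⬝ᵥ evV (edgeField M a b T) x) = 0) {p : M.IntFace → SPoly}
    (hp : ∀ f : M.IntFace, ∀ x ∈ hull f.1, ∀ τ, faceNormal o f ⬝ᵥ τ = 0 →
      (evV (gradP (p f)) x + (evV (G (o.plus f)) x - evV (G (o.minus f)) x)) ⬝ᵥ τ = 0)
    (hm : ∀ f : M.IntFace, avg f.1 (ev (p f)) = 0)
    (hindep : AffineIndependent ℝ ((↑) : ({a, b} : Finset E) → E)) {x : E} (hx : x ∈ hull {a, b}) :
    ∑ f : M.IntFace, edgeDet o a b f * ev (p f) x = 0 := by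
  set L : SPoly := ∑ f : M.IntFace, edgeDet o a b f • p f
  have hL : ∀ y, ev L y = ∑ f : M.IntFace, edgeDet o a b f * ev (p f) y := fun y => by
    simp only [L, ev_sum, ev_smul]
  have hseg : ∀ f : M.IntFace, ∀ z ∈ hull {a, b}, a ∈ f.1 → b ∈ f.1 → z ∈ hull f.1 :=
    fun f z hz ha hb => by
      refine convexHull_mono ?_ hz
      intro v hv
      simp only [Finset.coe_insert, Finset.coe_singleton, Set.mem_insert_iff,
        Set.mem_singleton_iff] at hv
      rcases hv with rfl | rfl
      · exact ha
      · exact hb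
  have hconst : ∀ y ∈ hull {a, b}, ev L y = ev L x := by
    intro y hy
    refine ev_eq_of_gradP_dot_eq_zero fun z hz => ?_
    have hzm : z ∈ hull {a, b} := (convex_convexHull ℝ _).segment_subset hy hx hz
    have e1 : evV (gradP L) z ⬝ᵥ (x - y).ofLp =
        ∑ f : M.IntFace, edgeDet o a b f * (evV (gradP (p f)) z ⬝ᵥ (x - y).ofLp) := by
      have : evV (gradP L) z = ∑ f : M.IntFace, edgeDet o a b f • evV (gradP (p f)) z := by
        ext i
        simp only [L, gradP_sum, gradP_smul, evV, Finset.sum_apply, ev_sum, Pi.smul_apply, ev_smul,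
          smul_eq_mul]
      rw [this, sum_dotProduct]
      simp only [smul_dotProduct, smul_eq_mul]
    -- The derivative of p_f along the edge is minus the difference of one quantity on the two
    -- adjacent elements, so the weighted sum telescopes around the edge.
    have e2 := sum_edgeDet_mul hΩ o hab (fun T => evV (G T) z ⬝ᵥ (x - y).ofLp)
    have e3 : ∀ f : M.IntFace, edgeDet o a b f * (evV (gradP (p f)) z ⬝ᵥ (x - y).ofLp) =
        -(edgeDet o a b f * (evV (G (o.plus f)) z ⬝ᵥ (x - y).ofLp -
          evV (G (o.minus f)) z ⬝ᵥ (x - y).ofLp)) := by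
      intro f
      by_cases hf : a ∉ f.1 ∨ b ∉ f.1
      · rw [edgeDet_eq_zero o hf]; ring
      · push Not at hf
        have h1 := hp f z (hseg f z hzm hf.1 hf.2) (x - y).ofLp
          (faceNormal_dot_sub o (hseg f y hy hf.1 hf.2) (hseg f x hx hf.1 hf.2))
        rw [add_dotProduct, sub_dotProduct] at h1
        rw [← mul_neg]
        congr 1
        linarith
    rw [e1, Finset.sum_congr rfl fun f _ => e3 f, Finset.sum_neg_distrib, e2, neg_zero]
  have havg : avg {a, b} (ev L) = 0 := by
    have : avg {a, b} (ev L) = ∑ f : M.IntFace, edgeDet o a b f * avg {a, b} (ev (p f)) := by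
      rw [show ev L = fun y => ∑ f : M.IntFace, edgeDet o a b f * ev (p f) y from funext hL,
        avg_sum hindep ⟨a, by simp⟩ _ (h := fun f y => edgeDet o a b f * ev (p f) y)
          (fun f _ => (continuous_const.mul (continuous_ev (p f))).continuousOn)]
      exact Finset.sum_congr rfl fun f _ => avg_const_mul _ _
    rw [this, sum_edgeDet_mul_avg hΩ o hab hne hG hp hm]
  rw [avg_congr hconst, avg_const hindep ⟨a, by simp⟩] at havg
  rw [← hL, havg]

/-- The matrix of the cross product with `τ`. -/
def crossMat (τ : V) (i j : Fin 3) : ℝ :=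
  (![![0, τ 2, -τ 1], ![-τ 2, 0, τ 0], ![τ 1, -τ 0, 0]] : Fin 3 → Fin 3 → ℝ) i j

/-- The coefficients are the entries of the antisymmetric matrix of the face normal and the gradient
of the third coordinate. Their cross product is parallel to the edge, as one sees by expanding b − a
in the cross products of N, ∇λ_a and ∇λ_b. Hence all index pairs i, j give one and the same scalar
condition at the edge. -/
theorem edgeCoeff_eq (o : M.FaceOrientation) (f : M.IntFace) {a b c : E} (hab : a ≠ b)
    (hca : c ≠ a) (hcb : c ≠ b) (hf : f.1 = {a, b, c}) (i j : Fin 3) :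
    edgeCoeff o f c i j = -(edgeDet o a b f * crossMat (b - a).ofLp i j) := by
  have hT := isTet (o.plus f)
  have ha : a ∈ f.1 := by rw [hf]; simp
  have hb : b ∈ f.1 := by rw [hf]; simp
  have hc : c ∈ f.1 := by rw [hf]; simp
  obtain ⟨t, ht⟩ := glam_third_eq o f hab hca hcb hf
  have h1 := faceNormal_dot_sub o (subset_convexHull ℝ _ ha) (subset_convexHull ℝ _ hb)
  have h2 := hT.glam_dot_sub (o.subset_plus f ha) (o.subset_plus f hb) hca.symm hcb.symm
  have h3 := hT.glam_dot_sub_self (o.subset_plus f ha) (o.subset_plus f hb) hab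
  have h4 : glam (o.plus f).1 a ⬝ᵥ (b - a).ofLp = -1 := by
    have := hT.lam_sub a b a
    rw [← this, hT.lam_self (o.subset_plus f ha), hT.lam_of_ne (o.subset_plus f hb) hab.symm]
    norm_num
  rw [edgeCoeff, edgeDet, ht]
  generalize (b - a).ofLp = τ at *
  generalize faceNormal o f = N at *
  generalize glam (o.plus f).1 a = A at *
  generalize glam (o.plus f).1 b = B at *
  have hv : ∀ k, (N ⬝ᵥ (A ⨯₃ B)) * τ k = (N ⨯₃ A) k + (N ⨯₃ B) k := by
    intro k
    have e : (N ⬝ᵥ (A ⨯₃ B)) * τ k = (N ⬝ᵥ τ) * (A ⨯₃ B) k + (A ⬝ᵥ τ) * (B ⨯₃ N) k +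
        (B ⬝ᵥ τ) * (N ⨯₃ A) k := by
      fin_cases k <;> simp [dotProduct, cross_apply, Fin.sum_univ_three] <;> ring
    rw [e, h1, h3, h4, ← cross_anticomm N B, Pi.neg_apply]
    ring
  have h0 := hv 0
  have h1 := hv 1
  have h2 := hv 2
  generalize N ⬝ᵥ (A ⨯₃ B) = D at *
  simp only [cross_apply, Matrix.cons_val] at h0 h1 h2
  fin_cases i <;> fin_cases j <;> simp [crossMat]
  · linear_combination h2
  · linear_combination -h1
  · linear_combination -h2
  · linear_combination h0
  · linear_combination h1
  · linear_combination -h0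

/-- The value on T is prescribed only almost everywhere. As T has positive volume, it is attained at
some interior point, where the lower bound holds. -/
theorem pos_of_isPiecewiseConst (hΩ : IsAdmissibleDomain Ω) {μ : E → ℝ} {μ₀ μ₁ : ℝ}
    (hμ₀ : 0 < μ₀) (hμ : ∀ x ∈ Ω, μ₀ ≤ μ x ∧ μ x ≤ μ₁) {μT : M.Elem → ℝ}
    (hA1 : M.IsPiecewiseConst μ μT) (T : M.Elem) : 0 < μT T := by
  have hv := volume_hull_pos (isTet T).1 (isTet T).2
  have hne : (volume.restrict (hull T.1)) ≠ 0 := by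
    intro h
    rw [Measure.restrict_eq_zero] at h
    rw [measureReal_def, h] at hv
    simp at hv
  haveI : NeBot (ae (volume.restrict (hull T.1))) := ae_neBot.2 hne
  obtain ⟨x, h1, h2⟩ := ((hA1 T).and (ae_mem_interior T.1)).exists
  rw [← h1]
  exact hμ₀.trans_le (hμ x (interior_hull_subset hΩ T h2)).1

theorem continuous_evV_dot (u w : VPoly) : Continuous fun x => evV u x ⬝ᵥ evV w x :=
  (continuous_evV u).dotProduct (continuous_evV w)

/-- A constant curl is the gradient of an affine polynomial, and Ĥ is orthogonal to such gradients
by its side condition. So Ĥ can be added to H_h in the discrete equation, and j becomes the curl of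
the sum. -/
theorem fem_orthogonality (hΩ : IsAdmissibleDomain Ω) {k k' : ℕ} (hk' : 1 ≤ k') {μ : E → ℝ}
    {μT : M.Elem → ℝ} (hA1 : M.IsPiecewiseConst μ μT) {j uh Hhat : M.Elem → VPoly}
    (huh : M.IsFEMSolution k μ (pwV j) uh)
    (hH : ∀ T, IsElementSolution k' j (Hh μT uh) T (Hhat T)) {w : M.Elem → VPoly} (hw : w ∈ M.R0 k)
    (hc : ∀ T, ∃ c : V, ∀ x, evV (curlP (w T)) x = c) :
    ∑ T : M.Elem, ∫ x in hull T.1, (evV ((Hh μT uh + Hhat) T) x ⬝ᵥ evV (curlP (w T)) x -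
      evV (curlP ((Hh μT uh + Hhat) T)) x ⬝ᵥ evV (w T) x) = 0 := by
  have h := huh.2.1 w hw
  have hl : ip Ω (fun x => (μ x)⁻¹ • pwV (curlh uh) x) (pwV (curlh w)) =
      ∑ T : M.Elem, ∫ x in hull T.1, evV (Hh μT uh T) x ⬝ᵥ evV (curlP (w T)) x := by
    refine setIntegral_domain hΩ (Fc := fun T x => evV (Hh μT uh T) x ⬝ᵥ evV (curlP (w T)) x)
      (fun T => continuous_evV_dot _ _) fun T => ?_
    filter_upwards [hA1 T, ae_pwV_eq (curlh uh) T, ae_pwV_eq (curlh w) T] with x h1 h2 h3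
    rw [h1, h2, h3, Hh, evV_smul]
    rfl
  have hr : ip Ω (pwV j) (pwV w) = ∑ T : M.Elem, ∫ x in hull T.1, evV (j T) x ⬝ᵥ evV (w T) x := by
    refine setIntegral_domain hΩ (Fc := fun T x => evV (j T) x ⬝ᵥ evV (w T) x)
      (fun T => continuous_evV_dot _ _) fun T => ?_
    filter_upwards [ae_pwV_eq j T, ae_pwV_eq w T] with x h2 h3
    rw [h2, h3]
  rw [hl, hr, ← sub_eq_zero, ← Finset.sum_sub_distrib] at h
  rw [← h]
  refine Finset.sum_congr rfl fun T _ => ?_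
  have hcurl : curlP ((Hh μT uh + Hhat) T) = j T := by
    rw [Pi.add_apply, curlP_add, (hH T).2.1]
    abel
  have hInt : ∀ u w : VPoly, IntegrableOn (fun x => evV u x ⬝ᵥ evV w x) (hull T.1) := fun u w =>
    integrableOn_hull_volume _ (continuous_evV_dot u w)
  rw [integral_sub (hInt _ _) (hInt _ _), hcurl]
  congr 1
  simp only [Pi.add_apply, evV_add, add_dotProduct]
  rw [integral_add (hInt _ _) (hInt _ _)]
  obtain ⟨c, hc⟩ := hc T
  have h0 := (hH T).2.2 (affPoly 0 c) (polyDeg_mono hk' (affPoly_mem_polyDeg 0 c))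
  have e : evV (gradP (affPoly 0 c)) = evV (curlP (w T)) := by
    funext x
    rw [hc, gradP_affPoly]
    ext i
    simp [evV]
  rw [e] at h0
  rw [ip] at h0
  rw [h0, add_zero]

-- The pointwise identity along the edge, rewritten with the coefficients that occur in the curl of
-- the jump field. Faces that do not contain the edge drop out of both forms.
open Classical in
theorem edge_condition (hΩ : IsAdmissibleDomain Ω) (o : M.FaceOrientation) {k k' : ℕ} (hk : 1 ≤ k)
    (hk' : 1 ≤ k') {μ : E → ℝ} {μT : M.Elem → ℝ} (hA1 : M.IsPiecewiseConst μ μT)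
    {j uh Hhat : M.Elem → VPoly} (huh : M.IsFEMSolution k μ (pwV j) uh)
    (hH : ∀ T, IsElementSolution k' j (Hh μT uh) T (Hhat T)) {lam : (f : M.IntFace) → hull f.1 → ℝ}
    (hlam : ∀ f, IsFaceSolution k' o (Hh μT uh + Hhat) f (lam f)) {x : E} {e : Finset E}
    (he : e ∈ M.faces) (hcard : e.card = 2) (hx : x ∈ hull e) (heΩ : (hull e ∩ Ω).Nonempty)
    (i j : Fin 3) :
    ∑ f : M.IntFace, ∑ v ∈ f.1, (if f.1.erase v = e then
      (if h : x ∈ hull f.1 then lam f ⟨x, h⟩ else 0) * edgeCoeff o f v i j else 0) = 0 := by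
  obtain ⟨a, b, hab, rfl⟩ := Finset.card_eq_two.1 hcard
  choose p hp hpl hpe hpm using hlam
  have hsum := sum_edgeDet_mul_eq_zero hΩ o heΩ hab
    (fem_orthogonality hΩ hk' hA1 huh hH (edgeField_mem_R0 hΩ o hk heΩ)
      fun T => ⟨_, evV_curlP_edgeField a b T⟩)
    (p := p) (fun f x hx => (face_equation_iff o _ f (p f) x).1 (hpe f x hx))
    (fun f => (avg_eq_zero_iff_integral f _).2 (hpm f)) (M.indep he) hx
  have key : ∀ f : M.IntFace, ∑ v ∈ f.1, (if f.1.erase v = {a, b} then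
      (if h : x ∈ hull f.1 then lam f ⟨x, h⟩ else 0) * edgeCoeff o f v i j else 0) =
      -(edgeDet o a b f * ev (p f) x) * crossMat (b - a).ofLp i j := by
    intro f
    by_cases hf : a ∉ f.1 ∨ b ∉ f.1
    · rw [edgeDet_eq_zero o hf, Finset.sum_eq_zero]
      · ring
      · intro v _
        rw [if_neg]
        intro h
        have ha : a ∈ f.1.erase v := by rw [h]; simp
        have hb : b ∈ f.1.erase v := by rw [h]; simp
        rcases hf with hf | hf
        · exact hf (Finset.mem_of_mem_erase ha)
        · exact hf (Finset.mem_of_mem_erase hb)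
    · push Not at hf
      obtain ⟨c, hca, hcb, hfc⟩ := exists_eq_insert_pair f.2.2.1 hf.1 hf.2 hab
      have hxf : x ∈ hull f.1 := by
        refine convexHull_mono (Finset.coe_subset.2 ?_) hx
        rw [hfc]
        intro v
        simp only [Finset.mem_insert, Finset.mem_singleton]
        tauto
      have hcf : c ∈ f.1 := by rw [hfc]; simp
      rw [Finset.sum_eq_single_of_mem c hcf, if_pos, dif_pos hxf, hpl f ⟨x, hxf⟩,
        edgeCoeff_eq o f hab hca hcb hfc]
      · ring
      · rw [hfc]
        ext v
        simp only [Finset.mem_erase, Finset.mem_insert, Finset.mem_singleton]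
        grind
      · intro v hv hvc
        rw [if_neg]
        intro h
        have : c ∈ f.1.erase v := Finset.mem_erase.2 ⟨hvc.symm, hcf⟩
        rw [h] at this
        simp only [Finset.mem_insert, Finset.mem_singleton] at this
        tauto
  rw [Finset.sum_congr rfl fun f _ => key f, ← Finset.sum_mul, Finset.sum_neg_distrib, hsum]
  ring

end TetMesh

namespace TetMesh

variable {Ω : Set E} {M : TetMesh Ω} {ν : E}

/-! ## Vertex patches -/

theorem patch_subset (hΩ : IsAdmissibleDomain Ω) (M : TetMesh Ω) (ν : E) : M.patch ν ⊆ Ω := by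
  have h : M.patch ν ⊆ interior (closure Ω) :=
    interior_mono (Set.iUnion_subset fun T => hull_subset_closure T.1)
  rwa [hΩ.interior_closure] at h

theorem interior_hull_subset_patch {T : M.Elem} (hT : ν ∈ T.1) :
    interior (hull T.1) ⊆ M.patch ν :=
  interior_mono (Set.subset_iUnion (fun T : {T : M.Elem // ν ∈ T.1} => hull T.1.1) ⟨T, hT⟩)

theorem closure_patch_subset : closure (M.patch ν) ⊆ ⋃ T : {T : M.Elem // ν ∈ T.1}, hull T.1.1 :=
  closure_minimal interior_subset (isClosed_iUnion_of_finite fun T => isClosed_hull _)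

theorem memLp_pw {m : Measure E} [IsFiniteMeasure m] (φ : M.Elem → SPoly) : MemLp (pw φ) 2 m := by
  have h : pw φ = fun x => ∑ T : M.Elem, (interior (hull T.1)).indicator (ev (φ T)) x := by
    ext1 x
    rw [pw, finsum_eq_sum_of_fintype]
  rw [h]
  refine memLp_finsetSum _ fun T _ => ?_
  obtain ⟨C, hC⟩ := (isCompact_hull T.1).exists_bound_of_continuousOn (continuous_ev (φ T)).continuousOn
  refine MemLp.of_bound ((continuous_ev (φ T)).aestronglyMeasurable.indicator
    isOpen_interior.measurableSet) (max C 0) (Eventually.of_forall fun x => ?_)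
  by_cases hx : x ∈ interior (hull T.1)
  · rw [Set.indicator_of_mem hx]
    exact (hC x (interior_subset hx)).trans (le_max_left _ _)
  · rw [Set.indicator_of_notMem hx, norm_zero]
    exact le_max_right _ _

theorem pd_ev_mul (p : SPoly) {ζ : E → ℝ} (hζ : Differentiable ℝ ζ) (i : Fin 3) (x : E) :
    pd i (fun y => ev p y * ζ y) x = ev (MvPolynomial.pderiv i p) x * ζ x + ev p x * pd i ζ x := by
  rw [pd_mul ((contDiff_ev p (n := 1)).differentiable (by simp)) hζ, pd_ev]

theorem integrableOn_pd_ev_mul (s : Finset E) (p : SPoly) {D : Set E} {ζ : E → ℝ} (hζ : IsTest D ζ)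
    (i : Fin 3) : IntegrableOn (pd i fun y => ev p y * ζ y) (hull s) :=
  integrableOn_hull_volume s (continuous_pd ((contDiff_ev p (n := 1)).mul hζ.contDiff_one) i)

-- Both sides of the weak gradient identity combine to elementwise integrals of a derivative. The
-- condition is then visibly linear in α and ready for the divergence theorem.
open Classical in
theorem hasWeakGrad_patch_iff (α : M.Elem → SPoly) :
    HasWeakGrad (M.patch ν) (pw α) (pwV (gradh α)) ↔ ∀ ζ, IsTest (M.patch ν) ζ → ∀ i,
      ∑ T : M.Elem with ν ∈ T.1, ∫ x in hull T.1, pd i (fun y => ev (α T) y * ζ y) x = 0 := by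
  refine forall_congr' fun ζ => forall_congr' fun hζ => forall_congr' fun i => ?_
  have hc := hζ.contDiff_one.continuous
  have hcp := continuous_pd hζ.contDiff_one i
  rw [setIntegral_patch (Fc := fun T x => ev (α T) x * pd i ζ x)
      (fun T => (continuous_ev _).mul hcp) (fun T _ => (ae_pw_eq α T).mono fun x h => by rw [h]),
    setIntegral_patch (Fc := fun T x => evV (gradP (α T)) x i * ζ x)
      (fun T => (continuous_ev _).mul hc) (fun T _ => (ae_pwV_eq (gradh α) T).mono fun x h => by
        rw [h]; rfl), ← sub_eq_zero, sub_neg_eq_add, ← Finset.sum_add_distrib]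
  refine Eq.congr_left (Finset.sum_congr rfl fun T _ => ?_)
  rw [← integral_add (f := fun x => ev (α T) x * pd i ζ x)
    (g := fun x => evV (gradP (α T)) x i * ζ x)
    (integrableOn_hull_volume _ ((continuous_ev _).mul hcp))
    (integrableOn_hull_volume _ ((continuous_ev _).mul hc))]
  refine integral_congr_ae (Eventually.of_forall fun x => ?_)
  simp only [pd_ev_mul (α T) hζ.differentiable]
  exact add_comm _ _

theorem memH1_patch_iff (hΩ : IsAdmissibleDomain Ω) (α : M.Elem → SPoly) :
    MemH1 (M.patch ν) (pw α) (pwV (gradh α)) ↔ HasWeakGrad (M.patch ν) (pw α) (pwV (gradh α)) := by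
  haveI : IsFiniteMeasure ((volume : Measure E).restrict (M.patch ν)) :=
    isFiniteMeasure_restrict.2 (hΩ.bounded.subset (patch_subset hΩ M ν)).measure_lt_top.ne
  exact ⟨fun h => h.2.2, fun h => ⟨memLp_pw _, memLp_pwV _, h⟩⟩

variable (M ν) in
/-- The space of the patch problem as a submodule. -/
def patchSubmodule (hΩ : IsAdmissibleDomain Ω) (k : ℕ) : Submodule ℝ (M.Elem → SPoly) where
  carrier := M.patchSpace k ν
  zero_mem' := by
    classical
    refine ⟨fun T => Submodule.zero_mem _, fun T _ => rfl, ?_, fun T _ x _ => ev_zero x⟩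
    rw [memH1_patch_iff hΩ, hasWeakGrad_patch_iff]
    intro ζ hζ i
    refine Finset.sum_eq_zero fun T _ => ?_
    have : (fun y => ev ((0 : M.Elem → SPoly) T) y * ζ y) = fun _ => 0 := by
      funext y
      rw [Pi.zero_apply, ev_zero, zero_mul]
    rw [this]
    simp [pd]
  add_mem' := by
    classical
    rintro α β ⟨h1, h2, h3, h4⟩ ⟨h1', h2', h3', h4'⟩
    refine ⟨fun T => Submodule.add_mem _ (h1 T) (h1' T), fun T hT => ?_, ?_, fun T hT x hx => ?_⟩
    · rw [Pi.add_apply, h2 T hT, h2' T hT, add_zero]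
    · rw [memH1_patch_iff hΩ, hasWeakGrad_patch_iff] at h3 h3' ⊢
      intro ζ hζ i
      rw [← add_zero (0 : ℝ)]
      nth_rewrite 1 [← h3 ζ hζ i]
      rw [← h3' ζ hζ i, ← Finset.sum_add_distrib]
      refine Finset.sum_congr rfl fun T _ => ?_
      rw [← integral_add (integrableOn_pd_ev_mul _ _ hζ i) (integrableOn_pd_ev_mul _ _ hζ i)]
      refine integral_congr_ae (Eventually.of_forall fun x => ?_)
      simp only [Pi.add_apply, pd_ev_mul _ hζ.differentiable, map_add]
      rw [ev_add, ev_add]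
      ring
    · rw [Pi.add_apply, ev_add, h4 T hT x hx, h4' T hT x hx, add_zero]
  smul_mem' := by
    classical
    rintro c α ⟨h1, h2, h3, h4⟩
    refine ⟨fun T => Submodule.smul_mem _ c (h1 T), fun T hT => ?_, ?_, fun T hT x hx => ?_⟩
    · rw [Pi.smul_apply, h2 T hT, smul_zero]
    · rw [memH1_patch_iff hΩ, hasWeakGrad_patch_iff] at h3 ⊢
      intro ζ hζ i
      rw [← mul_zero c, ← h3 ζ hζ i, Finset.mul_sum]
      refine Finset.sum_congr rfl fun T _ => ?_
      rw [← integral_const_mul]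
      refine integral_congr_ae (Eventually.of_forall fun x => ?_)
      simp only [Pi.smul_apply, pd_ev_mul _ hζ.differentiable, Derivation.map_smul]
      rw [ev_smul, ev_smul]
      ring
    · rw [Pi.smul_apply, ev_smul, h4 T hT x hx, mul_zero]

instance (hΩ : IsAdmissibleDomain Ω) (k : ℕ) : FiniteDimensional ℝ (patchSubmodule M ν hΩ k) := by
  let L : patchSubmodule M ν hΩ k →ₗ[ℝ] (M.Elem → PolyDeg k) :=
    { toFun := fun s T => ⟨s.1 T, s.2.1 T⟩
      map_add' := fun _ _ => rfl
      map_smul' := fun _ _ => rfl }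
  refine FiniteDimensional.of_injective L fun s t h => Subtype.ext (funext fun T => ?_)
  exact congrArg Subtype.val (congrFun h T)

/-- Points of the relative interior of an internal face between an element of the patch and an
element outside of the patch belong to `Γ_ν`. -/
theorem mem_patchGamma_of_face (hΩ : IsAdmissibleDomain Ω) {T T' : M.Elem} {f : Finset E}
    (hf : f ⊆ T.1) (hf' : f ⊆ T'.1) (hc : f.card = 3) (hT : ν ∈ T.1) (hT' : ν ∉ T'.1) {x : E}
    (hx : x ∈ hull f) (hpos : ∀ v ∈ f, 0 < ev (lam T.1 v) x) : x ∈ M.patchGamma ν := by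
  have hne : T ≠ T' := fun h => hT' (h ▸ hT)
  have hxΩ : x ∈ Ω := mem_of_mem_relint_face hΩ hne hf hf' hc hpos hx
  have hcl : ∀ S : M.Elem, f ⊆ S.1 → x ∈ closure (interior (hull S.1)) := fun S hS => by
    rw [(convex_convexHull ℝ _).closure_interior_eq_closure_of_nonempty_interior
      (isTet S).interior_nonempty]
    exact subset_closure (convexHull_mono (Finset.coe_subset.2 hS) hx)
  have hfr : x ∈ frontier (M.patch ν) := by
    refine ⟨closure_mono (interior_hull_subset_patch hT) (hcl T hf), fun hxi => ?_⟩
    rw [patch, interior_interior, ← patch] at hxi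
    obtain ⟨y, hy, hy'⟩ := mem_closure_iff.1 (hcl T' hf') _ isOpen_interior hxi
    obtain ⟨S, hS⟩ := Set.mem_iUnion.1 (interior_subset hy)
    have := eq_of_mem_interior hy' hS
    exact hT' (this ▸ S.2)
  rw [patchGamma]
  split_ifs
  · exact ⟨hfr, fun h => h.2 (hΩ.isOpen.interior_eq.symm ▸ hxΩ)⟩
  · exact hfr

theorem ev_eq_zero_of_relint {T f : Finset E} (hT : IsTet T) (hf : f ⊆ T) (hc : f.card = 3)
    {p : SPoly} (h : ∀ x ∈ hull f, (∀ v ∈ f, 0 < ev (lam T v) x) → ev p x = 0) {x : E}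
    (hx : x ∈ hull f) : ev p x = 0 := by
  by_contra hne
  obtain ⟨y, hy, hyf, hpos⟩ := exists_relint_near hT hf hc hx
    ((continuous_ev p).continuousAt.eventually (isOpen_ne.mem_nhds hne))
  exact hy (h y hyf hpos)

/-- Continuity across a face has three different reasons: membership in H¹ if both elements belong
to the patch, the condition on Γ_ν if exactly one does, and extension by zero if none does. -/
theorem patchSpace_face_eq (hΩ : IsAdmissibleDomain Ω) (o : M.FaceOrientation) {k : ℕ}
    {α : M.Elem → SPoly} (hα : α ∈ M.patchSpace k ν) (f : M.IntFace) {x : E} (hx : x ∈ hull f.1) :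
    ev (α (o.plus f)) x = ev (α (o.minus f)) x := by
  classical
  obtain ⟨-, h0, h1, hΓ⟩ := hα
  by_cases hp : ν ∈ (o.plus f).1
  swap
  · rw [h0 _ hp, ev_zero]
    by_cases hm : ν ∈ (o.minus f).1
    · exact (ev_eq_zero_of_relint (isTet _) (o.subset_minus f) f.2.2.1 (fun y hy hpos =>
        hΓ _ hm y ⟨o.mem_minus hy, mem_patchGamma_of_face hΩ (o.subset_minus f) (o.subset_plus f)
          f.2.2.1 hm hp hy hpos⟩) hx).symm
    · rw [h0 _ hm, ev_zero]
  by_cases hm : ν ∈ (o.minus f).1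
  swap
  · rw [h0 _ hm, ev_zero]
    exact ev_eq_zero_of_relint (isTet _) (o.subset_plus f) f.2.2.1 (fun y hy hpos =>
        hΓ _ hp y ⟨o.mem_plus hy, mem_patchGamma_of_face hΩ (o.subset_plus f) (o.subset_minus f)
          f.2.2.1 hp hm hy hpos⟩) hx
  rw [memH1_patch_iff hΩ, hasWeakGrad_patch_iff] at h1
  have hi : ∀ i, faceNormal o f i * (ev (α (o.plus f)) x - ev (α (o.minus f)) x) = 0 := by
    intro i
    -- The weak gradient is tested only inside the patch. This suffices, as the patch is a
    -- neighbourhood of every relative interior point of a face between two of its elements.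
    refine jump_eq_zero hΩ o (D := M.patch ν)
      (q := fun f x => faceNormal o f i * (ev (α (o.plus f)) x - ev (α (o.minus f)) x)) f
      (continuous_const.mul ((continuous_ev _).sub (continuous_ev _))) (fun y hy hpos => ?_)
      (fun ζ hζ => ?_) hx
    · refine isOpen_interior.mem_nhds (mem_interior_iff_mem_nhds.2 ?_)
      filter_upwards [exists_ball_subset_union (o.ne f) (o.subset_plus f) (o.subset_minus f) f.2.2.1
        hpos hy] with z hz
      rcases hz with hz | hz
      · exact Set.mem_iUnion.2 ⟨⟨o.plus f, hp⟩, hz⟩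
      · exact Set.mem_iUnion.2 ⟨⟨o.minus f, hm⟩, hz⟩
    · have hζ' : IsTest (M.patch ν) ζ := ⟨hζ.1, hζ.2.1, hζ.2.2.trans Set.inter_subset_left⟩
      have hd : ∀ T, ContDiff ℝ 1 fun x => ev (α T) x * ζ x := fun T =>
        (contDiff_ev (α T) (n := 1)).mul hζ.contDiff_one
      have h := sum_integral_div_of_eq_zero hΩ o
        (Ψ := fun T x => Pi.single i (ev (α T) x * ζ x)) (fun T l => by
          by_cases hl : l = i
          · subst hl
            simpa using hd T
          · simpa [Pi.single_eq_of_ne hl] using contDiff_const)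
        (fun T y hy => by
          rw [hζ.eq_zero fun h => hy h.2, mul_zero, Pi.single_zero])
      have hl : ∀ T : M.Elem, ∀ y, ∑ l, pd l (fun z => (Pi.single i (ev (α T) z * ζ z) : V) l) y =
          pd i (fun z => ev (α T) z * ζ z) y := by
        intro T y
        rw [Finset.sum_eq_single i]
        · simp
        · intro l _ hl
          simp [Pi.single_eq_of_ne hl, pd]
        · simp
      simp only [hl] at h
      have hs : ∑ T : M.Elem, ∫ y in hull T.1, pd i (fun z => ev (α T) z * ζ z) y = 0 := by
        rw [← h1 ζ hζ' i, Finset.sum_filter]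
        refine Finset.sum_congr rfl fun T _ => ?_
        split_ifs with hT
        · rfl
        · have : (fun y => ev (α T) y * ζ y) = fun _ => 0 := by
            funext y
            rw [h0 T hT, ev_zero, zero_mul]
          rw [this]
          simp [pd]
      rw [hs] at h
      rw [← (mul_eq_zero.1 h.symm).resolve_left (neg_ne_zero.2 (stokesConst_pos 4).ne')]
      refine Finset.sum_congr rfl fun g _ => avg_congr fun y _ => ?_
      rw [dotProduct_sub, dotProduct_single, dotProduct_single]
      ring
  obtain ⟨i, hi'⟩ := Function.ne_iff.1 (faceNormal_ne_zero o f)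
  exact sub_eq_zero.1 ((mul_eq_zero.1 (hi i)).resolve_left hi')

end TetMesh

/-! ### The energy form and the solvability of the patch problems -/

namespace TetMesh

variable {Ω : Set E} {M : TetMesh Ω} {ν : E}

open Classical in
variable (ν) in
/-- The energy form of the patch problem. -/
def patchForm (μT : M.Elem → ℝ) : (M.Elem → SPoly) →ₗ[ℝ] (M.Elem → SPoly) →ₗ[ℝ] ℝ :=
  ∑ T : M.Elem with ν ∈ T.1, μT T •
    (ipB T.1).compl₁₂ (gradPₗ ∘ₗ LinearMap.proj T) (gradPₗ ∘ₗ LinearMap.proj T)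

open Classical in
theorem patchForm_apply (μT : M.Elem → ℝ) (α β : M.Elem → SPoly) : patchForm ν μT α β =
    ∑ T : M.Elem with ν ∈ T.1, μT T * ipB T.1 (gradP (α T)) (gradP (β T)) := by
  simp only [patchForm, LinearMap.sum_apply, LinearMap.smul_apply, LinearMap.compl₁₂_apply,
    smul_eq_mul]
  rfl

theorem ip_patch_eq {μ : E → ℝ} {μT : M.Elem → ℝ} (hA1 : M.IsPiecewiseConst μ μT)
    (α β : M.Elem → SPoly) :
    ip (M.patch ν) (fun x => μ x • pwV (gradh α) x) (pwV (gradh β)) = patchForm ν μT α β := by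
  classical
  rw [patchForm_apply, ip, setIntegral_patch
    (Fc := fun T x => μT T * (evV (gradP (α T)) x ⬝ᵥ evV (gradP (β T)) x))
    (fun T => continuous_const.mul (continuous_evV_dot _ _))]
  · refine Finset.sum_congr rfl fun T _ => ?_
    rw [integral_const_mul]
    rfl
  · intro T _
    filter_upwards [hA1 T, ae_pwV_eq (gradh α) T, ae_pwV_eq (gradh β) T] with x h1 h2 h3
    rw [h1, h2, h3, smul_dotProduct, smul_eq_mul]
    rfl

theorem isPatchSolution_iff {k' : ℕ} {μ : E → ℝ} {μT : M.Elem → ℝ} (hA1 : M.IsPiecewiseConst μ μT)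
    (φ α : M.Elem → SPoly) : IsPatchSolution k' μ φ ν α ↔ α ∈ M.patchSpace (k' + 1) ν ∧
      ∀ ψ ∈ M.patchSpace (k' + 1) ν, patchForm ν μT α ψ = patchForm ν μT (M.hat ν * φ) ψ := by
  simp only [IsPatchSolution, ip_patch_eq hA1]

theorem exists_isPatchSolution (hΩ : IsAdmissibleDomain Ω) {k' : ℕ} {μ : E → ℝ} {μT : M.Elem → ℝ}
    (hA1 : M.IsPiecewiseConst μ μT) (hpos : ∀ T, 0 < μT T) (φ : M.Elem → SPoly) :
    ∃ α, IsPatchSolution k' μ φ ν α := by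
  obtain ⟨α, hα, h⟩ := exists_projection (patchForm ν μT)
    (fun α β => by
      rw [patchForm_apply, patchForm_apply]
      exact Finset.sum_congr rfl fun T _ => by rw [ipB_symm])
    (fun α => by
      rw [patchForm_apply]
      exact Finset.sum_nonneg fun T _ => mul_nonneg (hpos T).le (ipB_self_nonneg _ _))
    (patchSubmodule M ν hΩ (k' + 1)) (M.hat ν * φ)
  exact ⟨α, (isPatchSolution_iff hA1 φ α).2 ⟨hα, h⟩⟩

theorem mem_closure_of_mem_elem {T : M.Elem} (hT : ν ∈ T.1) : ν ∈ closure Ω :=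
  hull_subset_closure T (subset_convexHull ℝ _ hT)

/-- The difference has zero energy, hence is constant on each element of the patch. It has no jumps
across faces through ν, and the elements at ν are connected through such faces, so the constants
agree. -/
theorem IsPatchSolution.exists_eq_add_C (hΩ : IsAdmissibleDomain Ω) {k' : ℕ} {μ : E → ℝ}
    {μT : M.Elem → ℝ} (hA1 : M.IsPiecewiseConst μ μT) (hpos : ∀ T, 0 < μT T) {φ α α' : M.Elem → SPoly}
    (h : IsPatchSolution k' μ φ ν α) (h' : IsPatchSolution k' μ φ ν α') :
    ∃ c : ℝ, ∀ T : M.Elem, ν ∈ T.1 → α' T = α T + MvPolynomial.C c := by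
  classical
  rw [isPatchSolution_iff hA1] at h h'
  obtain ⟨o⟩ := M.nonempty_faceOrientation
  set β : M.Elem → SPoly := α' - α
  have hβ : β ∈ patchSubmodule M ν hΩ (k' + 1) := Submodule.sub_mem _ h'.1 h.1
  have h0 : patchForm ν μT β β = 0 := by
    have e : patchForm ν μT β = patchForm ν μT α' - patchForm ν μT α := map_sub _ _ _
    rw [e, LinearMap.sub_apply, h'.2 β hβ, h.2 β hβ, sub_self]
  rw [patchForm_apply, Finset.sum_eq_zero_iff_of_nonneg fun T _ =>
    mul_nonneg (hpos T).le (ipB_self_nonneg _ _)] at h0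
  have hC : ∀ T : M.Elem, ν ∈ T.1 → β T = MvPolynomial.C (ev (β T) ν) := by
    intro T hT
    have h1 := (mul_eq_zero.1 (h0 T (Finset.mem_filter.2 ⟨Finset.mem_univ _, hT⟩))).resolve_left
      (hpos T).ne'
    have h2 := eq_C_of_gradP_eq_zero ((isTet T).eq_zero_of_ipB_self h1)
    rw [h2, ev_C]
  by_cases hex : ∃ T : M.Elem, ν ∈ T.1
  · obtain ⟨T₀, hT₀⟩ := hex
    refine ⟨ev (β T₀) ν, fun T hT => ?_⟩
    rw [eq_of_forall_face_eq hΩ o (mem_closure_of_mem_elem hT₀) (e := fun T => ev (β T) ν)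
      (fun f hf => patchSpace_face_eq hΩ o hβ f hf) (subset_convexHull ℝ _ hT₀)
      (subset_convexHull ℝ _ hT), ← hC T hT]
    exact (add_sub_cancel _ _).symm
  · exact ⟨0, fun T hT => absurd ⟨T, hT⟩ hex⟩

theorem existsUnique_isPatchSolution (hΩ : IsAdmissibleDomain Ω) {k' : ℕ} {μ : E → ℝ}
    {μT : M.Elem → ℝ} (hA1 : M.IsPiecewiseConst μ μT) (hpos : ∀ T, 0 < μT T) (φ : M.Elem → SPoly)
    (hΓ : (M.patchGamma ν).Nonempty) : ∃! α, IsPatchSolution k' μ φ ν α := by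
  obtain ⟨α, hα⟩ := exists_isPatchSolution hΩ (k' := k') (ν := ν) hA1 hpos φ
  refine ⟨α, hα, fun α' hα' => ?_⟩
  obtain ⟨c, hc⟩ := hα.exists_eq_add_C hΩ hA1 hpos hα'
  obtain ⟨x, hx⟩ := hΓ
  have hx' : x ∈ closure (M.patch ν) := by
    rw [patchGamma] at hx
    split_ifs at hx
    · exact hx.1.1
    · exact hx.1
  obtain ⟨⟨T, hT⟩, hxT⟩ := Set.mem_iUnion.1 (closure_patch_subset hx')
  have h1 := hα.1.2.2.2 T hT x ⟨hxT, hx⟩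
  have h2 := hα'.1.2.2.2 T hT x ⟨hxT, hx⟩
  rw [hc T hT, ev_add, h1, ev_C, zero_add] at h2
  funext S
  by_cases hS : ν ∈ S.1
  · rw [hc S hS, h2, map_zero, add_zero]
  · rw [hα.1.2.1 S hS, hα'.1.2.1 S hS]

end TetMesh

/-! ## The equilibrated field -/

theorem gradP_dot_sub_eq_zero {s : Set E} (hs : Convex ℝ s) {q : SPoly} (hq : ∀ x ∈ s, ev q x = 0)
    {x y : E} (hx : x ∈ s) (hy : y ∈ s) : evV (gradP q) x ⬝ᵥ (y - x).ofLp = 0 := by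
  have hline : HasDerivAt (fun t : ℝ => x + t • (y - x)) (y - x) 0 := by
    simpa using ((hasDerivAt_id (0 : ℝ)).smul_const (y - x)).const_add x
  have hfd : HasFDerivAt (ev q) (fderiv ℝ (ev q) x) (x + (0 : ℝ) • (y - x)) := by
    rw [zero_smul, add_zero]
    exact ((contDiff_ev q (n := 1)).differentiable (by simp) x).hasFDerivAt
  have h1 : HasDerivAt (fun t : ℝ => ev q (x + t • (y - x))) (fderiv ℝ (ev q) x (y - x)) 0 :=
    (hfd.comp_hasDerivAt (0 : ℝ) hline :)
  have h2 : HasDerivWithinAt (fun t : ℝ => ev q (x + t • (y - x))) 0 (Set.Icc 0 1) 0 := by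
    refine (hasDerivWithinAt_const (0 : ℝ) (Set.Icc (0 : ℝ) 1) (0 : ℝ)).congr (fun t ht => ?_) ?_
    · exact hq _ (hs.add_smul_sub_mem hx hy ht)
    · simpa using hq x hx
  have hu : UniqueDiffWithinAt ℝ (Set.Icc (0 : ℝ) 1) 0 :=
    (uniqueDiffOn_Icc zero_lt_one) 0 (Set.left_mem_Icc.2 zero_le_one)
  have := hu.eq_deriv _ h1.hasDerivWithinAt h2
  rwa [fderiv_ev] at this

theorem pd_cross {ζ : E → V} (hζ : ∀ i, Differentiable ℝ fun y => ζ y i) (F : VPoly) (x : E) :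
    ∑ i, pd i (fun y => (ζ y ⨯₃ evV F y) i) x =
      evV F x ⬝ᵥ curl ζ x - evV (curlP F) x ⬝ᵥ ζ x := by
  have hF : ∀ i, Differentiable ℝ fun y => evV F y i := fun i =>
    (contDiff_ev (F i) (n := 1)).differentiable (by simp)
  have hpF : ∀ i l, pd i (fun y => evV F y l) x = ev (MvPolynomial.pderiv i (F l)) x := fun i l =>
    pd_ev i (F l) x
  have key : ∀ i l m, pd i (fun y => ζ y l * evV F y m - ζ y m * evV F y l) x =
      pd i (fun y => ζ y l) x * evV F x m + ζ x l * ev (MvPolynomial.pderiv i (F m)) x -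
      (pd i (fun y => ζ y m) x * evV F x l + ζ x m * ev (MvPolynomial.pderiv i (F l)) x) := by
    intro i l m
    rw [pd_sub ((hζ l).fun_mul (hF m)) ((hζ m).fun_mul (hF l)), pd_mul (hζ l) (hF m),
      pd_mul (hζ m) (hF l), hpF, hpF]
  have e0 : (fun y => (ζ y ⨯₃ evV F y) 0) = fun y => ζ y 1 * evV F y 2 - ζ y 2 * evV F y 1 := by
    funext y; simp [cross_apply]
  have e1 : (fun y => (ζ y ⨯₃ evV F y) 1) = fun y => ζ y 2 * evV F y 0 - ζ y 0 * evV F y 2 := by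
    funext y; simp [cross_apply]
  have e2 : (fun y => (ζ y ⨯₃ evV F y) 2) = fun y => ζ y 0 * evV F y 1 - ζ y 1 * evV F y 0 := by
    funext y; simp [cross_apply]
  rw [Fin.sum_univ_three, e0, e1, e2, key, key, key]
  simp [curl, curlP, dotProduct, Fin.sum_univ_three, evV]
  ring

namespace TetMesh

variable {Ω : Set E} {M : TetMesh Ω}

/-- A tangential vector is a combination of the directions from x to the vertices of f. The
derivatives in these directions vanish also when x is on the boundary of the face, because one-sided
derivatives suffice. -/
theorem gradP_dot_eq_zero_of_face (o : M.FaceOrientation) (f : M.IntFace) {q : SPoly}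
    (hq : ∀ x ∈ hull f.1, ev q x = 0) {x : E} (hx : x ∈ hull f.1) {τ : V}
    (hτ : faceNormal o f ⬝ᵥ τ = 0) : evV (gradP q) x ⬝ᵥ τ = 0 := by
  have hT := isTet (o.plus f)
  obtain ⟨hw, -, he⟩ := hT.opp_spec (o.subset_plus f) f.2.2.1
  have hvol := volume_hull_pos hT.1 hT.2
  rw [faceNormal, areaNormal, smul_dotProduct, smul_eq_zero] at hτ
  have hτ' := hτ.resolve_left hvol.ne'
  have h1 := hT.sum_glam_dot_smul (WithLp.toLp 2 τ)
  have h2 := hT.sum_glam_dot (WithLp.toLp 2 τ)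
  rw [← Finset.add_sum_erase _ _ hw, he] at h1 h2
  rw [hτ', zero_smul, zero_add] at h1
  rw [hτ', zero_add] at h2
  have h3 : WithLp.toLp 2 τ = ∑ v ∈ f.1, (glam (o.plus f).1 v ⬝ᵥ τ) • (v - x) := by
    simp only [smul_sub, Finset.sum_sub_distrib]
    rw [← Finset.sum_smul, h2, zero_smul, sub_zero, h1]
  have h4 : evV (gradP q) x ⬝ᵥ τ =
      ∑ v ∈ f.1, (glam (o.plus f).1 v ⬝ᵥ τ) * (evV (gradP q) x ⬝ᵥ (v - x).ofLp) := by
    have : τ = ∑ v ∈ f.1, (glam (o.plus f).1 v ⬝ᵥ τ) • (v - x).ofLp := by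
      have := congrArg WithLp.ofLp h3
      rw [WithLp.ofLp_sum] at this
      simpa using this
    conv_lhs => rw [this]
    rw [dotProduct_sum]
    simp only [dotProduct_smul, smul_eq_mul]
  rw [h4]
  refine Finset.sum_eq_zero fun v hv => ?_
  rw [gradP_dot_sub_eq_zero (convex_convexHull ℝ _) hq hx (subset_convexHull ℝ _ hv), mul_zero]

/-- Elementwise Green formula for tangentially continuous fields. -/
theorem ip_curl_eq_of_test (hΩ : IsAdmissibleDomain Ω) (o : M.FaceOrientation) {F j : M.Elem → VPoly}
    (hcurl : ∀ T, curlP (F T) = j T)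
    (hjump : ∀ f : M.IntFace, ∀ x ∈ hull f.1, ∀ τ, faceNormal o f ⬝ᵥ τ = 0 →
      (evV (F (o.plus f)) x - evV (F (o.minus f)) x) ⬝ᵥ τ = 0) {ζ : E → V} (hζ : IsTest Ω ζ) :
    ip Ω (pwV F) (curl ζ) = ip Ω (pwV j) ζ := by
  have hζi : ∀ i, ContDiff ℝ 1 fun y => ζ y i := fun i => contDiff_pi.1 hζ.contDiff_one i
  have hcc : Continuous (curl ζ) := by
    refine continuous_pi fun i => ?_
    have := fun i l => continuous_pd (hζi i) l
    fin_cases i <;> simp [curl] <;> fun_prop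
  have hc : Continuous ζ := hζ.contDiff_one.continuous
  have h := sum_integral_div_of_eq_zero hΩ o (Ψ := fun T x => ζ x ⨯₃ evV (F T) x)
    (fun T i => by
      have hF : ∀ i, ContDiff ℝ 1 fun y => evV (F T) y i := fun i => contDiff_ev (F T i) (n := 1)
      fin_cases i <;> simp [cross_apply] <;> fun_prop)
    (fun T x hx => by rw [hζ.eq_zero hx]; simp)
  simp only [pd_cross fun i => (hζi i).differentiable (by simp), hcurl] at h
  rw [Finset.sum_eq_zero (s := Finset.univ (α := M.IntFace)), mul_zero] at h
  · rw [ip, ip, setIntegral_domain (M := M) hΩ (Fc := fun T x => evV (F T) x ⬝ᵥ curl ζ x)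
      (fun T => (continuous_evV _).dotProduct hcc) (fun T => (ae_pwV_eq F T).mono fun x hx => by rw [hx]),
      setIntegral_domain (M := M) hΩ (Fc := fun T x => evV (j T) x ⬝ᵥ ζ x)
      (fun T => (continuous_evV _).dotProduct hc) (fun T => (ae_pwV_eq j T).mono fun x hx => by rw [hx]),
      ← sub_eq_zero, ← Finset.sum_sub_distrib, ← h]
    refine Finset.sum_congr rfl fun T _ => ?_
    rw [integral_sub]
    · exact integrableOn_hull_volume _ ((continuous_evV _).dotProduct hcc)
    · exact integrableOn_hull_volume _ ((continuous_evV _).dotProduct hc)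
  · intro f _
    rw [← avg_const (face_indep f) (face_nonempty f) 0]
    refine avg_congr fun x hx => ?_
    have h1 := hjump f x hx (faceNormal o f ⨯₃ ζ x) (dot_self_cross _ _)
    rw [← h1]
    simp [dotProduct, cross_apply, Fin.sum_univ_three]
    ring

end TetMesh

/-! ## Square integrable fields -/

theorem abs_dotProduct_le (v w : V) : |v ⬝ᵥ w| ≤ 3 * ‖v‖ * ‖w‖ := by
  rw [dotProduct]
  calc |∑ i, v i * w i| ≤ ∑ i : Fin 3, |v i * w i| := Finset.abs_sum_le_sum_abs _ _
    _ ≤ ∑ _i : Fin 3, ‖v‖ * ‖w‖ := Finset.sum_le_sum fun i _ => by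
        rw [abs_mul]
        exact mul_le_mul (norm_le_pi_norm v i) (norm_le_pi_norm w i) (abs_nonneg _) (norm_nonneg _)
    _ = 3 * ‖v‖ * ‖w‖ := by simp; ring

theorem integrable_dotProduct {m : Measure E} {u w : E → V} (hu : MemLp u 2 m) (hw : MemLp w 2 m) :
    Integrable (fun x => u x ⬝ᵥ w x) m := by
  have h : ∀ {u : E → V}, MemLp u 2 m → ∀ i, MemLp (fun x => u x i) 2 m := fun {u} hu i =>
    hu.mono ((continuous_apply i).comp_aestronglyMeasurable hu.1)
      (Eventually.of_forall fun x => norm_le_pi_norm (u x) i)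
  simp only [dotProduct]
  exact integrable_finsetSum _ fun i _ => (h hu i).integrable_mul (h hw i)

theorem ip_sub_right {D : Set E} {u w w' : E → V} (hu : MemLp u 2 (volume.restrict D))
    (hw : MemLp w 2 (volume.restrict D)) (hw' : MemLp w' 2 (volume.restrict D)) :
    ip D u (w - w') = ip D u w - ip D u w' := by
  simp only [ip, Pi.sub_apply, dotProduct_sub]
  exact integral_sub (integrable_dotProduct hu hw) (integrable_dotProduct hu hw')

theorem ip_comm (D : Set E) (u w : E → V) : ip D u w = ip D w u := by
  simp only [ip, dotProduct_comm]

/-- The inner product with a bounded field is continuous on `L²`. -/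
theorem tendsto_ip {D : Set E} [IsFiniteMeasure ((volume : Measure E).restrict D)] {a f : E → V}
    {g : ℕ → E → V} {K : ℝ} (ha : MemLp a 2 (volume.restrict D)) (hK : ∀ x, ‖a x‖ ≤ K)
    (hf : MemLp f 2 (volume.restrict D)) (hg : ∀ n, MemLp (g n) 2 (volume.restrict D))
    (h : Tendsto (fun n => eLpNorm (f - g n) 2 (volume.restrict D)) atTop (𝓝 0)) :
    Tendsto (fun n => ip D a (g n)) atTop (𝓝 (ip D a f)) := by
  set m := (volume : Measure E).restrict D
  have hK0 : 0 ≤ K := (norm_nonneg _).trans (hK 0)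
  refine tendsto_integral_of_L1' _ (integrable_dotProduct ha hf).1
    (Eventually.of_forall fun n => integrable_dotProduct ha (hg n)) ?_
  have hb : ∀ n, eLpNorm (fun x => a x ⬝ᵥ g n x - a x ⬝ᵥ f x) 1 m ≤
      ENNReal.ofReal (3 * K) * (eLpNorm (f - g n) 2 m *
        m Set.univ ^ (1 / (1 : ENNReal).toReal - 1 / (2 : ENNReal).toReal)) := by
    intro n
    refine (eLpNorm_le_mul_eLpNorm_of_ae_le_mul (g := f - g n) (c := 3 * K)
      (Eventually.of_forall fun x => ?_) 1).trans ?_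
    · rw [← dotProduct_sub, Real.norm_eq_abs]
      refine (abs_dotProduct_le _ _).trans ?_
      rw [Pi.sub_apply, norm_sub_rev]
      gcongr
      exact hK x
    · gcongr
      exact eLpNorm_le_eLpNorm_mul_rpow_measure_univ (by norm_num) (hf.sub (hg n)).1
  have h0 : Tendsto (fun n => ENNReal.ofReal (3 * K) * (eLpNorm (f - g n) 2 m *
      m Set.univ ^ (1 / (1 : ENNReal).toReal - 1 / (2 : ENNReal).toReal))) atTop (𝓝 0) := by
    have h1 := ENNReal.Tendsto.mul_const (b := m Set.univ ^ (1 / (1 : ENNReal).toReal -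
      1 / (2 : ENNReal).toReal)) h (Or.inr
      (ENNReal.rpow_ne_top_of_nonneg (by norm_num) (measure_ne_top _ _)))
    have h2 := ENNReal.Tendsto.const_mul (a := ENNReal.ofReal (3 * K)) h1
      (Or.inr ENNReal.ofReal_ne_top)
    simpa using h2
  exact tendsto_of_tendsto_of_tendsto_of_le_of_le tendsto_const_nhds h0 (fun _ => zero_le) hb

theorem l2norm_le_of_orthogonal {D : Set E} {X Y : E → V} (hX : MemLp X 2 (volume.restrict D))
    (hY : MemLp Y 2 (volume.restrict D)) (h : ip D X (Y - X) = 0) : l2norm D X ≤ l2norm D Y := by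
  refine Real.sqrt_le_sqrt ?_
  have hXY := integrable_dotProduct hX (hY.sub hX)
  have hZ := integrable_dotProduct (hY.sub hX) (hY.sub hX)
  have e : ip D Y Y = ip D X X + (2 * ip D X (Y - X) + ip D (Y - X) (Y - X)) := by
    rw [ip, ip, ip, ip, ← integral_const_mul, ← integral_add (hXY.const_mul 2) hZ,
      ← integral_add (g := fun x => 2 * X x ⬝ᵥ (Y - X) x + (Y - X) x ⬝ᵥ (Y - X) x)
        (integrable_dotProduct hX hX) ((hXY.const_mul 2).add hZ)]
    refine integral_congr_ae (Eventually.of_forall fun x => ?_)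
    simp only [Pi.sub_apply, dotProduct, Fin.sum_univ_three]
    ring
  rw [e, h, mul_zero, zero_add]
  exact le_add_of_nonneg_right (integral_nonneg fun x => dotProduct_self_nonneg' _)

namespace TetMesh

variable {Ω : Set E} {M : TetMesh Ω}

/-- Density of test fields: F and j are bounded, so both sides are continuous under L² convergence
of the field and of its curl. -/
theorem ip_eq_of_memH0Curl (hΩ : IsAdmissibleDomain Ω) (o : M.FaceOrientation) {F j : M.Elem → VPoly}
    (hcurl : ∀ T, curlP (F T) = j T)
    (hjump : ∀ f : M.IntFace, ∀ x ∈ hull f.1, ∀ τ, faceNormal o f ⬝ᵥ τ = 0 →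
      (evV (F (o.plus f)) x - evV (F (o.minus f)) x) ⬝ᵥ τ = 0) {w c : E → V}
    (hw : MemH0Curl Ω w c) : ip Ω (pwV F) c = ip Ω (pwV j) w := by
  haveI := isFiniteMeasure_restrict_domain hΩ
  obtain ⟨hw2, hc2, ζ, hζ, h1, h2⟩ := hw
  obtain ⟨K, hK⟩ := exists_pwV_bound F
  obtain ⟨K', hK'⟩ := exists_pwV_bound j
  have hζ2 : ∀ n, MemLp (ζ n) 2 (volume.restrict Ω) := fun n =>
    ((hζ n).contDiff_one.continuous.memLp_of_hasCompactSupport (hζ n).2.1).restrict Ω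
  have hcζ2 : ∀ n, MemLp (curl (ζ n)) 2 (volume.restrict Ω) := by
    intro n
    have hζi : ∀ i, ContDiff ℝ 1 fun y => ζ n y i := fun i => contDiff_pi.1 (hζ n).contDiff_one i
    have hcc : Continuous (curl (ζ n)) := by
      refine continuous_pi fun i => ?_
      have := fun i l => continuous_pd (hζi i) l
      fin_cases i <;> simp [curl] <;> fun_prop
    refine (hcc.memLp_of_hasCompactSupport ?_).restrict Ω
    refine HasCompactSupport.of_support_subset_isCompact (hζ n).2.1 fun x hx => ?_
    by_contra hxs
    refine hx ?_
    have hz : ∀ i l, pd l (fun y => ζ n y i) x = 0 := fun i l => by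
      refine pd_eq_zero_of_notMem_tsupport (fun h => hxs ?_) l
      refine closure_mono (fun y hy => ?_) h
      exact fun h0 => hy (congrFun h0 i)
    ext i
    fin_cases i <;> simp [curl, hz]
  have l1 := tendsto_ip (memLp_pwV F) hK hc2 hcζ2 h2
  have l2 := tendsto_ip (memLp_pwV j) hK' hw2 hζ2 h1
  refine tendsto_nhds_unique l1 (l2.congr fun n => ?_)
  exact (ip_curl_eq_of_test hΩ o hcurl hjump (hζ n)).symm

theorem ae_domain (hΩ : IsAdmissibleDomain Ω) {P : E → Prop}
    (h : ∀ T : M.Elem, ∀ᵐ x ∂(volume.restrict (hull T.1)), P x) : ∀ᵐ x ∂(volume.restrict Ω), P x := by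
  have h1 : ∀ᵐ x ∂(volume.restrict Ω), ∀ T : M.Elem, x ∈ hull T.1 → P x :=
    eventually_all.2 fun T => ae_restrict_of_ae ((ae_restrict_iff' (measurableSet_hull _)).1 (h T))
  filter_upwards [h1, ae_exists_mem_interior hΩ M] with x hx hT
  obtain ⟨T, hT⟩ := hT
  exact hx T (interior_subset hT)

/-- Measurability of c is not given in advance; it comes from the almost everywhere equality with a
piecewise constant function, which also bounds it. -/
theorem memLp_mul_of_piecewise (hΩ : IsAdmissibleDomain Ω) {c : E → ℝ} {cT : M.Elem → ℝ}
    (hc : ∀ T : M.Elem, ∀ᵐ x ∂(volume.restrict (hull T.1)), c x = cT T) {v : E → V}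
    (hv : MemLp v 2 (volume.restrict Ω)) : MemLp (fun x => c x • v x) 2 (volume.restrict Ω) := by
  haveI := isFiniteMeasure_restrict_domain hΩ
  have h1 : ∀ᵐ x ∂(volume.restrict Ω), c x = pw (fun T : M.Elem => MvPolynomial.C (cT T)) x :=
    ae_domain (M := M) hΩ fun T => by
      filter_upwards [hc T, ae_pw_eq (fun T : M.Elem => MvPolynomial.C (cT T)) T] with x h2 h3
      rw [h2, h3, ev_C]
  have h4 : ∀ᵐ x ∂(volume.restrict Ω), |c x| ≤ ∑ T, |cT T| := ae_domain (M := M) hΩ fun T => by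
    filter_upwards [hc T] with x h2
    rw [h2]
    exact Finset.single_le_sum (f := fun T => |cT T|) (fun T _ => abs_nonneg _) (Finset.mem_univ T)
  have hm : AEStronglyMeasurable c (volume.restrict Ω) :=
    (memLp_pw (m := volume.restrict Ω) fun T : M.Elem => MvPolynomial.C (cT T)).1.congr
      (h1.mono fun x hx => hx.symm)
  refine hv.of_le_mul (c := ∑ T, |cT T|) (hm.smul hv.1) ?_
  filter_upwards [h4] with x hx
  rw [norm_smul]
  exact mul_le_mul_of_nonneg_right hx (norm_nonneg _)

end TetMesh

/-! ### The equilibrated field and the error bound -/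

namespace TetMesh

variable {Ω : Set E} {M : TetMesh Ω}

theorem curlP_equilibrated {k' : ℕ} {j H Hhat : M.Elem → VPoly}
    (hH : ∀ T, IsElementSolution k' j H T (Hhat T)) (φ : M.Elem → SPoly)
    (α : M.Vertex → M.Elem → SPoly) (T : M.Elem) :
    curlP ((H + equilibratedField Hhat φ α) T) = j T := by
  rw [Pi.add_apply, equilibratedField, curlP_add, curlP_sub, curlP_add, curlP_gradP, curlP_gradP,
    (hH T).2.1]
  abel

/-- The jumps of H_h + Ĥ and of ∇_h φ are tangentially −∇_f λ_f and ∇_f λ_f, and the sum of the α_ν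
is continuous across the face, so its gradient has no tangential jump. -/
theorem equilibrated_jump (hΩ : IsAdmissibleDomain Ω) (o : M.FaceOrientation) {k' : ℕ}
    (hk' : 1 ≤ k') {H Hhat : M.Elem → VPoly} {lam : (f : M.IntFace) → hull f.1 → ℝ}
    (hlam : ∀ f, IsFaceSolution k' o (H + Hhat) f (lam f)) {φ : M.Elem → SPoly}
    (hφ : IsNodalField k' o lam φ) {α : M.Vertex → M.Elem → SPoly}
    (hα : ∀ ν : M.Vertex, α ν ∈ M.patchSpace (k' + 1) ν) (f : M.IntFace) {x : E}
    (hx : x ∈ hull f.1) {τ : V} (hτ : faceNormal o f ⬝ᵥ τ = 0) :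
    (evV ((H + equilibratedField Hhat φ α) (o.plus f)) x -
      evV ((H + equilibratedField Hhat φ α) (o.minus f)) x) ⬝ᵥ τ = 0 := by
  obtain ⟨p, hp, hpl, hpe, -⟩ := hlam f
  have h1 := (face_equation_iff o (H + Hhat) f p x).1 (hpe x hx) τ hτ
  have h2 := gradP_dot_eq_zero_of_face o f (q := φ (o.plus f) - φ (o.minus f) - p)
    (fun y hy => by rw [ev_sub, ev_sub, nodalField_jump hk' hφ hp hpl hy, sub_self]) hx hτ
  have h3 := gradP_dot_eq_zero_of_face o f
    (q := ∑ᶠ ν : M.Vertex, α ν (o.plus f) - ∑ᶠ ν : M.Vertex, α ν (o.minus f))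
    (fun y hy => by
      rw [ev_sub, finsum_eq_sum_of_fintype, finsum_eq_sum_of_fintype, ev_sum, ev_sum, sub_eq_zero]
      exact Finset.sum_congr rfl fun ν _ => patchSpace_face_eq hΩ o (hα ν) f hy) hx hτ
  simp only [gradP_sub, evV_sub, sub_dotProduct] at h2 h3
  simp only [Pi.add_apply, evV_add, add_dotProduct, sub_dotProduct] at h1
  simp only [Pi.add_apply, equilibratedField, evV_add, evV_sub, add_dotProduct, sub_dotProduct]
  linarith

/-- Comparison of the error with the distance to an equilibrated field. -/
theorem l2norm_error_le (hΩ : IsAdmissibleDomain Ω) (o : M.FaceOrientation) {μ : E → ℝ}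
    {μ₀ μ₁ : ℝ} (hμ₀ : 0 < μ₀) (hμ : ∀ x ∈ Ω, μ₀ ≤ μ x ∧ μ x ≤ μ₁) {μT : M.Elem → ℝ}
    (hA1 : M.IsPiecewiseConst μ μT) {j uh G : M.Elem → VPoly} {u curlu : E → V}
    (hu : IsWeakSolution Ω μ (pwV j) u curlu) (huh : MemH0Curl Ω (pwV uh) (pwV (curlh uh)))
    (hcurl : ∀ T, curlP ((Hh μT uh + G) T) = j T)
    (hjump : ∀ f : M.IntFace, ∀ x ∈ hull f.1, ∀ τ, faceNormal o f ⬝ᵥ τ = 0 →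
      (evV ((Hh μT uh + G) (o.plus f)) x - evV ((Hh μT uh + G) (o.minus f)) x) ⬝ᵥ τ = 0) :
    l2norm Ω (fun x => √(μ x) • ((μ x)⁻¹ • curlu x - pwV (Hh μT uh) x)) ≤
      l2norm Ω (fun x => √(μ x) • pwV G x) := by
  haveI := isFiniteMeasure_restrict_domain hΩ
  have hc2 : MemLp curlu 2 (volume.restrict Ω) := hu.1.2.1
  have hsq : ∀ T : M.Elem, ∀ᵐ x ∂(volume.restrict (hull T.1)), √(μ x) = √(μT T) := fun T =>
    (hA1 T).mono fun x hx => by rw [hx]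
  have hinv : ∀ T : M.Elem, ∀ᵐ x ∂(volume.restrict (hull T.1)), (μ x)⁻¹ = (μT T)⁻¹ := fun T =>
    (hA1 T).mono fun x hx => by rw [hx]
  have hHm : MemLp (fun x => (μ x)⁻¹ • curlu x) 2 (volume.restrict Ω) :=
    memLp_mul_of_piecewise hΩ hinv hc2
  have hX := memLp_mul_of_piecewise hΩ hsq (hHm.sub (memLp_pwV (Hh μT uh)))
  have hY := memLp_mul_of_piecewise hΩ hsq (memLp_pwV G)
  refine l2norm_le_of_orthogonal hX hY ?_
  -- With F = H_h + G the two square roots multiply to μ, and μ(H − H_h) = ∇×(u − u_h). The weighted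
  -- product becomes the unweighted product of F − H with a curl.
  have e : ip Ω (fun x => √(μ x) • ((μ x)⁻¹ • curlu x - pwV (Hh μT uh) x))
      ((fun x => √(μ x) • pwV G x) - fun x => √(μ x) • ((μ x)⁻¹ • curlu x - pwV (Hh μT uh) x)) =
      ip Ω (pwV (Hh μT uh + G) - fun x => (μ x)⁻¹ • curlu x) (curlu - pwV (curlh uh)) := by
    refine integral_congr_ae (ae_domain (M := M) hΩ fun T => ?_)
    filter_upwards [hA1 T, ae_mem_interior T.1] with x h1 h2
    have hμx : 0 < μ x := hμ₀.trans_le (hμ x (interior_hull_subset hΩ T h2)).1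
    have hs : √(μ x) * √(μ x) = μ x := Real.mul_self_sqrt hμx.le
    simp only [Pi.sub_apply, pwV_eq _ h2, Hh, curlh, Pi.add_apply, evV_add, evV_smul, ← h1]
    generalize evV (curlP (uh T)) x = a
    generalize evV (G T) x = b
    rw [← smul_sub, ← smul_sub, smul_dotProduct, dotProduct_smul, smul_dotProduct, smul_eq_mul,
      smul_eq_mul, smul_eq_mul, ← mul_assoc, ← mul_assoc, hs, mul_inv_cancel₀ hμx.ne', one_mul,
      dotProduct_comm]
    congr 1
    rw [smul_sub]
    abel
  have hF := memLp_pwV (ν := volume.restrict Ω) (Hh μT uh + G)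
  -- Tested with the curls of u and of u_h, both F and H give the product with j: F by the Green
  -- formula, H by the variational problem. The four terms cancel in pairs.
  rw [e, ip_sub_right (hF.sub hHm) hc2 (memLp_pwV _), ip_comm Ω _ curlu,
    ip_comm Ω _ (pwV (curlh uh)), ip_sub_right hc2 hF hHm, ip_sub_right (memLp_pwV _) hF hHm,
    ip_comm Ω curlu, ip_comm Ω curlu, ip_comm Ω (pwV (curlh uh)), ip_comm Ω (pwV (curlh uh)),
    hu.2.2 _ _ hu.1, hu.2.2 _ _ huh, ip_eq_of_memH0Curl hΩ o hcurl hjump hu.1,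
    ip_eq_of_memH0Curl hΩ o hcurl hjump huh]
  ring

theorem l2norm_eq_etah (hΩ : IsAdmissibleDomain Ω) {μ : E → ℝ} {μT : M.Elem → ℝ}
    (hA1 : M.IsPiecewiseConst μ μT) (G : M.Elem → VPoly) :
    l2norm Ω (fun x => √(μ x) • pwV G x) = etah μ G := by
  have hc : ∀ T : M.Elem, Continuous fun x => (√(μT T) • evV (G T) x) ⬝ᵥ (√(μT T) • evV (G T) x) :=
    fun T => by
      have h : Continuous fun x => √(μT T) • evV (G T) x :=
        (continuous_evV (G T)).fun_const_smul _
      exact h.dotProduct h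
  have hae : ∀ T : M.Elem, ∀ᵐ x ∂(volume.restrict (hull T.1)),
      (√(μ x) • pwV G x) ⬝ᵥ (√(μ x) • pwV G x) =
        (√(μT T) • evV (G T) x) ⬝ᵥ (√(μT T) • evV (G T) x) := fun T => by
    filter_upwards [hA1 T, ae_pwV_eq G T] with x h1 h2
    rw [h1, h2]
  rw [l2norm, etah, ip, setIntegral_domain hΩ hc hae, finsum_eq_sum_of_fintype]
  congr 1
  refine Finset.sum_congr rfl fun T _ => ?_
  rw [etaT, l2norm, Real.sq_sqrt]
  · exact (integral_congr_ae (hae T)).symm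
  · exact integral_nonneg fun x => dotProduct_self_nonneg' _

end TetMesh

end Magnetostatic

end

/-! ### Assembly of the theorem -/

theorem theorem3p3
    (Ω : Set E) (hΩ : IsAdmissibleDomain Ω)
    (M : TetMesh Ω) (o : M.FaceOrientation)
    (k k' : ℕ) (hk : 1 ≤ k) (hkk' : k ≤ k')
    (μ : E → ℝ) (μ₀ μ₁ : ℝ) (hμ₀ : 0 < μ₀) (hμ : ∀ x ∈ Ω, μ₀ ≤ μ x ∧ μ x ≤ μ₁)
    (μT : M.Elem → ℝ) (hA1 : M.IsPiecewiseConst μ μT)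
    (j : M.Elem → VPoly) (hA2 : j ∈ M.DDivZero k')
    (u curlu : E → V) (hu : IsWeakSolution Ω μ (pwV j) u curlu)
    (uh : M.Elem → VPoly) (huh : M.IsFEMSolution k μ (pwV j) uh) :
    (∀ T : M.Elem, ∃! G : VPoly, IsElementSolution k' j (Hh μT uh) T G) ∧
    ∀ Hhat : M.Elem → VPoly,
      (∀ T, IsElementSolution k' j (Hh μT uh) T (Hhat T)) →
    (∀ f : M.IntFace, ∃! lam : hull f.1 → ℝ,
      IsFaceSolution k' o (Hh μT uh + Hhat) f lam) ∧
    ∀ lam : (f : M.IntFace) → hull f.1 → ℝ,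
      (∀ f, IsFaceSolution k' o (Hh μT uh + Hhat) f (lam f)) →
    (∀ x ∈ M.nodes k', ∃! d : {T : M.Elem // x ∈ hull T.1} → ℝ, IsNodeSolution o lam x d) ∧
    (∃! φ : M.Elem → SPoly, IsNodalField k' o lam φ) ∧
    ∀ φ : M.Elem → SPoly, IsNodalField k' o lam φ →
    (∀ ν : M.Vertex, (∃ α : M.Elem → SPoly, IsPatchSolution k' μ φ ν α) ∧
      ((M.patchGamma ν).Nonempty → ∃! α : M.Elem → SPoly, IsPatchSolution k' μ φ ν α) ∧
      ∀ α α' : M.Elem → SPoly, IsPatchSolution k' μ φ ν α → IsPatchSolution k' μ φ ν α' →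
        ∃ c : ℝ, ∀ T : M.Elem, (ν : E) ∈ T.1 → α' T = α T + MvPolynomial.C c) ∧
    ∀ α : M.Vertex → M.Elem → SPoly, (∀ ν : M.Vertex, IsPatchSolution k' μ φ ν (α ν)) →
    l2norm Ω (fun x => √(μ x) • ((μ x)⁻¹ • curlu x - pwV (Hh μT uh) x)) ≤
        l2norm Ω (fun x => √(μ x) • pwV (equilibratedField Hhat φ α) x) ∧
      l2norm Ω (fun x => √(μ x) • pwV (equilibratedField Hhat φ α) x) =
        etah μ (equilibratedField Hhat φ α) := by
  have hk' : 1 ≤ k' := hk.trans hkk'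
  have hpos := pos_of_isPiecewiseConst hΩ hμ₀ hμ hA1
  have hHdeg : ∀ T i, Hh μT uh T i ∈ PolyDeg (k' - 1) := fun T i =>
    polyDeg_mono (Nat.sub_le_sub_right hkk' 1) (Hh_mem_polyDeg huh.1.1 μT T i)
  refine ⟨fun T => existsUnique_elementSolution hk' (hA2.1 T) (divP_eq_zero hΩ o hA2.2 T) (hHdeg T),
    fun Hhat hH => ⟨fun f => ?_, fun lam hlam => ?_⟩⟩
  · have hcurl : ∀ T, curlP ((Hh μT uh + Hhat) T) = j T := fun T => by
      rw [Pi.add_apply, curlP_add, (hH T).2.1]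
      abel
    refine existsUnique_faceSolution (G := Hh μT uh + Hhat) hk' o
      (fun T => nedelec_add (mem_nedelec_of_polyDeg hk' (hHdeg T)) (hH T).1) f fun x hx => ?_
    -- The curl of H_h + Ĥ is j on both sides of the face, so the compatibility condition is the
    -- continuity of the normal component of j.
    rw [hcurl, hcurl]
    exact normal_jump_eq_zero hΩ o hA2.2 f hx
  have hnode : ∀ x ∈ M.nodes k', ∃! d : {T : M.Elem // x ∈ hull T.1} → ℝ,
      IsNodeSolution o lam x d := fun x hx =>
    existsUnique_nodeSolution hΩ o (nodes_subset_closure hk' hx) lam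
      fun e he hcard hxe heΩ => edge_condition hΩ o hk hk' hA1 huh hH hlam he hcard hxe heΩ
  refine ⟨hnode, existsUnique_nodalField hk' o hnode, fun φ hφ => ⟨fun ν =>
    ⟨exists_isPatchSolution hΩ hA1 hpos φ, existsUnique_isPatchSolution hΩ hA1 hpos φ,
      fun α α' h h' => h.exists_eq_add_C hΩ hA1 hpos h'⟩, fun α hα => ⟨?_, l2norm_eq_etah hΩ hA1 _⟩⟩⟩
  exact l2norm_error_le hΩ o hμ₀ hμ hA1 hu huh.1.2 (curlP_equilibrated hH φ α)
    fun f x hx τ hτ => equilibrated_jump hΩ o hk' hlam hφ (fun ν => (hα ν).1) f hx hτ
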